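/- **Conventions.** $\Omega^q_Y$ is the sheaf of holomorphic $q$-forms on a complex manifold $Y$ and $\Omega^q(Y)=\Gamma(Y,\Omega^q_Y)$; both are $0$ for $q<0$. Tensor products without index are over $\mathbb{Q}$. **Orlik–Solomon spaces.** Let $L=\{L_1,\dots,L_l\}$ be a central hyperplane arrangement in $\mathbb{C}^n$ (finitely many distinct linear hyperplanes), $L_i=\{f_i=0\}$ with $f_i$ a linear form. For $I\subset\{1,\dots,l\}$ put $L_I=\bigcap_{i\in I}L_i$ ($L_\varnothing=\mathbb{C}^n$); the $L_I$ are the strata, and $I$ is dependent (resp. independent) if $\operatorname{codim}L_I<|I|$ (resp. $=|I|$). For $I=\{i_1<\dots<i_k\}$ put $e_I=e_{i_1}\wedge\dots\wedge e_{i_k}$ in the exterior algebra $\Lambda^\bullet(\mathbb{Q}e_1\oplus\dots\oplus\mathbb{Q}e_l)$ and $\delta(e_I)=\sum_{s=1}^k(-1)^{s-1}e_{i_1}\wedge\dots\wedge\widehat{e_{i_s}}\wedge\dots\wedge e_{i_k}$. The Orlik–Solomon algebra $A_\bullet(L)$ is the quotient of the exterior algebra by the ideal generated by the $\delta(e_I)$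 for $I$ dependent. For a stratum $S$, $A_S(L)\subset A_\bullet(L)$ is the $\mathbb{Q}$-subspace spanned by the $e_I$ with $L_I=S$. **Theorem, local version.** Let $L$ be a central hyperplane arrangement in $\mathbb{C}^n$ and let $k\ge 0$. Put $\omega_i=df_i/f_i$ and $\omega_I=\omega_{i_1}\wedge\dots\wedge\omega_{i_r}$ for $I=\{i_1<\dots<i_r\}$. Let $\Omega^\bullet\langle L\rangle$ be the complex of forms on $\mathbb{C}^n\setminus(L_1\cup\dots\cup L_l)$ that are linear combinations over $\mathbb{C}$ of forms $\eta\wedge\omega_I$ with $\eta$ a holomorphic form on $\mathbb{C}^n$, let $W_k\Omega^\bullet\langle L\rangle$ be the subcomplex spanned by those with $|I|\le k$ (and $W_{-1}=0$), and let $\operatorname{gr}_k^W=W_k/W_{k-1}$. Let $$G_k^\bullet(L)=\bigoplus_{S\ \text{stratum},\ \operatorname{codim}S=k}\Omega^{\bullet-k}(S)\otimes A_S(L),$$ a complex with differential $\eta\otimes a\mapsto d\eta\otimes a$. There is one and only one morphism of complexes of $\mathbb{C}$-vector spaces $$\Phi:G_k^\bullet(L)\to\operatorname{gr}_k^W\Omega^\bullet\langle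 L\rangle,\qquad \Phi(\eta\otimes e_I)=(2i\pi)^{-k}\,\tilde\eta\wedge\omega_I,$$ for all independent $I$ with $|I|=k$, all holomorphic forms $\eta$ on $L_I$ and all holomorphic forms $\tilde\eta$ on $\mathbb{C}^n$ with $\tilde\eta|_{L_I}=\eta$; and $\Phi$ is an isomorphism of complexes. **Theorem, global version.** Let $X$ be a complex manifold and let $L=\{L_1,\dots,L_l\}$ be a hypersurface arrangement in $X$: a finite set of smooth hypersurfaces such that around each point of $X$ there is a holomorphic chart in which each $L_i$ that meets the domain of the chart is given by one non-zero linear equation. Suppose that all the intersections $L_I=\bigcap_{i\in I}L_i$, $I\subset\{1,\dots,l\}$ (with $L_\varnothing=X$), are connected or empty. The strata are the non-empty $L_I$; they are complex submanifolds $i_S:S\hookrightarrow X$. For $p\in S$, the tangent spaces $T_pL_i$ of the $L_i$ that contain $p$ form a central hyperplane arrangement $L^{(p)}$ in $T_pX$, and $A_S(L)=A_{T_pS}(L^{(p)})$ (up to canonical isomorphism it does not depend on $p$; a point $p$ of $S$ is fixed here). A defining equation of $L_i$ on an open set is a holomorphic function with zero set $L_i$ whose differential does not vanish on $L_i$. Let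 $\Omega^\bullet_{\langle X,L\rangle}$ be the complex of sheaves of forms on the complement of $L_1\cup\dots\cup L_l$ that are locally on $X$ linear combinations over $\mathbb{C}$ of forms $$\eta\wedge\frac{df_{i_1}}{f_{i_1}}\wedge\dots\wedge\frac{df_{i_r}}{f_{i_r}},\qquad i_1<\dots<i_r,$$ with $\eta$ holomorphic and $f_i$ local defining equations of the $L_i$; let $W_k\Omega^\bullet_{\langle X,L\rangle}$ be the subcomplex of sheaves of those that locally need only $r\le k$, and let $\operatorname{gr}^W_k=W_k/W_{k-1}$ (quotient sheaf). For $k\ge0$ let $$\mathcal{G}_k^\bullet(X,L)=\bigoplus_{S\ \text{stratum},\ \operatorname{codim}S=k}(i_S)_*\Omega_S^{\bullet-k}\otimes A_S(L),$$ with differential $\eta\otimes a\mapsto d\eta\otimes a$. There is one and only one morphism of complexes of sheaves of $\mathbb{C}$-vector spaces on $X$ $$\Phi:\mathcal{G}_k^\bullet(X,L)\to\operatorname{gr}_k^W\Omega^\bullet_{\langle X,L\rangle},\qquad \Phi(\eta\otimes e_I)=(2i\pi)^{-k}\,\tilde\eta\wedge\frac{df_{i_1}}{f_{i_1}}\wedge\dots\wedge\frac{df_{i_k}}{f_{i_k}},$$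 for all strata $S$ of codimension $k$, all sets $I=\{i_1<\dots<i_k\}$ of $k$ hypersurfaces with $L_I=S$, all local sections $\eta$ of $\Omega_S^{\bullet-k}$, all local holomorphic forms $\tilde\eta$ on $X$ that restrict to $\eta$, and all local defining equations $f_i$ of the $L_i$; and $\Phi$ is an isomorphism of complexes of sheaves. -/

import Mathlib

open CategoryTheory TopologicalSpace Opposite
open scoped Manifold ContDiff TensorProduct DirectSum Topology

noncomputable section

set_option linter.unusedSectionVars false

namespace LogArr

universe u v w

section Alternating

variable {E F : Type} [NormedAddCommGroup E] [NormedSpace ℂ E]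
  [NormedAddCommGroup F] [NormedSpace ℂ F]

/-- Alternating complex `q`-forms on the vector space `E`. -/
abbrev Alt (E : Type) [NormedAddCommGroup E] [NormedSpace ℂ E] (q : ℕ) : Type :=
  E [⋀^Fin q]→L[ℂ] ℂ

instance {X : Type u} (q : ℕ) : AddCommGroup (X → Alt E q) := Pi.addCommGroup

instance {X : Type u} (q : ℕ) : AddCommMonoid (X → Alt E q) := AddCommGroup.toAddCommMonoid

/-- The exterior product `η ∧ θ` of a `q`-form with a `1`-form:
`(η ∧ θ)(v₀, …, v_q) = ∑ i, (-1) ^ (q - i) η(v₀, …, v̂ᵢ, …, v_q) θ(vᵢ)`. -/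
def wedgeOne {q : ℕ} (η : Alt E q) (θ : E →L[ℂ] ℂ) : Alt E (q + 1) :=
  (-1 : ℂ) ^ q • ContinuousAlternatingMap.alternatizeUncurryFin (θ.smulRight η)

theorem wedgeOne_apply {q : ℕ} (η : Alt E q) (θ : E →L[ℂ] ℂ) (v : Fin (q + 1) → E) :
    wedgeOne η θ v = (-1) ^ q * ∑ i : Fin (q + 1), (-1) ^ (i : ℕ) * (η (i.removeNth v) * θ (v i)) := by
  simp [wedgeOne, ContinuousAlternatingMap.alternatizeUncurryFin_apply, mul_comm]

/-- The iterated exterior product `η ∧ θ₁ ∧ ⋯ ∧ θ_r`. -/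
def wedgeTuple {q : ℕ} (η : Alt E q) : (r : ℕ) → (Fin r → (E →L[ℂ] ℂ)) → Alt E (q + r)
  | 0, _ => η
  | r + 1, θ => wedgeOne (wedgeTuple η r (Fin.init θ)) (θ (Fin.last r))

/-- Pull-back (restriction) of an alternating form along a linear map. -/
abbrev pull {q : ℕ} (η : Alt F q) (T : E →L[ℂ] F) : Alt E q :=
  η.compContinuousLinearMap T

theorem wedgeOne_pull {q : ℕ} (η : Alt F q) (θ : F →L[ℂ] ℂ) (T : E →L[ℂ] F) :
    pull (wedgeOne η θ) T = wedgeOne (pull η T) (θ.comp T) := by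
  ext v
  simp [wedgeOne_apply]
  rfl

/-- The logarithmic differential `dg / g` of a function `g` on a vector space. -/
def dlogVec (g : E → ℂ) (y : E) : E →L[ℂ] ℂ := (g y)⁻¹ • fderiv ℂ g y

section Analytic

theorem analyticAt_extDeriv {q : ℕ} {η : E → Alt E q} {y : E} (h : AnalyticAt ℂ η y) :
    AnalyticAt ℂ (extDeriv η) y := by
  let T : (E →L[ℂ] Alt E q) →L[ℂ] Alt E (q + 1) :=
    ContinuousAlternatingMap.alternatizeUncurryFinCLM (n := q) ℂ E ℂ
  exact (T.analyticAt _).comp h.fderiv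

theorem extDeriv_extDeriv_zero {q : ℕ} {η : E → Alt E q} {y : E} (h : AnalyticAt ℂ η y) :
    extDeriv (extDeriv η) y = 0 :=
  extDeriv_extDeriv_apply (r := ω) h.contDiffAt le_top

theorem analyticAt_wedgeOne {q : ℕ} {η : E → Alt E q} {θ : E → (E →L[ℂ] ℂ)} {y : E}
    (h : AnalyticAt ℂ η y) (hθ : AnalyticAt ℂ θ y) :
    AnalyticAt ℂ (fun z => wedgeOne (η z) (θ z)) y := by
  have h1 : AnalyticAt ℂ (fun z => (θ z).smulRight (η z)) y := by
    exact (hθ.contDiffAt.smulRight h.contDiffAt : ContDiffAt ℂ ω _ y).analyticAt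
  let T : (E →L[ℂ] Alt E q) →L[ℂ] Alt E (q + 1) :=
    (-1 : ℂ) ^ q • ContinuousAlternatingMap.alternatizeUncurryFinCLM (n := q) ℂ E ℂ
  exact (T.analyticAt _).comp h1

theorem analyticAt_dlogVec {g : E → ℂ} {y : E} (hg : AnalyticAt ℂ g y) (h0 : g y ≠ 0) :
    AnalyticAt ℂ (dlogVec g) y :=
  (hg.inv h0).smul hg.fderiv

theorem extDeriv_mul {q : ℕ} {η : E → Alt E q} {h : E → ℂ} {y : E}
    (hη : DifferentiableAt ℂ η y) (hh : DifferentiableAt ℂ h y) :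
    extDeriv (fun z => h z • η z) y = h y • extDeriv η y +
      ContinuousAlternatingMap.alternatizeUncurryFin ((fderiv ℂ h y).smulRight (η y)) := by
  rw [extDeriv, fderiv_fun_smul hh hη, ContinuousAlternatingMap.alternatizeUncurryFin_add,
    ContinuousAlternatingMap.alternatizeUncurryFin_smul]
  rfl

theorem extDeriv_wedgeOne_dlogVec {q : ℕ} {η : E → Alt E q} {g : E → ℂ} {y : E}
    (hη : AnalyticAt ℂ η y) (hg : AnalyticAt ℂ g y) (h0 : g y ≠ 0) :
    extDeriv (fun z => wedgeOne (η z) (dlogVec g z)) y =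
      wedgeOne (extDeriv η y) (dlogVec g y) := by
  set h : E → ℂ := fun z => Complex.log ((g y)⁻¹ * g z) with hh
  have hsl : (g y)⁻¹ * g y ∈ Complex.slitPlane := by
    rw [inv_mul_cancel₀ h0]; exact Complex.one_mem_slitPlane
  have han : AnalyticAt ℂ h y := (analyticAt_const.mul hg).clog hsl
  have hd : ∀ᶠ z in 𝓝 y, fderiv ℂ h z = dlogVec g z := by
    have h1 : ∀ᶠ z in 𝓝 y, (g y)⁻¹ * g z ∈ Complex.slitPlane :=
      ((continuousAt_const.mul hg.continuousAt).eventually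
        (Complex.isOpen_slitPlane.mem_nhds hsl))
    filter_upwards [h1, hg.eventually_analyticAt] with z hz hgz
    have h2 : HasFDerivAt (fun z => (g y)⁻¹ * g z) ((g y)⁻¹ • fderiv ℂ g z) z :=
      hgz.differentiableAt.hasFDerivAt.const_mul _
    have h3 := (h2.clog hz).fderiv
    rw [hh, h3, dlogVec, smul_smul, mul_inv, inv_inv]
    congr 1
    field_simp
  have key : (fun z => wedgeOne (η z) (dlogVec g z)) =ᶠ[𝓝 y] fun z =>
      (-1 : ℂ) ^ q • (extDeriv (fun z => h z • η z) z - h z • extDeriv η z) := by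
    filter_upwards [hd, hη.eventually_analyticAt, han.eventually_analyticAt] with z hz h1 h2
    rw [extDeriv_mul h1.differentiableAt h2.differentiableAt, hz, wedgeOne]
    simp
  have a1 : AnalyticAt ℂ (fun z => h z • η z) y := han.smul hη
  have a2 : AnalyticAt ℂ (extDeriv (fun z => h z • η z)) y := analyticAt_extDeriv a1
  have a3 : AnalyticAt ℂ (fun z => h z • extDeriv η z) y := han.smul (analyticAt_extDeriv hη)
  rw [key.extDeriv_eq]
  refine (extDeriv_fun_smul _ _).trans ?_
  have a4 : extDeriv (fun z => extDeriv (fun z => h z • η z) z - h z • extDeriv η z) y =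
      extDeriv (fun z => extDeriv (fun z => h z • η z) z) y -
        extDeriv (fun z => h z • extDeriv η z) y := by
    have := extDeriv_fun_add (ω₁ := fun z => extDeriv (fun z => h z • η z) z)
      (ω₂ := fun z => (-1 : ℂ) • (h z • extDeriv η z)) a2.differentiableAt
      (a3.differentiableAt.const_smul (-1 : ℂ))
    have h5 : extDeriv (fun z => (-1 : ℂ) • h z • extDeriv η z) y =
        (-1 : ℂ) • extDeriv (fun z => h z • extDeriv η z) y :=
      extDeriv_fun_smul (-1 : ℂ) (fun z => h z • extDeriv η z)
    rw [h5] at this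
    simpa [sub_eq_add_neg] using this
  rw [a4, extDeriv_extDeriv_zero a1, extDeriv_mul (analyticAt_extDeriv hη).differentiableAt
    han.differentiableAt, extDeriv_extDeriv_zero hη, hd.self_of_nhds, wedgeOne, pow_succ]
  simp

end Analytic

end Alternating

section OrlikSolomon

variable {E : Type} [AddCommGroup E] [Module ℂ E]

/-- The codimension of a linear subspace. -/
def codim (K : Submodule ℂ E) : ℕ := Module.finrank ℂ (E ⧸ K)

variable {ι : Type} [LinearOrder ι]

/-- The exterior algebra over `ℚ` with one generator `e i` in degree `1` for each index. -/
abbrev ExtAlg (ι : Type) : Type := ExteriorAlgebra ℚ (ι →₀ ℚ)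

/-- The monomial `e_I = e_{i₁} ∧ ⋯ ∧ e_{i_k}` for `I = {i₁ < ⋯ < i_k}`. -/
def extMonomial (I : Finset ι) : ExtAlg ι :=
  (List.ofFn fun s : Fin I.card =>
    ExteriorAlgebra.ι ℚ (Finsupp.single (I.orderEmbOfFin rfl s) (1 : ℚ))).prod

/-- `δ(e_I) = ∑ s, (-1) ^ s e_{i₀} ∧ ⋯ ∧ ê_{i_s} ∧ ⋯ ∧ e_{i_{k-1}}`, with `s` from `0` to
`k - 1`, for `I = {i₀ < ⋯ < i_{k-1}}`. -/
def extDelta (I : Finset ι) : ExtAlg ι :=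
  ∑ s : Fin I.card, (-1 : ℚ) ^ (s : ℕ) • extMonomial (I.erase (I.orderEmbOfFin rfl s))

/-- The intersection `⋂_{i ∈ I} H i`, equal to the whole space for `I = ∅`. -/
def inter (H : ι → Submodule ℂ E) (I : Finset ι) : Submodule ℂ E := ⨅ i ∈ I, H i

/-- The two-sided ideal generated by the `δ(e_I)` for `I` dependent, i.e.
`codim (⋂_{i ∈ I} H i) < |I|` (as a rational vector space). -/
def osIdeal (H : ι → Submodule ℂ E) : Submodule ℚ (ExtAlg ι) :=
  Submodule.span ℚ {z | ∃ (a b : ExtAlg ι) (I : Finset ι),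
    codim (inter H I) < I.card ∧ z = a * extDelta I * b}

/-- (The vector space underlying) the Orlik-Solomon algebra of the central arrangement `H`. -/
abbrev OS (H : ι → Submodule ℂ E) : Type := ExtAlg ι ⧸ osIdeal H

/-- The class of the monomial `e_I` in the Orlik-Solomon algebra. -/
def osMonomial (H : ι → Submodule ℂ E) (I : Finset ι) : OS H :=
  (osIdeal H).mkQ (extMonomial I)

/-- `A_S`: the subspace of the Orlik-Solomon algebra spanned by the monomials `e_I` such that
`⋂_{i ∈ I} H i = S`. -/
def osPart (H : ι → Submodule ℂ E) (S : Submodule ℂ E) : Submodule ℚ (OS H) :=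
  Submodule.span ℚ {z | ∃ I : Finset ι, inter H I = S ∧ z = osMonomial H I}

/-- The monomial `e_I` as an element of `A_S`, for `S = ⋂_{i ∈ I} H i`. -/
def osGen (H : ι → Submodule ℂ E) {S : Submodule ℂ E} (I : Finset ι) (hI : inter H I = S) :
    osPart H S :=
  ⟨osMonomial H I, Submodule.subset_span ⟨I, hI, rfl⟩⟩

end OrlikSolomon

section LinearAlgebra

variable {M M' M'' : Type u} [AddCommGroup M] [Module ℂ M] [AddCommGroup M'] [Module ℂ M']
  [AddCommGroup M''] [Module ℂ M''] (A : Type) [AddCommGroup A] [Module ℚ A]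

/-- The tensor product `M ⊗ A` over `ℚ` of a complex vector space `M` and a rational vector
space `A`, written as `M ⊗_ℂ (ℂ ⊗_ℚ A)`. -/
def TensQ (M : Type u) [AddCommGroup M] [Module ℂ M] (A : Type) [AddCommGroup A] [Module ℚ A] :
    Type u := M ⊗[ℂ] (ℂ ⊗[ℚ] A)

instance : AddCommGroup (TensQ M A) := inferInstanceAs (AddCommGroup (M ⊗[ℂ] (ℂ ⊗[ℚ] A)))
instance : Module ℂ (TensQ M A) := inferInstanceAs (Module ℂ (M ⊗[ℂ] (ℂ ⊗[ℚ] A)))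

variable {A} in
/-- The element `m ⊗ a` of `M ⊗ A`. -/
def TensQ.tmul (m : M) (a : A) : TensQ M A := m ⊗ₜ[ℂ] ((1 : ℂ) ⊗ₜ[ℚ] a)

/-- The map `m ⊗ a ↦ φ(m) ⊗ a`. -/
def TensQ.map (φ : M →ₗ[ℂ] M') : TensQ M A →ₗ[ℂ] TensQ M' A := φ.rTensor (ℂ ⊗[ℚ] A)

theorem TensQ.map_map (φ : M →ₗ[ℂ] M') (ψ : M' →ₗ[ℂ] M'') (x : TensQ M A) :
    TensQ.map A ψ (TensQ.map A φ x) = TensQ.map A (ψ ∘ₗ φ) x :=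
  (LinearMap.rTensor_comp_apply (ℂ ⊗[ℚ] A) ψ φ x).symm

theorem TensQ.map_zero (x : TensQ M A) : TensQ.map A (0 : M →ₗ[ℂ] M') x = 0 := by
  have := LinearMap.rTensor_zero (R := ℂ) (N := M) (P := M') (ℂ ⊗[ℚ] A)
  exact LinearMap.congr_fun this x

theorem TensQ.map_id (x : TensQ M A) : TensQ.map A (LinearMap.id : M →ₗ[ℂ] M) x = x :=
  LinearMap.rTensor_id_apply (ℂ ⊗[ℚ] A) M x

/-- The embedding `q ↦ q + k` of the shape of `ℕ`-indexed cochain complexes into itself. The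
extension of a complex `K` along it is `K^{• - k}`, with zeros in degrees `< k`, and with the
same differentials as `K`. -/
abbrev shiftBy (k : ℕ) : ComplexShape.Embedding (ComplexShape.up ℕ) (ComplexShape.up ℕ) :=
  ComplexShape.embeddingUp'Add 1 k

end LinearAlgebra

section Local

variable {E : Type} [NormedAddCommGroup E] [NormedSpace ℂ E]

/-- Holomorphic `q`-forms on the vector space `E`. -/
def Hol (E : Type) [NormedAddCommGroup E] [NormedSpace ℂ E] (q : ℕ) :
    Submodule ℂ (E → Alt E q) where
  carrier := {η | ∀ x, AnalyticAt ℂ η x}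
  add_mem' h h' x := (h x).add (h' x)
  zero_mem' _ := analyticAt_const
  smul_mem' _ _ h x := AnalyticAt.smul analyticAt_const (h x)

/-- The exterior differential on holomorphic forms. -/
def Hol.d (E : Type) [NormedAddCommGroup E] [NormedSpace ℂ E] (q : ℕ) :
    Hol E q →ₗ[ℂ] Hol E (q + 1) where
  toFun η := ⟨_root_.extDeriv η.1, fun x => analyticAt_extDeriv (η.2 x)⟩
  map_add' η η' := Subtype.ext <| funext fun x =>
    extDeriv_add (η.2 x).differentiableAt (η'.2 x).differentiableAt
  map_smul' c η := Subtype.ext <| funext fun _ => extDeriv_smul c η.1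

theorem Hol.d_d (q : ℕ) (η : Hol E q) : Hol.d E (q + 1) (Hol.d E q η) = 0 :=
  Subtype.ext <| funext fun x => extDeriv_extDeriv_zero (η.2 x)

/-- The restriction of a holomorphic form to a linear subspace. -/
def Hol.res {q : ℕ} (S : Submodule ℂ E) (η : Hol E q) : Hol S q :=
  ⟨fun s => pull (η.1 s) S.subtypeL, fun s => by
    let T : Alt E q →L[ℂ] Alt S q :=
      ContinuousAlternatingMap.compContinuousLinearMapCLM S.subtypeL
    exact (T.analyticAt _).comp ((η.2 s).comp (S.subtypeL.analyticAt s))⟩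

/-- A central hyperplane arrangement in `E`: finitely many pairwise distinct hyperplanes
`L_i = {f_i = 0}`, together with a choice of the linear forms `f_i`. -/
structure Central (E : Type) [NormedAddCommGroup E] [NormedSpace ℂ E] (l : ℕ) where
  f : Fin l → (E →L[ℂ] ℂ)
  ne_zero : ∀ i, f i ≠ 0
  injective : Function.Injective fun i => (f i).ker

namespace Central

variable {l : ℕ} (L : Central E l)

/-- The hyperplanes. -/
def hyp (i : Fin l) : Submodule ℂ E := (L.f i).ker

/-- The complement of the union of the hyperplanes. -/
def compl : Set E := {x | ∀ i, L.f i x ≠ 0}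

theorem isOpen_compl : IsOpen L.compl := by
  have : L.compl = ⋂ i, {x | L.f i x ≠ 0} := by ext; simp [compl]
  rw [this]
  exact isOpen_iInter_of_finite fun i => isOpen_ne_fun (L.f i).continuous continuous_const

/-- The forms `η ∧ ω_I` on the complement, where `η` is a holomorphic form on `E`,
`ω_I = ω_{i₁} ∧ ⋯ ∧ ω_{i_r}` for `I = {i₁ < ⋯ < i_r}` and `ω_i = d f_i / f_i`. A form on the
complement is encoded as a function on `E` whose values outside the complement are immaterial. -/
inductive IsMonomial : Finset (Fin l) → (p : ℕ) → (E → Alt E p) → Prop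
  | hol {q : ℕ} (η : E → Alt E q) (hη : η ∈ Hol E q) : IsMonomial ∅ q η
  | wedge {I : Finset (Fin l)} {p : ℕ} {η : E → Alt E p} (h : IsMonomial I p η)
      (j : Fin l) (hj : ∀ i ∈ I, i < j) :
      IsMonomial (insert j I) (p + 1) fun x => wedgeOne (η x) (dlogVec (L.f j) x)

/-- `W_k Ω^p⟨L⟩`: the complex vector space spanned by the forms `η ∧ ω_I` of degree `p` with
`|I| ≤ k`. A form on the complement of the hyperplanes is extended by zero to `E`.
The space `Ω^p⟨L⟩` of forms with logarithmic poles is the union of these spaces. -/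
def W (k : ℤ) (p : ℕ) : Submodule ℂ (E → Alt E p) :=
  Submodule.span ℂ {ζ | ∃ (I : Finset (Fin l)) (η : E → Alt E p),
    (I.card : ℤ) ≤ k ∧ L.IsMonomial I p η ∧ ζ = L.compl.indicator η}

variable {L}

theorem IsMonomial.analyticAt {I : Finset (Fin l)} {p : ℕ} {η : E → Alt E p}
    (h : L.IsMonomial I p η) {x : E} (hx : x ∈ L.compl) : AnalyticAt ℂ η x := by
  induction h with
  | hol η hη => exact hη x
  | wedge h j hj ih =>
    exact analyticAt_wedgeOne ih (analyticAt_dlogVec ((L.f j).analyticAt x) (hx j))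

theorem IsMonomial.extDeriv {I : Finset (Fin l)} {p : ℕ} {η : E → Alt E p}
    (h : L.IsMonomial I p η) :
    ∃ η', L.IsMonomial I (p + 1) η' ∧ ∀ x ∈ L.compl, extDeriv η x = η' x := by
  induction h with
  | @hol q η hη => exact ⟨_, .hol _ (Hol.d E q ⟨η, hη⟩).2, fun _ _ => rfl⟩
  | @wedge I p η h j hj ih =>
    obtain ⟨η', h', he⟩ := ih
    refine ⟨_, .wedge h' j hj, fun x hx => ?_⟩
    rw [extDeriv_wedgeOne_dlogVec (h.analyticAt hx) ((L.f j).analyticAt x) (hx j), he x hx]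

variable (L)

theorem W_analyticAt {k : ℤ} {p : ℕ} {η : E → Alt E p} (h : η ∈ L.W k p) {x : E}
    (hx : x ∈ L.compl) : AnalyticAt ℂ η x := by
  induction h using Submodule.span_induction with
  | mem η h =>
    obtain ⟨I, η, -, h, rfl⟩ := h
    refine (h.analyticAt hx).congr ?_
    filter_upwards [L.isOpen_compl.mem_nhds hx] with y hy
    rw [Set.indicator_of_mem hy]
  | zero => exact analyticAt_const
  | add _ _ _ _ h h' => exact h.add h'
  | smul c _ _ h => exact analyticAt_const.smul h

/-- The exterior differential of a form on the complement of the hyperplanes. -/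
def dCompl {p : ℕ} (η : E → Alt E p) : E → Alt E (p + 1) := L.compl.indicator (extDeriv η)

theorem dCompl_add {k : ℤ} {p : ℕ} {η η' : E → Alt E p} (h : η ∈ L.W k p) (h' : η' ∈ L.W k p) :
    L.dCompl (η + η') = L.dCompl η + L.dCompl η' := by
  ext1 x
  by_cases hx : x ∈ L.compl
  · simp only [dCompl, Set.indicator_of_mem hx, Pi.add_apply]
    exact extDeriv_add (L.W_analyticAt h hx).differentiableAt
      (L.W_analyticAt h' hx).differentiableAt
  · simp [dCompl, Set.indicator_of_notMem hx]

theorem dCompl_smul {p : ℕ} (c : ℂ) (η : E → Alt E p) :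
    L.dCompl (c • η) = c • L.dCompl η := by
  ext1 x
  by_cases hx : x ∈ L.compl
  · simp only [dCompl, Set.indicator_of_mem hx, Pi.smul_apply]
    exact extDeriv_smul c η
  · simp only [dCompl, Set.indicator_of_notMem hx, Pi.smul_apply]
    exact (smul_zero (A := Alt E (p + 1)) c).symm

theorem dCompl_mem {k : ℤ} {p : ℕ} {η : E → Alt E p} (h : η ∈ L.W k p) :
    L.dCompl η ∈ L.W k (p + 1) := by
  induction h using Submodule.span_induction with
  | mem η h =>
    obtain ⟨I, η, hI, h, rfl⟩ := h
    obtain ⟨η', h', he⟩ := h.extDeriv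
    refine Submodule.subset_span ⟨I, η', hI, h', ?_⟩
    ext1 x
    by_cases hx : x ∈ L.compl
    · simp only [dCompl, Set.indicator_of_mem hx, ← he x hx]
      refine Filter.EventuallyEq.extDeriv_eq ?_
      filter_upwards [L.isOpen_compl.mem_nhds hx] with y hy
      rw [Set.indicator_of_mem hy]
    · simp [dCompl, Set.indicator_of_notMem hx]
  | zero =>
    have := L.dCompl_smul (0 : ℂ) (0 : E → Alt E p)
    rw [zero_smul, zero_smul] at this
    rw [this]; exact zero_mem _
  | add _ _ hx hy h h' => rw [L.dCompl_add hx hy]; exact add_mem h h'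
  | smul c _ _ h => rw [L.dCompl_smul]; exact Submodule.smul_mem _ _ h

theorem dCompl_dCompl {k : ℤ} {p : ℕ} {η : E → Alt E p} (h : η ∈ L.W k p) :
    L.dCompl (L.dCompl η) = 0 := by
  ext1 x
  by_cases hx : x ∈ L.compl
  · rw [dCompl, Set.indicator_of_mem hx]
    refine Eq.trans (Filter.EventuallyEq.extDeriv_eq ?_)
      (extDeriv_extDeriv_zero (L.W_analyticAt h hx))
    filter_upwards [L.isOpen_compl.mem_nhds hx] with y hy
    rw [dCompl, Set.indicator_of_mem hy]
  · simp [dCompl, Set.indicator_of_notMem hx]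

/-- The exterior differential `W_k Ω^p⟨L⟩ → W_k Ω^{p+1}⟨L⟩`. -/
def Wd (k : ℤ) (p : ℕ) : L.W k p →ₗ[ℂ] L.W k (p + 1) where
  toFun η := ⟨L.dCompl η.1, L.dCompl_mem η.2⟩
  map_add' η η' := Subtype.ext (L.dCompl_add η.2 η'.2)
  map_smul' c η := Subtype.ext (L.dCompl_smul c η.1)

/-- `gr_k^W Ω^p⟨L⟩ = W_k Ω^p⟨L⟩ / W_{k-1} Ω^p⟨L⟩`. -/
abbrev grObj (k : ℤ) (p : ℕ) : Type := L.W k p ⧸ (L.W (k - 1) p).submoduleOf (L.W k p)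

/-- The differential of `gr_k^W Ω^•⟨L⟩`. -/
def grd (k : ℤ) (p : ℕ) : L.grObj k p →ₗ[ℂ] L.grObj k (p + 1) :=
  Submodule.mapQ _ _ (L.Wd k p) fun _ h => L.dCompl_mem (k := k - 1) h

/-- The complex `gr_k^W Ω^•⟨L⟩`. -/
def gr (k : ℤ) : CochainComplex (ModuleCat.{0} ℂ) ℕ :=
  CochainComplex.of (fun p => ModuleCat.of ℂ (L.grObj k p))
    (fun p => ModuleCat.ofHom (L.grd k p)) (fun p => by
      rw [← ModuleCat.ofHom_comp]
      ext1
      refine LinearMap.ext fun x => ?_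
      obtain ⟨x, rfl⟩ := Submodule.mkQ_surjective _ x
      have : L.Wd k (p + 1) (L.Wd k p x) = 0 := Subtype.ext (L.dCompl_dCompl x.2)
      change Submodule.Quotient.mk (L.Wd k (p + 1) (L.Wd k p x)) = 0
      rw [this, Submodule.Quotient.mk_zero])

/-- The strata of codimension `k`. -/
def Stratum (k : ℕ) : Type :=
  {S : Submodule ℂ E // (∃ I : Finset (Fin l), inter L.hyp I = S) ∧ codim S = k}

/-- `⨁_{codim S = k} Ω^q(S) ⊗ A_S(L)`. -/
abbrev GObj (k q : ℕ) : Type := ⨁ S : L.Stratum k, TensQ (Hol S.1 q) (osPart L.hyp S.1)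

/-- The differential `η ⊗ a ↦ dη ⊗ a`. -/
def Gd (k q : ℕ) : L.GObj k q →ₗ[ℂ] L.GObj k (q + 1) :=
  DirectSum.lmap fun S => TensQ.map (osPart L.hyp S.1) (Hol.d S.1 q)

/-- The complex `q ↦ ⨁_{codim S = k} Ω^q(S) ⊗ A_S(L)`. -/
def GUnshifted (k : ℕ) : CochainComplex (ModuleCat.{0} ℂ) ℕ :=
  CochainComplex.of (fun q => ModuleCat.of ℂ (L.GObj k q))
    (fun q => ModuleCat.ofHom (L.Gd k q)) (fun q => by
      rw [← ModuleCat.ofHom_comp]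
      ext1
      classical
      refine DirectSum.linearMap_ext _ fun S => LinearMap.ext fun x => ?_
      have h : Hol.d S.1 (q + 1) ∘ₗ Hol.d S.1 q = 0 := LinearMap.ext fun η => Hol.d_d q η
      simp [Gd, TensQ.map_map, h, TensQ.map_zero])

/-- The complex `G_k^•(L) = ⨁_{codim S = k} Ω^{• - k}(S) ⊗ A_S(L)`. -/
def G (k : ℕ) : CochainComplex (ModuleCat.{0} ℂ) ℕ := (L.GUnshifted k).extend (shiftBy k)

/-- The form `η ∧ ω_I` for `I = {i₁ < ⋯ < i_k}`. -/
def wedgeOmega {q k : ℕ} (η : E → Alt E q) (I : Finset (Fin l)) (hI : I.card = k) :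
    E → Alt E (q + k) :=
  fun x => wedgeTuple (η x) k fun s => dlogVec (L.f (I.orderEmbOfFin hI s)) x

variable {L} in
theorem isMonomial_wedgeTuple {q : ℕ} {η : E → Alt E q} (hη : η ∈ Hol E q) (r : ℕ)
    (i : Fin r → Fin l) (hi : StrictMono i) :
    L.IsMonomial (Finset.univ.image i) (q + r)
      fun x => wedgeTuple (η x) r fun s => dlogVec (L.f (i s)) x := by
  induction r with
  | zero => exact .hol η hη
  | succ r ih =>
    have h1 := ih (Fin.init i) (fun a b hab => hi (Fin.castSucc_lt_castSucc_iff.2 hab))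
    have h2 : Finset.univ.image i =
        insert (i (Fin.last r)) (Finset.univ.image (Fin.init i)) := by
      ext a
      simp only [Finset.mem_image, Finset.mem_univ, true_and, Finset.mem_insert]
      constructor
      · rintro ⟨b, rfl⟩
        induction b using Fin.lastCases with
        | last => exact Or.inl rfl
        | cast b => exact Or.inr ⟨b, rfl⟩
      · rintro (rfl | ⟨b, rfl⟩)
        · exact ⟨_, rfl⟩
        · exact ⟨b.castSucc, rfl⟩
    rw [h2]
    refine .wedge h1 (i (Fin.last r)) fun a ha => ?_
    obtain ⟨b, -, rfl⟩ := Finset.mem_image.1 ha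
    exact hi (Fin.castSucc_lt_last b)

/-- `(2iπ)^{-k} η ∧ ω_I` as an element of `W_k Ω^{q+k}⟨L⟩`, for `|I| = k`. -/
def phiForm {q k : ℕ} (η : Hol E q) (I : Finset (Fin l)) (hI : I.card = k) : L.W k (q + k) :=
  ((2 * Complex.I * Real.pi : ℂ) ^ k)⁻¹ • ⟨L.compl.indicator (L.wedgeOmega η.1 I hI),
    Submodule.subset_span ⟨I, _, by simp [hI], by
      have := isMonomial_wedgeTuple (L := L) η.2 k (I.orderEmbOfFin hI)
        (I.orderEmbOfFin hI).strictMono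
      rwa [Finset.image_orderEmbOfFin_univ] at this, rfl⟩⟩

open scoped Classical in
/-- The element `η ⊗ e_I` of `G_k^{q+k}(L)`, for `η` a holomorphic `q`-form on the stratum
`S = L_I` of codimension `k`. -/
def gElem {q k : ℕ} (S : L.Stratum k) (η : Hol S.1 q) (I : Finset (Fin l))
    (hS : inter L.hyp I = S.1) : (L.G k).X (q + k) :=
  ((L.GUnshifted k).extendXIso (shiftBy k) (i := q) rfl).inv
    (DirectSum.lof ℂ (L.Stratum k) (fun S => TensQ (Hol S.1 q) (osPart L.hyp S.1)) S
      (TensQ.tmul η (osGen L.hyp I hS)))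

/-- A morphism of complexes `Φ : G_k^•(L) ⟶ gr_k^W Ω^•⟨L⟩` satisfies
`Φ(η ⊗ e_I) = (2iπ)^{-k} η̃ ∧ ω_I` for all independent `I` of cardinality `k`, all holomorphic
forms `η` on `L_I` and all holomorphic forms `η̃` on `E` that restrict to `η`. -/
def IsPhi (k : ℕ) (Φ : L.G k ⟶ L.gr k) : Prop :=
  ∀ (q : ℕ) (S : L.Stratum k) (I : Finset (Fin l)) (hI : I.card = k)
    (hS : inter L.hyp I = S.1) (η : Hol S.1 q) (η' : Hol E q), Hol.res S.1 η' = η →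
    Φ.f (q + k) (L.gElem S η I hS) =
      ((L.W (k - 1) (q + k)).submoduleOf (L.W k (q + k))).mkQ (L.phiForm η' I hI)

end Central

end Local

section Manifold

variable {E : Type} [NormedAddCommGroup E] [NormedSpace ℂ E]
  {X : Type u} [TopologicalSpace X] [ChartedSpace E X]

/-! A differential `q`-form on (a subset of) a complex manifold `X` modelled on `E` assigns to a
point `x` an alternating `q`-form on the tangent space `TangentSpace 𝓘(ℂ, E) x`, which is `E`
by definition. A form on a subset is extended by zero to `X`. -/

/-- The differential of a map `f` at `x`. -/
def mfd {E' : Type} [NormedAddCommGroup E'] [NormedSpace ℂ E'] {Y : Type u} {Y' : Type v}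
    [TopologicalSpace Y] [ChartedSpace E Y] [TopologicalSpace Y'] [ChartedSpace E' Y']
    (f : Y → Y') (x : Y) : E →L[ℂ] E' := mfderiv 𝓘(ℂ, E) 𝓘(ℂ, E') f x

theorem mfd_eq_fderiv {E' : Type} [NormedAddCommGroup E'] [NormedSpace ℂ E'] (f : E → E')
    (x : E) : mfd f x = fderiv ℂ f x := mfderiv_eq_fderiv

theorem mfd_comp {E' E'' : Type} [NormedAddCommGroup E'] [NormedSpace ℂ E']
    [NormedAddCommGroup E''] [NormedSpace ℂ E''] {Y : Type u} {Y' : Type v} {Y'' : Type w}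
    [TopologicalSpace Y] [ChartedSpace E Y] [TopologicalSpace Y'] [ChartedSpace E' Y']
    [TopologicalSpace Y''] [ChartedSpace E'' Y'']
    {g : Y' → Y''} {f : Y → Y'} (x : Y) (hg : MDifferentiableAt 𝓘(ℂ, E') 𝓘(ℂ, E'') g (f x))
    (hf : MDifferentiableAt 𝓘(ℂ, E) 𝓘(ℂ, E') f x) :
    mfd (E := E) (E' := E'') (g ∘ f) x =
      (mfd (E := E') (E' := E'') g (f x)).comp (mfd (E := E) (E' := E') f x) :=
  mfderiv_comp x hg hf

/-- The local expression of a form in a chart, i.e. its pull-back along the inverse of the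
chart. -/
def chartRep {q : ℕ} (φ : OpenPartialHomeomorph X E) (ζ : X → Alt E q) (y : E) : Alt E q :=
  pull (ζ (φ.symm y)) (mfd (E := E) (E' := E) φ.symm y)

/-- The exterior differential of a form: `dζ` at `x` is computed in the preferred chart at
`x`. -/
def extM {q : ℕ} (ζ : X → Alt E q) (x : X) : Alt E (q + 1) :=
  pull (extDeriv (chartRep (chartAt E x) ζ) (chartAt E x x))
    (mfd (E := E) (E' := E) (chartAt E x) x)

theorem chartRep_add {q : ℕ} (φ : OpenPartialHomeomorph X E) (ζ ζ' : X → Alt E q) :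
    chartRep φ (ζ + ζ') = chartRep φ ζ + chartRep φ ζ' := rfl

theorem chartRep_smul {q : ℕ} (φ : OpenPartialHomeomorph X E) (c : ℂ) (ζ : X → Alt E q) :
    chartRep φ (c • ζ) = c • chartRep φ ζ := rfl

theorem chartRep_congr {q : ℕ} {φ : OpenPartialHomeomorph X E} {ζ ζ' : X → Alt E q} {y : E}
    (hy : y ∈ φ.target) (h : ∀ᶠ x in 𝓝 (φ.symm y), ζ x = ζ' x) :
    chartRep φ ζ =ᶠ[𝓝 y] chartRep φ ζ' := by
  filter_upwards [(φ.continuousAt_symm hy).eventually h] with z hz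
  rw [chartRep, chartRep, hz]

theorem extM_congr {q : ℕ} {ζ ζ' : X → Alt E q} {x : X} (h : ∀ᶠ z in 𝓝 x, ζ z = ζ' z) :
    extM ζ x = extM ζ' x := by
  rw [extM, extM, Filter.EventuallyEq.extDeriv_eq (chartRep_congr (mem_chart_target E x) ?_)]
  rwa [(chartAt E x).left_inv (mem_chart_source E x)]

theorem extM_smul {q : ℕ} (c : ℂ) (ζ : X → Alt E q) (x : X) :
    extM (c • ζ) x = c • extM ζ x := by
  rw [extM, chartRep_smul, extDeriv_smul]
  rfl

/-- A form is holomorphic at `x` if its expression in every chart around `x` is. -/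
def HolAt {q : ℕ} (ζ : X → Alt E q) (x : X) : Prop :=
  ∀ φ ∈ IsManifold.maximalAtlas 𝓘(ℂ, E) ω X, x ∈ φ.source → AnalyticAt ℂ (chartRep φ ζ) (φ x)

theorem HolAt.add {q : ℕ} {ζ ζ' : X → Alt E q} {x : X} (h : HolAt ζ x) (h' : HolAt ζ' x) :
    HolAt (ζ + ζ') x := fun φ hφ hx => (h φ hφ hx).add (h' φ hφ hx)

theorem HolAt.smul {q : ℕ} {ζ : X → Alt E q} {x : X} (c : ℂ) (h : HolAt ζ x) :
    HolAt (c • ζ) x := fun φ hφ hx => by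
  rw [chartRep_smul]; exact (h φ hφ hx).const_smul

theorem HolAt.zero {q : ℕ} {x : X} : HolAt (0 : X → Alt E q) x := fun _ _ _ =>
  (analyticAt_const (v := (0 : Alt E q)))

theorem HolAt.congr {q : ℕ} {ζ ζ' : X → Alt E q} {x : X} (h : HolAt ζ x)
    (h' : ∀ᶠ z in 𝓝 x, ζ z = ζ' z) : HolAt ζ' x := fun φ hφ hx =>
  (h φ hφ hx).congr (chartRep_congr (φ.map_source hx) (by rwa [φ.left_inv hx]))

section Smooth

variable [IsManifold 𝓘(ℂ, E) ω X]

theorem mdiff_chart {φ : OpenPartialHomeomorph X E}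
    (hφ : φ ∈ IsManifold.maximalAtlas 𝓘(ℂ, E) ω X) {x : X} (hx : x ∈ φ.source) :
    MDifferentiableAt 𝓘(ℂ, E) 𝓘(ℂ, E) φ x :=
  ((contMDiffOn_of_mem_maximalAtlas hφ).contMDiffAt
    (φ.open_source.mem_nhds hx)).mdifferentiableAt (by simp)

theorem mdiff_symm {φ : OpenPartialHomeomorph X E}
    (hφ : φ ∈ IsManifold.maximalAtlas 𝓘(ℂ, E) ω X) {y : E} (hy : y ∈ φ.target) :
    MDifferentiableAt 𝓘(ℂ, E) 𝓘(ℂ, E) φ.symm y :=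
  ((contMDiffOn_symm_of_mem_maximalAtlas hφ).contMDiffAt
    (φ.open_target.mem_nhds hy)).mdifferentiableAt (by simp)

theorem mfderiv_symm_comp {φ : OpenPartialHomeomorph X E}
    (hφ : φ ∈ IsManifold.maximalAtlas 𝓘(ℂ, E) ω X) {x : X} (hx : x ∈ φ.source) :
    (mfd (E := E) (E' := E) φ.symm (φ x)).comp
      (mfd (E := E) (E' := E) φ x) = ContinuousLinearMap.id ℂ E := by
  have h1 := mfderiv_comp (I := 𝓘(ℂ, E)) (I'' := 𝓘(ℂ, E)) x (mdiff_symm hφ (φ.map_source hx)) (mdiff_chart hφ hx)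
  have h2 : φ.symm ∘ φ =ᶠ[𝓝 x] id := by
    filter_upwards [φ.open_source.mem_nhds hx] with z hz using φ.left_inv hz
  rw [h2.mfderiv_eq, mfderiv_id] at h1
  exact h1.symm

theorem chartRep_extM {q : ℕ} {ζ : X → Alt E q} {x : X} (h : HolAt ζ x)
    {φ : OpenPartialHomeomorph X E} (hφ : φ ∈ IsManifold.maximalAtlas 𝓘(ℂ, E) ω X)
    (hx : x ∈ φ.source) :
    chartRep φ (extM ζ) (φ x) = extDeriv (chartRep φ ζ) (φ x) := by
  set ψ := chartAt E x
  have hψ : ψ ∈ IsManifold.maximalAtlas 𝓘(ℂ, E) ω X := IsManifold.chart_mem_maximalAtlas x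
  have hxψ : x ∈ ψ.source := mem_chart_source E x
  have hy := φ.map_source hx
  set g : E → E := ψ ∘ φ.symm with hg
  have hgx : g (φ x) = ψ x := by simp [hg, φ.left_inv hx]
  have hev : ∀ᶠ z in 𝓝 (φ x), z ∈ φ.target ∧ φ.symm z ∈ ψ.source := by
    refine Filter.Eventually.and (φ.open_target.mem_nhds hy) ?_
    refine (φ.continuousAt_symm hy).eventually ?_
    rw [φ.left_inv hx]
    exact ψ.open_source.mem_nhds hxψ
  have hcomp : ∀ z, z ∈ φ.target → φ.symm z ∈ ψ.source → fderiv ℂ g z =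
      (mfd (E := E) (E' := E) ψ (φ.symm z)).comp
        (mfd (E := E) (E' := E) φ.symm z) := fun z hz hz' => by
    rw [← mfd_eq_fderiv]
    exact mfd_comp z (mdiff_chart hψ hz') (mdiff_symm hφ hz)
  have hrep : chartRep φ ζ =ᶠ[𝓝 (φ x)] fun z => pull (chartRep ψ ζ (g z)) (fderiv ℂ g z) := by
    filter_upwards [hev] with z hz
    have h1 := mfderiv_symm_comp hψ hz.2
    have h2 : ψ.symm (g z) = φ.symm z := ψ.left_inv hz.2
    ext v
    rw [hcomp z hz.1 hz.2]
    change ζ (φ.symm z) (fun i => _) = ζ (ψ.symm (g z)) (fun i => _)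
    rw [h2]
    congr 1
    ext1 i
    exact (DFunLike.congr_fun h1 _).symm
  have hgc : ContDiffAt ℂ ω g (φ x) := by
    rw [← contMDiffAt_iff_contDiffAt]
    refine ContMDiffAt.comp (φ x) ?_ ((contMDiffOn_symm_of_mem_maximalAtlas hφ).contMDiffAt
      (φ.open_target.mem_nhds hy))
    rw [φ.left_inv hx]
    exact (contMDiffOn_of_mem_maximalAtlas hψ).contMDiffAt (ψ.open_source.mem_nhds hxψ)
  rw [hrep.extDeriv_eq, extDeriv_pullback (by rw [hgx]; exact (h ψ hψ hxψ).differentiableAt)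
    hgc le_top, hgx, hcomp _ hy (by rwa [φ.left_inv hx]), chartRep, φ.left_inv hx]
  rfl

theorem HolAt.eventually_chartRep {q : ℕ} {ζ : X → Alt E q} {x : X}
    (h : ∀ᶠ z in 𝓝 x, HolAt ζ z) {φ : OpenPartialHomeomorph X E}
    (hφ : φ ∈ IsManifold.maximalAtlas 𝓘(ℂ, E) ω X) (hx : x ∈ φ.source) :
    chartRep φ (extM ζ) =ᶠ[𝓝 (φ x)] extDeriv (chartRep φ ζ) := by
  have hy := φ.map_source hx
  have h1 : ∀ᶠ z in 𝓝 (φ x), HolAt ζ (φ.symm z) :=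
    (φ.continuousAt_symm hy).eventually (by rwa [φ.left_inv hx])
  filter_upwards [h1, φ.open_target.mem_nhds hy] with z hz hz'
  have := chartRep_extM hz hφ (φ.map_target hz')
  rwa [φ.right_inv hz'] at this

theorem HolAt.extM {q : ℕ} {ζ : X → Alt E q} {x : X} (h : ∀ᶠ z in 𝓝 x, HolAt ζ z) :
    HolAt (extM ζ) x := fun φ hφ hx =>
  (analyticAt_extDeriv (h.self_of_nhds φ hφ hx)).congr (HolAt.eventually_chartRep h hφ hx).symm

theorem extM_extM {q : ℕ} {ζ : X → Alt E q} {x : X} (h : ∀ᶠ z in 𝓝 x, HolAt ζ z) :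
    LogArr.extM (LogArr.extM ζ) x = 0 := by
  have hψ : chartAt E x ∈ IsManifold.maximalAtlas 𝓘(ℂ, E) ω X :=
    IsManifold.chart_mem_maximalAtlas x
  have hx := mem_chart_source E x
  rw [LogArr.extM, (HolAt.eventually_chartRep h hψ hx).extDeriv_eq,
    extDeriv_extDeriv_zero (h.self_of_nhds _ hψ hx)]
  rfl

theorem extM_add {q : ℕ} {ζ ζ' : X → Alt E q} {x : X} (h : HolAt ζ x) (h' : HolAt ζ' x) :
    LogArr.extM (ζ + ζ') x = LogArr.extM ζ x + LogArr.extM ζ' x := by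
  have hψ : chartAt E x ∈ IsManifold.maximalAtlas 𝓘(ℂ, E) ω X :=
    IsManifold.chart_mem_maximalAtlas x
  have hx := mem_chart_source E x
  rw [LogArr.extM, chartRep_add, extDeriv_add (h _ hψ hx).differentiableAt
    (h' _ hψ hx).differentiableAt]
  rfl

/-- The logarithmic differential `df / f` of a function on a manifold. -/
def dlogM (f : X → ℂ) (x : X) : E →L[ℂ] ℂ :=
  (f x)⁻¹ • (mfd (E := E) (E' := ℂ) f x)

theorem chartRep_wedge {q : ℕ} (ζ : X → Alt E q) {f : X → ℂ} {x : X}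
    (hf : ContMDiffAt 𝓘(ℂ, E) 𝓘(ℂ, ℂ) ω f x) {φ : OpenPartialHomeomorph X E}
    (hφ : φ ∈ IsManifold.maximalAtlas 𝓘(ℂ, E) ω X) (hx : x ∈ φ.source) :
    chartRep φ (fun z => wedgeOne (ζ z) (dlogM f z)) =ᶠ[𝓝 (φ x)]
      fun y => wedgeOne (chartRep φ ζ y) (dlogVec (f ∘ φ.symm) y) := by
  have hy := φ.map_source hx
  have h1 : ∀ᶠ z in 𝓝 x, MDifferentiableAt 𝓘(ℂ, E) 𝓘(ℂ, ℂ) f z := by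
    filter_upwards [(contMDiffAt_iff_contMDiffAt_nhds (by simp)).1
      (hf.of_le (le_top : (1 : WithTop ℕ∞) ≤ ω))] with z hz
    exact hz.mdifferentiableAt (by simp)
  have h2 : ∀ᶠ y in 𝓝 (φ x), MDifferentiableAt 𝓘(ℂ, E) 𝓘(ℂ, ℂ) f (φ.symm y) :=
    (φ.continuousAt_symm hy).eventually (by rwa [φ.left_inv hx])
  filter_upwards [h2, φ.open_target.mem_nhds hy] with y hy1 hy2
  rw [chartRep, wedgeOne_pull, chartRep]
  congr 1
  rw [dlogM, dlogVec, ← mfd_eq_fderiv, mfd_comp y hy1 (mdiff_symm hφ hy2)]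
  rfl

theorem analyticAt_comp_symm {f : X → ℂ} {x : X}
    (hf : ContMDiffAt 𝓘(ℂ, E) 𝓘(ℂ, ℂ) ω f x) {φ : OpenPartialHomeomorph X E}
    (hφ : φ ∈ IsManifold.maximalAtlas 𝓘(ℂ, E) ω X) (hx : x ∈ φ.source) :
    AnalyticAt ℂ (f ∘ φ.symm) (φ x) := by
  have hy := φ.map_source hx
  refine ContDiffAt.analyticAt ?_
  rw [← contMDiffAt_iff_contDiffAt]
  refine ContMDiffAt.comp (φ x) ?_ ((contMDiffOn_symm_of_mem_maximalAtlas hφ).contMDiffAt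
    (φ.open_target.mem_nhds hy))
  rwa [φ.left_inv hx]

theorem HolAt.wedge {q : ℕ} {ζ : X → Alt E q} {f : X → ℂ} {x : X} (h : HolAt ζ x)
    (hf : ContMDiffAt 𝓘(ℂ, E) 𝓘(ℂ, ℂ) ω f x) (h0 : f x ≠ 0) :
    HolAt (fun z => wedgeOne (ζ z) (dlogM f z)) x := fun φ hφ hx =>
  (analyticAt_wedgeOne (h φ hφ hx) (analyticAt_dlogVec (analyticAt_comp_symm hf hφ hx)
    (by simpa [φ.left_inv hx] using h0))).congr (chartRep_wedge ζ hf hφ hx).symm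

theorem extM_wedge {q : ℕ} {ζ : X → Alt E q} {f : X → ℂ} {x : X} (h : HolAt ζ x)
    (hf : ContMDiffAt 𝓘(ℂ, E) 𝓘(ℂ, ℂ) ω f x) (h0 : f x ≠ 0) :
    LogArr.extM (fun z => wedgeOne (ζ z) (dlogM f z)) x =
      wedgeOne (LogArr.extM ζ x) (dlogM f x) := by
  have hψ : chartAt E x ∈ IsManifold.maximalAtlas 𝓘(ℂ, E) ω X :=
    IsManifold.chart_mem_maximalAtlas x
  have hx := mem_chart_source E x
  rw [LogArr.extM, (chartRep_wedge ζ hf hψ hx).extDeriv_eq,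
    extDeriv_wedgeOne_dlogVec (h _ hψ hx) (analyticAt_comp_symm hf hψ hx)
    (by simpa [(chartAt E x).left_inv hx] using h0), wedgeOne_pull]
  congr 1
  rw [dlogM, dlogVec, ← mfd_eq_fderiv, mfd_comp _ (by
    rw [(chartAt E x).left_inv hx]; exact hf.mdifferentiableAt (by simp))
    (mdiff_symm hψ ((chartAt E x).map_source hx))]
  have h1 := mfderiv_symm_comp hψ hx
  rw [ContinuousLinearMap.smul_comp, ContinuousLinearMap.comp_assoc, h1,
    ContinuousLinearMap.comp_id, Function.comp_apply, (chartAt E x).left_inv hx]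

end Smooth

end Manifold

section HolomorphicForms

variable {E : Type} [NormedAddCommGroup E] [NormedSpace ℂ E]
  {X : Type u} [TopologicalSpace X] [ChartedSpace E X]

/-- Holomorphic `q`-forms on the open set `U`. -/
def HolOn (U : Set X) (q : ℕ) : Submodule ℂ (X → Alt E q) where
  carrier := {ζ | (∀ x ∉ U, ζ x = 0) ∧ ∀ x ∈ U, HolAt ζ x}
  add_mem' h h' := ⟨fun x hx => by
    rw [Pi.add_apply, h.1 x hx, h'.1 x hx, add_zero], fun x hx => (h.2 x hx).add (h'.2 x hx)⟩
  zero_mem' := ⟨fun _ _ => rfl, fun _ _ => HolAt.zero⟩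
  smul_mem' c ζ h := ⟨fun x hx => by
    rw [Pi.smul_apply, h.1 x hx]; exact smul_zero (A := Alt E q) c, fun x hx => (h.2 x hx).smul c⟩

theorem eventually_indicator {q : ℕ} {U : Set X} (hU : IsOpen U) {x : X} (hx : x ∈ U)
    (ζ : X → Alt E q) : ∀ᶠ z in 𝓝 x, ζ z = U.indicator ζ z := by
  filter_upwards [hU.mem_nhds hx] with z hz
  rw [Set.indicator_of_mem hz]

theorem HolOn.indicator {U : Set X} {q : ℕ} {ζ : X → Alt E q} (h : ζ ∈ HolOn U q) {V : Set X}
    (hV : IsOpen V) (hVU : V ⊆ U) : V.indicator ζ ∈ HolOn V q :=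
  ⟨fun _ hx => Set.indicator_of_notMem hx _, fun x hx =>
    (h.2 x (hVU hx)).congr (eventually_indicator hV hx ζ)⟩

/-- The exterior differential of a form on the open set `U`. -/
def dOn (U : Set X) {q : ℕ} (ζ : X → Alt E q) : X → Alt E (q + 1) := U.indicator (extM ζ)

theorem dOn_smul (U : Set X) {q : ℕ} (c : ℂ) (ζ : X → Alt E q) :
    dOn U (c • ζ) = c • dOn U ζ := by
  ext1 x
  by_cases hx : x ∈ U
  · simp only [dOn, Set.indicator_of_mem hx, Pi.smul_apply]
    exact extM_smul c ζ x
  · simp only [dOn, Set.indicator_of_notMem hx, Pi.smul_apply]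
    exact (smul_zero (A := Alt E (q + 1)) c).symm

theorem dOn_indicator {U V : Set X} (hV : IsOpen V) (hVU : V ⊆ U) {q : ℕ} (ζ : X → Alt E q) :
    dOn V (V.indicator ζ) = V.indicator (dOn U ζ) := by
  ext1 x
  by_cases hx : x ∈ V
  · simp only [dOn, Set.indicator_of_mem hx, Set.indicator_of_mem (hVU hx)]
    exact (extM_congr (eventually_indicator hV hx ζ)).symm
  · simp only [dOn, Set.indicator_of_notMem hx]

variable [IsManifold 𝓘(ℂ, E) ω X]

theorem eventually_holAt {U : Set X} (hU : IsOpen U) {q : ℕ} {ζ : X → Alt E q}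
    (h : ∀ x ∈ U, HolAt ζ x) {x : X} (hx : x ∈ U) : ∀ᶠ z in 𝓝 x, HolAt ζ z := by
  filter_upwards [hU.mem_nhds hx] with z hz using h z hz

theorem dOn_add {U : Set X} {q : ℕ} {ζ ζ' : X → Alt E q} (h : ζ ∈ HolOn U q)
    (h' : ζ' ∈ HolOn U q) : dOn U (ζ + ζ') = dOn U ζ + dOn U ζ' := by
  ext1 x
  by_cases hx : x ∈ U
  · simp only [dOn, Set.indicator_of_mem hx, Pi.add_apply]
    exact extM_add (h.2 x hx) (h'.2 x hx)
  · simp [dOn, Set.indicator_of_notMem hx]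

theorem dOn_mem {U : Set X} (hU : IsOpen U) {q : ℕ} {ζ : X → Alt E q} (h : ζ ∈ HolOn U q) :
    dOn U ζ ∈ HolOn U (q + 1) :=
  ⟨fun _ hx => Set.indicator_of_notMem hx _, fun _ hx =>
    (HolAt.extM (eventually_holAt hU h.2 hx)).congr (eventually_indicator hU hx _)⟩

theorem dOn_dOn {U : Set X} (hU : IsOpen U) {q : ℕ} {ζ : X → Alt E q} (h : ζ ∈ HolOn U q) :
    dOn U (dOn U ζ) = 0 := by
  ext1 x
  by_cases hx : x ∈ U
  · rw [dOn, Set.indicator_of_mem hx, Pi.zero_apply,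
      ← extM_extM (eventually_holAt hU h.2 hx)]
    exact (extM_congr (eventually_indicator hU hx (extM ζ))).symm
  · simp [dOn, Set.indicator_of_notMem hx]

end HolomorphicForms

section Subspaces

variable {E : Type} [NormedAddCommGroup E] [NormedSpace ℂ E]
  {X : Type u} [TopologicalSpace X] [ChartedSpace E X]

/-- The tangent space at `x` of a complex submanifold `S` of `X`: the tangent vectors of `X` that
are killed by the differentials of all holomorphic functions, defined around `x`, that vanish on
`S`. -/
def tan (S : Set X) (x : X) : Submodule ℂ E where
  carrier := {v | ∀ f : X → ℂ, ContMDiffAt 𝓘(ℂ, E) 𝓘(ℂ, ℂ) ω f x →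
    (∀ᶠ z in 𝓝[S] x, f z = 0) → mfd (E := E) (E' := ℂ) f x v = 0}
  add_mem' h h' f hf hf' := by rw [map_add, h f hf hf', h' f hf hf', add_zero]
  zero_mem' f _ _ := map_zero _
  smul_mem' c v h f hf hf' := by rw [map_smul, h f hf hf', smul_zero]

/-- Families of alternating forms on the tangent spaces of `S`. -/
abbrev TForm (S : Set X) (q : ℕ) : Type u := (x : X) → Alt (tan (E := E) S x) q

instance (S : Set X) (q : ℕ) : AddCommGroup (TForm (E := E) S q) := Pi.addCommGroup

instance (S : Set X) (q : ℕ) : AddCommMonoid (TForm (E := E) S q) :=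
  AddCommGroup.toAddCommMonoid

/-- The restriction of a form to the tangent spaces of `S`. -/
def resT (S : Set X) {q : ℕ} (η : X → Alt E q) (x : X) : Alt (tan (E := E) S x) q :=
  pull (η x) (tan (E := E) S x).subtypeL

/-- The form `η` on `V` restricts to the form `ζ` on `S ∩ V`. -/
def Extends (S : Set X) {q : ℕ} (V : Opens X) (η : X → Alt E q) (ζ : TForm (E := E) S q) :
    Prop := η ∈ HolOn (V : Set X) q ∧ ∀ y ∈ S ∩ V, ζ y = resT S η y

theorem Extends.add {S : Set X} {q : ℕ} {V V' : Opens X} {η η' : X → Alt E q}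
    {ζ ζ' : TForm (E := E) S q} (h : Extends S V η ζ) (h' : Extends S V' η' ζ') :
    Extends S (V ⊓ V') (((V ⊓ V' : Opens X) : Set X).indicator (η + η')) (ζ + ζ') := by
  refine ⟨⟨fun _ hx => Set.indicator_of_notMem hx _, fun x hx => ?_⟩, fun y hy => ?_⟩
  · exact ((h.1.2 x hx.1).add (h'.1.2 x hx.2)).congr
      (eventually_indicator (V ⊓ V').isOpen hx _)
  · rw [resT, Set.indicator_of_mem hy.2, Pi.add_apply, h.2 y ⟨hy.1, hy.2.1⟩,
      h'.2 y ⟨hy.1, hy.2.2⟩]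
    rfl

theorem Extends.smul {S : Set X} {q : ℕ} {V : Opens X} {η : X → Alt E q}
    {ζ : TForm (E := E) S q} (c : ℂ) (h : Extends S V η ζ) : Extends S V (c • η) (c • ζ) :=
  ⟨Submodule.smul_mem _ c h.1, fun y hy => by rw [Pi.smul_apply, h.2 y hy]; rfl⟩

/-- Holomorphic `q`-forms on `S ∩ U`, for `S` a complex submanifold of `X` and `U` open in `X`:
families of alternating forms on the tangent spaces of `S` at the points of `S ∩ U`
(extended by zero) that are locally restrictions of holomorphic forms on open subsets of `X`. -/
def HolS (S : Set X) (q : ℕ) (U : Opens X) : Submodule ℂ (TForm (E := E) S q) where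
  carrier := {ζ | (∀ x ∉ S ∩ U, ζ x = 0) ∧
    ∀ x ∈ S ∩ U, ∃ (V : Opens X) (η : X → Alt E q), x ∈ V ∧ V ≤ U ∧ Extends S V η ζ}
  add_mem' := by
    rintro ζ ζ' ⟨h1, h2⟩ ⟨h1', h2'⟩
    refine ⟨fun x hx => by rw [Pi.add_apply, h1 x hx, h1' x hx, add_zero], fun x hx => ?_⟩
    obtain ⟨V, η, hxV, hV, h⟩ := h2 x hx
    obtain ⟨V', η', hxV', hV', h'⟩ := h2' x hx
    exact ⟨V ⊓ V', _, ⟨hxV, hxV'⟩, inf_le_left.trans hV, h.add h'⟩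
  zero_mem' := by
    refine ⟨fun _ _ => rfl, fun x hx => ?_⟩
    exact ⟨U, 0, hx.2, le_rfl, Submodule.zero_mem _, fun _ _ => rfl⟩
  smul_mem' := by
    rintro c ζ ⟨h1, h2⟩
    refine ⟨fun x hx => by
      rw [Pi.smul_apply, h1 x hx]; exact smul_zero (A := Alt (tan (E := E) S x) q) c,
      fun x hx => ?_⟩
    obtain ⟨V, η, hxV, hV, h⟩ := h2 x hx
    exact ⟨V, _, hxV, hV, h.smul c⟩

open scoped Classical in
/-- The exterior differential of a holomorphic form on `S ∩ U`: `dζ = (dη)|_S` for any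
holomorphic form `η` on an open set `V ⊆ U` with `ζ = η|_S` on `S ∩ V`. -/
def dS (S : Set X) {q : ℕ} (U : Opens X) (ζ : TForm (E := E) S q) : TForm (E := E) S (q + 1) :=
  fun x =>
    if h : x ∈ S ∧ ∃ η : X → Alt E q, ∃ V : Opens X, x ∈ V ∧ V ≤ U ∧ Extends S V η ζ then
      resT S (extM h.2.choose) x
    else 0

variable (E) in
/-- In a chart around each of its points, `S` is given by linear equations. -/
def LocLin (S : Set X) : Prop :=
  ∀ x ∈ S, ∃ φ ∈ IsManifold.maximalAtlas 𝓘(ℂ, E) ω X, x ∈ φ.source ∧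
    ∃ (ι : Type) (f : ι → (E →L[ℂ] ℂ)), ∀ z ∈ φ.source, z ∈ S ↔ ∀ i, f i (φ z) = 0

variable [IsManifold 𝓘(ℂ, E) ω X]

theorem resT_extM_zero {S : Set X} (hS : LocLin E S) {q : ℕ} {V : Opens X} {η : X → Alt E q}
    (hη : η ∈ HolOn (V : Set X) q) (h : ∀ y ∈ S ∩ V, resT S η y = 0) {x : X} (hx : x ∈ S ∩ V) :
    resT S (extM η) x = 0 := by
  obtain ⟨φ, hφ, hxφ, ι, f, hf⟩ := hS x hx.1
  let K : Submodule ℂ E := ⨅ i, (f i).ker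
  have hK : ∀ v, v ∈ K ↔ ∀ i, f i v = 0 := fun v => by simp [K, Submodule.mem_iInf]
  have hy := φ.map_source hxφ
  -- vectors of `K` are tangent to `S`
  have h1 : ∀ y ∈ φ.target, φ.symm y ∈ S → ∀ v ∈ K,
      mfd (E := E) (E' := E) φ.symm y v ∈ tan (E := E) S (φ.symm y) := by
    intro y hyt hyS v hv g hg hg0
    have hgm : MDifferentiableAt 𝓘(ℂ, E) 𝓘(ℂ, ℂ) g (φ.symm y) := hg.mdifferentiableAt (by simp)
    have e1 : mfd (E := E) (E' := ℂ) (g ∘ φ.symm) y v =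
        mfd (E := E) (E' := ℂ) g (φ.symm y) (mfd (E := E) (E' := E) φ.symm y v) := by
      rw [mfd_comp y hgm (mdiff_symm hφ hyt)]; rfl
    rw [← e1, mfd_eq_fderiv]
    have hd : DifferentiableAt ℂ (g ∘ φ.symm) y :=
      (hgm.comp y (mdiff_symm hφ hyt)).differentiableAt
    have hline : HasDerivAt (fun t : ℂ => (g ∘ φ.symm) (y + t • v))
        (fderiv ℂ (g ∘ φ.symm) y v) 0 := by
      have h2 : HasFDerivAt (g ∘ φ.symm) (fderiv ℂ (g ∘ φ.symm) y) (y + (0 : ℂ) • v) := by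
        simpa using hd.hasFDerivAt
      have h3 : HasDerivAt (fun t : ℂ => y + t • v) v 0 := by
        simpa using ((hasDerivAt_id (0 : ℂ)).smul_const v).const_add y
      exact h2.comp_hasDerivAt (0 : ℂ) h3
    have hyK : y ∈ K := by
      rw [hK]; intro i
      have := (hf _ (φ.map_target hyt)).1 hyS i
      rwa [φ.right_inv hyt] at this
    have hcont : Filter.Tendsto (fun t : ℂ => φ.symm (y + t • v)) (𝓝 0) (𝓝[S] (φ.symm y)) := by
      have hc : Filter.Tendsto (fun t : ℂ => y + t • v) (𝓝 0) (𝓝 y) := by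
        have : Continuous fun t : ℂ => y + t • v := by fun_prop
        simpa using this.tendsto 0
      refine tendsto_nhdsWithin_iff.2 ⟨(φ.continuousAt_symm hyt).tendsto.comp hc, ?_⟩
      filter_upwards [hc.eventually (φ.open_target.mem_nhds hyt)] with t ht
      rw [hf _ (φ.map_target ht), φ.right_inv ht]
      exact fun i => (hK _).1 (K.add_mem hyK (K.smul_mem t hv)) i
    have hz : (fun t : ℂ => (g ∘ φ.symm) (y + t • v)) =ᶠ[𝓝 0] fun _ => 0 := hcont.eventually hg0
    rw [← hline.deriv, hz.deriv_eq, deriv_const]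
  -- tangent vectors of `S` at `x` lie in `K`
  have h2 : ∀ v ∈ tan (E := E) S x, mfd (E := E) (E' := E) φ x v ∈ K := by
    intro v hv
    rw [hK]; intro i
    have hc : ContMDiffAt 𝓘(ℂ, E) 𝓘(ℂ, ℂ) ω (f i ∘ φ) x :=
      (f i).contMDiff.contMDiffAt.comp x
        ((contMDiffOn_of_mem_maximalAtlas hφ).contMDiffAt (φ.open_source.mem_nhds hxφ))
    have := hv (f i ∘ φ) hc (by
      filter_upwards [self_mem_nhdsWithin,
        mem_nhdsWithin_of_mem_nhds (φ.open_source.mem_nhds hxφ)] with z hz hz'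
      exact (hf z hz').1 hz i)
    rw [mfd_comp x (f i).differentiableAt.mdifferentiableAt (mdiff_chart hφ hxφ),
      mfd_eq_fderiv, (f i).fderiv] at this
    exact this
  have hxK : φ x ∈ K := (hK _).2 ((hf x hxφ).1 hx.1)
  let β := chartRep φ η
  have hβ : (fun s : K => pull (β s) (fderiv ℂ K.subtypeL s)) =ᶠ[𝓝 (⟨φ x, hxK⟩ : K)]
      fun _ => 0 := by
    have hev : ∀ᶠ y in 𝓝 (φ x), y ∈ φ.target ∧ φ.symm y ∈ V := by
      refine Filter.Eventually.and (φ.open_target.mem_nhds hy) ?_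
      refine (φ.continuousAt_symm hy).eventually ?_
      rw [φ.left_inv hxφ]
      exact V.isOpen.mem_nhds hx.2
    have hc : Filter.Tendsto (fun s : K => (s : E)) (𝓝 ⟨φ x, hxK⟩) (𝓝 (φ x)) :=
      continuous_subtype_val.tendsto _
    filter_upwards [hc.eventually hev] with s hs
    have hsS : φ.symm s ∈ S := by
      rw [hf _ (φ.map_target hs.1), φ.right_inv hs.1]
      exact (hK _).1 s.2
    ext v
    have h3 := h _ ⟨hsS, hs.2⟩
    rw [K.subtypeL.fderiv]
    exact DFunLike.congr_fun h3 fun i => ⟨_, h1 s hs.1 hsS (v i) (v i).2⟩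
  have hβa : AnalyticAt ℂ β (φ x) := hη.2 x hx.2 φ hφ hxφ
  have hβd : DifferentiableAt ℂ β (K.subtypeL (⟨φ x, hxK⟩ : K)) := hβa.differentiableAt
  have h4 := extDeriv_pullback (r := ω) hβd K.subtypeL.contDiff.contDiffAt le_top
  have h5 : extDeriv (fun _ : K => (0 : Alt K q)) ⟨φ x, hxK⟩ = 0 := by
    have := extDeriv_smul (x := (⟨φ x, hxK⟩ : K)) (0 : ℂ) (fun _ : K => (0 : Alt K q))
    rw [zero_smul, zero_smul] at this
    exact this
  replace h4 := (hβ.extDeriv_eq.symm.trans h4).symm.trans h5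
  rw [K.subtypeL.fderiv] at h4
  have h6 : chartRep φ (extM η) (φ x) = extDeriv β (φ x) := chartRep_extM (hη.2 x hx.2) hφ hxφ
  ext v
  have h7 := mfderiv_symm_comp hφ hxφ
  have h8 := DFunLike.congr_fun h4 fun i => (⟨_, h2 (v i) (v i).2⟩ : K)
  have h9 : extDeriv β (φ x) (fun i => mfd (E := E) (E' := E) φ x (v i)) = 0 := h8
  rw [← h6, chartRep, φ.left_inv hxφ] at h9
  refine Eq.trans ?_ h9
  change extM η x (fun i => _) = extM η x (fun i => _)
  congr 1
  ext1 i
  exact (DFunLike.congr_fun h7 (v i : E)).symm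

theorem dS_eq {S : Set X} (hS : LocLin E S) {q : ℕ} {U V : Opens X} {η : X → Alt E q}
    {ζ : TForm (E := E) S q} (h : Extends S V η ζ) (hVU : V ≤ U) {x : X} (hx : x ∈ S ∩ V) :
    dS S U ζ x = resT S (extM η) x := by
  have hex : x ∈ S ∧ ∃ η : X → Alt E q, ∃ V : Opens X, x ∈ V ∧ V ≤ U ∧ Extends S V η ζ :=
    ⟨hx.1, η, V, hx.2, hVU, h⟩
  rw [dS, dif_pos hex]
  obtain ⟨V', hxV', -, h'⟩ := hex.2.choose_spec
  set η' := hex.2.choose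
  have e1 := (h.smul (-1)).add h'
  have e2 := resT_extM_zero hS e1.1 (fun y hy => by
    rw [← e1.2 y hy]
    simp) (x := x) ⟨hx.1, hx.2, hxV'⟩
  have e3 : extM (((V ⊓ V' : Opens X) : Set X).indicator ((-1 : ℂ) • η + η')) x =
      (-1 : ℂ) • extM η x + extM η' x := by
    rw [← extM_congr (eventually_indicator (V ⊓ V').isOpen ⟨hx.2, hxV'⟩ _),
      extM_add ((h.1.2 x hx.2).smul _) (h'.1.2 x hxV'), extM_smul]
  rw [resT, e3] at e2
  ext v
  have e4 := DFunLike.congr_fun e2 v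
  have e5 : (-1 : ℂ) * resT S (extM η) x v + resT S (extM η') x v = 0 := e4
  linear_combination e5

theorem dS_of_notMem {S : Set X} {q : ℕ} {U : Opens X} {ζ : TForm (E := E) S q} {x : X}
    (hx : x ∉ S ∩ U) : dS S U ζ x = 0 := by
  rw [dS, dif_neg]
  rintro ⟨h1, η, V, h2, h3, -⟩
  exact hx ⟨h1, h3 h2⟩

theorem Extends.d {S : Set X} (hS : LocLin E S) {q : ℕ} {U V : Opens X} {η : X → Alt E q}
    {ζ : TForm (E := E) S q} (h : Extends S V η ζ) (hVU : V ≤ U) :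
    Extends S V (dOn (V : Set X) η) (dS S U ζ) :=
  ⟨dOn_mem V.isOpen h.1, fun y hy => by
    rw [dS_eq hS h hVU hy, resT, resT, dOn, Set.indicator_of_mem hy.2]⟩

/-- The exterior differential `Ω^q(S ∩ U) → Ω^{q+1}(S ∩ U)`. -/
def HolS.d {S : Set X} (hS : LocLin E S) (q : ℕ) (U : Opens X) :
    HolS (E := E) S q U →ₗ[ℂ] HolS (E := E) S (q + 1) U where
  toFun ζ := ⟨dS S U ζ.1, fun _ hx => dS_of_notMem hx, fun x hx => by
    obtain ⟨V, η, hxV, hV, h⟩ := ζ.2.2 x hx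
    exact ⟨V, _, hxV, hV, h.d hS hV⟩⟩
  map_add' ζ ζ' := by
    refine Subtype.ext <| funext fun x => ?_
    change dS S U (ζ.1 + ζ'.1) x = dS S U ζ.1 x + dS S U ζ'.1 x
    by_cases hx : x ∈ S ∩ U
    · obtain ⟨V, η, hxV, hV, h⟩ := ζ.2.2 x hx
      obtain ⟨V', η', hxV', hV', h'⟩ := ζ'.2.2 x hx
      rw [dS_eq hS h hV ⟨hx.1, hxV⟩, dS_eq hS h' hV' ⟨hx.1, hxV'⟩,
        dS_eq hS (h.add h') (inf_le_left.trans hV) ⟨hx.1, hxV, hxV'⟩, resT,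
        ← extM_congr (eventually_indicator (V ⊓ V').isOpen ⟨hxV, hxV'⟩ _),
        extM_add (h.1.2 x hxV) (h'.1.2 x hxV')]
      rfl
    · rw [dS_of_notMem hx, dS_of_notMem hx, dS_of_notMem hx, add_zero]
  map_smul' c ζ := by
    refine Subtype.ext <| funext fun x => ?_
    change dS S U (c • ζ.1) x = c • dS S U ζ.1 x
    by_cases hx : x ∈ S ∩ U
    · obtain ⟨V, η, hxV, hV, h⟩ := ζ.2.2 x hx
      rw [dS_eq hS h hV ⟨hx.1, hxV⟩, dS_eq hS (h.smul c) hV ⟨hx.1, hxV⟩, resT, extM_smul]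
      rfl
    · rw [dS_of_notMem hx, dS_of_notMem hx]
      exact (smul_zero (A := Alt (tan (E := E) S x) (q + 1)) c).symm

theorem HolS.d_d {S : Set X} (hS : LocLin E S) (q : ℕ) (U : Opens X)
    (ζ : HolS (E := E) S q U) : HolS.d hS (q + 1) U (HolS.d hS q U ζ) = 0 := by
  refine Subtype.ext <| funext fun x => ?_
  change dS S U (dS S U ζ.1) x = 0
  by_cases hx : x ∈ S ∩ U
  · obtain ⟨V, η, hxV, hV, h⟩ := ζ.2.2 x hx
    rw [dS_eq hS (h.d hS hV) hV ⟨hx.1, hxV⟩, resT]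
    have e1 := congrFun (dOn_dOn V.isOpen h.1) x
    rw [dOn, Set.indicator_of_mem (show x ∈ (V : Set X) from hxV)] at e1
    rw [e1]
    rfl
  · exact dS_of_notMem hx

open scoped Classical in
/-- The restriction map `Ω^q(S ∩ U) → Ω^q(S ∩ U')` for `U' ⊆ U`. -/
def HolS.res (S : Set X) (q : ℕ) {U U' : Opens X} (hU : U' ≤ U) :
    HolS (E := E) S q U →ₗ[ℂ] HolS (E := E) S q U' where
  toFun ζ := ⟨fun x => if x ∈ U' then ζ.1 x else 0, fun x hx => by
      change (if x ∈ U' then ζ.1 x else 0) = 0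
      by_cases hx' : x ∈ U'
      · rw [if_pos hx']; exact ζ.2.1 x fun h => hx ⟨h.1, hx'⟩
      · rw [if_neg hx'], fun x hx => by
      obtain ⟨V, η, hxV, hV, h⟩ := ζ.2.2 x ⟨hx.1, hU hx.2⟩
      refine ⟨V ⊓ U', _, ⟨hxV, hx.2⟩, inf_le_right,
        HolOn.indicator h.1 (V ⊓ U').isOpen inf_le_left, fun y hy => ?_⟩
      change (if y ∈ U' then ζ.1 y else 0) = _
      rw [if_pos (show y ∈ U' from hy.2.2), h.2 y ⟨hy.1, hy.2.1⟩, resT, resT, Set.indicator_of_mem hy.2]⟩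
  map_add' ζ ζ' := by
    refine Subtype.ext <| funext fun x => ?_
    by_cases hx' : x ∈ U' <;> simp [hx']
  map_smul' c ζ := by
    refine Subtype.ext <| funext fun x => ?_
    by_cases hx' : x ∈ U'
    · simp [hx']
    · simp only [if_neg hx']
      change _ = c • (if x ∈ U' then ζ.1 x else 0)
      rw [if_neg hx']
      exact (smul_zero (A := Alt (tan (E := E) S x) q) c).symm

theorem HolS.res_res (S : Set X) (q : ℕ) {U U' U'' : Opens X} (hU : U' ≤ U) (hU' : U'' ≤ U') :
    HolS.res S q hU' ∘ₗ HolS.res (E := E) S q hU = HolS.res S q (hU'.trans hU) := by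
  classical
  refine LinearMap.ext fun ζ => Subtype.ext <| funext fun x => ?_
  change (if x ∈ U'' then (if x ∈ U' then ζ.1 x else 0) else 0) = if x ∈ U'' then ζ.1 x else 0
  by_cases h : x ∈ U''
  · rw [if_pos h, if_pos h, if_pos (hU' h)]
  · rw [if_neg h, if_neg h]

theorem HolS.res_self (S : Set X) (q : ℕ) (U : Opens X) :
    HolS.res (E := E) S q (le_refl U) = LinearMap.id := by
  classical
  refine LinearMap.ext fun ζ => Subtype.ext <| funext fun x => ?_
  change (if x ∈ U then ζ.1 x else 0) = ζ.1 x
  by_cases h : x ∈ U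
  · rw [if_pos h]
  · rw [if_neg h]; exact (ζ.2.1 x fun h' => h h'.2).symm

theorem HolS.d_res {S : Set X} (hS : LocLin E S) (q : ℕ) {U U' : Opens X} (hU : U' ≤ U) :
    HolS.d hS q U' ∘ₗ HolS.res S q hU = HolS.res S (q + 1) hU ∘ₗ HolS.d hS q U := by
  classical
  refine LinearMap.ext fun ζ => Subtype.ext <| funext fun x => ?_
  change dS S U' (HolS.res S q hU ζ).1 x = if x ∈ U' then dS S U ζ.1 x else 0
  by_cases hx : x ∈ S ∩ U'
  · rw [if_pos (show x ∈ U' from hx.2)]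
    obtain ⟨V, η, hxV, hV, h⟩ := (HolS.res S q hU ζ).2.2 x hx
    have h' : Extends S V η ζ.1 := ⟨h.1, fun y hy => by
      rw [← h.2 y hy]
      exact (if_pos (hV hy.2)).symm⟩
    rw [dS_eq hS h hV ⟨hx.1, hxV⟩, dS_eq hS h' (hV.trans hU) ⟨hx.1, hxV⟩]
  · rw [dS_of_notMem hx]
    split_ifs with h
    · exact (dS_of_notMem fun h' => hx ⟨h'.1, h⟩).symm
    · rfl

end Subspaces

section Global

/-- A hypersurface arrangement in a complex manifold `X` modelled on `E`: finitely many pairwise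
distinct subsets `L_i` of `X` such that around each point of `X` there is a chart in which every
`L_i` (that meets the domain of the chart) is given by one non-zero linear equation. -/
structure Hypersurfaces (E : Type) [NormedAddCommGroup E] [NormedSpace ℂ E] (X : Type u)
    [TopologicalSpace X] [ChartedSpace E X] (l : ℕ) where
  hyp : Fin l → Set X
  injective : Function.Injective hyp
  locally_linear : ∀ x : X, ∃ φ ∈ IsManifold.maximalAtlas 𝓘(ℂ, E) ω X, x ∈ φ.source ∧
    ∀ i, (∀ z ∈ φ.source, z ∉ hyp i) ∨
      ∃ f : E →L[ℂ] ℂ, f ≠ 0 ∧ ∀ z ∈ φ.source, z ∈ hyp i ↔ f (φ z) = 0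

namespace Hypersurfaces

variable {E : Type} [NormedAddCommGroup E] [NormedSpace ℂ E]
  {X : Type u} [TopologicalSpace X] [ChartedSpace E X] {l : ℕ} (L : Hypersurfaces E X l)

/-- The intersection `L_I = ⋂_{i ∈ I} L_i`, equal to `X` for `I = ∅`. -/
def interX (I : Finset (Fin l)) : Set X := ⋂ i ∈ I, L.hyp i

/-- The union of the hypersurfaces. -/
def union : Set X := ⋃ i, L.hyp i

theorem isClosed_hyp (i : Fin l) : IsClosed (L.hyp i) := by
  rw [← isOpen_compl_iff, isOpen_iff_mem_nhds]
  intro x hx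
  obtain ⟨φ, -, hxφ, h⟩ := L.locally_linear x
  rcases h i with h | ⟨f, -, h⟩
  · filter_upwards [φ.open_source.mem_nhds hxφ] with z hz using h z hz
  · have h0 : f (φ x) ≠ 0 := fun h0 => hx ((h x hxφ).2 h0)
    filter_upwards [φ.open_source.mem_nhds hxφ,
      (f.continuous.continuousAt.comp (φ.continuousAt hxφ)).eventually_ne h0] with z hz hz'
    exact fun h' => hz' ((h z hz).1 h')

theorem isOpen_diff (U : Opens X) : IsOpen ((U : Set X) \ L.union) :=
  U.isOpen.sdiff (isClosed_iUnion_of_finite L.isClosed_hyp)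

theorem locLin_interX (I : Finset (Fin l)) : LocLin E (L.interX I) := by
  intro x hx
  obtain ⟨φ, hφ, hxφ, h⟩ := L.locally_linear x
  have h' : ∀ i : I, ∃ f : E →L[ℂ] ℂ, ∀ z ∈ φ.source, z ∈ L.hyp i ↔ f (φ z) = 0 := fun i => by
    rcases h i with h | ⟨f, -, h⟩
    · exact absurd (Set.mem_iInter₂.1 hx i i.2) (h x hxφ)
    · exact ⟨f, h⟩
  choose f hf using h'
  refine ⟨φ, hφ, hxφ, I, f, fun z hz => ?_⟩
  rw [interX, Set.mem_iInter₂]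
  exact ⟨fun hz' i => (hf i z hz).1 (hz' i i.2), fun hz' i hi => (hf ⟨i, hi⟩ z hz).2 (hz' ⟨i, hi⟩)⟩

/-- `f` is a defining equation of `L_i` on the open set `V`: it is holomorphic on `V`, its zero
set in `V` is `L_i ∩ V`, and its differential does not vanish at the points of `L_i ∩ V`. -/
def IsEquation (i : Fin l) (V : Opens X) (f : X → ℂ) : Prop :=
  ∀ x ∈ V, ContMDiffAt 𝓘(ℂ, E) 𝓘(ℂ, ℂ) ω f x ∧ (x ∈ L.hyp i ↔ f x = 0) ∧
    (x ∈ L.hyp i → mfd (E := E) (E' := ℂ) f x ≠ 0)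

/-- The forms `η ∧ df_{i₁}/f_{i₁} ∧ ⋯ ∧ df_{i_r}/f_{i_r}` on `V ∖ L`, where `η` is a holomorphic
form on `V`, `I = {i₁ < ⋯ < i_r}` and `f_i` is a defining equation of `L_i` on `V`. A form on
`V ∖ L` is encoded as a function on `X` whose values outside `V ∖ L` are immaterial. -/
inductive IsMonomial (V : Opens X) : Finset (Fin l) → (p : ℕ) → (X → Alt E p) → Prop
  | hol {q : ℕ} (η : X → Alt E q) (hη : η ∈ HolOn (V : Set X) q) : IsMonomial V ∅ q η
  | wedge {I : Finset (Fin l)} {p : ℕ} {η : X → Alt E p} (h : IsMonomial V I p η)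
      (j : Fin l) (hj : ∀ i ∈ I, i < j) (f : X → ℂ) (hf : L.IsEquation j V f) :
      IsMonomial V (insert j I) (p + 1) fun x => wedgeOne (η x) (dlogM f x)

/-- The linear combinations of the forms `η ∧ df_{i₁}/f_{i₁} ∧ ⋯ ∧ df_{i_r}/f_{i_r}` of degree `p`
on `V ∖ L` with `r ≤ k`, extended by zero to `X`. -/
def monSpan (k : ℤ) (p : ℕ) (V : Opens X) : Submodule ℂ (X → Alt E p) :=
  Submodule.span ℂ {ζ | ∃ (I : Finset (Fin l)) (η : X → Alt E p),
    (I.card : ℤ) ≤ k ∧ L.IsMonomial V I p η ∧ ζ = ((V : Set X) \ L.union).indicator η}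

/-- The restriction of forms to `V ∖ L` (extended by zero), as a linear map. -/
def cut (p : ℕ) (V : Opens X) : (X → Alt E p) →ₗ[ℂ] (X → Alt E p) where
  toFun ζ := ((V : Set X) \ L.union).indicator ζ
  map_add' ζ ζ' := Set.indicator_add _ _ _
  map_smul' c ζ := by
    ext1 x
    by_cases hx : x ∈ (V : Set X) \ L.union
    · simp [Set.indicator_of_mem hx]
    · simp only [Set.indicator_of_notMem hx, Pi.smul_apply, RingHom.id_apply]
      exact (smul_zero (A := Alt E p) c).symm

theorem cut_of_notMem {p : ℕ} {V : Opens X} {x : X} (hx : x ∉ (V : Set X) \ L.union)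
    (ζ : X → Alt E p) : L.cut p V ζ x = 0 :=
  Set.indicator_of_notMem hx ζ

theorem cut_cut (p : ℕ) {V V' : Opens X} (h : V' ≤ V) (ζ : X → Alt E p) :
    L.cut p V' (L.cut p V ζ) = L.cut p V' ζ := by
  ext1 x
  by_cases hx : x ∈ (V' : Set X) \ L.union
  · have hx' : x ∈ (V : Set X) \ L.union := ⟨h hx.1, hx.2⟩
    simp [cut, Set.indicator_of_mem hx, Set.indicator_of_mem hx']
  · simp [cut, Set.indicator_of_notMem hx]

variable {L} in
theorem IsMonomial.mono {V V' : Opens X} (hV : V' ≤ V) {I : Finset (Fin l)} {p : ℕ}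
    {η : X → Alt E p} (h : L.IsMonomial V I p η) :
    ∃ η', L.IsMonomial V' I p η' ∧ ∀ x ∈ V', η x = η' x := by
  induction h with
  | hol η hη =>
    exact ⟨_, .hol _ (HolOn.indicator hη V'.isOpen hV), fun x hx =>
      (Set.indicator_of_mem (show x ∈ (V' : Set X) from hx) η).symm⟩
  | wedge h j hj f hf ih =>
    obtain ⟨η', h', he⟩ := ih
    exact ⟨_, .wedge h' j hj f fun x hx => hf x (hV hx), fun x hx =>
      congrArg (fun a => wedgeOne a (dlogM f x)) (he x hx)⟩

theorem monSpan_mono {k : ℤ} {p : ℕ} {V V' : Opens X} (hV : V' ≤ V) {ζ : X → Alt E p}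
    (h : ζ ∈ L.monSpan k p V) : L.cut p V' ζ ∈ L.monSpan k p V' := by
  have : L.monSpan k p V ≤ (L.monSpan k p V').comap (L.cut p V') := by
    refine Submodule.span_le.2 ?_
    rintro _ ⟨I, η, hI, h, rfl⟩
    obtain ⟨η', h', he⟩ := h.mono hV
    refine Submodule.subset_span ⟨I, η', hI, h', ?_⟩
    have e1 := L.cut_cut p hV η
    refine e1.trans ?_
    refine Set.indicator_congr fun x hx => he x hx.1
  exact this h

/-- The sections over `U` of the sheaf `W_k Ω^p_{⟨X, L⟩}`: the forms on `U ∖ L` (extended by zero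
to `X`) that are locally on `U` linear combinations of forms
`η ∧ df_{i₁}/f_{i₁} ∧ ⋯ ∧ df_{i_r}/f_{i_r}` with `r ≤ k`, `η` holomorphic and `f_i` a local
defining equation of `L_i`. The sheaf `Ω^p_{⟨X, L⟩}` is the union of these sheaves. -/
def W (k : ℤ) (p : ℕ) (U : Opens X) : Submodule ℂ (X → Alt E p) where
  carrier := {ζ | (∀ x ∉ (U : Set X) \ L.union, ζ x = 0) ∧
    ∀ x ∈ U, ∃ V : Opens X, x ∈ V ∧ V ≤ U ∧ L.cut p V ζ ∈ L.monSpan k p V}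
  add_mem' := by
    rintro ζ ζ' ⟨h1, h2⟩ ⟨h1', h2'⟩
    refine ⟨fun x hx => by rw [Pi.add_apply, h1 x hx, h1' x hx, add_zero], fun x hx => ?_⟩
    obtain ⟨V, hxV, hV, h⟩ := h2 x hx
    obtain ⟨V', hxV', hV', h'⟩ := h2' x hx
    refine ⟨V ⊓ V', ⟨hxV, hxV'⟩, inf_le_left.trans hV, ?_⟩
    rw [map_add, ← L.cut_cut p inf_le_left ζ, ← L.cut_cut p inf_le_right ζ']
    exact add_mem (L.monSpan_mono inf_le_left h) (L.monSpan_mono inf_le_right h')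
  zero_mem' := by
    refine ⟨fun _ _ => rfl, fun x hx => ⟨U, hx, le_rfl, ?_⟩⟩
    rw [map_zero]
    exact zero_mem _
  smul_mem' := by
    rintro c ζ ⟨h1, h2⟩
    refine ⟨fun x hx => by
      rw [Pi.smul_apply, h1 x hx]; exact smul_zero (A := Alt E p) c, fun x hx => ?_⟩
    obtain ⟨V, hxV, hV, h⟩ := h2 x hx
    refine ⟨V, hxV, hV, ?_⟩
    rw [map_smul]
    exact Submodule.smul_mem _ _ h

theorem cut_mem_W {k : ℤ} {p : ℕ} {U U' : Opens X} (hU : U' ≤ U) {ζ : X → Alt E p}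
    (h : ζ ∈ L.W k p U) : L.cut p U' ζ ∈ L.W k p U' := by
  refine ⟨fun x hx => Set.indicator_of_notMem hx _, fun x hx => ?_⟩
  obtain ⟨V, hxV, hV, h⟩ := h.2 x (hU hx)
  refine ⟨V ⊓ U', ⟨hxV, hx⟩, inf_le_right, ?_⟩
  rw [L.cut_cut p inf_le_right, ← L.cut_cut p inf_le_left]
  exact L.monSpan_mono inf_le_left h

theorem cut_self {k : ℤ} {p : ℕ} {U : Opens X} {ζ : X → Alt E p} (h : ζ ∈ L.W k p U) :
    L.cut p U ζ = ζ := by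
  ext1 x
  by_cases hx : x ∈ (U : Set X) \ L.union
  · simp [cut, Set.indicator_of_mem hx]
  · rw [h.1 x hx]
    simp [cut, Set.indicator_of_notMem hx]

variable [IsManifold 𝓘(ℂ, E) ω X]

variable {L} in
theorem IsMonomial.holAt {V : Opens X} {I : Finset (Fin l)} {p : ℕ} {η : X → Alt E p}
    (h : L.IsMonomial V I p η) {x : X} (hx : x ∈ (V : Set X) \ L.union) : HolAt η x := by
  induction h with
  | hol η hη => exact hη.2 x hx.1
  | wedge h j hj f hf ih =>
    exact HolAt.wedge ih (hf x hx.1).1 fun h0 =>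
      hx.2 (Set.mem_iUnion.2 ⟨j, (hf x hx.1).2.1.2 h0⟩)

variable {L} in
theorem IsMonomial.extM {V : Opens X} {I : Finset (Fin l)} {p : ℕ} {η : X → Alt E p}
    (h : L.IsMonomial V I p η) :
    ∃ η', L.IsMonomial V I (p + 1) η' ∧ ∀ x ∈ (V : Set X) \ L.union, extM η x = η' x := by
  induction h with
  | hol η hη =>
    exact ⟨_, .hol _ (dOn_mem V.isOpen hη), fun x hx =>
      (Set.indicator_of_mem hx.1 (LogArr.extM η)).symm⟩
  | wedge h j hj f hf ih =>
    obtain ⟨η', h', he⟩ := ih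
    refine ⟨_, .wedge h' j hj f hf, fun x hx => ?_⟩
    rw [extM_wedge (h.holAt hx) (hf x hx.1).1 fun h0 =>
      hx.2 (Set.mem_iUnion.2 ⟨j, (hf x hx.1).2.1.2 h0⟩), he x hx]

theorem monSpan_le_holOn (k : ℤ) (p : ℕ) (V : Opens X) :
    L.monSpan k p V ≤ HolOn ((V : Set X) \ L.union) p := by
  refine Submodule.span_le.2 ?_
  rintro _ ⟨I, η, hI, h, rfl⟩
  exact ⟨fun x hx => Set.indicator_of_notMem hx _, fun x hx =>
    (h.holAt hx).congr (eventually_indicator (L.isOpen_diff V) hx η)⟩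

theorem dOn_mem_monSpan {k : ℤ} {p : ℕ} {V : Opens X} {ζ : X → Alt E p}
    (h : ζ ∈ L.monSpan k p V) :
    dOn ((V : Set X) \ L.union) ζ ∈ L.monSpan k (p + 1) V := by
  induction h using Submodule.span_induction with
  | mem ζ h =>
    obtain ⟨I, η, hI, h, rfl⟩ := h
    obtain ⟨η', h', he⟩ := h.extM
    refine Submodule.subset_span ⟨I, η', hI, h', ?_⟩
    refine Set.indicator_congr fun x hx => ?_
    rw [← he x hx]
    exact (extM_congr (eventually_indicator (L.isOpen_diff V) hx η)).symm
  | zero =>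
    have := dOn_smul ((V : Set X) \ L.union) (0 : ℂ) (0 : X → Alt E p)
    rw [zero_smul, zero_smul] at this
    rw [this]; exact zero_mem _
  | add _ _ hx hy h h' =>
    rw [dOn_add (L.monSpan_le_holOn k p V hx) (L.monSpan_le_holOn k p V hy)]
    exact add_mem h h'
  | smul c _ _ h => rw [dOn_smul]; exact Submodule.smul_mem _ _ h

theorem W_le_holOn (k : ℤ) (p : ℕ) (U : Opens X) :
    L.W k p U ≤ HolOn ((U : Set X) \ L.union) p := by
  refine fun ζ h => ⟨h.1, fun x hx => ?_⟩
  obtain ⟨V, hxV, hV, h⟩ := h.2 x hx.1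
  have hx' : x ∈ (V : Set X) \ L.union := ⟨hxV, hx.2⟩
  refine ((L.monSpan_le_holOn k p V h).2 x hx').congr ?_
  filter_upwards [eventually_indicator (L.isOpen_diff V) hx' ζ] with z hz using hz.symm

theorem cut_dOn {p : ℕ} {U U' : Opens X} (hU : U' ≤ U) (ζ : X → Alt E p) :
    L.cut (p + 1) U' (dOn ((U : Set X) \ L.union) ζ) =
      dOn ((U' : Set X) \ L.union) (L.cut p U' ζ) :=
  (dOn_indicator (L.isOpen_diff U') (Set.sdiff_subset_sdiff_left hU) ζ).symm

theorem dOn_mem_W {k : ℤ} {p : ℕ} {U : Opens X} {ζ : X → Alt E p} (h : ζ ∈ L.W k p U) :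
    dOn ((U : Set X) \ L.union) ζ ∈ L.W k (p + 1) U := by
  refine ⟨fun x hx => Set.indicator_of_notMem hx _, fun x hx => ?_⟩
  obtain ⟨V, hxV, hV, h⟩ := h.2 x hx
  refine ⟨V, hxV, hV, ?_⟩
  rw [L.cut_dOn hV]
  exact L.dOn_mem_monSpan h

/-- The exterior differential of `W_k Ω^•_{⟨X, L⟩}(U)`. -/
def Wd (k : ℤ) (p : ℕ) (U : Opens X) : L.W k p U →ₗ[ℂ] L.W k (p + 1) U where
  toFun ζ := ⟨dOn ((U : Set X) \ L.union) ζ.1, L.dOn_mem_W ζ.2⟩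
  map_add' ζ ζ' := Subtype.ext (dOn_add (L.W_le_holOn k p U ζ.2) (L.W_le_holOn k p U ζ'.2))
  map_smul' c ζ := Subtype.ext (dOn_smul _ c ζ.1)

/-- The restriction map `W_k Ω^p_{⟨X, L⟩}(U) → W_k Ω^p_{⟨X, L⟩}(U')` for `U' ⊆ U`. -/
def Wres (k : ℤ) (p : ℕ) {U U' : Opens X} (hU : U' ≤ U) : L.W k p U →ₗ[ℂ] L.W k p U' :=
  (L.cut p U').restrict fun _ h => L.cut_mem_W hU h

/-- The quotient `W_k Ω^p_{⟨X, L⟩}(U) / W_{k-1} Ω^p_{⟨X, L⟩}(U)`. -/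
abbrev grObj (k : ℤ) (p : ℕ) (U : Opens X) : Type u :=
  L.W k p U ⧸ (L.W (k - 1) p U).submoduleOf (L.W k p U)

/-- The class of a section of `W_k` in the quotient. -/
abbrev grMk (k : ℤ) (p : ℕ) (U : Opens X) : L.W k p U →ₗ[ℂ] L.grObj k p U :=
  ((L.W (k - 1) p U).submoduleOf (L.W k p U)).mkQ

/-- The differential of the quotient complex. -/
def grd (k : ℤ) (p : ℕ) (U : Opens X) : L.grObj k p U →ₗ[ℂ] L.grObj k (p + 1) U :=
  Submodule.mapQ _ _ (L.Wd k p U) fun _ h => L.dOn_mem_W (k := k - 1) h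

/-- The restriction maps of the quotients. -/
def grRes (k : ℤ) (p : ℕ) {U U' : Opens X} (hU : U' ≤ U) : L.grObj k p U →ₗ[ℂ] L.grObj k p U' :=
  Submodule.mapQ _ _ (L.Wres k p hU) fun _ h => L.cut_mem_W (k := k - 1) hU h

/-- The presheaf `U ↦ W_k Ω^p_{⟨X, L⟩}(U) / W_{k-1} Ω^p_{⟨X, L⟩}(U)`. -/
def grPsh (k : ℤ) (p : ℕ) : (Opens X)ᵒᵖ ⥤ ModuleCat.{u} ℂ where
  obj U := ModuleCat.of ℂ (L.grObj k p U.unop)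
  map i := ModuleCat.ofHom (L.grRes k p i.unop.le)
  map_id U := by
    ext1
    refine LinearMap.ext fun x => ?_
    obtain ⟨x, rfl⟩ := Submodule.mkQ_surjective _ x
    exact congrArg (L.grMk k p U.unop) (Subtype.ext (L.cut_self x.2))
  map_comp {U U' U''} i j := by
    ext1
    refine LinearMap.ext fun x => ?_
    obtain ⟨x, rfl⟩ := Submodule.mkQ_surjective _ x
    exact congrArg (L.grMk k p U''.unop) (Subtype.ext (L.cut_cut p j.unop.le x.1).symm)

/-- The complex of presheaves `U ↦ W_k Ω^•_{⟨X, L⟩}(U) / W_{k-1} Ω^•_{⟨X, L⟩}(U)`. -/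
def grPshCx (k : ℤ) : CochainComplex ((Opens X)ᵒᵖ ⥤ ModuleCat.{u} ℂ) ℕ :=
  CochainComplex.of (L.grPsh k)
    (fun p =>
      { app := fun U => ModuleCat.ofHom (L.grd k p U.unop)
        naturality := fun U U' i => by
          ext1
          refine LinearMap.ext fun x => ?_
          obtain ⟨x, rfl⟩ := Submodule.mkQ_surjective _ x
          exact congrArg (L.grMk k (p + 1) U'.unop)
            (Subtype.ext (L.cut_dOn i.unop.le x.1).symm) })
    (fun p => by
      ext U : 2
      ext1
      refine LinearMap.ext fun x => ?_
      obtain ⟨x, rfl⟩ := Submodule.mkQ_surjective _ x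
      have : L.Wd k (p + 1) U.unop (L.Wd k p U.unop x) = 0 :=
        Subtype.ext (dOn_dOn (L.isOpen_diff U.unop) (L.W_le_holOn k p U.unop x.2))
      change L.grMk k (p + 2) U.unop (L.Wd k (p + 1) U.unop (L.Wd k p U.unop x)) = 0
      rw [this, map_zero])

instance forget_preservesFilteredColimits :
    Limits.PreservesFilteredColimitsOfSize.{u, u} (forget (ModuleCat.{u} ℂ)) :=
  inferInstanceAs (Limits.PreservesFilteredColimitsOfSize.{u, u}
    (forget₂ (ModuleCat.{u} ℂ) AddCommGrpCat.{u} ⋙ forget AddCommGrpCat.{u}))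

/-- Sheafification of complexes of presheaves of complex vector spaces. -/
abbrev sheafifyCx (K : CochainComplex ((Opens X)ᵒᵖ ⥤ ModuleCat.{u} ℂ) ℕ) :
    CochainComplex (Sheaf (Opens.grothendieckTopology X) (ModuleCat.{u} ℂ)) ℕ :=
  ((presheafToSheaf (Opens.grothendieckTopology X) (ModuleCat.{u} ℂ)).mapHomologicalComplex
    (ComplexShape.up ℕ)).obj K

/-- The complex of sheaves `gr_k^W Ω^•_{⟨X, L⟩} = W_k Ω^•_{⟨X, L⟩} / W_{k-1} Ω^•_{⟨X, L⟩}`. -/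
def gr (k : ℤ) : CochainComplex (Sheaf (Opens.grothendieckTopology X) (ModuleCat.{u} ℂ)) ℕ :=
  sheafifyCx (L.grPshCx k)

/-- The strata of codimension `k`: the non-empty intersections `L_I` of codimension `k`. -/
structure Stratum (k : ℕ) : Type u where
  carrier : Set X
  exists_eq : ∃ I : Finset (Fin l), L.interX I = carrier
  nonempty : carrier.Nonempty
  codim_eq : ∀ x ∈ carrier, codim (tan (E := E) carrier x) = k

namespace Stratum

variable {L} {k : ℕ} (S : L.Stratum k)

theorem locLin : LocLin E S.carrier := by
  obtain ⟨I, hI⟩ := S.exists_eq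
  rw [← hI]
  exact L.locLin_interX I

/-- A point `p` of the stratum. -/
def point : X := S.nonempty.some

/-- The indices of the hypersurfaces that contain the point `p` of the stratum. -/
abbrev Index : Type := {i : Fin l // S.point ∈ L.hyp i}

/-- The central hyperplane arrangement `L^{(p)}` in the tangent space of `X` at the point `p` of
the stratum: its hyperplanes are the tangent spaces of the hypersurfaces through `p`. -/
def localArr (i : S.Index) : Submodule ℂ E := tan (L.hyp i) S.point

/-- `A_S(L) = A_S(L^{(p)})` for the point `p` of the stratum `S`. -/
abbrev A : Type := osPart S.localArr (tan S.carrier S.point)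

end Stratum

/-- `⨁_{codim S = k} Ω^q(S ∩ U) ⊗ A_S(L)`. -/
abbrev GObj (k q : ℕ) (U : Opens X) : Type u :=
  ⨁ S : L.Stratum k, TensQ (HolS (E := E) S.carrier q U) S.A

/-- The presheaf `U ↦ ⨁_{codim S = k} Ω^q(S ∩ U) ⊗ A_S(L)`. -/
def GPsh (k q : ℕ) : (Opens X)ᵒᵖ ⥤ ModuleCat.{u} ℂ where
  obj U := ModuleCat.of ℂ (L.GObj k q U.unop)
  map i := ModuleCat.ofHom (DirectSum.lmap fun S : L.Stratum k =>
    TensQ.map S.A (HolS.res S.carrier q i.unop.le))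
  map_id U := by
    classical
    ext1
    refine DirectSum.linearMap_ext _ fun S => LinearMap.ext fun x => ?_
    simp [HolS.res_self, TensQ.map_id]
  map_comp i j := by
    classical
    ext1
    refine DirectSum.linearMap_ext _ fun S => LinearMap.ext fun x => ?_
    simp [HolS.res_res, TensQ.map_map]

/-- The complex of presheaves `q ↦ (U ↦ ⨁_{codim S = k} Ω^q(S ∩ U) ⊗ A_S(L))`, with the
differentials `η ⊗ a ↦ dη ⊗ a`. -/
def GPshCx (k : ℕ) : CochainComplex ((Opens X)ᵒᵖ ⥤ ModuleCat.{u} ℂ) ℕ :=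
  CochainComplex.of (L.GPsh k)
    (fun q =>
      { app := fun U => ModuleCat.ofHom (DirectSum.lmap fun S : L.Stratum k =>
          TensQ.map S.A (HolS.d S.locLin q U.unop))
        naturality := fun U U' i => by
          classical
          ext1
          refine DirectSum.linearMap_ext _ fun S => LinearMap.ext fun x => ?_
          change DirectSum.lmap _ (DirectSum.lmap _ (DirectSum.lof ℂ _
              (fun S : L.Stratum k => TensQ (HolS (E := E) S.carrier q U.unop) S.A) S x)) =
            DirectSum.lmap _ (DirectSum.lmap _ (DirectSum.lof ℂ _
              (fun S : L.Stratum k => TensQ (HolS (E := E) S.carrier q U.unop) S.A) S x))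
          simp only [DirectSum.lmap_lof]
          refine congrArg _ ?_
          simp only [TensQ.map_map, HolS.d_res] })
    (fun q => by
      classical
      ext U : 2
      ext1
      refine DirectSum.linearMap_ext _ fun S => LinearMap.ext fun x => ?_
      have h : HolS.d S.locLin (q + 1) U.unop ∘ₗ HolS.d S.locLin q U.unop = 0 :=
        LinearMap.ext fun η => HolS.d_d S.locLin q U.unop η
      change DirectSum.lmap _ (DirectSum.lmap _ (DirectSum.lof ℂ _
          (fun S : L.Stratum k => TensQ (HolS (E := E) S.carrier q U.unop) S.A) S x)) = 0
      simp only [DirectSum.lmap_lof, TensQ.map_map, h, TensQ.map_zero, map_zero])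

/-- The complex of sheaves
`𝒢_k^•(X, L) = ⨁_{codim S = k} (i_S)_* Ω_S^{• - k} ⊗ A_S(L)`. -/
def G (k : ℕ) : CochainComplex (Sheaf (Opens.grothendieckTopology X) (ModuleCat.{u} ℂ)) ℕ :=
  (sheafifyCx (L.GPshCx k)).extend (shiftBy k)

open scoped Classical in
/-- The section `η ⊗ e_I` over `U` of `⨁_{codim S = k} (i_S)_* Ω_S^q ⊗ A_S(L)`, for a
holomorphic `q`-form `η` on `S ∩ U` and a set `I` of hypersurfaces through the point `p` of `S`
such that `L^{(p)}_I = T_p S`. -/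
def gElem {k q : ℕ} {U : Opens X} (S : L.Stratum k) (η : HolS (E := E) S.carrier q U)
    (I : Finset S.Index) (hI : inter S.localArr I = tan S.carrier S.point) :
    (L.GPsh k q).obj (op U) :=
  DirectSum.lof ℂ (L.Stratum k) (fun S => TensQ (HolS (E := E) S.carrier q U) S.A) S
    (TensQ.tmul η (osGen S.localArr I hI))

/-- The form `(2iπ)^{-k} η ∧ df_{i₁}/f_{i₁} ∧ ⋯ ∧ df_{i_k}/f_{i_k}` on `U ∖ L`, extended by
zero to `X`. -/
def phiFun {k q : ℕ} (U : Opens X) (η : X → Alt E q) (i : Fin k → Fin l)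
    (f : Fin l → X → ℂ) : X → Alt E (q + k) :=
  ((2 * Complex.I * Real.pi : ℂ) ^ k)⁻¹ • L.cut (q + k) U
    fun x => wedgeTuple (η x) k fun s => dlogM (f (i s)) x

variable {L} in
theorem isMonomial_wedgeTuple {q : ℕ} {U : Opens X} {η : X → Alt E q}
    (hη : η ∈ HolOn (U : Set X) q) (f : Fin l → X → ℂ) (r : ℕ) (i : Fin r → Fin l)
    (hi : StrictMono i) (hf : ∀ s, L.IsEquation (i s) U (f (i s))) :
    L.IsMonomial U (Finset.univ.image i) (q + r)
      fun x => wedgeTuple (η x) r fun s => dlogM (f (i s)) x := by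
  induction r with
  | zero => exact .hol η hη
  | succ r ih =>
    have h1 := ih (Fin.init i) (fun a b hab => hi (Fin.castSucc_lt_castSucc_iff.2 hab))
      fun s => hf s.castSucc
    have h2 : Finset.univ.image i =
        insert (i (Fin.last r)) (Finset.univ.image (Fin.init i)) := by
      ext a
      simp only [Finset.mem_image, Finset.mem_univ, true_and, Finset.mem_insert]
      constructor
      · rintro ⟨b, rfl⟩
        induction b using Fin.lastCases with
        | last => exact Or.inl rfl
        | cast b => exact Or.inr ⟨b, rfl⟩
      · rintro (rfl | ⟨b, rfl⟩)
        · exact ⟨_, rfl⟩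
        · exact ⟨b.castSucc, rfl⟩
    rw [h2]
    refine .wedge h1 (i (Fin.last r)) (fun a ha => ?_) _ (hf (Fin.last r))
    obtain ⟨b, -, rfl⟩ := Finset.mem_image.1 ha
    exact hi (Fin.castSucc_lt_last b)

theorem phiFun_mem {k q : ℕ} {U : Opens X} {η : X → Alt E q} (hη : η ∈ HolOn (U : Set X) q)
    {i : Fin k → Fin l} (hi : StrictMono i) {f : Fin l → X → ℂ}
    (hf : ∀ s, L.IsEquation (i s) U (f (i s))) : L.phiFun U η i f ∈ L.W k (q + k) U := by
  refine Submodule.smul_mem _ _ ⟨fun x hx => L.cut_of_notMem hx _, fun x hx => ⟨U, hx, le_rfl, ?_⟩⟩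
  rw [L.cut_cut _ le_rfl]
  refine Submodule.subset_span ⟨_, _, ?_, isMonomial_wedgeTuple hη f k i hi hf, rfl⟩
  exact_mod_cast Finset.card_image_le.trans (by simp)

/-- The indices `i₁ < ⋯ < i_k` of a set `I` of `k` hypersurfaces through a point. -/
def Stratum.enum {L : Hypersurfaces E X l} {k : ℕ} {S : L.Stratum k} (I : Finset S.Index)
    (hI : I.card = k) (s : Fin k) : Fin l := (I.orderEmbOfFin hI s).1

theorem Stratum.enum_strictMono {L : Hypersurfaces E X l} {k : ℕ} {S : L.Stratum k}
    (I : Finset S.Index) (hI : I.card = k) : StrictMono (Stratum.enum I hI) :=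
  fun _ _ h => (I.orderEmbOfFin hI).strictMono h

/-- A morphism of complexes of sheaves `Φ : 𝒢_k^•(X, L) ⟶ gr_k^W Ω^•_{⟨X, L⟩}` satisfies
`Φ(η ⊗ e_I) = (2iπ)^{-k} η̃ ∧ df_{i₁}/f_{i₁} ∧ ⋯ ∧ df_{i_k}/f_{i_k}` for all local
sections `η` of `Ω_S^q`, all independent `I = {i₁ < ⋯ < i_k}` with `L_I = S`, all holomorphic
forms `η̃` that restrict to `η` and all local defining equations `f_i` of the `L_i`. -/
def IsPhi (k : ℕ) (Φ : L.G k ⟶ L.gr k) : Prop :=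
  ∀ (q : ℕ) (U : Opens X) (S : L.Stratum k) (I : Finset S.Index) (hI : I.card = k)
    (hS : inter S.localArr I = tan S.carrier S.point)
    (η : HolS (E := E) S.carrier q U) (η' : X → Alt E q) (hη' : η' ∈ HolOn (U : Set X) q)
    (_ : ∀ x ∈ S.carrier ∩ U, η.1 x = resT S.carrier η' x)
    (f : Fin l → X → ℂ)
    (hf : ∀ s, L.IsEquation (Stratum.enum I hI s) U (f (Stratum.enum I hI s))),
    (toSheafify (Opens.grothendieckTopology X) (L.GPsh k q) ≫
        (((sheafifyCx (L.GPshCx k)).extendXIso (shiftBy k) (i := q) rfl).inv ≫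
          Φ.f (q + k)).hom).app (op U) (L.gElem S η I hS) =
      (toSheafify (Opens.grothendieckTopology X) (L.grPsh k (q + k))).app (op U)
        (L.grMk k (q + k) U ⟨L.phiFun U η' (Stratum.enum I hI) f,
          L.phiFun_mem hη' (Stratum.enum_strictMono I hI) hf⟩)

end Hypersurfaces

end Global

end LogArr

end

/-!
# Logarithmic forms and the Orlik-Solomon algebra

Near a point all hypersurfaces are hyperplanes `f i = 0`, and the theorem becomes a statement on
forms `η ∧ ω_I`, where `ω_i = d f_i / f_i`, modulo forms of the same kind with fewer poles.

*The map exists.* The Orlik-Solomon relations hold between the `ω_I` on the nose: the contraction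
with the Euler vector field maps each `ω_i` to `1`, hence turns the zero form `ω_I` of a dependent
set `I` into the image of `δ(e_I)` (`extEval_extDelta`, `extEval_dlogVec_extDelta`). The choice of
the extension `η̃` does not matter: by Hadamard's lemma (`exists_analyticOnNhd_div`) a form that
vanishes on `L_I` is a combination of multiples of the `f_i` and of the `d f_i`, for `i ∈ I`, and
both cancel a pole of `ω_I` (`logMon_mem_of_vanish`).

*It is surjective*, because the monomials `ω_I` of dependent sets vanish
(`extEval_dlogVec_eq_zero`).

*It is injective.* The monomials `e_J` for the sets `J` without broken circuits span `A_S`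
(`osPart_le_span_nbc`), so it is enough that a sum of forms `η_J ∧ ω_J` over sets `J` of
cardinality `k` without broken circuits has fewer than `k` poles only if every `η_J` vanishes on
`L_J` (`pull_eq_zero_of_sum_mem`). The form `η_J` on `L_J` is recovered as an iterated residue.
Instead of taking `k` residues in turn, one evaluates the sum along the curve
`x + t e_1 + t² e_2 + ⋯ + t^k e_k` that leaves `L_J` at a generic point `x` at different speeds in
the directions dual to the elements of `J`. As `t → 0` each `d f_i / f_i` tends to a covector that
sees at most one of these directions, namely the one in the leading term of `f_i`
(`exists_limit_covectors`). The limit of `η_I ∧ ω_I` is therefore zero if `I` has fewer than `k`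
elements (`tendsto_zero_of_mem_logSpan`), and for two sets `I` and `J` without broken circuits all
`k` directions are leading in `I` only if `I = J` (`eq_of_leading`).

*From the local to the global statement.* Since the intersections `L_J` are connected, an inclusion
`L_J ⊆ L_a` can be read off in a chart around any point of `L_J` (`LinChart.subset_hyp_iff`). The
relations of `A_S`, which are defined at one point of the stratum `S`, therefore hold around all of
its points. Replacing the linear equations by other defining equations changes `η̃ ∧ ω_I` by forms
with fewer poles (`LinChart.chartRep_monM_sub_mem`). In order to define a morphism of sheaves one
considers the subspace `phiRel` of pairs of sections that is spanned by the pairs of `η ⊗ e_I` and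
the class of `(2iπ)^{-k} η̃ ∧ ω_I`. Locally every section of either presheaf belongs to a pair
(`exists_phiRel_left`, `exists_phiRel_right`), and the local statement at all points shows that
each member of a pair determines the other one (`eq_zero_of_phiRel_left`,
`eq_zero_of_phiRel_right`). Both projections of `phiRel` hence become isomorphisms after
sheafification. The differentials preserve `phiRel` (`phiRel_d`), so these isomorphisms are
compatible with them, and the compatible morphism is unique because the first projection is an
isomorphism.
-/

noncomputable section

set_option linter.unusedSectionVars false

namespace LogArr

universe u v w

/-! ### Monomials in the exterior algebra -/

section ExteriorMonomials

variable {ι : Type} [LinearOrder ι]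

/-- The generator `e_i` of the exterior algebra. -/
abbrev extGen (i : ι) : ExtAlg ι := ExteriorAlgebra.ι ℚ (Finsupp.single i (1 : ℚ))

theorem extGen_mul_self (i : ι) : extGen i * extGen i = 0 := ExteriorAlgebra.ι_sq_zero _

theorem extGen_mul_swap (i j : ι) : extGen i * extGen j = -(extGen j * extGen i) :=
  eq_neg_of_add_eq_zero_left (ExteriorAlgebra.ι_add_mul_swap _ _)

theorem extMonomial_eq_prod (I : Finset ι) :
    extMonomial I = ((I.sort (· ≤ ·)).map extGen).prod := by
  rw [extMonomial, ← Finset.listMap_orderEmbOfFin_finRange I rfl, List.map_map, List.ofFn_eq_map]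
  rfl

theorem extMonomial_empty : extMonomial (∅ : Finset ι) = 1 := by
  simp [extMonomial_eq_prod]

theorem extMonomial_insert_min {a : ι} {I : Finset ι} (h : ∀ i ∈ I, a < i) :
    extMonomial (insert a I) = extGen a * extMonomial I := by
  rw [extMonomial_eq_prod, extMonomial_eq_prod,
    Finset.sort_insert _ (fun b hb => (h b hb).le) fun ha => lt_irrefl _ (h a ha)]
  simp

theorem orderEmbOfFin_insert_min {a : ι} {I : Finset ι} (h : ∀ i ∈ I, a < i) {k : ℕ}
    (hk : I.card = k) (hk' : (insert a I).card = k + 1) :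
    ⇑((insert a I).orderEmbOfFin hk') = Fin.cons a (I.orderEmbOfFin hk) := by
  symm
  refine Finset.orderEmbOfFin_unique hk' (fun x => ?_) fun x y hxy => ?_
  · induction x using Fin.cases with
    | zero => simp
    | succ x => simp [Finset.orderEmbOfFin_mem]
  · induction y using Fin.cases with
    | zero => exact absurd hxy (Fin.not_lt_zero x)
    | succ y =>
      induction x using Fin.cases with
      | zero => simpa using h _ (Finset.orderEmbOfFin_mem I hk y)
      | succ x => simpa using hxy

theorem extDelta_eq_sum {I : Finset ι} {k : ℕ} (hk : I.card = k) :
    extDelta I = ∑ s : Fin k, (-1 : ℚ) ^ (s : ℕ) •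
      extMonomial (I.erase (I.orderEmbOfFin hk s)) := by
  subst hk; rfl

theorem extDelta_empty : extDelta (∅ : Finset ι) = 0 := by
  rw [extDelta_eq_sum Finset.card_empty, Fin.sum_univ_zero]

theorem extDelta_insert_min {a : ι} {I : Finset ι} (h : ∀ i ∈ I, a < i) :
    extDelta (insert a I) = extMonomial I - extGen a * extDelta I := by
  have ha : a ∉ I := fun ha => lt_irrefl _ (h a ha)
  rw [extDelta_eq_sum (Finset.card_insert_of_notMem ha), Fin.sum_univ_succ,
    orderEmbOfFin_insert_min h rfl, extDelta, Finset.mul_sum, sub_eq_add_neg,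
    ← Finset.sum_neg_distrib]
  congr 1
  · simp [ha]
  · refine Finset.sum_congr rfl fun s _ => ?_
    have hs := Finset.orderEmbOfFin_mem I rfl s
    rw [Fin.cons_succ, Finset.erase_insert_of_ne (h _ hs).ne, extMonomial_insert_min fun i hi =>
      h i (Finset.mem_of_mem_erase hi)]
    simp [pow_succ]

theorem extMonomial_union {A B : Finset ι} (h : ∀ a ∈ A, ∀ b ∈ B, a < b) :
    extMonomial (A ∪ B) = extMonomial A * extMonomial B := by
  induction A using Finset.induction_on_min with
  | empty => simp [extMonomial_empty]
  | insert a A ha ih =>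
    rw [Finset.insert_union, extMonomial_insert_min, ih, extMonomial_insert_min ha, mul_assoc]
    · exact fun x hx b hb => h x (Finset.mem_insert_of_mem hx) b hb
    · intro i hi
      rcases Finset.mem_union.1 hi with hi | hi
      · exact ha i hi
      · exact h a (Finset.mem_insert_self _ _) i hi

theorem extGen_mul_extMonomial_of_mem {j : ι} {I : Finset ι} (hj : j ∈ I) :
    extGen j * extMonomial I = 0 := by
  induction I using Finset.induction_on_min with
  | empty => simp at hj
  | insert a I ha ih =>
    rw [extMonomial_insert_min ha, ← mul_assoc]
    rcases Finset.mem_insert.1 hj with rfl | hj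
    · rw [extGen_mul_self, zero_mul]
    · rw [extGen_mul_swap, neg_mul, mul_assoc, ih hj, mul_zero, neg_zero]

theorem extGen_mul_extMonomial {j : ι} {I : Finset ι} (hj : j ∉ I) :
    extGen j * extMonomial I = extMonomial (insert j I) ∨
      extGen j * extMonomial I = -extMonomial (insert j I) := by
  induction I using Finset.induction_on_min with
  | empty => left; rw [extMonomial_insert_min (by simp)]
  | insert a I ha ih =>
    rw [Finset.mem_insert, not_or] at hj
    rcases lt_or_gt_of_ne hj.1 with hja | hja
    · exact Or.inl (extMonomial_insert_min fun i hi => by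
        rcases Finset.mem_insert.1 hi with rfl | hi
        exacts [hja, hja.trans (ha i hi)]).symm
    · have h1 : ∀ i ∈ insert j I, a < i := by
        intro i hi
        rcases Finset.mem_insert.1 hi with rfl | hi
        exacts [hja, ha i hi]
      rw [extMonomial_insert_min ha, ← mul_assoc, extGen_mul_swap, neg_mul, mul_assoc,
        Finset.insert_comm, extMonomial_insert_min h1]
      rcases ih hj.2 with h | h
      · right; rw [h]
      · left; rw [h]; simp

theorem extMonomial_mul_extGen_comm (j : ι) (I : Finset ι) :
    extMonomial I * extGen j = (-1 : ℚ) ^ I.card • (extGen j * extMonomial I) := by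
  induction I using Finset.induction_on_min with
  | empty => simp [extMonomial_empty]
  | insert a I ha ih =>
    rw [extMonomial_insert_min ha, mul_assoc, ih,
      Finset.card_insert_of_notMem fun h => lt_irrefl _ (ha a h), mul_smul_comm, ← mul_assoc,
      ← mul_assoc, extGen_mul_swap a j, pow_succ]
    simp

end ExteriorMonomials

/-! ### Dependence and broken circuits -/

section Arrangement

variable {E : Type} [AddCommGroup E] [Module ℂ E] {ι : Type} [LinearOrder ι]
  {H : ι → Submodule ℂ E}

theorem mem_inter {I : Finset ι} {v : E} : v ∈ inter H I ↔ ∀ i ∈ I, v ∈ H i := by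
  simp [inter, Submodule.mem_iInf]

theorem inter_anti {I J : Finset ι} (h : I ⊆ J) : inter H J ≤ inter H I := fun _ hv =>
  mem_inter.2 fun i hi => mem_inter.1 hv i (h hi)

theorem inter_le {I : Finset ι} {i : ι} (h : i ∈ I) : inter H I ≤ H i := fun _ hv =>
  mem_inter.1 hv i h

theorem inter_insert (a : ι) (I : Finset ι) : inter H (insert a I) = inter H I ⊓ H a := by
  ext v; simp [mem_inter, and_comm]

/-- The hyperplanes of `I` are independent: none of them contains the intersection of the
others. -/
def Indep (H : ι → Submodule ℂ E) (I : Finset ι) : Prop :=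
  ∀ c ∈ I, ¬ inter H (I.erase c) ≤ H c

/-- The set `I` contains no broken circuit: no hyperplane `H i` contains the intersection of the
hyperplanes of `I` whose index is larger than `i`. -/
def NoBroken (H : ι → Submodule ℂ E) (I : Finset ι) : Prop :=
  ∀ i, ¬ inter H (I.filter (i < ·)) ≤ H i

theorem Indep.mono {I J : Finset ι} (h : Indep H J) (hI : I ⊆ J) : Indep H I := fun c hc hle =>
  h c (hI hc) ((inter_anti (Finset.erase_subset_erase c hI)).trans hle)

/-- Every member of the family is the kernel of a linear form, possibly zero. -/
def IsKer (H : ι → Submodule ℂ E) : Prop := ∀ i, ∃ f : E →ₗ[ℂ] ℂ, H i = LinearMap.ker f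

variable [FiniteDimensional ℂ E]

theorem codim_add_finrank (K : Submodule ℂ E) :
    codim K + Module.finrank ℂ K = Module.finrank ℂ E := K.finrank_quotient_add_finrank

theorem codim_inf_ker {K : Submodule ℂ E} {f : E →ₗ[ℂ] ℂ} (h : ¬ K ≤ LinearMap.ker f) :
    codim (K ⊓ LinearMap.ker f) = codim K + 1 := by
  have h1 : f.domRestrict K ≠ 0 := by
    intro h0
    exact h fun v hv => LinearMap.congr_fun h0 ⟨v, hv⟩
  have h2 := Module.Dual.finrank_ker_add_one_of_ne_zero (f := f.domRestrict K) h1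
  have h3 : (LinearMap.ker (f.domRestrict K)).map K.subtype = K ⊓ LinearMap.ker f := by
    ext v
    simp [and_comm]
  have h4 := Submodule.finrank_map_subtype_eq K (LinearMap.ker (f.domRestrict K))
  rw [h3] at h4
  have h5 := codim_add_finrank K
  have h6 := codim_add_finrank (K ⊓ LinearMap.ker f)
  omega

theorem codim_inter_insert_le (hH : IsKer H) (a : ι) (I : Finset ι) :
    codim (inter H (insert a I)) ≤ codim (inter H I) + 1 := by
  obtain ⟨f, hf⟩ := hH a
  rw [inter_insert]
  by_cases h : inter H I ≤ H a
  · rw [inf_eq_left.2 h]; omega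
  · rw [hf] at h ⊢
    rw [codim_inf_ker h]

theorem codim_inter_insert (hH : IsKer H) {a : ι} {I : Finset ι} (h : ¬ inter H I ≤ H a) :
    codim (inter H (insert a I)) = codim (inter H I) + 1 := by
  obtain ⟨f, hf⟩ := hH a
  rw [inter_insert]
  rw [hf] at h ⊢
  rw [codim_inf_ker h]

theorem codim_inter_empty : codim (inter H ∅) = 0 := by
  have : inter H ∅ = ⊤ := by ext; simp [mem_inter]
  rw [this]
  have := codim_add_finrank (⊤ : Submodule ℂ E)
  rw [finrank_top] at this
  omega

theorem codim_inter_le (hH : IsKer H) (I : Finset ι) : codim (inter H I) ≤ I.card := by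
  induction I using Finset.induction_on with
  | empty => simp [codim_inter_empty]
  | insert a I ha ih =>
    rw [Finset.card_insert_of_notMem ha]
    exact (codim_inter_insert_le hH a I).trans (by omega)

/-- Independence in terms of codimensions agrees with the condition that no member of the family
contains the intersection of the others. -/
theorem codim_inter_eq_iff (hH : IsKer H) (I : Finset ι) :
    codim (inter H I) = I.card ↔ Indep H I := by
  constructor
  · intro h c hc hle
    have h1 : inter H I = inter H (I.erase c) := by
      conv_lhs => rw [← Finset.insert_erase hc]
      rw [inter_insert, inf_eq_left.2 hle]
    have h2 := codim_inter_le hH (I.erase c)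
    rw [← h1, h] at h2
    have := Finset.card_erase_lt_of_mem hc
    omega
  · induction I using Finset.induction_on with
    | empty => intro _; simp [codim_inter_empty]
    | insert a I ha ih =>
      intro h
      have h1 := h a (Finset.mem_insert_self a I)
      rw [Finset.erase_insert ha] at h1
      rw [codim_inter_insert hH h1, Finset.card_insert_of_notMem ha,
        ih (h.mono (Finset.subset_insert a I))]

theorem codim_inter_lt_iff (hH : IsKer H) (I : Finset ι) :
    codim (inter H I) < I.card ↔ ¬ Indep H I := by
  rw [← codim_inter_eq_iff hH]
  have := codim_inter_le hH I
  omega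

theorem eq_of_le_of_codim_le {K K' : Submodule ℂ E} (h : K ≤ K') (hc : codim K ≤ codim K') :
    K = K' := by
  refine Submodule.eq_of_le_of_finrank_le h ?_
  have h1 := codim_add_finrank K
  have h2 := codim_add_finrank K'
  omega

/-! ### Broken circuits in the Orlik-Solomon algebra -/

theorem mul_mem_osIdeal (a b : ExtAlg ι) {z : ExtAlg ι} (hz : z ∈ osIdeal H) :
    a * z * b ∈ osIdeal H := by
  induction hz using Submodule.span_induction with
  | mem z hz =>
    obtain ⟨a', b', I, hI, rfl⟩ := hz
    exact Submodule.subset_span ⟨a * a', b' * b, I, hI, by simp only [mul_assoc]⟩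
  | zero => simp
  | add x y _ _ hx hy => rw [mul_add, add_mul]; exact add_mem hx hy
  | smul c x _ hx => rw [mul_smul_comm, smul_mul_assoc]; exact Submodule.smul_mem _ _ hx

theorem extDelta_mem_osIdeal {I : Finset ι} (hI : codim (inter H I) < I.card) :
    extDelta I ∈ osIdeal H := Submodule.subset_span ⟨1, 1, I, hI, by simp⟩

/-- If `a` is the first element of the dependent set `I`, then `e_a δ(e_I) = e_I`. -/
theorem extMonomial_mem_osIdeal {I : Finset ι} (hI : codim (inter H I) < I.card) :
    extMonomial I ∈ osIdeal H := by
  have hne : I.Nonempty := Finset.card_pos.1 (by omega)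
  obtain ⟨a, J, ha, rfl⟩ : ∃ a J, (∀ i ∈ J, a < i) ∧ I = insert a J :=
    ⟨I.min' hne, I.erase (I.min' hne), fun i hi => Finset.min'_lt_of_mem_erase_min' I hne hi,
      (Finset.insert_erase (Finset.min'_mem I hne)).symm⟩
  have h := mul_mem_osIdeal (extGen a) 1 (extDelta_mem_osIdeal hI)
  rwa [extDelta_insert_min ha, mul_sub, ← mul_assoc, extGen_mul_self, zero_mul, sub_zero,
    mul_one, ← extMonomial_insert_min ha] at h

theorem osMonomial_eq_zero {I : Finset ι} (hI : codim (inter H I) < I.card) :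
    osMonomial H I = 0 := (Submodule.Quotient.mk_eq_zero _).2 (extMonomial_mem_osIdeal hI)

variable (H) in
/-- The monomials of `A_S` without broken circuits. -/
def nbcMonomials (S : Submodule ℂ E) : Set (OS H) :=
  {z | ∃ J : Finset ι, NoBroken H J ∧ Indep H J ∧ inter H J = S ∧ z = osMonomial H J}

/-- If `H i` contains the intersection of the hyperplanes of `I` with index larger than `i`, then
the relation attached to the corresponding circuit replaces one of these indices by the smaller
index `i`. -/
theorem osMonomial_mem_span_exchange {I : Finset ι} (hI : Indep H I) (hH : IsKer H) {i : ι}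
    (hi : inter H (I.filter (i < ·)) ≤ H i) :
    osMonomial H I ∈ Submodule.span ℚ
      {z | ∃ t ∈ I, i < t ∧ z = osMonomial H ((insert i I).erase t)} := by
  set K := I.filter (i < ·) with hK
  set B := I.filter (· < i) with hB
  have hiI : i ∉ I := fun h => hI i h ((inter_anti fun j hj => by
    rw [hK, Finset.mem_filter] at hj
    exact Finset.mem_erase.2 ⟨hj.2.ne', hj.1⟩).trans hi)
  have hKi : ∀ j ∈ K, i < j := fun j hj => (Finset.mem_filter.1 hj).2
  have hiK : i ∉ K := fun h => hiI (Finset.mem_filter.1 h).1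
  have hBK : I = B ∪ K := by
    ext j
    simp only [hB, hK, Finset.mem_union, Finset.mem_filter]
    refine ⟨fun h => ?_, fun h => h.elim And.left And.left⟩
    rcases lt_trichotomy j i with h' | rfl | h'
    · exact Or.inl ⟨h, h'⟩
    · exact absurd h hiI
    · exact Or.inr ⟨h, h'⟩
  have hdep : codim (inter H (insert i K)) < (insert i K).card := by
    rw [codim_inter_lt_iff hH]
    intro h
    refine h i (Finset.mem_insert_self i K) ?_
    rwa [Finset.erase_insert hiK]
  have h1 := mul_mem_osIdeal (extMonomial B) 1 (extDelta_mem_osIdeal hdep)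
  -- `{i} ∪ K` is dependent. Multiply `δ(e_i e_K) = e_K - e_i δ(e_K)` by `e_B`; the terms of the
  -- second summand are the monomials with `i` in place of an element of `K`.
  have h2 : extMonomial I = extMonomial B * extDelta (insert i K) * 1 +
      ∑ s : Fin K.card, (-1 : ℚ) ^ (s : ℕ) •
        extMonomial ((insert i I).erase (K.orderEmbOfFin rfl s)) := by
    rw [extDelta_insert_min hKi, hBK, extMonomial_union, mul_one, mul_sub, eq_comm,
      sub_add_eq_add_sub, sub_eq_iff_eq_add, add_right_inj, extDelta, Finset.mul_sum,
      Finset.mul_sum]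
    · refine Finset.sum_congr rfl fun s _ => ?_
      have hs := Finset.orderEmbOfFin_mem K rfl s
      rw [mul_smul_comm, mul_smul_comm, ← extMonomial_insert_min fun j hj =>
        hKi j (Finset.mem_of_mem_erase hj), ← extMonomial_union]
      · congr 2
        have hsB : K.orderEmbOfFin rfl s ∉ B := fun h =>
          lt_asymm (hKi _ hs) (Finset.mem_filter.1 h).2
        ext j
        simp only [Finset.mem_erase, Finset.mem_union, Finset.mem_insert]
        constructor
        · rintro ⟨h1, rfl | h | h⟩
          exacts [Or.inr (Or.inl rfl), Or.inl h, Or.inr (Or.inr ⟨h1, h⟩)]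
        · rintro (h | rfl | h)
          exacts [⟨fun e => hsB (e ▸ h), Or.inr (Or.inl h)⟩, ⟨(hKi _ hs).ne, Or.inl rfl⟩,
            ⟨h.1, Or.inr (Or.inr h.2)⟩]
      · intro a ha b hb
        have ha' := (Finset.mem_filter.1 ha).2
        rcases Finset.mem_insert.1 hb with rfl | hb
        · exact ha'
        · exact ha'.trans (hKi _ (Finset.mem_of_mem_erase hb))
    · exact fun a ha b hb => (Finset.mem_filter.1 ha).2.trans (hKi b hb)
  rw [osMonomial, h2, map_add, Submodule.mkQ_apply, (Submodule.Quotient.mk_eq_zero _).2 h1,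
    zero_add, map_sum]
  refine Submodule.sum_mem _ fun s _ => ?_
  rw [map_smul]
  have hs := Finset.orderEmbOfFin_mem K rfl s
  exact Submodule.smul_mem _ _ (Submodule.subset_span
    ⟨_, (Finset.mem_filter.1 hs).1, hKi _ hs, rfl⟩)

/-- The monomials without broken circuits span: exchange as long as there is a broken circuit. -/
theorem osMonomial_mem_span_nbc [Fintype ι] (hH : IsKer H) {I : Finset ι} (hI : Indep H I) :
    osMonomial H I ∈ Submodule.span ℚ (nbcMonomials H (inter H I)) := by
  classical
  -- The exchange lowers the sum of the positions of the indices.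
  let w : ι → ℕ := fun a => (Finset.univ.filter (· < a)).card
  have hw : ∀ a b, a < b → w a < w b := fun a b hab => Finset.card_lt_card <| by
    rw [Finset.ssubset_iff_of_subset fun c hc => by
      simp only [Finset.mem_filter, Finset.mem_univ, true_and] at hc ⊢
      exact hc.trans hab]
    exact ⟨a, by simp [hab], by simp⟩
  induction hN : ∑ a ∈ I, w a using Nat.strong_induction_on generalizing I with
  | _ N ih =>
    by_cases hnb : NoBroken H I
    · exact Submodule.subset_span ⟨I, hnb, hI, rfl, rfl⟩
    · simp only [NoBroken, not_forall, not_not] at hnb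
      obtain ⟨i, hi⟩ := hnb
      refine Submodule.span_le.2 ?_ (osMonomial_mem_span_exchange hI hH hi)
      rintro _ ⟨t, ht, hit, rfl⟩
      have hiI : i ∉ I := fun h => hI i h ((inter_anti fun j hj => by
        rw [Finset.mem_filter] at hj
        exact Finset.mem_erase.2 ⟨hj.2.ne', hj.1⟩).trans hi)
      set I' := (insert i I).erase t with hI'
      have hcard : I'.card = I.card := by
        rw [hI', Finset.card_erase_of_mem (Finset.mem_insert_of_mem ht),
          Finset.card_insert_of_notMem hiI]
        rfl
      by_cases hind : Indep H I'
      · have hle : inter H I ≤ inter H I' := by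
          have : inter H (insert i I) = inter H I := by
            rw [inter_insert]
            exact inf_eq_left.2 ((inter_anti (Finset.filter_subset _ _)).trans hi)
          rw [← this]
          exact inter_anti (Finset.erase_subset _ _)
        have heq : inter H I = inter H I' := eq_of_le_of_codim_le hle (by
          rw [(codim_inter_eq_iff hH I).2 hI, (codim_inter_eq_iff hH I').2 hind, hcard])
        rw [heq]
        refine ih _ ?_ hind rfl
        rw [← hN]
        have h1 : ∑ a ∈ I', w a + w t = ∑ a ∈ insert i I, w a :=
          Finset.sum_erase_add _ _ (Finset.mem_insert_of_mem ht)
        rw [Finset.sum_insert hiI] at h1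
        have := hw i t hit
        omega
      · rw [osMonomial_eq_zero ((codim_inter_lt_iff hH I').2 hind)]
        exact zero_mem _

theorem osPart_le_span_nbc [Fintype ι] (hH : IsKer H) (S : Submodule ℂ E) :
    osPart H S ≤ Submodule.span ℚ (nbcMonomials H S) := by
  refine Submodule.span_le.2 ?_
  rintro _ ⟨I, rfl, rfl⟩
  by_cases hI : Indep H I
  · exact osMonomial_mem_span_nbc hH hI
  · rw [osMonomial_eq_zero ((codim_inter_lt_iff hH I).2 hI)]
    exact zero_mem _

end Arrangement

/-! ### Rational tensor products -/

section RationalTensor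

variable {M : Type u} {Q : Type v} [AddCommGroup M] [Module ℂ M] {A : Type} [AddCommGroup A]
  [Module ℚ A]

theorem TensQ.tmul_add_left (m m' : M) (a : A) :
    TensQ.tmul (m + m') a = TensQ.tmul m a + TensQ.tmul m' a := TensorProduct.add_tmul _ _ _

theorem TensQ.tmul_zero_left (a : A) : TensQ.tmul (0 : M) a = 0 := TensorProduct.zero_tmul _ _

theorem TensQ.map_tmul {M' : Type u} [AddCommGroup M'] [Module ℂ M'] (φ : M →ₗ[ℂ] M') (m : M)
    (a : A) : TensQ.map A φ (TensQ.tmul m a) = TensQ.tmul (φ m) a := rfl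

theorem TensQ.tmul_sum_right {J : Type*} (s : Finset J) (m : M) (a : J → A) :
    TensQ.tmul m (∑ j ∈ s, a j) = ∑ j ∈ s, TensQ.tmul m (a j) := by
  unfold TensQ.tmul
  rw [TensorProduct.tmul_sum, TensorProduct.tmul_sum]
  rfl

theorem TensQ.tmul_smul_right (c : ℚ) (m : M) (a : A) :
    TensQ.tmul m (c • a) = TensQ.tmul ((c : ℂ) • m) a := by
  unfold TensQ.tmul
  have h : (1 : ℂ) ⊗ₜ[ℚ] (c • a) = (c : ℂ) • ((1 : ℂ) ⊗ₜ[ℚ] a) := by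
    rw [TensorProduct.tmul_smul, TensorProduct.smul_tmul', TensorProduct.smul_tmul']
    simp [Algebra.smul_def]
  rw [h, TensorProduct.smul_tmul]

/-- If the vectors `a j` span `A`, then every element of `M ⊗ A` is a sum of tensors
`m j ⊗ a j`. -/
theorem TensQ.exists_sum {J : Type*} [Fintype J] (a : J → A)
    (ha : ∀ b, b ∈ Submodule.span ℚ (Set.range a)) (x : TensQ M A) :
    ∃ m : J → M, x = ∑ j, TensQ.tmul (m j) (a j) := by
  have h1 : ∀ (z : ℂ ⊗[ℚ] A) (m : M), ∃ m' : J → M,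
      ((m ⊗ₜ[ℂ] z : M ⊗[ℂ] (ℂ ⊗[ℚ] A)) : TensQ M A) = ∑ j, TensQ.tmul (m' j) (a j) := by
    intro z m
    induction z using TensorProduct.induction_on with
    | zero => exact ⟨0, by simp [TensQ.tmul_zero_left, TensorProduct.tmul_zero]; rfl⟩
    | tmul c b =>
      obtain ⟨r, hr⟩ := (Submodule.mem_span_range_iff_exists_fun ℚ).1 (ha b)
      refine ⟨fun j => (r j : ℂ) • c • m, ?_⟩
      have h2 : ((m ⊗ₜ[ℂ] (c ⊗ₜ[ℚ] b) : M ⊗[ℂ] (ℂ ⊗[ℚ] A)) : TensQ M A) =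
          TensQ.tmul (c • m) b := by
        unfold TensQ.tmul
        rw [TensorProduct.smul_tmul, TensorProduct.smul_tmul', smul_eq_mul, mul_one]
      rw [h2, ← hr, TensQ.tmul_sum_right]
      exact Finset.sum_congr rfl fun j _ => TensQ.tmul_smul_right _ _ _
    | add z z' h h' =>
      obtain ⟨m1, h1⟩ := h
      obtain ⟨m2, h2⟩ := h'
      refine ⟨m1 + m2, ?_⟩
      rw [TensorProduct.tmul_add]
      simp only [Pi.add_apply, TensQ.tmul_add_left, Finset.sum_add_distrib]
      rw [← h1, ← h2]
      rfl
  induction x using TensorProduct.induction_on with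
  | zero => exact ⟨0, by simp [TensQ.tmul_zero_left]; rfl⟩
  | tmul m z => exact h1 z m
  | add x y hx hy =>
    obtain ⟨m1, h1⟩ := hx
    obtain ⟨m2, h2⟩ := hy
    refine ⟨m1 + m2, ?_⟩
    simp only [Pi.add_apply, TensQ.tmul_add_left, Finset.sum_add_distrib]
    rw [← h1, ← h2]
    rfl

/-- A map out of `M ⊗ A` is determined by an additive map from `A` to the linear maps on `M`. -/
theorem TensQ.exists_lift [AddCommGroup Q] [Module ℂ Q] (g : A →+ (M →ₗ[ℂ] Q)) :
    ∃ B : TensQ M A →ₗ[ℂ] Q, ∀ m a, B (TensQ.tmul m a) = g a m := by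
  let _ : Module ℚ (M →ₗ[ℂ] Q) := Module.compHom _ (algebraMap ℚ ℂ)
  have _ : IsScalarTower ℚ ℂ (M →ₗ[ℂ] Q) := IsScalarTower.of_algebraMap_smul fun _ _ => rfl
  let h : ℂ ⊗[ℚ] A →ₗ[ℂ] (M →ₗ[ℂ] Q) := LinearMap.liftBaseChange ℂ g.toRatLinearMap
  refine ⟨TensorProduct.lift h.flip, fun m a => ?_⟩
  refine (TensorProduct.lift.tmul _ _).trans ?_
  rw [LinearMap.flip_apply]
  change (LinearMap.liftBaseChange ℂ g.toRatLinearMap (1 ⊗ₜ a)) m = _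
  rw [LinearMap.liftBaseChange_tmul]
  simp

end RationalTensor

/-! ### Exterior products with one-forms -/

section WedgeAction

variable {E F : Type} [NormedAddCommGroup E] [NormedSpace ℂ E]
  [NormedAddCommGroup F] [NormedSpace ℂ F] {q p : ℕ}

theorem wedgeOne_add_left (η η' : Alt E q) (θ : E →L[ℂ] ℂ) :
    wedgeOne (η + η') θ = wedgeOne η θ + wedgeOne η' θ := by
  ext v
  simp only [wedgeOne_apply, ContinuousAlternatingMap.add_apply]
  rw [← mul_add, ← Finset.sum_add_distrib]
  congr 1
  exact Finset.sum_congr rfl fun i _ => by ring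

theorem wedgeOne_smul_left (c : ℂ) (η : Alt E q) (θ : E →L[ℂ] ℂ) :
    wedgeOne (c • η) θ = c • wedgeOne η θ := by
  ext v
  simp only [wedgeOne_apply, ContinuousAlternatingMap.smul_apply, smul_eq_mul, Finset.mul_sum]
  exact Finset.sum_congr rfl fun i _ => by ring

theorem wedgeOne_add_right (η : Alt E q) (θ θ' : E →L[ℂ] ℂ) :
    wedgeOne η (θ + θ') = wedgeOne η θ + wedgeOne η θ' := by
  ext v
  simp only [wedgeOne_apply, ContinuousAlternatingMap.add_apply, _root_.add_apply]
  rw [← mul_add, ← Finset.sum_add_distrib]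
  congr 1
  exact Finset.sum_congr rfl fun i _ => by ring

theorem wedgeOne_smul_right (c : ℂ) (η : Alt E q) (θ : E →L[ℂ] ℂ) :
    wedgeOne η (c • θ) = c • wedgeOne η θ := by
  ext v
  simp only [wedgeOne_apply, ContinuousAlternatingMap.smul_apply, _root_.smul_apply,
    smul_eq_mul, Finset.mul_sum]
  exact Finset.sum_congr rfl fun i _ => by ring

theorem wedgeOne_wedgeOne_self (η : Alt E q) (θ : E →L[ℂ] ℂ) :
    wedgeOne (wedgeOne η θ) θ = 0 := by
  have h := ContinuousAlternatingMap.alternatizeUncurryFin_alternatizeUncurryFinCLM_comp_of_symmetric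
    (f := θ.smulRight (θ.smulRight η)) (fun v w => by
      simp [ContinuousLinearMap.smulRight_apply, smul_smul, mul_comm])
  have h2 : wedgeOne (wedgeOne η θ) θ = ((-1 : ℂ) ^ (q + 1) * (-1) ^ q) •
      ContinuousAlternatingMap.alternatizeUncurryFin
        ((ContinuousAlternatingMap.alternatizeUncurryFinCLM ℂ E ℂ).comp
          (θ.smulRight (θ.smulRight η))) := by
    have h3 : θ.smulRight ((-1 : ℂ) ^ q •
        ContinuousAlternatingMap.alternatizeUncurryFin (θ.smulRight η)) =
        (-1 : ℂ) ^ q • (ContinuousAlternatingMap.alternatizeUncurryFinCLM ℂ E ℂ).comp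
          (θ.smulRight (θ.smulRight η)) :=
      ContinuousLinearMap.ext fun v => ContinuousAlternatingMap.ext fun w => by
        simp [mul_left_comm]
    rw [wedgeOne, wedgeOne, mul_smul, h3, ContinuousAlternatingMap.alternatizeUncurryFin_smul]
  rw [h2, h, smul_zero]

/-- Right multiplication by a one-form, on families of forms of all degrees. -/
def wedgeRight (θ : E →L[ℂ] ℂ) : Module.End ℂ ((q : ℕ) → Alt E q) where
  toFun η q := match q with
    | 0 => 0
    | q + 1 => wedgeOne (η q) θ
  map_add' η η' := by
    funext q
    cases q with
    | zero => exact (add_zero (0 : Alt E 0)).symm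
    | succ q => exact wedgeOne_add_left _ _ _
  map_smul' c η := by
    funext q
    cases q with
    | zero => exact (smul_zero (A := Alt E 0) c).symm
    | succ q => exact wedgeOne_smul_left _ _ _

variable (E) in
/-- The right action of the exterior algebra of the dual space on forms, by exterior
multiplication. It serves to do all computations with signs in the exterior algebra. -/
def formAction : ExteriorAlgebra ℂ (E →L[ℂ] ℂ) →ₐ[ℂ] (Module.End ℂ ((q : ℕ) → Alt E q))ᵐᵒᵖ :=
  ExteriorAlgebra.lift ℂ ⟨(MulOpposite.opLinearEquiv ℂ).toLinearMap ∘ₗ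
    { toFun := wedgeRight
      map_add' := fun θ θ' => by
        refine LinearMap.ext fun η => funext fun q => ?_
        cases q with
        | zero => exact (add_zero (0 : Alt E 0)).symm
        | succ q => exact wedgeOne_add_right _ _ _
      map_smul' := fun c θ => by
        refine LinearMap.ext fun η => funext fun q => ?_
        cases q with
        | zero => exact (smul_zero (A := Alt E 0) c).symm
        | succ q => exact wedgeOne_smul_right _ _ _ }, fun θ => by
      refine congrArg MulOpposite.op (LinearMap.ext fun η => funext fun q => ?_ :
        wedgeRight θ * wedgeRight θ = 0)
      match q with
      | 0 => rfl
      | 1 =>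
        change wedgeOne (0 : Alt E 0) θ = 0
        ext v; simp [wedgeOne_apply]
      | q + 2 => exact wedgeOne_wedgeOne_self _ _⟩

theorem formAction_ι (θ : E →L[ℂ] ℂ) :
    formAction E (ExteriorAlgebra.ι ℂ θ) = MulOpposite.op (wedgeRight θ) :=
  ExteriorAlgebra.lift_ι_apply _ _ _ _

set_option synthInstance.maxHeartbeats 400000 in
/-- The exterior product `η ∧ a`, in degree `p`, of a `q`-form `η` with an element `a` of the
exterior algebra of the dual space. -/
def wedgeExt (q p : ℕ) : ExteriorAlgebra ℂ (E →L[ℂ] ℂ) →ₗ[ℂ] Alt E q →ₗ[ℂ] Alt E p where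
  toFun a := LinearMap.proj p ∘ₗ (formAction E a).unop ∘ₗ LinearMap.single ℂ (fun q => Alt E q) q
  map_add' a b := by rw [map_add]; rfl
  map_smul' c a := by rw [map_smul]; rfl

theorem wedgeExt_apply (a : ExteriorAlgebra ℂ (E →L[ℂ] ℂ)) (η : Alt E q) :
    wedgeExt q p a η =
      (formAction E a).unop (LinearMap.single ℂ (fun q => Alt E q) q η) p := rfl

theorem wedgeExt_one (η : Alt E q) : wedgeExt q q 1 η = η := by
  simp [wedgeExt_apply]

theorem wedgeExt_mul_ι (a : ExteriorAlgebra ℂ (E →L[ℂ] ℂ)) (θ : E →L[ℂ] ℂ) (η : Alt E q) :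
    wedgeExt q (p + 1) (a * ExteriorAlgebra.ι ℂ θ) η = wedgeOne (wedgeExt q p a η) θ := by
  simp only [wedgeExt_apply, map_mul, formAction_ι]
  rfl

theorem wedgeExt_ι_mul (a : ExteriorAlgebra ℂ (E →L[ℂ] ℂ)) (θ : E →L[ℂ] ℂ) (η : Alt E q) :
    wedgeExt q p (ExteriorAlgebra.ι ℂ θ * a) η = wedgeExt (q + 1) p a (wedgeOne η θ) := by
  have h : wedgeRight θ (LinearMap.single ℂ (fun q => Alt E q) q η) =
      LinearMap.single ℂ (fun q => Alt E q) (q + 1) (wedgeOne η θ) := by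
    funext r
    cases r with
    | zero => exact (Pi.single_eq_of_ne (M := fun q => Alt E q) (Nat.succ_ne_zero q).symm
        (wedgeOne η θ)).symm
    | succ r =>
      change wedgeOne (Pi.single (M := fun q => Alt E q) q η r) θ =
        Pi.single (M := fun q => Alt E q) (q + 1) (wedgeOne η θ) (r + 1)
      by_cases hr : r = q
      · subst hr; simp
      · rw [Pi.single_eq_of_ne hr, Pi.single_eq_of_ne (fun h => hr (Nat.succ_injective h))]
        ext v; simp [wedgeOne_apply]
  simp only [wedgeExt_apply, map_mul, formAction_ι, MulOpposite.unop_mul,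
    MulOpposite.unop_op, Module.End.mul_apply]
  rw [h]

theorem wedgeExt_prod (η : Alt E q) (r : ℕ) (θ : Fin r → (E →L[ℂ] ℂ)) :
    wedgeExt q (q + r) (List.ofFn fun s => ExteriorAlgebra.ι ℂ (θ s)).prod η =
      wedgeTuple η r θ := by
  induction r with
  | zero => exact wedgeExt_one η
  | succ r ih =>
    rw [List.ofFn_succ', List.concat_eq_append, List.prod_append, List.prod_singleton]
    refine (wedgeExt_mul_ι _ _ _).trans ?_
    exact congrArg (fun ξ => wedgeOne ξ (θ (Fin.last r))) (ih fun s => θ s.castSucc)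

theorem wedgeTuple_pull (η : Alt F q) (r : ℕ) (θ : Fin r → (F →L[ℂ] ℂ)) (T : E →L[ℂ] F) :
    pull (wedgeTuple η r θ) T = wedgeTuple (pull η T) r fun s => (θ s).comp T := by
  induction r with
  | zero => rfl
  | succ r ih =>
    change pull (wedgeOne _ _) T = wedgeOne _ _
    rw [wedgeOne_pull, ih]
    rfl

end WedgeAction

/-! ### Evaluation of monomials at one-forms -/

section Evaluation

variable {E : Type} [NormedAddCommGroup E] [NormedSpace ℂ E] {ι : Type} [LinearOrder ι]
  {q p : ℕ} (θ : ι → (E →L[ℂ] ℂ))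

/-- The homomorphism from the rational exterior algebra to the exterior algebra of the dual space
that maps the generator `e_i` to the one-form `θ i`. -/
def extEval : ExtAlg ι →ₐ[ℚ] ExteriorAlgebra ℂ (E →L[ℂ] ℂ) :=
  ExteriorAlgebra.lift ℚ
    ⟨(ExteriorAlgebra.ι ℂ).restrictScalars ℚ ∘ₗ Finsupp.linearCombination ℚ θ, fun _ =>
      ExteriorAlgebra.ι_sq_zero _⟩

theorem extEval_extGen (i : ι) : extEval θ (extGen i) = ExteriorAlgebra.ι ℂ (θ i) := by
  refine (ExteriorAlgebra.lift_ι_apply _ _ _ _).trans ?_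
  simp

theorem extEval_extMonomial {I : Finset ι} {k : ℕ} (hI : I.card = k) :
    extEval θ (extMonomial I) =
      (List.ofFn fun s => ExteriorAlgebra.ι ℂ (θ (I.orderEmbOfFin hI s))).prod := by
  subst hI
  rw [extMonomial, map_list_prod, List.map_ofFn]
  congr 2
  funext s
  exact extEval_extGen θ _

theorem wedgeExt_extMonomial (η : Alt E q) {I : Finset ι} {k : ℕ} (hI : I.card = k) :
    wedgeExt q (q + k) (extEval θ (extMonomial I)) η =
      wedgeTuple η k fun s => θ (I.orderEmbOfFin hI s) := by
  rw [extEval_extMonomial θ hI, wedgeExt_prod]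

theorem extEval_extMonomial_mul_ι (I : Finset ι) (α : E →L[ℂ] ℂ) :
    extEval θ (extMonomial I) * ExteriorAlgebra.ι ℂ α =
      (-1 : ℂ) ^ I.card • (ExteriorAlgebra.ι ℂ α * extEval θ (extMonomial I)) := by
  induction I using Finset.induction_on_min with
  | empty => simp [extMonomial_empty]
  | insert a I ha ih =>
    have h : ExteriorAlgebra.ι ℂ (θ a) * ExteriorAlgebra.ι ℂ α =
        -(ExteriorAlgebra.ι ℂ α * ExteriorAlgebra.ι ℂ (θ a)) :=
      eq_neg_of_add_eq_zero_left (ExteriorAlgebra.ι_add_mul_swap _ _)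
    rw [extMonomial_insert_min ha, map_mul, extEval_extGen, mul_assoc, ih,
      Finset.card_insert_of_notMem fun h => lt_irrefl _ (ha a h), mul_smul_comm, ← mul_assoc,
      ← mul_assoc, h, pow_succ]
    simp

/-- Linearly dependent one-forms have exterior product zero. -/
theorem extEval_extMonomial_eq_zero {I : Finset ι} {c : ι} (hc : c ∈ I)
    (h : ∀ v, (∀ i ∈ I.erase c, θ i v = 0) → θ c v = 0) :
    extEval θ (extMonomial I) = 0 := by
  have h1 : (θ c : E →ₗ[ℂ] ℂ) ∈ Submodule.span ℂ
      (Set.range fun i : I.erase c => (θ i : E →ₗ[ℂ] ℂ)) := by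
    refine mem_span_of_iInf_ker_le_ker fun v hv => h v fun i hi => ?_
    exact (Submodule.mem_iInf _).1 hv ⟨i, hi⟩
  obtain ⟨a, ha⟩ := (Submodule.mem_span_range_iff_exists_fun ℂ).1 h1
  have h2 : θ c = ∑ i : I.erase c, a i • θ i := by
    ext v
    have := LinearMap.congr_fun ha v
    simp only [LinearMap.sum_apply, LinearMap.smul_apply, ContinuousLinearMap.coe_coe] at this
    simp [← this]
  have h3 : extEval θ (extGen c * extMonomial (I.erase c)) = 0 := by
    rw [map_mul, extEval_extGen, h2, map_sum, Finset.sum_mul]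
    refine Finset.sum_eq_zero fun i _ => ?_
    rw [map_smul, smul_mul_assoc, ← extEval_extGen θ, ← map_mul,
      extGen_mul_extMonomial_of_mem i.2, map_zero, smul_zero]
  rcases extGen_mul_extMonomial (Finset.notMem_erase c I) with h4 | h4
  · rwa [h4, Finset.insert_erase hc] at h3
  · rwa [h4, Finset.insert_erase hc, map_neg, neg_eq_zero] at h3

/-- If all the one-forms take the value `1` on the vector `y`, then the derivation `δ` becomes the
contraction with `y`. -/
theorem extEval_extDelta {I : Finset ι} {y : E} (h : ∀ i ∈ I, θ i y = 1) :
    extEval θ (extDelta I) = CliffordAlgebra.contractLeft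
      ((ContinuousLinearMap.apply ℂ ℂ y : (E →L[ℂ] ℂ) →L[ℂ] ℂ) : (E →L[ℂ] ℂ) →ₗ[ℂ] ℂ)
      (extEval θ (extMonomial I)) := by
  induction I using Finset.induction_on_min with
  | empty =>
    rw [extMonomial_empty, map_one]
    refine Eq.trans ?_ (CliffordAlgebra.contractLeft_one _ _).symm
    rw [extDelta_empty, map_zero]
  | insert a I ha ih =>
    rw [extMonomial_insert_min ha, extDelta_insert_min ha, map_sub, map_mul, map_mul,
      extEval_extGen, ih fun i hi => h i (Finset.mem_insert_of_mem hi)]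
    refine Eq.trans ?_ (CliffordAlgebra.contractLeft_ι_mul _ _ _).symm
    have : θ a y = 1 := h a (Finset.mem_insert_self a I)
    simp [this]

theorem extEval_extDelta_eq_zero {I : Finset ι} {y : E} (h : ∀ i ∈ I, θ i y = 1) {c : ι}
    (hc : c ∈ I) (hle : ∀ v, (∀ i ∈ I.erase c, θ i v = 0) → θ c v = 0) :
    extEval θ (extDelta I) = 0 := by
  rw [extEval_extDelta θ h, extEval_extMonomial_eq_zero θ hc hle, map_zero]

end Evaluation

/-! ### Division of analytic functions by a linear form -/

section Division

variable {E F : Type} [NormedAddCommGroup E] [NormedSpace ℂ E]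
  [NormedAddCommGroup F] [NormedSpace ℂ F]

/-- The projection `v ↦ v - f(v) e` onto the kernel of `f`, along a vector `e` with `f(e) = 1`. -/
def projAlong (f : E →L[ℂ] ℂ) (e : E) : E →L[ℂ] E := ContinuousLinearMap.id ℂ E - f.smulRight e

theorem projAlong_apply (f : E →L[ℂ] ℂ) (e v : E) : projAlong f e v = v - f v • e := by
  simp [projAlong]

/-- For a homogeneous polynomial `P` of degree `n + 1`, the difference `P - P ∘ π`, with `π` the
projection onto the kernel of `f`, is the product of `f` and a homogeneous polynomial of degree
`n` that depends linearly on `P`, with norm growing at most geometrically in `n`. -/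
theorem exists_divided_difference (f : E →L[ℂ] ℂ) (e : E) (n : ℕ) :
    ∃ D : (E [×(n + 1)]→L[ℂ] F) →L[ℂ] (E [×n]→L[ℂ] F),
      ‖D‖ ≤ (1 + ‖e‖ + ‖projAlong f e‖) ^ (n + 1) ∧
      ∀ P v, P (fun _ => v) - P (fun _ => projAlong f e v) = f v • D P fun _ => v := by
  set π := projAlong f e with hπ
  have hsub : ∀ v, v - π v = f v • e := fun v => by rw [hπ, projAlong_apply, sub_sub_cancel]
  have hcurry : ∀ (m : ℕ) (P : E [×(m + 1)]→L[ℂ] F) (v : E), P (fun _ => v) =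
      (continuousMultilinearCurryLeftEquiv ℂ (fun _ : Fin (m + 1) => E) F P v) fun _ => v := by
    intro m P v
    rw [continuousMultilinearCurryLeftEquiv_apply]
    congr 1
    funext i
    induction i using Fin.cases <;> rfl
  induction n with
  | zero =>
    let C := continuousMultilinearCurryLeftEquiv ℂ (fun _ : Fin 1 => E) F
    refine ⟨(ContinuousLinearMap.apply ℂ _ e).comp
      (C.toContinuousLinearEquiv : _ →L[ℂ] _), ?_, fun P v => ?_⟩
    · refine ContinuousLinearMap.opNorm_le_bound _ (by positivity) fun P => ?_
      have h1 : ‖C P e‖ ≤ ‖C P‖ * ‖e‖ := (C P).le_opNorm e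
      rw [C.norm_map] at h1
      have h2 : 0 ≤ ‖π‖ := norm_nonneg _
      change ‖C P e‖ ≤ _
      have h3 : (1 + ‖e‖ + ‖π‖) ^ (0 + 1) = 1 + ‖e‖ + ‖π‖ := by ring
      rw [h3]
      nlinarith [norm_nonneg P, norm_nonneg e, mul_nonneg (norm_nonneg P) h2]
    · rw [hcurry, hcurry]
      change C P v _ - C P (π v) _ = f v • C P e _
      have h3 : (fun _ : Fin 0 => π v) = fun _ => v := Subsingleton.elim _ _
      rw [h3]
      have h4 : C P v - C P (π v) = f v • C P e := by rw [← map_sub, hsub, map_smul]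
      exact DFunLike.congr_fun h4 fun _ => v
  | succ n ih =>
    obtain ⟨D, hD, h⟩ := ih
    let C := continuousMultilinearCurryLeftEquiv ℂ (fun _ : Fin (n + 2) => E) F
    let C' := continuousMultilinearCurryLeftEquiv ℂ (fun _ : Fin (n + 1) => E) F
    refine ⟨(ContinuousLinearMap.apply ℂ _ e).comp (C.toContinuousLinearEquiv : _ →L[ℂ] _) +
      (C'.symm.toContinuousLinearEquiv : _ →L[ℂ] _).comp
        (((ContinuousLinearMap.compL ℂ E _ _ D).comp
          ((ContinuousLinearMap.compL ℂ E E _).flip π)).comp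
            (C.toContinuousLinearEquiv : _ →L[ℂ] _)), ?_, fun P v => ?_⟩
    · refine ContinuousLinearMap.opNorm_le_bound _ (by positivity) fun P => ?_
      change ‖C P e + C'.symm (D.comp ((C P).comp π))‖ ≤ _
      have h1 : ‖C P e‖ ≤ ‖C P‖ * ‖e‖ := (C P).le_opNorm e
      have h2 : ‖D.comp ((C P).comp π)‖ ≤ ‖D‖ * (‖C P‖ * ‖π‖) :=
        (D.opNorm_comp_le _).trans (by gcongr; exact (C P).opNorm_comp_le π)
      rw [C.norm_map] at h1 h2
      refine (norm_add_le _ _).trans ?_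
      rw [C'.symm.norm_map]
      set B := 1 + ‖e‖ + ‖π‖ with hB
      have hB1 : 1 ≤ B := by rw [hB]; linarith [norm_nonneg e, norm_nonneg π]
      have hBn : 1 ≤ B ^ (n + 1) := one_le_pow₀ hB1
      have h3 : ‖D‖ * (‖P‖ * ‖π‖) ≤ B ^ (n + 1) * (‖P‖ * ‖π‖) := by gcongr
      have h4 : ‖P‖ * ‖e‖ ≤ B ^ (n + 1) * (‖P‖ * ‖e‖) :=
        le_mul_of_one_le_left (by positivity) hBn
      calc ‖C P e‖ + ‖D.comp ((C P).comp π)‖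
          ≤ B ^ (n + 1) * (‖P‖ * ‖e‖) + B ^ (n + 1) * (‖P‖ * ‖π‖) := by linarith
        _ ≤ B ^ (n + 1) * (‖P‖ * ‖e‖) + B ^ (n + 1) * (‖P‖ * ‖π‖) + B ^ (n + 1) * ‖P‖ := by
            have : 0 ≤ B ^ (n + 1) * ‖P‖ := by positivity
            linarith
        _ = B ^ (n + 1 + 1) * ‖P‖ := by rw [pow_succ B (n + 1)]; rw [hB]; ring
    · rw [hcurry (n + 1) P v, hcurry (n + 1) P (π v)]
      change C P v _ - C P (π v) _ = f v • (C P e + C'.symm (D.comp ((C P).comp π))) _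
      have h4 : C P v - C P (π v) = f v • C P e := by rw [← map_sub, hsub, map_smul]
      have h5 : C P v (fun _ => v) - C P (π v) (fun _ => v) = f v • C P e fun _ => v :=
        DFunLike.congr_fun h4 fun _ => v
      have h6 : C'.symm (D.comp ((C P).comp π)) (fun _ => v) = D (C P (π v)) fun _ => v := by
        rw [hcurry, LinearIsometryEquiv.apply_symm_apply]
        rfl
      change _ = f v • (C P e (fun _ => v) + C'.symm (D.comp ((C P).comp π)) fun _ => v)
      rw [h6, smul_add, ← h5, ← h (C P (π v)) v]
      abel

variable [CompleteSpace F]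

/-- The local form of Hadamard's lemma at a zero `a` of `f`. The terms of the power series of `g`
are divided by `f` one by one, with bounds on the quotients that keep the radius of convergence
positive. -/
theorem exists_analyticAt_div {g : E → F} {a : E} (hg : AnalyticAt ℂ g a) (f : E →L[ℂ] ℂ)
    (e : E) (ha : f a = 0) :
    ∃ h : E → F, AnalyticAt ℂ h a ∧ ∀ᶠ y in 𝓝 a, g y - g (projAlong f e y) = f y • h y := by
  set π := projAlong f e with hπ
  obtain ⟨p, r, hp⟩ := hg
  choose D hD h using fun n => exists_divided_difference (F := F) f e n
  set B := 1 + ‖e‖ + ‖projAlong f e‖ with hB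
  have hB1 : 1 ≤ B := by rw [hB]; linarith [norm_nonneg e, norm_nonneg (projAlong f e)]
  let q : FormalMultilinearSeries ℂ E F := fun n => D n (p (n + 1))
  -- The division multiplies the norm of the term of degree `n` by at most `B ^ n`.
  have hrad : 0 < q.radius := by
    obtain ⟨c, s, hc, hs, hcs⟩ := p.le_mul_pow_of_radius_pos hp.radius_pos
    have hpos : 0 < (B * s)⁻¹ := by positivity
    refine lt_of_lt_of_le ?_ (q.le_radius_of_bound (r := (B * s)⁻¹.toNNReal) (B * c * s)
      fun n => ?_)
    · simpa using hpos
    · rw [Real.coe_toNNReal _ hpos.le]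
      have h1 : ‖q n‖ ≤ B ^ (n + 1) * (c * s ^ (n + 1)) :=
        ((D n).le_opNorm _).trans (by gcongr; exacts [hD n, hcs (n + 1)])
      calc ‖q n‖ * (B * s)⁻¹ ^ n ≤ B ^ (n + 1) * (c * s ^ (n + 1)) * (B * s)⁻¹ ^ n := by gcongr
        _ = B * c * s * ((B * s) ^ n * (B * s)⁻¹ ^ n) := by rw [mul_pow]; ring
        _ = B * c * s := by rw [← mul_pow, mul_inv_cancel₀ (by positivity), one_pow, mul_one]
  have hq := q.hasFPowerSeriesOnBall hrad
  refine ⟨fun y => q.sum (y - a), ?_, ?_⟩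
  · have : AnalyticAt ℂ q.sum (a - a) := by rw [sub_self]; exact hq.analyticAt
    exact this.comp (f := fun y => y - a) (by fun_prop)
  · have e1 : ∀ᶠ y in 𝓝 a, y - a ∈ Metric.eball (0 : E) r := by
      have : Filter.Tendsto (fun y => y - a) (𝓝 a) (𝓝 0) := by
        have h : Continuous fun y => y - a := by fun_prop
        simpa using h.tendsto a
      exact this.eventually (Metric.eball_mem_nhds 0 hp.r_pos)
    have e2 : ∀ᶠ y in 𝓝 a, π (y - a) ∈ Metric.eball (0 : E) r := by
      have : Filter.Tendsto (fun y => π (y - a)) (𝓝 a) (𝓝 0) := by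
        have h : Continuous fun y => π (y - a) := by fun_prop
        simpa only [sub_self, map_zero] using h.tendsto a
      exact this.eventually (Metric.eball_mem_nhds 0 hp.r_pos)
    have e3 : ∀ᶠ y in 𝓝 a, y - a ∈ Metric.eball (0 : E) q.radius := by
      have : Filter.Tendsto (fun y => y - a) (𝓝 a) (𝓝 0) := by
        have h : Continuous fun y => y - a := by fun_prop
        simpa using h.tendsto a
      exact this.eventually (Metric.eball_mem_nhds 0 hrad)
    filter_upwards [e1, e2, e3] with y h1 h2 h3
    have s1 := hp.hasSum h1
    have s2 := hp.hasSum h2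
    have s3 := (hq.hasSum h3).const_smul (f y)
    have hfa : f (y - a) = f y := by rw [map_sub, ha, sub_zero]
    have e4 : a + (y - a) = y := by abel
    have e5 : a + π (y - a) = π y := by
      rw [hπ, projAlong_apply, projAlong_apply, hfa]; abel
    rw [e4] at s1
    rw [e5] at s2
    rw [zero_add] at s3
    have s4 := s1.sub s2
    rw [← hasSum_nat_add_iff' 1] at s4
    have e6 : (fun n => (p (n + 1) fun _ => y - a) - p (n + 1) fun _ => π (y - a)) =
        fun n => f y • q n fun _ => y - a := by
      funext n
      rw [h n (p (n + 1)) (y - a), hfa]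
    rw [e6] at s4
    have e7 := s4.unique s3
    rw [← e7, Finset.sum_range_one]
    have : (fun _ : Fin 0 => y - a) = fun _ => π (y - a) := Subsingleton.elim _ _
    rw [this, sub_self, sub_zero]

/-- Hadamard's lemma: an analytic function differs from its composition with the projection onto
the kernel of `f` by a multiple of `f`. -/
theorem exists_analyticOnNhd_div {A : Set E} {g : E → F} (hg : AnalyticOnNhd ℂ g A)
    {f : E →L[ℂ] ℂ} {e : E} (he : f e = 1) (hA : ∀ a ∈ A, projAlong f e a ∈ A) :
    ∃ h : E → F, AnalyticOnNhd ℂ h A ∧ ∀ y, g y - g (projAlong f e y) = f y • h y := by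
  classical
  -- On the kernel of `f` the quotient has to be the derivative of `g` in the direction `e`.
  let h : E → F := fun y => if f y = 0 then fderiv ℂ g y e else
    (f y)⁻¹ • (g y - g (projAlong f e y))
  refine ⟨h, fun a ha => ?_, fun y => ?_⟩
  · have hga := hg a ha
    have hga' : AnalyticAt ℂ (fun y => g (projAlong f e y)) a :=
      (hg _ (hA a ha)).comp ((projAlong f e).analyticAt a)
    by_cases hfa : f a = 0
    · obtain ⟨h', hh', heq⟩ := exists_analyticAt_div hga f e hfa
      refine hh'.congr ?_
      filter_upwards [heq.eventually_nhds, heq, hga.eventually_analyticAt,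
        hh'.eventually_analyticAt] with b hb hb' hgb hhb
      change _ = if f b = 0 then fderiv ℂ g b e else (f b)⁻¹ • (g b - g (projAlong f e b))
      split_ifs with hfb
      · have hpb : projAlong f e b = b := by rw [projAlong_apply, hfb, zero_smul, sub_zero]
        have d1 : HasFDerivAt (fun y => g y - g (projAlong f e y))
            (fderiv ℂ g b - (fderiv ℂ g b).comp (projAlong f e)) b := by
          refine hgb.differentiableAt.hasFDerivAt.sub ?_
          refine HasFDerivAt.comp b (g := g) ?_ (projAlong f e).hasFDerivAt
          rw [hpb]
          exact hgb.differentiableAt.hasFDerivAt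
        have d2 : HasFDerivAt (fun y => f y • h' y)
            (f b • fderiv ℂ h' b + f.smulRight (h' b)) b :=
          f.hasFDerivAt.smul hhb.differentiableAt.hasFDerivAt
        have d3 := (d1.congr_of_eventuallyEq (Filter.EventuallyEq.symm hb)).unique d2
        have d4 := DFunLike.congr_fun d3 e
        have hpe : projAlong f e e = 0 := by rw [projAlong_apply, he, one_smul, sub_self]
        simp [hpe, hfb, he] at d4
        exact d4.symm
      · rw [hb', smul_smul, inv_mul_cancel₀ hfb, one_smul]
    · have h1 : AnalyticAt ℂ (fun y => (f y)⁻¹ • (g y - g (projAlong f e y))) a :=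
        ((f.analyticAt a).inv hfa).smul (hga.sub hga')
      refine h1.congr ?_
      filter_upwards [f.continuous.continuousAt.eventually_ne hfa] with y hy
      exact (if_neg hy).symm
  · change _ = f y • if f y = 0 then fderiv ℂ g y e else (f y)⁻¹ • (g y - g (projAlong f e y))
    split_ifs with hy
    · rw [hy, zero_smul, projAlong_apply, hy, zero_smul, sub_zero, sub_self]
    · rw [smul_smul, mul_inv_cancel₀ hy, one_smul]

end Division

/-! ### Forms that are killed by a vector -/

section Kills

variable {E : Type} [NormedAddCommGroup E] [NormedSpace ℂ E] {q : ℕ}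

/-- The form `ξ` vanishes as soon as one of its arguments is the vector `u`. -/
def Kills (ξ : Alt E q) (u : E) : Prop := ∀ (w : Fin q → E) (i : Fin q), w i = u → ξ w = 0

theorem Kills.apply_sub {ξ : Alt E q} {u : E} (h : Kills ξ u) (v : Fin q → E) (c : Fin q → ℂ) :
    ξ (fun i => v i - c i • u) = ξ v := by
  classical
  have key : ∀ s : Finset (Fin q), ξ (s.piecewise (fun i => v i - c i • u) v) = ξ v := by
    intro s
    induction s using Finset.induction_on with
    | empty => simp
    | insert i s hi ih =>
      rw [Finset.piecewise_insert, ContinuousAlternatingMap.map_update_sub,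
        ContinuousAlternatingMap.map_update_smul, h _ i (Function.update_self _ _ _), smul_zero,
        sub_zero, ← ih]
      congr 1
      rw [Function.update_eq_self_iff, Finset.piecewise_eq_of_notMem _ _ _ hi]
  rw [← key Finset.univ, Finset.piecewise_univ]

theorem kills_of_curryLeft {ξ : Alt E (q + 1)} {u : E} (h : ξ.curryLeft u = 0) : Kills ξ u := by
  intro w i hi
  have h1 := ContinuousAlternatingMap.map_insertNth ξ i (w i) (i.removeNth w)
  rw [Fin.insertNth_self_removeNth] at h1
  rw [h1, hi]
  have h2 := DFunLike.congr_fun h (i.removeNth w)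
  rw [ContinuousAlternatingMap.curryLeft_apply_apply] at h2
  rw [h2]
  simp

theorem Kills.wedgeOne {ξ : Alt E q} {θ : E →L[ℂ] ℂ} {u : E} (h : Kills ξ u) (hθ : θ u = 0) :
    Kills (wedgeOne ξ θ) u := by
  intro w i hi
  rw [wedgeOne_apply, Finset.sum_eq_zero, mul_zero]
  intro j _
  by_cases hj : i = j
  · rw [← hj, hi, hθ]; simp
  · obtain ⟨m, hm⟩ := Fin.exists_succAbove_eq hj
    rw [h _ m (by rw [Fin.removeNth_apply, hm, hi])]
    simp

theorem Kills.wedgeTuple {ξ : Alt E q} {u : E} (h : Kills ξ u) (r : ℕ)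
    {θ : Fin r → (E →L[ℂ] ℂ)} (hθ : ∀ s, θ s u = 0) : Kills (wedgeTuple ξ r θ) u := by
  induction r with
  | zero => exact h
  | succ r ih => exact (ih fun s => hθ s.castSucc).wedgeOne (hθ _)

/-- Evaluation of `ξ ∧ θ_1 ∧ ⋯ ∧ θ_r` on vectors the last `r` of which are dual to the `θ_s`, while
the others are killed by them. -/
theorem wedgeTuple_apply_of_dual (ξ : Alt E q) (r : ℕ) {θ : Fin r → (E →L[ℂ] ℂ)}
    {v : Fin (q + r) → E} (h : ∀ s j, θ s (v j) = if j = Fin.natAdd q s then 1 else 0) :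
    wedgeTuple ξ r θ v = ξ fun a => v (Fin.castAdd r a) := by
  induction r with
  | zero => rfl
  | succ r ih =>
    change wedgeOne (q := q + r) (wedgeTuple ξ r (Fin.init θ)) (θ (Fin.last r)) v = _
    rw [wedgeOne_apply (q := q + r), Finset.sum_eq_single (Fin.last (q + r))]
    · have h1 := h (Fin.last r) (Fin.last (q + r))
      rw [if_pos (by ext; simp)] at h1
      rw [h1, mul_one, ← mul_assoc, ← pow_add, Fin.val_last, Even.neg_one_pow ⟨q + r, rfl⟩,
        one_mul, ih]
      · congr 1
        funext a
        rw [Fin.removeNth_apply, Fin.succAbove_last]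
        congr 1
      · intro s j
        rw [Fin.removeNth_apply, Fin.succAbove_last]
        refine (h s.castSucc j.castSucc).trans ?_
        congr 1
        simp [Fin.ext_iff]
    · intro j _ hj
      have h1 := h (Fin.last r) j
      rw [if_neg fun h' => hj (h'.trans (by ext; simp))] at h1
      rw [h1]; simp
    · simp

/-- The difference of a form and its pull-back under the projection along `e` is divisible by
`f`. -/
theorem wedgeOne_sub_pull_projAlong (ξ : Alt E q) {f : E →L[ℂ] ℂ} {e : E} (he : f e = 1) :
    wedgeOne (ξ - pull ξ (projAlong f e)) f = 0 := by
  have hpe : f.comp (projAlong f e) = 0 := by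
    ext v; simp [projAlong_apply, he]
  cases q with
  | zero =>
    have : ξ - pull ξ (projAlong f e) = 0 := by
      ext v
      have : (fun i => projAlong f e (v i)) = v := Subsingleton.elim _ _
      change ξ v - ξ (fun i => projAlong f e (v i)) = 0
      rw [this, sub_self]
    rw [this]
    ext v; simp [wedgeOne_apply]
  | succ q =>
    -- Write `ξ = ζ ± (ι_e ξ) ∧ f`, where `ζ` is killed by `e` and hence equal to its pull-back.
    set η := ξ.curryLeft e with hη
    set ζ := ξ - (-1 : ℂ) ^ q • wedgeOne η f with hζ
    have hk : Kills ζ e := by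
      refine kills_of_curryLeft ?_
      ext v
      rw [ContinuousAlternatingMap.curryLeft_apply_apply, hζ]
      change ξ _ - (-1 : ℂ) ^ q * wedgeOne η f _ = 0
      rw [wedgeOne_apply, Fin.sum_univ_succ, Finset.sum_eq_zero]
      · rw [add_zero, ← mul_assoc, ← mul_pow]
        simp [he, hη]
      · intro i _
        have h0 : η (i.succ.removeNth (Matrix.vecCons e v)) = 0 := by
          rw [hη, ContinuousAlternatingMap.curryLeft_apply_apply]
          cases q with
          | zero => exact i.elim0
          | succ q =>
            refine ξ.map_eq_zero_of_eq _ (i := 0) (j := 1) ?_ (by simp)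
            simp only [Matrix.cons_val_zero, Matrix.cons_val_one]
            rfl
        rw [h0]; simp
    have h1 : pull ζ (projAlong f e) = ζ := by
      ext v
      change ζ (fun i => projAlong f e (v i)) = ζ v
      simp only [projAlong_apply]
      exact hk.apply_sub v fun i => f (v i)
    have h2 : pull ζ (projAlong f e) = pull ξ (projAlong f e) := by
      have h3 : pull (wedgeOne η f) (projAlong f e) = 0 := by
        rw [wedgeOne_pull, hpe]
        ext v; simp [wedgeOne_apply]
      ext v
      have h4 : pull (wedgeOne η f) (projAlong f e) v = 0 := by rw [h3]; rfl
      refine Eq.trans (b := pull ξ (projAlong f e) v -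
        (-1 : ℂ) ^ q * pull (wedgeOne η f) (projAlong f e) v) rfl ?_
      rw [h4, mul_zero, sub_zero]
    rw [← h2, h1, hζ, sub_sub_cancel, wedgeOne_smul_left, wedgeOne_wedgeOne_self]
    exact smul_zero (M := ℂ) (A := Alt E (q + 1 + 1)) _

end Kills

/-! ### Continuity of exterior products and pull-backs -/

section Continuity

variable {E F : Type} [NormedAddCommGroup E] [NormedSpace ℂ E]
  [NormedAddCommGroup F] [NormedSpace ℂ F] {q : ℕ} {X : Type*} {l : Filter X}

theorem tendsto_wedgeOne {η : X → Alt E q} {η₀ : Alt E q} {θ : X → (E →L[ℂ] ℂ)}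
    {θ₀ : E →L[ℂ] ℂ} (hη : Filter.Tendsto η l (𝓝 η₀)) (hθ : Filter.Tendsto θ l (𝓝 θ₀)) :
    Filter.Tendsto (fun x => wedgeOne (η x) (θ x)) l (𝓝 (wedgeOne η₀ θ₀)) := by
  let T : (E →L[ℂ] Alt E q) →L[ℂ] Alt E (q + 1) :=
    (-1 : ℂ) ^ q • ContinuousAlternatingMap.alternatizeUncurryFinCLM (n := q) ℂ E ℂ
  have h1 : Continuous fun z : (E →L[ℂ] ℂ) × Alt E q =>
      ContinuousLinearMap.smulRightL ℂ E (Alt E q) z.1 z.2 := by fun_prop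
  have h2 : Filter.Tendsto (fun x => ContinuousLinearMap.smulRightL ℂ E (Alt E q) (θ x) (η x)) l
      (𝓝 (ContinuousLinearMap.smulRightL ℂ E (Alt E q) θ₀ η₀)) :=
    by
      have h4 : Filter.Tendsto (fun x => (θ x, η x)) l (𝓝 (θ₀, η₀)) := hθ.prodMk_nhds hη
      have h5 := (h1.tendsto (θ₀, η₀)).comp h4
      exact h5
  have h3 : ∀ (ξ : Alt E q) (ψ : E →L[ℂ] ℂ),
      wedgeOne ξ ψ = T (ContinuousLinearMap.smulRightL ℂ E (Alt E q) ψ ξ) := fun _ _ => rfl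
  simp only [h3]
  exact (T.continuous.tendsto _).comp h2

theorem tendsto_wedgeTuple {η : X → Alt E q} {η₀ : Alt E q} (r : ℕ)
    {θ : X → Fin r → (E →L[ℂ] ℂ)} {θ₀ : Fin r → (E →L[ℂ] ℂ)} (hη : Filter.Tendsto η l (𝓝 η₀))
    (hθ : ∀ s, Filter.Tendsto (fun x => θ x s) l (𝓝 (θ₀ s))) :
    Filter.Tendsto (fun x => wedgeTuple (η x) r (θ x)) l (𝓝 (wedgeTuple η₀ r θ₀)) := by
  induction r with
  | zero => exact hη
  | succ r ih => exact tendsto_wedgeOne (ih fun s => hθ s.castSucc) (hθ (Fin.last r))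

theorem tendsto_pull {η : X → Alt F q} {η₀ : Alt F q} {T : X → (E →L[ℂ] F)} {T₀ : E →L[ℂ] F}
    (hη : Filter.Tendsto η l (𝓝 η₀)) (hT : Filter.Tendsto T l (𝓝 T₀)) :
    Filter.Tendsto (fun x => pull (η x) (T x)) l (𝓝 (pull η₀ T₀)) :=
  (isBoundedBilinearMap_apply.continuous.tendsto
    ((ContinuousAlternatingMap.compContinuousLinearMapCLM T₀, η₀) :
      (Alt F q →L[ℂ] Alt E q) × _)).comp
      (((ContinuousAlternatingMap.continuous_compContinuousLinearMapCLM.tendsto T₀).comp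
        hT).prodMk_nhds hη)

end Continuity

/-! ### Logarithmic forms for an arrangement of linear forms -/

section LogForms

variable {E : Type} [NormedAddCommGroup E] [NormedSpace ℂ E] {ι : Type} [LinearOrder ι]

theorem wedgeOne_zero_left {q : ℕ} (θ : E →L[ℂ] ℂ) : wedgeOne (0 : Alt E q) θ = 0 := by
  ext v
  simp [wedgeOne_apply]

/-- The kernels of a family of linear forms. -/
def kers (f : ι → (E →L[ℂ] ℂ)) (i : ι) : Submodule ℂ E := (f i).ker

theorem mem_kers {f : ι → (E →L[ℂ] ℂ)} {i : ι} {v : E} : v ∈ kers f i ↔ f i v = 0 := Iff.rfl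

theorem isKer_kers (f : ι → (E →L[ℂ] ℂ)) : IsKer (kers f) := fun i => ⟨f i, rfl⟩

theorem Indep.ne_zero {f : ι → (E →L[ℂ] ℂ)} {I : Finset ι} (h : Indep (kers f) I) {i : ι}
    (hi : i ∈ I) : f i ≠ 0 := fun h0 => h i hi fun v _ => by rw [mem_kers, h0]; rfl

/-- The complement of the kernels of those forms that are not zero. -/
def offHyp (f : ι → (E →L[ℂ] ℂ)) : Set E := {y | ∀ i, f i ≠ 0 → f i y ≠ 0}

theorem dlogVec_linear (g : E →L[ℂ] ℂ) (y : E) : dlogVec g y = (g y)⁻¹ • g := by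
  rw [dlogVec, g.fderiv]

/-- The form `η ∧ ω_I`, in degree `p`, where `ω_i = d f_i / f_i`. -/
def logMon (f : ι → (E →L[ℂ] ℂ)) (q p : ℕ) (I : Finset ι) (η : E → Alt E q) : E → Alt E p :=
  fun y => wedgeExt q p (extEval (fun i => dlogVec (f i) y) (extMonomial I)) (η y)

/-- The forms that are, off the hyperplanes and near the set `A`, linear combinations of forms
`η ∧ ω_I` of degree `p`, with `η` analytic on `A` and `|I| < k`. In the applications `A` is the
whole space or one point. -/
def logSpan (f : ι → (E →L[ℂ] ℂ)) (A : Set E) (k p : ℕ) : Submodule ℂ (E → Alt E p) where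
  carrier := {ζ | ∃ ζ' ∈ Submodule.span ℂ {ξ | ∃ (I : Finset ι) (q : ℕ) (η : E → Alt E q),
    I.card < k ∧ q + I.card = p ∧ AnalyticOnNhd ℂ η A ∧ ξ = logMon f q p I η},
      ∀ᶠ y in 𝓝ˢ A, y ∈ offHyp f → ζ y = ζ' y}
  add_mem' := by
    rintro a b ⟨a', ha', ha⟩ ⟨b', hb', hb⟩
    refine ⟨a' + b', add_mem ha' hb', ?_⟩
    filter_upwards [ha, hb] with y h1 h2 hy
    rw [Pi.add_apply, Pi.add_apply, h1 hy, h2 hy]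
  zero_mem' := ⟨0, zero_mem _, Filter.Eventually.of_forall fun _ _ => rfl⟩
  smul_mem' := by
    rintro c a ⟨a', ha', ha⟩
    refine ⟨c • a', Submodule.smul_mem _ c ha', ?_⟩
    filter_upwards [ha] with y h1 hy
    rw [Pi.smul_apply, Pi.smul_apply, h1 hy]

variable {f : ι → (E →L[ℂ] ℂ)} {A : Set E} {k p q : ℕ}

theorem logSpan_congr {ζ ζ' : E → Alt E p} (h : ζ' ∈ logSpan f A k p)
    (he : ∀ᶠ y in 𝓝ˢ A, y ∈ offHyp f → ζ y = ζ' y) : ζ ∈ logSpan f A k p := by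
  obtain ⟨ξ, hξ, h⟩ := h
  refine ⟨ξ, hξ, ?_⟩
  filter_upwards [h, he] with y h1 h2 hy
  rw [h2 hy, h1 hy]

theorem logMon_mem {I : Finset ι} {η : E → Alt E q} (hI : I.card < k) (hp : q + I.card = p)
    (hη : AnalyticOnNhd ℂ η A) : logMon f q p I η ∈ logSpan f A k p :=
  ⟨_, Submodule.subset_span ⟨I, q, η, hI, hp, hη, rfl⟩, Filter.Eventually.of_forall fun _ _ => rfl⟩

/-- To prove a property of all elements of `logSpan`, it suffices to prove it for the monomials
and to show that it is preserved under linear combinations and changes away from the complement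
of the hyperplanes near `A`. -/
theorem logSpan_induction {P : (E → Alt E p) → Prop}
    (mon : ∀ (I : Finset ι) (q : ℕ) (η : E → Alt E q), I.card < k → q + I.card = p →
      AnalyticOnNhd ℂ η A → P (logMon f q p I η))
    (zero : P 0) (add : ∀ a b, P a → P b → P (a + b)) (smul : ∀ (c : ℂ) a, P a → P (c • a))
    (congr : ∀ ζ ζ', P ζ' → (∀ᶠ y in 𝓝ˢ A, y ∈ offHyp f → ζ y = ζ' y) → P ζ)
    {ζ : E → Alt E p} (h : ζ ∈ logSpan f A k p) : P ζ := by
  obtain ⟨ζ', h', he⟩ := h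
  refine congr ζ ζ' ?_ he
  clear he
  induction h' using Submodule.span_induction with
  | mem x hx =>
    obtain ⟨I, q, η, h1, h2, h3, rfl⟩ := hx
    exact mon I q η h1 h2 h3
  | zero => exact zero
  | add a b _ _ ha hb => exact add a b ha hb
  | smul c a _ ha => exact smul c a ha

theorem logSpan_mono {k' : ℕ} (hk : k ≤ k') {ζ : E → Alt E p} (h : ζ ∈ logSpan f A k p) :
    ζ ∈ logSpan f A k' p :=
  logSpan_induction (P := (· ∈ logSpan f A k' p))
    (fun _ _ _ hI hp hη => logMon_mem (hI.trans_le hk) hp hη) (zero_mem _)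
    (fun _ _ ha hb => add_mem ha hb) (fun c _ ha => Submodule.smul_mem _ c ha)
    (fun _ _ h he => logSpan_congr h he) h

theorem logMon_add (I : Finset ι) (η η' : E → Alt E q) :
    logMon f q p I (η + η') = logMon f q p I η + logMon f q p I η' :=
  funext fun _ => map_add _ _ _

theorem logMon_sub (I : Finset ι) (η η' : E → Alt E q) :
    logMon f q p I (η - η') = logMon f q p I η - logMon f q p I η' :=
  funext fun _ => map_sub _ _ _

theorem logMon_eq_wedgeTuple {I : Finset ι} {k : ℕ} (hI : I.card = k) (η : E → Alt E q) (y : E) :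
    logMon f q (q + k) I η y =
      wedgeTuple (η y) k fun s => dlogVec (f (I.orderEmbOfFin hI s)) y :=
  wedgeExt_extMonomial _ _ hI

/-- The exterior product with a holomorphic one-form does not add a pole. -/
theorem wedgeOne_analytic_mem {ζ : E → Alt E p} (h : ζ ∈ logSpan f A k p)
    {α : E → (E →L[ℂ] ℂ)} (hα : AnalyticOnNhd ℂ α A) :
    (fun y => wedgeOne (ζ y) (α y)) ∈ logSpan f A k (p + 1) := by
  refine logSpan_induction (P := fun ζ => (fun y => wedgeOne (ζ y) (α y)) ∈
    logSpan f A k (p + 1)) (fun I q η hI hp hη => ?_) ?_ (fun a b ha hb => ?_) (fun c a ha => ?_)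
    (fun a b h he => ?_) h
  · have h1 : (fun y => wedgeOne (logMon f q p I η y) (α y)) =
        (-1 : ℂ) ^ I.card • logMon f (q + 1) (p + 1) I fun y => wedgeOne (η y) (α y) := by
      funext y
      rw [Pi.smul_apply]
      simp only [logMon]
      rw [← wedgeExt_mul_ι, extEval_extMonomial_mul_ι, map_smul, LinearMap.smul_apply,
        wedgeExt_ι_mul]
    rw [h1]
    exact Submodule.smul_mem _ _ (logMon_mem hI (by omega) fun a ha =>
      analyticAt_wedgeOne (hη a ha) (hα a ha))
  · convert zero_mem (logSpan f A k (p + 1))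
    exact wedgeOne_zero_left _
  · convert add_mem ha hb using 1
    funext y
    exact wedgeOne_add_left _ _ _
  · convert Submodule.smul_mem _ c ha using 1
    funext y
    exact wedgeOne_smul_left _ _ _
  · refine logSpan_congr h ?_
    filter_upwards [he] with y hy hy'
    rw [hy hy']

/-- The exterior product of `η ∧ ω_I` with `ω_j` is zero or, up to sign, `η ∧ ω_J` with
`J = I ∪ {j}`. -/
theorem wedgeOne_logMon_dlogVec {I : Finset ι} (hp : q + I.card = p) (hI : I.card < k)
    {η : E → Alt E q} (hη : AnalyticOnNhd ℂ η A) (j : ι) :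
    (fun y => wedgeOne (logMon f q p I η y) (dlogVec (f j) y)) ∈ logSpan f A (k + 1) (p + 1) := by
  have h1 : (fun y => wedgeOne (logMon f q p I η y) (dlogVec (f j) y)) = fun y =>
      wedgeExt q (p + 1) (extEval (fun i => dlogVec (f i) y) (extMonomial I * extGen j)) (η y) := by
    funext y
    rw [map_mul, extEval_extGen, wedgeExt_mul_ι]
    rfl
  rw [h1, extMonomial_mul_extGen_comm]
  by_cases hj : j ∈ I
  · convert zero_mem (logSpan f A (k + 1) (p + 1))
    rw [extGen_mul_extMonomial_of_mem hj, smul_zero, map_zero, map_zero]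
    rfl
  · have hmem : logMon f q (p + 1) (insert j I) η ∈ logSpan f A (k + 1) (p + 1) := by
      have := Finset.card_insert_of_notMem hj
      exact logMon_mem (by omega) (by omega) hη
    obtain ⟨c, hc⟩ : ∃ c : ℂ, (fun y => wedgeExt q (p + 1) (extEval (fun i => dlogVec (f i) y)
        ((-1 : ℚ) ^ I.card • (extGen j * extMonomial I))) (η y)) =
          c • logMon f q (p + 1) (insert j I) η := by
      rcases neg_one_pow_eq_or ℚ I.card with h3 | h3 <;>
      rcases extGen_mul_extMonomial hj with h2 | h2 <;> rw [h2, h3]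
      · exact ⟨1, funext fun y => by rw [one_smul, one_smul]; rfl⟩
      · refine ⟨-1, funext fun y => ?_⟩
        rw [one_smul, map_neg, map_neg, neg_one_smul]; rfl
      · refine ⟨-1, funext fun y => ?_⟩
        rw [neg_one_smul, map_neg, map_neg, neg_one_smul]; rfl
      · exact ⟨1, funext fun y => by rw [neg_one_smul, neg_neg, one_smul]; rfl⟩
    rw [hc]
    exact Submodule.smul_mem _ c hmem

theorem wedgeOne_dlogVec_mem {ζ : E → Alt E p} (h : ζ ∈ logSpan f A k p) (j : ι) :
    (fun y => wedgeOne (ζ y) (dlogVec (f j) y)) ∈ logSpan f A (k + 1) (p + 1) := by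
  refine logSpan_induction (P := fun ζ => (fun y => wedgeOne (ζ y) (dlogVec (f j) y)) ∈
    logSpan f A (k + 1) (p + 1)) (fun I q η hI hp hη => wedgeOne_logMon_dlogVec hp hI hη j) ?_
    (fun a b ha hb => ?_) (fun c a ha => ?_) (fun a b h he => ?_) h
  · convert zero_mem (logSpan f A (k + 1) (p + 1))
    exact wedgeOne_zero_left _
  · convert add_mem ha hb using 1
    funext y
    exact wedgeOne_add_left _ _ _
  · convert Submodule.smul_mem _ c ha using 1
    funext y
    exact wedgeOne_smul_left _ _ _
  · refine logSpan_congr h ?_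
    filter_upwards [he] with y hy hy'
    rw [hy hy']

/-! ### Relations between logarithmic forms -/

theorem dlogVec_apply_eq_zero_iff {y : E} (hy : y ∈ offHyp f) (i : ι) (v : E) :
    dlogVec (f i) y v = 0 ↔ f i v = 0 := by
  rw [dlogVec_linear]
  by_cases h : f i = 0
  · simp [h]
  · simp [hy i h]

/-- The monomials of dependent sets of linear forms vanish. -/
theorem extEval_dlogVec_eq_zero {y : E} (hy : y ∈ offHyp f) {I : Finset ι}
    (hI : ¬ Indep (kers f) I) : extEval (fun i => dlogVec (f i) y) (extMonomial I) = 0 := by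
  simp only [Indep, not_forall, not_not] at hI
  obtain ⟨c, hc, hle⟩ := hI
  refine extEval_extMonomial_eq_zero _ hc fun v hv => ?_
  rw [dlogVec_apply_eq_zero_iff hy]
  refine hle (mem_inter.2 fun i hi => ?_)
  exact (dlogVec_apply_eq_zero_iff hy i v).1 (hv i hi)

/-- The Orlik-Solomon relations hold between logarithmic forms. -/
theorem extEval_dlogVec_extDelta {y : E} (hy : y ∈ offHyp f) {I : Finset ι}
    (h0 : ∀ i ∈ I, f i ≠ 0) (hI : ¬ Indep (kers f) I) :
    extEval (fun i => dlogVec (f i) y) (extDelta I) = 0 := by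
  simp only [Indep, not_forall, not_not] at hI
  obtain ⟨c, hc, hle⟩ := hI
  refine extEval_extDelta_eq_zero _ (y := y) (fun i hi => ?_) hc fun v hv => ?_
  · rw [dlogVec_linear]
    simp [hy i (h0 i hi)]
  · rw [dlogVec_apply_eq_zero_iff hy]
    refine hle (mem_inter.2 fun i hi => ?_)
    exact (dlogVec_apply_eq_zero_iff hy i v).1 (hv i hi)

theorem exists_dual_vectors {I : Finset ι} (hI : Indep (kers f) I) :
    ∃ e : ι → E, ∀ i ∈ I, ∀ j ∈ I, f i (e j) = if i = j then 1 else 0 := by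
  have h : ∀ j, ∃ e : E, j ∈ I → ∀ i ∈ I, f i e = if i = j then 1 else 0 := by
    intro j
    by_cases hj : j ∈ I
    · obtain ⟨v, hv, hvj⟩ := SetLike.not_le_iff_exists.1 (hI j hj)
      rw [mem_kers] at hvj
      refine ⟨(f j v)⁻¹ • v, fun _ i hi => ?_⟩
      split_ifs with hij
      · rw [hij, map_smul, smul_eq_mul, inv_mul_cancel₀ hvj]
      · rw [map_smul, mem_kers.1 (mem_inter.1 hv i (Finset.mem_erase.2 ⟨hij, hi⟩)), smul_zero]
    · exact ⟨0, fun h => absurd h hj⟩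
  choose e he using h
  exact ⟨e, fun i hi j hj => he j hj i hi⟩

/-- The factor `ω_i` of `η ∧ ω_I` may be moved next to `η`; the sign `c` depends on `i` and `I`
only. -/
theorem logMon_eq_erase {I : Finset ι} {i : ι} (hi : i ∈ I) :
    ∃ c : ℂ, ∀ (η : E → Alt E q) (y : E), logMon f q p I η y =
      c • wedgeExt (q + 1) p (extEval (fun i => dlogVec (f i) y) (extMonomial (I.erase i)))
        (wedgeOne (η y) (dlogVec (f i) y)) := by
  have h1 : ∀ (η : E → Alt E q) (y : E),
      wedgeExt (q + 1) p (extEval (fun i => dlogVec (f i) y) (extMonomial (I.erase i)))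
        (wedgeOne (η y) (dlogVec (f i) y)) =
      wedgeExt q p (extEval (fun i => dlogVec (f i) y) (extGen i * extMonomial (I.erase i)))
        (η y) := by
    intro η y
    rw [map_mul, extEval_extGen, wedgeExt_ι_mul]
  simp only [h1]
  rcases extGen_mul_extMonomial (Finset.notMem_erase i I) with h2 | h2 <;>
    rw [h2, Finset.insert_erase hi]
  · exact ⟨1, fun η y => (one_smul _ _).symm⟩
  · refine ⟨-1, fun η y => ?_⟩
    rw [map_neg, map_neg, LinearMap.neg_apply, smul_neg, neg_one_smul, neg_neg]
    rfl

/-- The set `A` is stable under the projections onto the hyperplanes. -/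
def ProjStable (f : ι → (E →L[ℂ] ℂ)) (A : Set E) : Prop :=
  ∀ i e, f i e = 1 → ∀ a ∈ A, projAlong (f i) e a ∈ A

/-- The pull-back of a form under a linear map. -/
def pullAlong {q : ℕ} (η : E → Alt E q) (T : E →L[ℂ] E) : E → Alt E q :=
  fun y => pull (η (T y)) T

theorem analyticOnNhd_pullAlong {η : E → Alt E q} (hη : AnalyticOnNhd ℂ η A) {T : E →L[ℂ] E}
    (hT : ∀ a ∈ A, T a ∈ A) : AnalyticOnNhd ℂ (pullAlong η T) A := fun a ha => by
  let P : Alt E q →L[ℂ] Alt E q := ContinuousAlternatingMap.compContinuousLinearMapCLM T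
  exact (P.analyticAt _).comp ((hη _ (hT a ha)).comp (T.analyticAt a))

/-- A form differs from its pull-back under the projection onto the kernel of `f i` by a multiple of
`f i` and a multiple of `d f_i`. The first cancels the pole of `ω_i`, the second is killed by it. -/
theorem logMon_sub_pullAlong_mem {I : Finset ι} (hI : I.card = k) (hp : q + k = p) {i : ι}
    (hi : i ∈ I) {e : E} (he : f i e = 1) {η : E → Alt E q} (hη : AnalyticOnNhd ℂ η A)
    (hA : ∀ a ∈ A, projAlong (f i) e a ∈ A) :
    logMon f q p I (η - pullAlong η (projAlong (f i) e)) ∈ logSpan f A k p := by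
  obtain ⟨h, hh, heq⟩ := exists_analyticOnNhd_div hη he hA
  obtain ⟨c, hc⟩ := logMon_eq_erase (f := f) (q := q) (p := p) hi
  have hcard := Finset.card_erase_add_one hi
  have hf0 : f i ≠ 0 := fun h0 => by rw [h0] at he; simp at he
  refine logSpan_congr (Submodule.smul_mem _ c (logMon_mem (f := f) (A := A) (k := k) (p := p)
    (I := I.erase i) (q := q + 1) (η := fun y => wedgeOne (h y) (f i)) (by omega) (by omega)
    fun a ha => analyticAt_wedgeOne (hh a ha) analyticAt_const)) ?_
  refine Filter.Eventually.of_forall fun y hy => ?_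
  rw [hc, Pi.smul_apply, logMon]
  congr 2
  have h1 : (η - pullAlong η (projAlong (f i) e)) y = f i y • h y +
      (η (projAlong (f i) e y) - pull (η (projAlong (f i) e y)) (projAlong (f i) e)) := by
    rw [← heq y, Pi.sub_apply, pullAlong]
    abel
  rw [h1, dlogVec_linear, wedgeOne_add_left, wedgeOne_smul_right _ (η _ - _),
    wedgeOne_sub_pull_projAlong _ he, wedgeOne_smul_left, wedgeOne_smul_right, smul_smul,
    mul_inv_cancel₀ (hy i hf0), one_smul]
  refine (congrArg (_ + ·) (smul_zero (M := ℂ) (A := Alt E (q + 1)) _)).trans ?_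
  exact add_zero _

/-- If the form `η` vanishes on the intersection of the hyperplanes of `I`, then `η ∧ ω_I` is
a combination of forms with fewer poles. -/
theorem logMon_mem_of_vanish (hA : ProjStable f A) {I : Finset ι} (hI : I.card = k)
    (hp : q + k = p) (hind : Indep (kers f) I) {η : E → Alt E q} (hη : AnalyticOnNhd ℂ η A)
    (h0 : ∀ᶠ y in 𝓝ˢ A, y ∈ inter (kers f) I →
      pull (η y) (inter (kers f) I).subtypeL = 0) :
    logMon f q p I η ∈ logSpan f A k p := by
  obtain ⟨e, he⟩ := exists_dual_vectors hind
  -- Project successively along the dual vectors of the elements of `I`.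
  have key : ∀ J : Finset ι, J ⊆ I → ∃ T : E →L[ℂ] E, (∀ a ∈ A, T a ∈ A) ∧
      (∀ j ∈ J, ∀ v, f j (T v) = 0) ∧ (∀ i ∈ I, i ∉ J → ∀ v, f i (T v) = f i v) ∧
      logMon f q p I (η - pullAlong η T) ∈ logSpan f A k p := by
    intro J
    induction J using Finset.induction_on with
    | empty =>
      refine fun _ => ⟨ContinuousLinearMap.id ℂ E, fun a ha => ha, by simp, fun _ _ _ _ => rfl, ?_⟩
      have : η - pullAlong η (ContinuousLinearMap.id ℂ E) = 0 := by
        funext y; exact sub_self (η y)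
      rw [this]
      convert zero_mem (logSpan f A k p)
      funext y
      exact map_zero _
    | insert i J hiJ ih =>
      intro hJ
      have hiI : i ∈ I := hJ (Finset.mem_insert_self i J)
      obtain ⟨T, hT1, hT2, hT3, hT4⟩ := ih ((Finset.subset_insert i J).trans hJ)
      have hei : f i (e i) = 1 := by rw [he i hiI i hiI, if_pos rfl]
      have hAi := hA i (e i) hei
      refine ⟨T.comp (projAlong (f i) (e i)), fun a ha => hT1 _ (hAi a ha), ?_, ?_, ?_⟩
      · intro j hj v
        rcases Finset.mem_insert.1 hj with rfl | hj
        · rw [ContinuousLinearMap.comp_apply, hT3 _ hiI hiJ, projAlong_apply]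
          simp [hei]
        · exact hT2 j hj _
      · intro j hj hjJ v
        rw [Finset.mem_insert, not_or] at hjJ
        rw [ContinuousLinearMap.comp_apply, hT3 j hj hjJ.2, projAlong_apply]
        simp [he j hj i hiI, hjJ.1]
      · have h1 : η - pullAlong η (T.comp (projAlong (f i) (e i))) = (η - pullAlong η T) +
            (pullAlong η T - pullAlong (pullAlong η T) (projAlong (f i) (e i))) := by
          funext y
          exact (sub_add_sub_cancel (η y) (pullAlong η T y) _).symm
        rw [h1, logMon_add]
        exact add_mem hT4 (logMon_sub_pullAlong_mem hI hp hiI hei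
          (analyticOnNhd_pullAlong hη hT1) hAi)
  obtain ⟨T, hT1, hT2, -, hT4⟩ := key I subset_rfl
  rw [logMon_sub] at hT4
  have h1 : logMon f q p I (pullAlong η T) ∈ logSpan f A k p := by
    refine logSpan_congr (zero_mem _) ?_
    have h2 : Filter.Tendsto T (𝓝ˢ A) (𝓝ˢ A) := T.continuous.tendsto_nhdsSet hT1
    filter_upwards [h2.eventually h0] with y hy _
    have h3 : T y ∈ inter (kers f) I := mem_inter.2 fun i hi => hT2 i hi y
    have h4 : pullAlong η T y = 0 := by
      ext v
      exact DFunLike.congr_fun (hy h3) fun j => ⟨T (v j), mem_inter.2 fun i hi => hT2 i hi _⟩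
    rw [logMon, h4, map_zero]
    rfl
  have := add_mem hT4 h1
  rwa [sub_add_cancel] at this

end LogForms

/-! ### Residues of logarithmic forms -/

section Residue

variable {E : Type} [NormedAddCommGroup E] [NormedSpace ℂ E] {q k : ℕ}

/-- A curve that starts at the point `x` and leaves it at different speeds in the directions
`e s`. -/
def residuePath (x : E) (e : Fin k → E) (t : ℂ) : E := x + ∑ s : Fin k, t ^ (s + 1 : ℕ) • e s

/-- The vectors `v a` and `t ^ (s + 1) e s`, as a linear map to `E`. -/
def residueFrame (v : Fin q → E) (e : Fin k → E) (t : ℂ) : (Fin q ⊕ Fin k → ℂ) →L[ℂ] E :=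
  ∑ a : Fin q, (ContinuousLinearMap.proj (Sum.inl a)).smulRight (v a) +
    ∑ s : Fin k, (ContinuousLinearMap.proj (Sum.inr s)).smulRight (t ^ (s + 1 : ℕ) • e s)

theorem continuous_residuePath (x : E) (e : Fin k → E) : Continuous (residuePath x e) := by
  unfold residuePath; fun_prop

theorem residuePath_zero (x : E) (e : Fin k → E) : residuePath x e 0 = x := by
  simp [residuePath]

theorem tendsto_residuePath (x : E) (e : Fin k → E) :
    Filter.Tendsto (residuePath x e) (𝓝[≠] 0) (𝓝 x) := by
  have h := (continuous_residuePath x e).tendsto 0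
  rw [residuePath_zero] at h
  exact h.mono_left nhdsWithin_le_nhds

theorem continuous_residueFrame (v : Fin q → E) (e : Fin k → E) :
    Continuous (residueFrame v e) := by
  unfold residueFrame
  refine continuous_const.add (continuous_finsetSum _ fun s _ => ?_)
  have h : Continuous fun u : E => (ContinuousLinearMap.proj (R := ℂ)
      (φ := fun _ : Fin q ⊕ Fin k => ℂ) (Sum.inr s)).smulRight u :=
    (ContinuousLinearMap.smulRightL ℂ (Fin q ⊕ Fin k → ℂ) E
      (ContinuousLinearMap.proj (Sum.inr s))).continuous
  exact h.comp (by fun_prop)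

theorem residueFrame_zero_inr (v : Fin q → E) (e : Fin k → E) (s : Fin k) :
    residueFrame v e 0 (Pi.single (Sum.inr s) 1) = 0 := by
  simp [residueFrame]

theorem residueFrame_inl (v : Fin q → E) (e : Fin k → E) (t : ℂ) (a : Fin q) :
    residueFrame v e t (Pi.single (Sum.inl a) 1) = v a := by
  simp [residueFrame, Pi.single_apply, ite_smul]

/-- The limit of a logarithmic differential `dg / g` along the curve. If `g` vanishes on the
curve to the order `s + 1` at its origin, the limit is the coordinate along `e s`. -/
theorem exists_tendsto_dlogVec (g : E →L[ℂ] ℂ) (x : E) (v : Fin q → E) (e : Fin k → E)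
    (hg : g ≠ 0 → g x ≠ 0 ∨ (g x = 0 ∧ (∀ a, g (v a) = 0) ∧ ∃ s, g (e s) ≠ 0)) :
    ∃ c : (Fin q ⊕ Fin k → ℂ) →L[ℂ] ℂ,
      (∀ᶠ t in 𝓝[≠] (0 : ℂ), g ≠ 0 → g (residuePath x e t) ≠ 0) ∧
      Filter.Tendsto (fun t => (dlogVec g (residuePath x e t)).comp (residueFrame v e t))
        (𝓝[≠] 0) (𝓝 c) ∧
      ((∃ s, (∀ s' < s, g (e s') = 0) ∧ g (e s) ≠ 0 ∧ g x = 0 ∧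
          c = ContinuousLinearMap.proj (Sum.inr s)) ∨
        ((g x ≠ 0 ∨ g = 0) ∧ ∀ s, c (Pi.single (Sum.inr s) 1) = 0)) := by
  by_cases hg0 : g = 0
  · subst hg0
    refine ⟨0, Filter.Eventually.of_forall fun _ h => absurd rfl h, ?_,
      Or.inr ⟨Or.inr rfl, fun _ => rfl⟩⟩
    refine tendsto_const_nhds.congr fun t => ?_
    have h0 : dlogVec (0 : E →L[ℂ] ℂ) (residuePath x e t) = 0 := by
      rw [dlogVec_linear]
      exact smul_zero (M := ℂ) (A := E →L[ℂ] ℂ) _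
    rw [h0, ContinuousLinearMap.zero_comp]
  rcases hg hg0 with hx | ⟨hx, hv, s, hs⟩
  · have h1 := (g.continuous.tendsto _).comp (tendsto_residuePath x e)
    refine ⟨((g x)⁻¹ • g).comp (residueFrame v e 0), ?_, ?_, Or.inr ⟨Or.inl hx, fun s => ?_⟩⟩
    · filter_upwards [h1.eventually_ne hx] with t ht _ using ht
    · simp only [dlogVec_linear]
      have h2 := ((continuous_residueFrame v e).tendsto 0).mono_left
        (nhdsWithin_le_nhds (s := ({0}ᶜ : Set ℂ)))
      have h3 := (h1.inv₀ hx).smul_const g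
      exact (ContinuousLinearMap.compL ℂ (Fin q ⊕ Fin k → ℂ) E ℂ).continuous₂.tendsto
        (((g x)⁻¹ • g), residueFrame v e 0) |>.comp (h3.prodMk_nhds h2)
    · rw [ContinuousLinearMap.comp_apply, residueFrame_zero_inr, map_zero]
  · obtain ⟨s, hs, hmin⟩ : ∃ s, g (e s) ≠ 0 ∧ ∀ s' < s, g (e s') = 0 := by
      have hne : (Finset.univ.filter fun s => g (e s) ≠ 0).Nonempty :=
        ⟨s, by simp [hs]⟩
      refine ⟨_, (Finset.mem_filter.1 (Finset.min'_mem _ hne)).2, fun s' hs' => ?_⟩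
      by_contra h
      exact absurd (Finset.min'_le _ s' (by simp [h])) (not_le.2 hs')
    -- Both `g` along the curve and `g` on the frame are divisible by `t ^ (s + 1)`, where `s` is
    -- the first index with `g (e s) ≠ 0`. The quotients `h` and `F` have limits.
    have hpow : ∀ (t : ℂ) (r : Fin k),
        t ^ (r + 1 : ℕ) * g (e r) = t ^ (s + 1 : ℕ) * (t ^ (r - s : ℕ) * g (e r)) := by
      intro t r
      rcases lt_or_ge r s with h | h
      · rw [hmin r h]; simp
      · rw [← mul_assoc, ← pow_add]
        congr 2
        have : (s : ℕ) ≤ r := h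
        omega
    let h : ℂ → ℂ := fun t => ∑ r : Fin k, t ^ (r - s : ℕ) * g (e r)
    let F : ℂ → ((Fin q ⊕ Fin k → ℂ) →L[ℂ] ℂ) := fun t =>
      ∑ r : Fin k, (t ^ (r - s : ℕ) * g (e r)) • ContinuousLinearMap.proj (Sum.inr r)
    have hcoef : ∀ r : Fin k, (0 : ℂ) ^ (r - s : ℕ) * g (e r) = if r = s then g (e s) else 0 := by
      intro r
      split_ifs with hr
      · rw [hr]; simp
      · rcases lt_or_gt_of_ne hr with h | h
        · rw [hmin r h, mul_zero]
        · have : (s : ℕ) < r := h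
          rw [zero_pow (by omega), zero_mul]
    have hh0 : h 0 = g (e s) := by simp only [h, hcoef]; simp
    have hF0 : F 0 = g (e s) • ContinuousLinearMap.proj (Sum.inr s) := by
      change ∑ r : Fin k, _ = _
      rw [Finset.sum_eq_single s]
      · rw [hcoef, if_pos rfl]
      · intro r _ hr
        rw [hcoef, if_neg hr]
        ext w
        simp
      · exact fun h => absurd (Finset.mem_univ s) h
    have hhc : Filter.Tendsto h (𝓝[≠] 0) (𝓝 (g (e s))) := by
      have : Continuous h := by fun_prop
      have := this.tendsto 0
      rw [hh0] at this
      exact this.mono_left nhdsWithin_le_nhds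
    have hFc : Filter.Tendsto F (𝓝[≠] 0)
        (𝓝 (g (e s) • ContinuousLinearMap.proj (Sum.inr s))) := by
      have : Continuous F := by fun_prop
      have := this.tendsto 0
      rw [hF0] at this
      exact this.mono_left nhdsWithin_le_nhds
    have hgx : ∀ t, g (residuePath x e t) = t ^ (s + 1 : ℕ) * h t := by
      intro t
      simp only [residuePath, map_add, hx, zero_add, map_sum, map_smul, smul_eq_mul, h,
        Finset.mul_sum, ← hpow]
    have hgT : ∀ t, g.comp (residueFrame v e t) = t ^ (s + 1 : ℕ) • F t := by
      intro t
      ext w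
      simp only [residueFrame, F, ContinuousLinearMap.comp_apply, map_add, map_sum,
        add_apply, sum_apply,
        ContinuousLinearMap.smulRight_apply, map_smul, hv, smul_apply, smul_eq_mul, Finset.mul_sum,
        ContinuousLinearMap.proj_apply, mul_zero, Finset.sum_const_zero, zero_add]
      refine Finset.sum_congr rfl fun r _ => ?_
      rw [hpow]
      ring
    refine ⟨ContinuousLinearMap.proj (Sum.inr s), ?_, ?_, Or.inl ⟨s, hmin, hs, hx, rfl⟩⟩
    · filter_upwards [hhc.eventually_ne hs, self_mem_nhdsWithin] with t ht ht0 _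
      rw [hgx]
      exact mul_ne_zero (pow_ne_zero _ ht0) ht
    · have h4 := (hhc.inv₀ hs).smul hFc
      rw [smul_smul, inv_mul_cancel₀ hs, one_smul] at h4
      refine h4.congr' ?_
      filter_upwards [self_mem_nhdsWithin] with t ht0
      rw [dlogVec_linear, ContinuousLinearMap.smul_comp, hgx, hgT, smul_smul, mul_inv,
        mul_comm (t ^ _)⁻¹, mul_assoc, inv_mul_cancel₀ (pow_ne_zero _ ht0), mul_one]

variable {ι : Type} [LinearOrder ι] {f : ι → (E →L[ℂ] ℂ)} {p : ℕ}

theorem tendsto_logMon {I : Finset ι} {r q' : ℕ} (hI : I.card = r) {η : E → Alt E q'} {x : E}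
    (hη : ContinuousAt η x) {v : Fin q → E} {e : Fin k → E}
    {c : ι → ((Fin q ⊕ Fin k → ℂ) →L[ℂ] ℂ)}
    (hc : ∀ i, Filter.Tendsto (fun t => (dlogVec (f i) (residuePath x e t)).comp
      (residueFrame v e t)) (𝓝[≠] 0) (𝓝 (c i))) :
    Filter.Tendsto (fun t => pull (logMon f q' (q' + r) I η (residuePath x e t))
      (residueFrame v e t)) (𝓝[≠] 0) (𝓝 (wedgeTuple (pull (η x) (residueFrame v e 0)) r
        fun s => c (I.orderEmbOfFin hI s))) := by
  simp only [logMon_eq_wedgeTuple hI, wedgeTuple_pull]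
  refine tendsto_wedgeTuple r (tendsto_pull ?_ ?_) fun s => hc _
  · exact hη.tendsto.comp (tendsto_residuePath x e)
  · exact ((continuous_residueFrame v e).tendsto 0).mono_left nhdsWithin_le_nhds

/-- If none of the limits of the `ω_i`, for `i ∈ I`, sees the direction `e s`, then the coefficient
of `η ∧ ω_I` on vectors that include this direction tends to zero: the vector `t ^ (s + 1) e s`
itself tends to zero, so that `η` does not see it either. -/
theorem tendsto_logMon_zero {I : Finset ι} {q' : ℕ} (hp : q' + I.card = p) {η : E → Alt E q'}
    {x : E} (hη : ContinuousAt η x) {v : Fin q → E} {e : Fin k → E}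
    {c : ι → ((Fin q ⊕ Fin k → ℂ) →L[ℂ] ℂ)}
    (hc : ∀ i, Filter.Tendsto (fun t => (dlogVec (f i) (residuePath x e t)).comp
      (residueFrame v e t)) (𝓝[≠] 0) (𝓝 (c i)))
    {s : Fin k} (hs : ∀ i ∈ I, c i (Pi.single (Sum.inr s) 1) = 0)
    {w : Fin p → Fin q ⊕ Fin k → ℂ} {j : Fin p} (hj : w j = Pi.single (Sum.inr s) 1) :
    Filter.Tendsto (fun t => pull (logMon f q' p I η (residuePath x e t))
      (residueFrame v e t) w) (𝓝[≠] 0) (𝓝 0) := by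
  subst hp
  have h1 := tendsto_logMon rfl hη hc (I := I)
  have h2 : Kills (pull (η x) (residueFrame v e 0)) (Pi.single (Sum.inr s) 1) := by
    intro w i hi
    refine (η x).map_coord_zero i ?_
    simp [hi, residueFrame_zero_inr]
  have h3 := h2.wedgeTuple I.card (θ := fun s => c (I.orderEmbOfFin rfl s)) fun s' =>
    hs _ (I.orderEmbOfFin_mem rfl s')
  have h4 := (((ContinuousAlternatingMap.apply ℂ (Fin q ⊕ Fin k → ℂ) ℂ w).continuous.tendsto
    _).comp h1)
  have h5 : ContinuousAlternatingMap.apply ℂ (Fin q ⊕ Fin k → ℂ) ℂ w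
      (wedgeTuple (pull (η x) (residueFrame v e 0)) I.card
        fun s => c (I.orderEmbOfFin rfl s)) = 0 := h3 w j hj
  rw [h5] at h4
  exact h4

end Residue

section Leading

variable {E : Type} [NormedAddCommGroup E] [NormedSpace ℂ E] {k q : ℕ}
  {ι : Type} [LinearOrder ι] {f : ι → (E →L[ℂ] ℂ)}

/-- The set `I` contains no broken circuit for the forms `f i` that are not zero. -/
def NoBrokenForms (f : ι → (E →L[ℂ] ℂ)) (I : Finset ι) : Prop :=
  ∀ i, f i ≠ 0 → ¬ inter (kers f) (I.filter (i < ·)) ≤ kers f i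

/-- The vectors `e s` are dual to the forms of the set `J`, listed in increasing order. -/
def IsDualTo (f : ι → (E →L[ℂ] ℂ)) (J : Finset ι) (hJ : J.card = k) (e : Fin k → E) : Prop :=
  ∀ s s', f (J.orderEmbOfFin hJ s) (e s') = if s = s' then 1 else 0

theorem exists_isDualTo {J : Finset ι} (hJ : J.card = k) (h : Indep (kers f) J) :
    ∃ e : Fin k → E, IsDualTo f J hJ e := by
  obtain ⟨e, he⟩ := exists_dual_vectors h
  refine ⟨fun s => e (J.orderEmbOfFin hJ s), fun s s' => ?_⟩
  rw [he _ (J.orderEmbOfFin_mem hJ s) _ (J.orderEmbOfFin_mem hJ s')]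
  simp

variable {J : Finset ι} {hJ : J.card = k} {e : Fin k → E}

/-- A form that vanishes on `L_J` is a combination of the forms of `J`, with the values on the dual
vectors as coefficients. -/
theorem IsDualTo.expand (he : IsDualTo f J hJ e) {g : E →L[ℂ] ℂ}
    (hg : inter (kers f) J ≤ (g : E →ₗ[ℂ] ℂ).ker) (v : E) :
    g v = ∑ s, f (J.orderEmbOfFin hJ s) v * g (e s) := by
  have h : v - ∑ s, f (J.orderEmbOfFin hJ s) v • e s ∈ inter (kers f) J := by
    refine mem_inter.2 fun i hi => ?_
    obtain ⟨s, rfl⟩ : ∃ s, J.orderEmbOfFin hJ s = i := by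
      have : i ∈ Set.range (J.orderEmbOfFin hJ) := by
        rw [Finset.range_orderEmbOfFin]; exact hi
      exact this
    rw [mem_kers, map_sub, map_sum]
    simp [he s]
  have h1 : g (v - ∑ s, f (J.orderEmbOfFin hJ s) v • e s) = 0 := hg h
  rw [map_sub, map_sum, sub_eq_zero] at h1
  simpa using h1

/-- If neither `I` nor `J` contains a broken circuit and every element of `J` is the first element
of `J` that occurs in the expansion of some element of `I`, then `I = J`. -/
theorem eq_of_leading (he : IsDualTo f J hJ e) (hJb : NoBrokenForms f J) {I : Finset ι}
    (hI : I.card = k) (hIb : NoBrokenForms f I)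
    (h : ∀ s, ∃ i ∈ I, inter (kers f) J ≤ kers f i ∧ f i (e s) ≠ 0 ∧ ∀ s' < s, f i (e s') = 0) :
    I = J := by
  choose i hiI hle hne hzero using h
  set j := J.orderEmbOfFin hJ
  -- An element of `I` has only one leading position.
  have hinj : Function.Injective i := by
    intro s s' hs
    by_contra hss
    rcases lt_or_gt_of_ne hss with h | h
    · exact hne s (by rw [hs]; exact hzero s' s h)
    · exact hne s' (by rw [← hs]; exact hzero s s' h)
  -- `f (i s)` is a combination of the forms of the elements `≥ j s` of `J`. If `i s` were smaller
  -- than `j s`, the set `J` would contain a broken circuit.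
  have hle' : ∀ s, j s ≤ i s := by
    intro s
    by_contra! hlt
    refine hJb (i s) (fun h0 => hne s (by rw [h0]; rfl)) fun v hv => ?_
    rw [mem_kers, he.expand (hle s)]
    refine Finset.sum_eq_zero fun s' _ => ?_
    rcases lt_or_ge s' s with h | h
    · rw [hzero s s' h, mul_zero]
    · have h1 : f (j s') v = 0 := mem_inter.1 hv (j s') (Finset.mem_filter.2
        ⟨J.orderEmbOfFin_mem hJ s', hlt.trans_le (j.monotone h)⟩)
      rw [h1, zero_mul]
  -- Downward induction on `s`. The elements `> j s` of `I` include, by induction, all later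
  -- elements of `J`. If `j s < i s`, they include `i s` too, so that `f (j s)` is a combination of
  -- their forms, and the set `I` contains a broken circuit.
  have heq : ∀ s, i s = j s := by
    intro s
    induction s using WellFoundedGT.induction with
    | ind s ih =>
      refine le_antisymm ?_ (hle' s)
      by_contra! hlt
      refine hIb (j s) (fun h0 => ?_) fun v hv => ?_
      · have := he s s
        rw [if_pos rfl] at this
        change f (j s) (e s) = 1 at this
        rw [h0] at this
        simp at this
      · have h1 : f (i s) v = 0 := mem_inter.1 hv _ (Finset.mem_filter.2 ⟨hiI s, hlt⟩)
        rw [he.expand (hle s), Finset.sum_eq_single s] at h1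
        · exact (mul_eq_zero.1 h1).resolve_right (hne s)
        · intro s' _ hs'
          rcases lt_or_gt_of_ne hs' with h | h
          · rw [hzero s s' h, mul_zero]
          · have h2 : f (i s') v = 0 := mem_inter.1 hv _ (Finset.mem_filter.2
              ⟨hiI s', by rw [ih s' h]; exact j.strictMono h⟩)
            rw [ih s' h] at h2
            rw [h2, zero_mul]
        · exact fun h => absurd (Finset.mem_univ s) h
  have h1 : Finset.univ.image i = I := by
    refine Finset.eq_of_subset_of_card_le (fun a ha => ?_) ?_
    · obtain ⟨s, -, rfl⟩ := Finset.mem_image.1 ha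
      exact hiI s
    · rw [Finset.card_image_of_injective _ hinj, hI]
      simp
  rw [← h1, funext heq]
  exact Finset.image_orderEmbOfFin_univ J hJ

/-- The point `x` of `L_J` lies on no other kernels than those that contain `L_J`. -/
def GenericIn (f : ι → (E →L[ℂ] ℂ)) (J : Finset ι) (x : E) : Prop :=
  x ∈ inter (kers f) J ∧ ∀ i, f i ≠ 0 → f i x ≠ 0 ∨ inter (kers f) J ≤ kers f i

/-- The limits `c i` of the forms `df_i / f_i` along the curve that starts at the generic point
`x` of `L_J`. Each of them has at most one coordinate that is not zero in the directions that
leave `L_J`; it is attached to the first element of `J` that occurs in the expansion of `f i`. -/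
theorem exists_limit_covectors [Finite ι] (he : IsDualTo f J hJ e) {x : E}
    (hx : GenericIn f J x) {v : Fin q → E} (hv : ∀ a, v a ∈ inter (kers f) J) :
    ∃ c : ι → ((Fin q ⊕ Fin k → ℂ) →L[ℂ] ℂ),
      (∀ᶠ t in 𝓝[≠] (0 : ℂ), residuePath x e t ∈ offHyp f) ∧
      (∀ i, Filter.Tendsto (fun t => (dlogVec (f i) (residuePath x e t)).comp
        (residueFrame v e t)) (𝓝[≠] 0) (𝓝 (c i))) ∧
      (∀ i s, c i (Pi.single (Sum.inr s) 1) ≠ 0 →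
        (∀ s', s' ≠ s → c i (Pi.single (Sum.inr s') 1) = 0) ∧
        inter (kers f) J ≤ kers f i ∧ f i (e s) ≠ 0 ∧ ∀ s' < s, f i (e s') = 0) ∧
      ∀ s, c (J.orderEmbOfFin hJ s) = ContinuousLinearMap.proj (Sum.inr s) := by
  have h : ∀ i, f i ≠ 0 → f i x ≠ 0 ∨
      (f i x = 0 ∧ (∀ a, f i (v a) = 0) ∧ ∃ s, f i (e s) ≠ 0) := by
    intro i hi
    refine (hx.2 i hi).imp_right fun hle => ⟨hle hx.1, fun a => hle (hv a), ?_⟩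
    by_contra! h0
    refine hi (ContinuousLinearMap.ext fun w => ?_)
    rw [he.expand hle]
    simp [h0]
  choose c hc1 hc2 hc3 using fun i => exists_tendsto_dlogVec (f i) x v e (h i)
  refine ⟨c, ?_, hc2, fun i s hs => ?_, fun s => ?_⟩
  · simpa [offHyp] using (Filter.eventually_all (ι := ι)).2 hc1
  · rcases hc3 i with ⟨s₀, h1, h2, h3, h4⟩ | ⟨-, h0⟩
    · have h5 : s = s₀ := by
        by_contra hne
        refine hs ?_
        rw [h4]
        simp [Ne.symm hne]
      subst h5
      refine ⟨fun s' hs' => ?_, (hx.2 i ?_).resolve_left (not_not.2 h3), h2, h1⟩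
      · rw [h4]
        simp [Ne.symm hs']
      · intro h0
        rw [h0] at h2
        exact h2 rfl
    · exact absurd (h0 s) hs
  · rcases hc3 (J.orderEmbOfFin hJ s) with ⟨s₀, h1, h2, h3, h4⟩ | ⟨h0, -⟩
    · rw [he s s₀] at h2
      have h5 : s = s₀ := by
        by_contra hne
        exact h2 (if_neg hne)
      rw [h4, h5]
    · exfalso
      rcases h0 with h0 | h0
      · exact h0 (mem_inter.1 hx.1 _ (J.orderEmbOfFin_mem hJ s))
      · have := he s s
        rw [h0, if_pos rfl] at this
        simp at this

/-- Near any point of `L_J` there are generic points of `L_J`. -/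
theorem exists_generic_direction [Finite ι] (f : ι → (E →L[ℂ] ℂ)) (J : Finset ι) :
    ∃ g ∈ inter (kers f) J, ∀ x ∈ inter (kers f) J,
      ∀ᶠ t in 𝓝[≠] (0 : ℂ), GenericIn f J (x + t • g) := by
  obtain ⟨g, hg, hg'⟩ := Module.Dual.exists_forall_mem_ne_zero_of_forall_exists
    (ι := {i // ¬ inter (kers f) J ≤ kers f i}) (K := ℂ) (inter (kers f) J)
    (fun i => ((f i : E →L[ℂ] ℂ) : E →ₗ[ℂ] ℂ)) fun i => by
      obtain ⟨v, hv, hv'⟩ := SetLike.not_le_iff_exists.1 i.2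
      exact ⟨v, hv, hv'⟩
  refine ⟨g, hg, fun x hx => ?_⟩
  have h1 : ∀ i, ∀ᶠ t in 𝓝[≠] (0 : ℂ), f i ≠ 0 →
      f i (x + t • g) ≠ 0 ∨ inter (kers f) J ≤ kers f i := by
    intro i
    by_cases hi : inter (kers f) J ≤ kers f i
    · exact Filter.Eventually.of_forall fun _ _ => Or.inr hi
    · have hgi : f i g ≠ 0 := hg' ⟨i, hi⟩
      by_cases hxi : f i x = 0
      · filter_upwards [self_mem_nhdsWithin] with t ht _
        left
        rw [map_add, hxi, zero_add, map_smul, smul_eq_mul]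
        exact mul_ne_zero ht hgi
      · have hc : Continuous fun t : ℂ => f i (x + t • g) := by fun_prop
        have := (hc.tendsto 0).mono_left (nhdsWithin_le_nhds (s := ({0}ᶜ : Set ℂ)))
        rw [zero_smul, add_zero] at this
        filter_upwards [this.eventually_ne hxi] with t ht _
        exact Or.inl ht
  filter_upwards [(Filter.eventually_all (ι := ι)).2 h1] with t ht
  exact ⟨add_mem hx (Submodule.smul_mem _ t hg), ht⟩

/-- The basis of the space `Fin q ⊕ Fin k → ℂ`. -/
def sumBasis (q k : ℕ) (j : Fin (q + k)) : Fin q ⊕ Fin k → ℂ := Pi.single (finSumFinEquiv.symm j) 1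

theorem sumBasis_natAdd (q k : ℕ) (s : Fin k) :
    sumBasis q k (Fin.natAdd q s) = Pi.single (Sum.inr s) 1 := by
  rw [sumBasis, finSumFinEquiv_symm_apply_natAdd]

/-- Forms with fewer than `k` poles have no residue along the stratum `L_J` of codimension `k`. -/
theorem tendsto_zero_of_mem_logSpan [Finite ι] (he : IsDualTo f J hJ e) {A : Set E}
    {ζ : E → Alt E (q + k)} (h : ζ ∈ logSpan f A k (q + k)) :
    ∀ᶠ x in 𝓝ˢ A, GenericIn f J x → ∀ v : Fin q → E, (∀ a, v a ∈ inter (kers f) J) →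
      Filter.Tendsto (fun t => pull (ζ (residuePath x e t)) (residueFrame v e t) (sumBasis q k))
        (𝓝[≠] 0) (𝓝 0) := by
  refine logSpan_induction (P := fun ζ => ∀ᶠ x in 𝓝ˢ A, GenericIn f J x → ∀ v : Fin q → E,
    (∀ a, v a ∈ inter (kers f) J) → Filter.Tendsto (fun t => pull (ζ (residuePath x e t))
      (residueFrame v e t) (sumBasis q k)) (𝓝[≠] 0) (𝓝 0)) ?_ ?_ ?_ ?_ ?_ h
  · intro I q' η hI hp hη
    have h1 : ∀ᶠ x in 𝓝ˢ A, ContinuousAt η x := eventually_nhdsSet_iff_forall.2 fun a ha =>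
      (hη a ha).eventually_analyticAt.mono fun _ h => h.continuousAt
    filter_upwards [h1] with x hx hgen v hv
    obtain ⟨c, -, hc, hlead, -⟩ := exists_limit_covectors he hgen hv
    -- Each of the fewer than `k` elements of `I` sees at most one of the `k` directions.
    obtain ⟨s, hs⟩ : ∃ s : Fin k, ∀ i ∈ I, c i (Pi.single (Sum.inr s) 1) = 0 := by
      by_contra! hall
      choose i hiI hi using hall
      have hinj : Function.Injective i := by
        intro s s' hss
        by_contra hne
        exact hi s' (by rw [← hss]; exact (hlead _ _ (hi s)).1 s' (Ne.symm hne))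
      have h2 := Finset.card_le_card (s := Finset.univ.image i) (t := I) fun a ha => by
        obtain ⟨s, -, rfl⟩ := Finset.mem_image.1 ha
        exact hiI s
      rw [Finset.card_image_of_injective _ hinj, Finset.card_univ, Fintype.card_fin] at h2
      omega
    exact tendsto_logMon_zero hp hx hc hs (sumBasis_natAdd q k s)
  · exact Filter.Eventually.of_forall fun x _ v _ => tendsto_const_nhds
  · intro a b ha hb
    filter_upwards [ha, hb] with x hx hx' hgen v hv
    simpa using (hx hgen v hv).add (hx' hgen v hv)
  · intro c a ha
    filter_upwards [ha] with x hx hgen v hv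
    simpa using (hx hgen v hv).const_mul c
  · intro ζ ζ' h' hev
    filter_upwards [h', hev.eventually_nhdsSet] with x hx hx' hgen v hv
    refine (hx hgen v hv).congr' ?_
    obtain ⟨c, hoff, -⟩ := exists_limit_covectors he hgen hv
    filter_upwards [hoff, (tendsto_residuePath x e).eventually hx'] with t ht ht'
    rw [ht' ht]

/-- The forms `η_J ∧ ω_J`, for the sets `J` of cardinality `k` without broken circuits, are
linearly independent modulo forms with fewer than `k` poles, in the following sense. -/
theorem pull_eq_zero_of_sum_mem [Finite ι] {A : Set E} {N : Finset (Finset ι)}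
    {η : Finset ι → E → Alt E q} (hcard : ∀ J ∈ N, J.card = k)
    (hind : ∀ J ∈ N, Indep (kers f) J) (hnb : ∀ J ∈ N, NoBrokenForms f J)
    (hη : ∀ J ∈ N, AnalyticOnNhd ℂ (η J) A)
    (h : ∑ J ∈ N, logMon f q (q + k) J (η J) ∈ logSpan f A k (q + k)) {J : Finset ι}
    (hJN : J ∈ N) : ∀ᶠ x in 𝓝ˢ A, x ∈ inter (kers f) J →
      pull (η J x) (inter (kers f) J).subtypeL = 0 := by
  have hJ := hcard J hJN
  obtain ⟨e, he⟩ := exists_isDualTo hJ (hind J hJN)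
  have h1 : ∀ᶠ x in 𝓝ˢ A, ∀ I ∈ N, ContinuousAt (η I) x :=
    (Finset.eventually_all N).2 fun I hI => eventually_nhdsSet_iff_forall.2 fun a ha =>
      (hη I hI a ha).eventually_analyticAt.mono fun _ h => h.continuousAt
  -- At generic points only the monomial of `J` has a limit that is not zero.
  have h2 : ∀ᶠ x in 𝓝ˢ A, GenericIn f J x →
      pull (η J x) (inter (kers f) J).subtypeL = 0 := by
    filter_upwards [h1, tendsto_zero_of_mem_logSpan he h] with x hx hx' hgen
    ext v
    set v' : Fin q → E := fun a => v a
    have hv : ∀ a, v' a ∈ inter (kers f) J := fun a => (v a).2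
    obtain ⟨c, -, hc, hlead, hcJ⟩ := exists_limit_covectors he hgen hv
    have h3 : ∀ I ∈ N, Filter.Tendsto (fun t => pull (logMon f q (q + k) I (η I)
        (residuePath x e t)) (residueFrame v' e t) (sumBasis q k)) (𝓝[≠] 0)
          (𝓝 (if I = J then η J x v' else 0)) := by
      intro I hI
      split_ifs with hIJ
      · subst hIJ
        have h4 := tendsto_logMon hJ (hx I hI) hc
        have h5 := ((ContinuousAlternatingMap.apply ℂ (Fin q ⊕ Fin k → ℂ) ℂ
          (sumBasis q k)).continuous.tendsto _).comp h4
        have h6 : ContinuousAlternatingMap.apply ℂ (Fin q ⊕ Fin k → ℂ) ℂ (sumBasis q k)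
            (wedgeTuple (pull (η I x) (residueFrame v' e 0)) k
              fun s => c (I.orderEmbOfFin hJ s)) = η I x v' := by
          refine (wedgeTuple_apply_of_dual _ k fun s j => ?_).trans ?_
          · rw [hcJ]
            simp only [sumBasis, ContinuousLinearMap.proj_apply, Pi.single_apply]
            refine if_congr ?_ rfl rfl
            rw [Equiv.eq_symm_apply, eq_comm]
            rfl
          · change η I x (fun a => residueFrame v' e 0 (sumBasis q k (Fin.castAdd k a))) = _
            congr 1
            funext a
            rw [sumBasis, finSumFinEquiv_symm_apply_castAdd, residueFrame_inl]
        rw [h6] at h5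
        exact h5
      · obtain ⟨s, hs⟩ : ∃ s : Fin k, ∀ i ∈ I, c i (Pi.single (Sum.inr s) 1) = 0 := by
          by_contra! hall
          refine hIJ (eq_of_leading he (hnb J hJN) (hcard I hI) (hnb I hI) fun s => ?_)
          obtain ⟨i, hi, hne⟩ := hall s
          exact ⟨i, hi, (hlead i s hne).2⟩
        exact tendsto_logMon_zero (by rw [hcard I hI]) (hx I hI) hc hs (sumBasis_natAdd q k s)
    have h4 := tendsto_finsetSum N h3
    rw [Finset.sum_ite_eq' N J, if_pos hJN] at h4
    refine tendsto_nhds_unique h4 ((hx' hgen v' hv).congr fun t => ?_)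
    rw [Finset.sum_apply, ← ContinuousAlternatingMap.sum_apply]
    congr 1
    exact map_sum (ContinuousAlternatingMap.compContinuousLinearMapCLM (residueFrame v' e t)) _ _
  -- The other points are limits of generic points.
  obtain ⟨g, hg, hg'⟩ := exists_generic_direction f J
  filter_upwards [h1, h2.eventually_nhdsSet] with x hx hx' hxJ
  have hline : Filter.Tendsto (fun t : ℂ => x + t • g) (𝓝[≠] 0) (𝓝 x) := by
    have hc : Continuous fun t : ℂ => x + t • g := by fun_prop
    have := (hc.tendsto 0).mono_left (nhdsWithin_le_nhds (s := ({0}ᶜ : Set ℂ)))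
    rwa [zero_smul, add_zero] at this
  have h5 : Filter.Tendsto (fun t : ℂ => pull (η J (x + t • g)) (inter (kers f) J).subtypeL)
      (𝓝[≠] 0) (𝓝 (pull (η J x) (inter (kers f) J).subtypeL)) :=
    tendsto_pull ((hx J hJN).tendsto.comp hline) tendsto_const_nhds
  refine tendsto_nhds_unique h5 (tendsto_const_nhds.congr' ?_)
  filter_upwards [hg' x hxJ, hline.eventually hx'] with t ht ht'
  exact (ht' ht).symm

end Leading

/-! ### Isomorphisms of shifted complexes -/

section Complexes

universe v₁ u₁

variable {C : Type u₁} [Category.{v₁} C] [Preadditive C] [Limits.HasZeroObject C]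

/-- Morphisms out of a shifted complex are determined by their components in the degrees `q + k`. -/
theorem hom_extend_ext {k : ℕ} {K L : CochainComplex C ℕ} {Φ Φ' : K.extend (shiftBy k) ⟶ L}
    (h : ∀ q, (K.extendXIso (shiftBy k) (i := q) rfl).inv ≫ Φ.f (q + k) =
      (K.extendXIso (shiftBy k) (i := q) rfl).inv ≫ Φ'.f (q + k)) : Φ = Φ' := by
  ext p
  by_cases hp : k ≤ p
  · obtain ⟨q, rfl⟩ := Nat.exists_eq_add_of_le' hp
    exact (Iso.cancel_iso_inv_left _ _ _).1 (h q)
  · refine (K.isZero_extend_X (shiftBy k) p fun q hq => ?_).eq_of_src _ _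
    change q + k = p at hq
    omega

/-- Isomorphisms `K^q ≅ L^{q + k}` that commute with the differentials form an isomorphism of the
shifted complex with `L`, if `L` is zero in degrees `< k`. -/
theorem exists_iso_extend {k : ℕ} {K L : CochainComplex C ℕ}
    (Ψ : ∀ q p, q + k = p → (K.X q ≅ L.X p))
    (hd : ∀ q p (h : q + k = p), (Ψ q p h).hom ≫ L.d p (p + 1) =
      K.d q (q + 1) ≫ (Ψ (q + 1) (p + 1) (by omega)).hom)
    (h0 : ∀ p < k, Limits.IsZero (L.X p)) :
    ∃ Φ : K.extend (shiftBy k) ≅ L, ∀ q,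
      (K.extendXIso (shiftBy k) (i := q) rfl).inv ≫ Φ.hom.f (q + k) = (Ψ q (q + k) rfl).hom := by
  classical
  have hz : ∀ p, ¬ k ≤ p → Limits.IsZero ((K.extend (shiftBy k)).X p) := fun p hp =>
    K.isZero_extend_X (shiftBy k) p fun q hq => by
      change q + k = p at hq
      omega
  let F : ∀ p, (K.extend (shiftBy k)).X p ≅ L.X p := fun p =>
    if hp : k ≤ p then
      K.extendXIso (shiftBy k) (i := p - k) (i' := p) (Nat.sub_add_cancel hp) ≪≫
        Ψ (p - k) p (Nat.sub_add_cancel hp)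
    else (hz p hp).iso (h0 p (not_le.1 hp))
  have hF : ∀ q p (h : (shiftBy k).f q = p), F p = K.extendXIso (shiftBy k) (i := q) (i' := p) h ≪≫
      Ψ q p h := by
    intro q p h
    have h : q + k = p := h
    have hp : k ≤ p := by omega
    obtain rfl : q = p - k := by omega
    exact dif_pos hp
  refine ⟨HomologicalComplex.Hom.isoOfComponents F fun p p' hpp => ?_, fun q => ?_⟩
  · obtain rfl : p + 1 = p' := hpp
    by_cases hp : k ≤ p
    · obtain ⟨q, hq⟩ := Nat.exists_eq_add_of_le' hp
      have h1 : (shiftBy k).f q = p := hq.symm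
      have h2 : (shiftBy k).f (q + 1) = p + 1 := by change q + 1 + k = p + 1; omega
      rw [hF q p h1, hF (q + 1) (p + 1) h2, K.extend_d_eq (shiftBy k) h1 h2]
      simp only [Iso.trans_hom, Category.assoc, Iso.inv_hom_id_assoc]
      exact congrArg (fun x => (K.extendXIso (shiftBy k) h1).hom ≫ x) (hd q p h1)
    · exact (hz p hp).eq_of_src _ _
  · change _ ≫ (F (q + k)).hom = _
    exact (congrArg (fun e : _ ≅ _ => (K.extendXIso (shiftBy k) (i := q) rfl).inv ≫ e.hom)
      (hF q (q + k) rfl)).trans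
      (Iso.inv_hom_id_assoc _ _)

end Complexes

/-! ### The residue map on one stratum -/

section Strata

variable {E' : Type} [AddCommGroup E'] [Module ℂ E'] {κ : Type} [LinearOrder κ]
  {H : κ → Submodule ℂ E'} {T : Submodule ℂ E'}

/-- A property of the elements of `M ⊗ A_S` may be checked on the elements `m ⊗ e_I`, for `I`
independent. -/
theorem TensQ.osPart_induction {M : Type u} [AddCommGroup M] [Module ℂ M]
    [FiniteDimensional ℂ E'] (hH : IsKer H) {P : TensQ M (osPart H T) → Prop} (zero : P 0)
    (add : ∀ x y, P x → P y → P (x + y))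
    (gen : ∀ m I (hI : inter H I = T), codim T = I.card → P (TensQ.tmul m (osGen H I hI)))
    (x : TensQ M (osPart H T)) : P x := by
  have h1 : ∀ a : OS H, a ∈ osPart H T → ∀ (ha : a ∈ osPart H T) (m : M),
      P (TensQ.tmul m ⟨a, ha⟩) := by
    intro a ha
    induction ha using Submodule.span_induction with
    | mem a ha =>
      obtain ⟨I, hI, rfl⟩ := ha
      intro ha m
      by_cases hc : codim T = I.card
      · exact gen m I hI hc
      · have h0 : osMonomial H I = 0 := osMonomial_eq_zero (by
          have := codim_inter_le hH I
          rw [hI] at this ⊢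
          omega)
        have h1 : (⟨osMonomial H I, ha⟩ : osPart H T) = 0 := Subtype.ext h0
        rw [h1]
        convert zero
        have := TensQ.tmul_smul_right (0 : ℚ) m (0 : osPart H T)
        rw [zero_smul] at this
        rw [this, Rat.cast_zero, zero_smul, TensQ.tmul_zero_left]
    | zero =>
      intro ha m
      convert zero
      have := TensQ.tmul_smul_right (0 : ℚ) m (0 : osPart H T)
      rw [zero_smul] at this
      refine Eq.trans this ?_
      rw [Rat.cast_zero, zero_smul, TensQ.tmul_zero_left]
    | add a b ha' hb' iha ihb =>
      intro ha m
      have := TensQ.tmul_sum_right (Finset.univ : Finset Bool) m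
        (fun c => if c then (⟨a, ha'⟩ : osPart H T) else ⟨b, hb'⟩)
      simp only [Fintype.sum_bool, if_true] at this
      exact (congrArg P this).mpr (add _ _ (iha ha' m) (ihb hb' m))
    | smul c a ha' iha =>
      intro ha m
      have := TensQ.tmul_smul_right c m (⟨a, ha'⟩ : osPart H T)
      exact (congrArg P this).mpr (iha ha' _)
  obtain ⟨m, rfl⟩ | h := em (∃ m : M, x = TensQ.tmul m 0)
  · exact h1 0 (zero_mem _) (zero_mem _) m
  clear h
  induction x using TensorProduct.induction_on with
  | zero => exact zero
  | add x y hx hy => exact add x y hx hy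
  | tmul m z =>
    induction z using TensorProduct.induction_on with
    | zero => rw [TensorProduct.tmul_zero]; exact zero
    | add z z' hz hz' => rw [TensorProduct.tmul_add]; exact add _ _ hz hz'
    | tmul c a =>
      have : m ⊗ₜ[ℂ] (c ⊗ₜ[ℚ] a) = TensQ.tmul (c • m) a := by
        rw [TensQ.tmul, TensorProduct.smul_tmul, TensorProduct.smul_tmul', smul_eq_mul, mul_one]
      rw [this]
      exact h1 a.1 a.2 a.2 _

theorem TensQ.mem_of_osGen {M : Type u} [AddCommGroup M] [Module ℂ M]
    [FiniteDimensional ℂ E'] (hH : IsKer H) (N : Submodule ℂ (TensQ M (osPart H T)))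
    (gen : ∀ m I (hI : inter H I = T), codim T = I.card → TensQ.tmul m (osGen H I hI) ∈ N)
    (x : TensQ M (osPart H T)) : x ∈ N :=
  TensQ.osPart_induction hH (P := (· ∈ N)) (zero_mem _) (fun _ _ => add_mem) gen x

variable {E : Type} [NormedAddCommGroup E] [NormedSpace ℂ E] {ι : Type} [LinearOrder ι]
  {f : ι → (E →L[ℂ] ℂ)} {A : Set E} {k p q : ℕ}

/-- The class of a form modulo forms with fewer than `k` poles. -/
abbrev logMk (f : ι → (E →L[ℂ] ℂ)) (A : Set E) (k p : ℕ) :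
    (E → Alt E p) →ₗ[ℂ] (E → Alt E p) ⧸ logSpan f A k p := (logSpan f A k p).mkQ

theorem logMk_eq_zero {ζ : E → Alt E p} : logMk f A k p ζ = 0 ↔ ζ ∈ logSpan f A k p :=
  Submodule.Quotient.mk_eq_zero _

/-- The map `m ⊗ e_I ↦ n ∧ ω_I` on one stratum, with values modulo forms with fewer poles. Here
`Rep m n` says that the form `n` on the ambient space represents `m`. The map is well defined
because the Orlik-Solomon relations hold between the forms `ω_I` and because the choice of the
representative does not matter. -/
theorem exists_logMap {M : Type u} [AddCommGroup M] [Module ℂ M]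
    {Rep : M → (E → Alt E q) → Prop} (g : κ → (E →L[ℂ] ℂ))
    (hOS : ∀ I : Finset κ, codim (inter H I) < I.card → ∀ y ∈ offHyp f,
      extEval (fun i => dlogVec (g i) y) (extDelta I) = 0)
    (hex : ∀ m, ∃ n, Rep m n) (hadd : ∀ m n m' n', Rep m n → Rep m' n' → Rep (m + m') (n + n'))
    (hsmul : ∀ (c : ℂ) m n, Rep m n → Rep (c • m) (c • n))
    (h0 : ∀ n, Rep 0 n → ∀ I, inter H I = T → logMon g q p I n ∈ logSpan f A k p) :
    ∃ B : TensQ M (osPart H T) →ₗ[ℂ] (E → Alt E p) ⧸ logSpan f A k p,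
      ∀ m n I (hI : inter H I = T), Rep m n →
        B (TensQ.tmul m (osGen H I hI)) = logMk f A k p (logMon g q p I n) := by
  -- `F z n` is the product of the form `n` with the image of `z`. Its class depends only on the
  -- class of `z` in the Orlik-Solomon algebra (`F_congr`) and on the element that `n` represents
  -- (`F_rep`).
  let F : ExtAlg κ → (E → Alt E q) → (E → Alt E p) := fun z n y =>
    wedgeExt q p (extEval (fun i => dlogVec (g i) y) z) (n y)
  have F_add : ∀ z n n', F z (n + n') = F z n + F z n' := fun z n n' => funext fun y =>
    map_add _ _ _
  have F_smul : ∀ z (c : ℂ) n, F z (c • n) = c • F z n := fun z c n => funext fun y =>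
    (wedgeExt q p _).map_smul c (n y)
  have F_add' : ∀ z z' n, F (z + z') n = F z n + F z' n := fun z z' n => funext fun y => by
    change wedgeExt q p (extEval _ (z + z')) (n y) = _
    rw [map_add, map_add]
    rfl
  have F_ratsmul : ∀ (c : ℚ) z n, F (c • z) n = (c : ℂ) • F z n := fun c z n => funext fun y => by
    have h : ∀ w : ExteriorAlgebra ℂ (E →L[ℂ] ℂ), c • w = (c : ℂ) • w := fun w => by
      rw [← algebraMap_smul ℂ c w]
      rfl
    change wedgeExt q p (extEval _ (c • z)) (n y) = (c : ℂ) • wedgeExt q p (extEval _ z) (n y)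
    rw [map_smul, h, map_smul]
    rfl
  have F_ideal : ∀ z ∈ osIdeal H, ∀ n, F z n ∈ logSpan f A k p := by
    intro z hz n
    refine logSpan_congr (zero_mem _) (Filter.Eventually.of_forall fun y hy => ?_)
    have h : extEval (fun i => dlogVec (g i) y) z = 0 := by
      induction hz using Submodule.span_induction with
      | mem z hz =>
        obtain ⟨a, b, I, hI, rfl⟩ := hz
        rw [map_mul, map_mul, hOS I hI y hy, mul_zero, zero_mul]
      | zero => exact map_zero _
      | add a b _ _ ha hb => rw [map_add, ha, hb, add_zero]
      | smul c a _ ha => rw [map_smul, ha, smul_zero]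
    change wedgeExt q p (extEval _ z) (n y) = 0
    rw [h, map_zero]
    rfl
  have F_congr : ∀ z z', (osIdeal H).mkQ z = (osIdeal H).mkQ z' → ∀ n,
      logMk f A k p (F z n) = logMk f A k p (F z' n) := by
    intro z z' h n
    have h1 : z - z' ∈ osIdeal H := (Submodule.Quotient.eq _).1 h
    have h2 : F z n = F (z - z') n + F z' n := by rw [← F_add', sub_add_cancel]
    rw [h2, map_add, logMk_eq_zero.2 (F_ideal _ h1 n), zero_add]
  choose lift hlift using (osIdeal H).mkQ_surjective
  have F_part : ∀ a ∈ osPart H T, ∀ n, Rep 0 n → logMk f A k p (F (lift a) n) = 0 := by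
    intro a ha n hn
    induction ha using Submodule.span_induction with
    | mem a ha =>
      obtain ⟨I, hI, rfl⟩ := ha
      rw [F_congr (lift (osMonomial H I)) (extMonomial I) (hlift _)]
      exact logMk_eq_zero.2 (h0 n hn I hI)
    | zero => exact logMk_eq_zero.2 (F_ideal _ ((Submodule.Quotient.mk_eq_zero _).1 (hlift 0)) n)
    | add a b _ _ ha hb =>
      rw [F_congr _ (lift a + lift b) (by rw [map_add, hlift, hlift, hlift]), F_add', map_add, ha,
        hb, add_zero]
    | smul c a _ ha =>
      rw [F_congr _ (c • lift a) (by rw [map_smul, hlift, hlift]), F_ratsmul, map_smul, ha,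
        smul_zero]
  have F_rep : ∀ a ∈ osPart H T, ∀ m n n', Rep m n → Rep m n' →
      logMk f A k p (F (lift a) n) = logMk f A k p (F (lift a) n') := by
    intro a ha m n n' hn hn'
    have h1 := F_part a ha (n + (-1 : ℂ) • n') (by
      have := hadd _ _ _ _ hn (hsmul (-1) _ _ hn')
      rwa [neg_one_smul, add_neg_cancel] at this)
    rw [F_add, F_smul, map_add, map_smul, neg_one_smul, add_neg_eq_zero] at h1
    exact h1
  choose n hn using hex
  obtain ⟨B, hB⟩ := TensQ.exists_lift (M := M) (A := osPart H T)
    (Q := (E → Alt E p) ⧸ logSpan f A k p)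
    { toFun := fun a =>
        { toFun := fun m => logMk f A k p (F (lift a.1) (n m))
          map_add' := fun m m' => by
            rw [← map_add, ← F_add]
            exact F_rep a.1 a.2 _ _ _ (hn _) (hadd _ _ _ _ (hn m) (hn m'))
          map_smul' := fun c m => by
            rw [RingHom.id_apply, ← map_smul, ← F_smul]
            exact F_rep a.1 a.2 _ _ _ (hn _) (hsmul _ _ _ (hn m)) }
      map_zero' := LinearMap.ext fun m => logMk_eq_zero.2
        (F_ideal _ ((Submodule.Quotient.mk_eq_zero _).1 (hlift 0)) _)
      map_add' := fun a b => LinearMap.ext fun m => by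
        change logMk f A k p (F (lift (a.1 + b.1)) (n m)) =
          logMk f A k p (F (lift a.1) (n m)) + logMk f A k p (F (lift b.1) (n m))
        rw [F_congr _ (lift a.1 + lift b.1) (by rw [map_add, hlift, hlift, hlift]), F_add',
          map_add] }
  refine ⟨B, fun m n' I hI h => ?_⟩
  rw [hB]
  exact (F_rep _ (osGen H I hI).2 m _ n' (hn m) h).trans
    (F_congr _ (extMonomial I) (hlift _) n')

end Strata

/-! ### Further properties of logarithmic monomials -/

section Monomials

variable {E : Type} [NormedAddCommGroup E] [NormedSpace ℂ E] {ι : Type} [LinearOrder ι]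
  {f : ι → (E →L[ℂ] ℂ)} {A : Set E} {k p q : ℕ}

theorem extMonomial_insert_max {j : ι} {I : Finset ι} (h : ∀ i ∈ I, i < j) :
    extMonomial (insert j I) = extMonomial I * extGen j := by
  have h1 : insert j I = I ∪ {j} := by
    rw [Finset.union_comm]; rfl
  have h2 : extMonomial ({j} : Finset ι) = extGen j := by
    have := extMonomial_insert_min (a := j) (I := ∅) (by simp)
    rwa [extMonomial_empty, mul_one] at this
  rw [h1, extMonomial_union (by simpa using h), h2]

theorem wedgeExt_extMonomial_insert_max (θ : ι → (E →L[ℂ] ℂ)) {j : ι} {I : Finset ι}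
    (h : ∀ i ∈ I, i < j) (ξ : Alt E q) :
    wedgeExt q (p + 1) (extEval θ (extMonomial (insert j I))) ξ =
      wedgeOne (wedgeExt q p (extEval θ (extMonomial I)) ξ) (θ j) := by
  rw [extMonomial_insert_max h, map_mul, extEval_extGen, wedgeExt_mul_ι]

theorem logMon_insert_max {j : ι} {I : Finset ι} (h : ∀ i ∈ I, i < j) (η : E → Alt E q) :
    logMon f q (p + 1) (insert j I) η =
      fun y => wedgeOne (logMon f q p I η y) (dlogVec (f j) y) :=
  funext fun y => wedgeExt_extMonomial_insert_max (fun i => dlogVec (f i) y) h (η y)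

theorem logMon_empty (η : E → Alt E q) : logMon f q q ∅ η = η := by
  funext y
  rw [logMon, extMonomial_empty, map_one, wedgeExt_one]

/-- The forms `ω_i` are closed. -/
theorem extDeriv_logMon {η : E → Alt E q} {y : E} (hη : AnalyticAt ℂ η y) {I : Finset ι}
    (h0 : ∀ i ∈ I, f i y ≠ 0) (hp : q + I.card = p) :
    AnalyticAt ℂ (logMon f q p I η) y ∧
      extDeriv (logMon f q p I η) y = logMon f (q + 1) (p + 1) I (extDeriv η) y := by
  induction I using Finset.induction_on_max generalizing p with
  | empty =>
    obtain rfl : q = p := hp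
    rw [logMon_empty, logMon_empty]
    exact ⟨hη, rfl⟩
  | insert j I hj ih =>
    rw [Finset.card_insert_of_notMem fun h => lt_irrefl _ (hj j h)] at hp
    obtain ⟨p, rfl⟩ : ∃ p', p = p' + 1 := ⟨q + I.card, hp.symm⟩
    obtain ⟨h1, h2⟩ := ih (fun i hi => h0 i (Finset.mem_insert_of_mem hi)) (p := p) (by omega)
    have hj0 := h0 j (Finset.mem_insert_self j I)
    rw [logMon_insert_max hj, logMon_insert_max hj]
    refine ⟨analyticAt_wedgeOne h1 (analyticAt_dlogVec ((f j).analyticAt y) hj0), ?_⟩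
    rw [extDeriv_wedgeOne_dlogVec h1 ((f j).analyticAt y) hj0, h2]

/-- Version of `logMon_mem_of_vanish` for sets that may be dependent. -/
theorem logMon_mem_of_vanish_of_codim [FiniteDimensional ℂ E] (hA : ProjStable f A)
    {I : Finset ι} (hI : codim (inter (kers f) I) = k) (hp : q + k = p) {η : E → Alt E q}
    (hη : AnalyticOnNhd ℂ η A)
    (h0 : ∀ᶠ y in 𝓝ˢ A, y ∈ inter (kers f) I →
      pull (η y) (inter (kers f) I).subtypeL = 0) :
    logMon f q p I η ∈ logSpan f A k p := by
  by_cases hind : Indep (kers f) I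
  · refine logMon_mem_of_vanish hA ?_ hp hind hη h0
    rw [← (codim_inter_eq_iff (isKer_kers f) I).2 hind, hI]
  · refine logSpan_congr (zero_mem _) (Filter.Eventually.of_forall fun y hy => ?_)
    rw [logMon, extEval_dlogVec_eq_zero hy hind, map_zero]
    rfl

/-- Version of `pull_eq_zero_of_sum_mem` for an indexed family of sets. -/
theorem pull_eq_zero_of_sum_mem_of_injective [Finite ι] {Z : Type*} [Fintype Z] {ψ : Z → Finset ι}
    (hψ : Function.Injective ψ) {η : Z → E → Alt E q} (hcard : ∀ z, (ψ z).card = k)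
    (hind : ∀ z, Indep (kers f) (ψ z)) (hnb : ∀ z, NoBrokenForms f (ψ z))
    (hη : ∀ z, AnalyticOnNhd ℂ (η z) A)
    (h : ∑ z, logMon f q (q + k) (ψ z) (η z) ∈ logSpan f A k (q + k)) (z : Z) :
    ∀ᶠ x in 𝓝ˢ A, x ∈ inter (kers f) (ψ z) →
      pull (η z x) (inter (kers f) (ψ z)).subtypeL = 0 := by
  classical
  have hext := fun z => hψ.extend_apply η (0 : Finset ι → E → Alt E q) z
  have h1 := pull_eq_zero_of_sum_mem (f := f) (A := A) (N := Finset.univ.image ψ) (k := k)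
    (η := Function.extend ψ η 0) (by simpa using hcard) (by simpa using hind)
    (by simpa using hnb) (by simpa [hext] using hη) (by
      rw [Finset.sum_image fun _ _ _ _ h => hψ h]
      simpa only [hext] using h) (Finset.mem_image_of_mem ψ (Finset.mem_univ z))
  rwa [hext] at h1

end Monomials

/-! ### Linear relations that are graphs of isomorphisms -/

/-- A linear relation is the graph of an isomorphism if both its projections are bijective. -/
theorem exists_equiv_of_relation {M : Type u} {N : Type v} [AddCommGroup M] [Module ℂ M]
    [AddCommGroup N] [Module ℂ N] (R : Submodule ℂ (M × N)) (h1 : ∀ m, ∃ n, (m, n) ∈ R)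
    (h2 : ∀ n, ∃ m, (m, n) ∈ R) (h3 : ∀ n, (0, n) ∈ R → n = 0) (h4 : ∀ m, (m, 0) ∈ R → m = 0) :
    ∃ Ψ : M ≃ₗ[ℂ] N, ∀ m n, (m, n) ∈ R → Ψ m = n := by
  have b1 : Function.Bijective (LinearMap.fst ℂ M N ∘ₗ R.subtype) := by
    constructor
    · rw [injective_iff_map_eq_zero]
      rintro ⟨⟨m, n⟩, hmn⟩ h
      obtain rfl : m = 0 := h
      exact Subtype.ext (Prod.ext rfl (h3 n hmn))
    · intro m
      obtain ⟨n, hn⟩ := h1 m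
      exact ⟨⟨_, hn⟩, rfl⟩
  have b2 : Function.Bijective (LinearMap.snd ℂ M N ∘ₗ R.subtype) := by
    constructor
    · rw [injective_iff_map_eq_zero]
      rintro ⟨⟨m, n⟩, hmn⟩ h
      obtain rfl : n = 0 := h
      exact Subtype.ext (Prod.ext (h4 m hmn) rfl)
    · intro n
      obtain ⟨m, hm⟩ := h2 n
      exact ⟨⟨_, hm⟩, rfl⟩
  refine ⟨(LinearEquiv.ofBijective _ b1).symm ≪≫ₗ LinearEquiv.ofBijective _ b2,
    fun m n h => ?_⟩
  have h5 : (LinearEquiv.ofBijective _ b1).symm m = ⟨(m, n), h⟩ :=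
    (LinearEquiv.symm_apply_eq _).2 rfl
  rw [LinearEquiv.trans_apply, h5]
  rfl

/-! ### The local theorem -/

namespace Central

variable {E : Type} [NormedAddCommGroup E] [NormedSpace ℂ E] {l : ℕ} (L : Central E l)
  {k p q : ℕ}

theorem offHyp_eq : offHyp L.f = L.compl := by
  ext y
  exact ⟨fun h i => h i (L.ne_zero i), fun h i _ => h i⟩

theorem isMonomial_logMon {η : E → Alt E q} (hη : η ∈ Hol E q) {I : Finset (Fin l)}
    (hp : q + I.card = p) : L.IsMonomial I p (logMon L.f q p I η) := by
  subst hp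
  have h1 : logMon L.f q (q + I.card) I η = fun x => wedgeTuple (η x) I.card
      fun s => dlogVec (L.f (I.orderEmbOfFin rfl s)) x :=
    funext fun x => logMon_eq_wedgeTuple rfl η x
  rw [h1]
  have := isMonomial_wedgeTuple (L := L) hη I.card (I.orderEmbOfFin rfl)
    (I.orderEmbOfFin rfl).strictMono
  rwa [Finset.image_orderEmbOfFin_univ] at this

variable {L} in
theorem IsMonomial.exists_logMon {I : Finset (Fin l)} {ζ : E → Alt E p}
    (h : L.IsMonomial I p ζ) :
    ∃ (q : ℕ) (η : E → Alt E q), η ∈ Hol E q ∧ q + I.card = p ∧ ζ = logMon L.f q p I η := by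
  induction h with
  | @hol q η hη => exact ⟨q, η, hη, by simp, (logMon_empty η).symm⟩
  | @wedge I p ζ h j hj ih =>
    obtain ⟨q, η, hη, hp, rfl⟩ := ih
    refine ⟨q, η, hη, ?_, (logMon_insert_max hj η).symm⟩
    rw [Finset.card_insert_of_notMem fun h => lt_irrefl _ (hj j h)]
    omega

/-- `W_{k - 1}` consists of the forms with fewer than `k` poles that are extended by zero. -/
theorem mem_W_iff {ζ : E → Alt E p} : ζ ∈ L.W ((k : ℤ) - 1) p ↔
    (∀ x ∉ L.compl, ζ x = 0) ∧ ζ ∈ logSpan L.f Set.univ k p := by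
  constructor
  · intro h
    induction h using Submodule.span_induction with
    | mem ζ h =>
      obtain ⟨I, η, hI, h, rfl⟩ := h
      obtain ⟨q, η, hη, hp, rfl⟩ := h.exists_logMon
      refine ⟨fun x hx => Set.indicator_of_notMem hx _, logSpan_congr
        (logMon_mem (η := η) (by omega) hp fun x _ => hη x) (Filter.Eventually.of_forall ?_)⟩
      intro y hy
      rw [L.offHyp_eq] at hy
      rw [Set.indicator_of_mem hy]
    | zero => exact ⟨fun _ _ => rfl, zero_mem _⟩
    | add a b _ _ ha hb =>
      exact ⟨fun x hx => by rw [Pi.add_apply, ha.1 x hx, hb.1 x hx, add_zero],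
        add_mem ha.2 hb.2⟩
    | smul c a _ ha =>
      exact ⟨fun x hx => by
        rw [Pi.smul_apply, ha.1 x hx]; exact smul_zero (M := ℂ) (A := Alt E p) c,
        Submodule.smul_mem _ c ha.2⟩
  · rintro ⟨h0, h⟩
    have h1 : L.compl.indicator ζ = ζ := by
      refine Set.indicator_eq_self.2 fun x hx => ?_
      by_contra h2
      exact hx (h0 x h2)
    rw [← h1]
    clear h1 h0
    refine logSpan_induction (P := fun ζ => L.compl.indicator ζ ∈ L.W ((k : ℤ) - 1) p)
      ?_ ?_ ?_ ?_ ?_ h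
    · intro I q η hI hp hη
      exact Submodule.subset_span ⟨I, _, by omega,
        L.isMonomial_logMon (fun x => hη x (Set.mem_univ x)) hp, rfl⟩
    · rw [Set.indicator_zero']
      exact zero_mem _
    · intro a b ha hb
      rw [Set.indicator_add']
      exact add_mem ha hb
    · intro c a ha
      have h2 : L.compl.indicator (c • a) = c • L.compl.indicator a := by
        funext x
        by_cases hx : x ∈ L.compl
        · simp [Set.indicator_of_mem hx]
        · simp only [Set.indicator_of_notMem hx, Pi.smul_apply]
          exact (smul_zero (M := ℂ) (A := Alt E p) c).symm
      rw [h2]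
      exact Submodule.smul_mem _ c ha
    · intro ζ ζ' h' he
      convert h' using 1
      funext x
      by_cases hx : x ∈ L.compl
      · rw [Set.indicator_of_mem hx, Set.indicator_of_mem hx]
        rw [nhdsSet_univ] at he
        exact Filter.eventually_top.1 he x (by rwa [L.offHyp_eq])
      · rw [Set.indicator_of_notMem hx, Set.indicator_of_notMem hx]

theorem mem_W_iff' {ζ : E → Alt E p} : ζ ∈ L.W (k : ℤ) p ↔
    (∀ x ∉ L.compl, ζ x = 0) ∧ ζ ∈ logSpan L.f Set.univ (k + 1) p := by
  rw [← mem_W_iff]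
  push_cast
  rw [add_sub_cancel_right]

/-- A form of degree `p` has at most `p` poles. -/
theorem W_le_of_lt (h : p < k) : L.W (k : ℤ) p ≤ L.W ((k : ℤ) - 1) p := by
  refine Submodule.span_le.2 ?_
  rintro _ ⟨I, η, hI, h', rfl⟩
  obtain ⟨q, η, hη, hp, rfl⟩ := h'.exists_logMon
  exact Submodule.subset_span ⟨I, _, by omega, h', rfl⟩

/-- Every holomorphic form on a linear subspace extends to the whole space. -/
theorem exists_res_eq [FiniteDimensional ℂ E] (S : Submodule ℂ E) (η : Hol S q) :
    ∃ η' : Hol E q, Hol.res S η' = η := by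
  obtain ⟨π, hπ⟩ := LinearMap.exists_leftInverse_of_injective S.subtype (by simp)
  let P : E →L[ℂ] S := LinearMap.toContinuousLinearMap π
  let T : Alt S q →L[ℂ] Alt E q := ContinuousAlternatingMap.compContinuousLinearMapCLM P
  have hP : ∀ s : S, P (s : E) = s := fun s => LinearMap.congr_fun hπ s
  refine ⟨⟨fun y => pull (η.1 (P y)) P, fun y =>
    (T.analyticAt _).comp ((η.2 (P y)).comp (P.analyticAt y))⟩, Subtype.ext <| funext fun s => ?_⟩
  ext v
  change η.1 (P (s : E)) (fun i => P (v i : E)) = η.1 s v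
  simp only [hP]

open scoped Classical in
/-- The relation between `η ⊗ e_I` and the class of `(2iπ)^{-k} η̃ ∧ ω_I`, in degree `p = q + k`. -/
def phiRel (k q p : ℕ) : Submodule ℂ (L.GObj k q × L.grObj (k : ℤ) p) :=
  Submodule.span ℂ {z | ∃ (S : L.Stratum k) (I : Finset (Fin l)) (_ : I.card = k)
    (hS : inter L.hyp I = S.1) (η' : Hol E q) (w : L.W (k : ℤ) p),
    w.1 = ((2 * Complex.I * Real.pi : ℂ) ^ k)⁻¹ • L.compl.indicator (logMon L.f q p I η'.1) ∧
    z = (DirectSum.lof ℂ (L.Stratum k) (fun S => TensQ (Hol S.1 q) (osPart L.hyp S.1)) S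
      (TensQ.tmul (Hol.res S.1 η') (osGen L.hyp I hS)), Submodule.Quotient.mk w)}

theorem inv_two_pi_I_pow_ne_zero (k : ℕ) : ((2 * Complex.I * Real.pi : ℂ) ^ k)⁻¹ ≠ 0 := by
  simp [Real.pi_ne_zero]

theorem indicator_logMon_mem {I : Finset (Fin l)} (hI : I.card ≤ k) (hp : q + I.card = p)
    {η : E → Alt E q} (hη : η ∈ Hol E q) :
    L.compl.indicator (logMon L.f q p I η) ∈ L.W (k : ℤ) p :=
  Submodule.subset_span ⟨I, _, by exact_mod_cast hI, L.isMonomial_logMon hη hp, rfl⟩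

theorem grMk_eq_zero {w : L.W (k : ℤ) p} :
    (Submodule.Quotient.mk w : L.grObj (k : ℤ) p) = 0 ↔ w.1 ∈ L.W ((k : ℤ) - 1) p :=
  (Submodule.Quotient.mk_eq_zero _).trans Iff.rfl

variable [FiniteDimensional ℂ E]

/-- Every element of `⨁_S Ω^q(S) ⊗ A_S` is related to a class of forms. -/
theorem exists_phiRel_left (hp : q + k = p) (g : L.GObj k q) : ∃ w, (g, w) ∈ L.phiRel k q p := by
  classical
  induction g using DirectSum.induction_on with
  | zero => exact ⟨0, zero_mem _⟩
  | add g g' h h' =>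
    obtain ⟨w, hw⟩ := h
    obtain ⟨w', hw'⟩ := h'
    exact ⟨w + w', add_mem hw hw'⟩
  | of S x =>
    have h := TensQ.mem_of_osGen (isKer_kers L.f)
      (((L.phiRel k q p).map (LinearMap.fst ℂ _ _)).comap (DirectSum.lof ℂ (L.Stratum k)
        (fun S => TensQ (Hol S.1 q) (osPart L.hyp S.1)) S)) (fun m I hI hc => ?_) x
    · obtain ⟨⟨g, w⟩, h1, h2⟩ := h
      exact ⟨w, (congrArg (fun g => (g, w) ∈ L.phiRel k q p) h2).mp h1⟩
    · obtain ⟨η', rfl⟩ := exists_res_eq S.1 m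
      have hk : I.card = k := by rw [← hc]; exact S.2.2
      exact ⟨_, Submodule.subset_span ⟨S, I, hk, hI, η', ⟨_, Submodule.smul_mem _ _
        (L.indicator_logMon_mem hk.le (by omega) η'.2)⟩, rfl, rfl⟩, rfl⟩

/-- Every class of forms is related to an element of `⨁_S Ω^q(S) ⊗ A_S`: monomials with fewer than
`k` poles and monomials of dependent sets have class zero. -/
theorem exists_phiRel_right (hp : q + k = p) (w : L.grObj (k : ℤ) p) :
    ∃ g, (g, w) ∈ L.phiRel k q p := by
  classical
  suffices h : ∀ ζ (hζ : ζ ∈ L.W (k : ℤ) p),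
      ∃ g, (g, (Submodule.Quotient.mk ⟨ζ, hζ⟩ : L.grObj (k : ℤ) p)) ∈ L.phiRel k q p by
    obtain ⟨⟨ζ, hζ⟩, rfl⟩ := Submodule.mkQ_surjective _ w
    exact h ζ hζ
  intro ζ hζ
  have hzero : ∀ (w : L.W (k : ℤ) p), w.1 ∈ L.W ((k : ℤ) - 1) p →
      ∃ g, (g, (Submodule.Quotient.mk w : L.grObj (k : ℤ) p)) ∈ L.phiRel k q p := fun w hw =>
    ⟨0, by rw [L.grMk_eq_zero.2 hw]; exact zero_mem _⟩
  induction hζ using Submodule.span_induction with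
  | mem ζ h =>
    have hζ : ζ ∈ L.W (k : ℤ) p := Submodule.subset_span h
    obtain ⟨I, η, hI, h', rfl⟩ := h
    obtain ⟨q', η, hη, hp', rfl⟩ := h'.exists_logMon
    rcases lt_or_eq_of_le (show I.card ≤ k by omega) with hlt | hk
    · exact hzero _ (Submodule.subset_span ⟨I, _, by omega, h', rfl⟩)
    · obtain rfl : q = q' := by omega
      by_cases hind : Indep L.hyp I
      · let S : L.Stratum k := ⟨inter L.hyp I, ⟨I, rfl⟩,
          ((codim_inter_eq_iff (isKer_kers L.f) I).2 hind).trans hk⟩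
        have h1 := Submodule.smul_mem (L.phiRel k q p) ((2 * Complex.I * Real.pi : ℂ) ^ k)
          (Submodule.subset_span ⟨S, I, hk, rfl, ⟨η, hη⟩, ⟨_, Submodule.smul_mem _ _
            (L.indicator_logMon_mem hk.le hp' hη)⟩, rfl, rfl⟩)
        refine ⟨_, (congrArg (fun w => (_, w) ∈ L.phiRel k q p) ?_).mp h1⟩
        rw [← Submodule.Quotient.mk_smul]
        congr 1
        refine Subtype.ext ?_
        change (2 * Complex.I * Real.pi : ℂ) ^ k • (((2 * Complex.I * Real.pi : ℂ) ^ k)⁻¹ • _) = _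
        rw [smul_smul, mul_inv_cancel₀ (fun h => inv_two_pi_I_pow_ne_zero k (by
          rw [h, inv_zero])), one_smul]
      · refine hzero _ ?_
        have h1 : L.compl.indicator (logMon L.f q p I η) = 0 := by
          funext y
          by_cases hy : y ∈ L.compl
          · rw [Set.indicator_of_mem hy, logMon, extEval_dlogVec_eq_zero
              (by rwa [L.offHyp_eq]) hind, map_zero]
            rfl
          · exact Set.indicator_of_notMem hy _
        change L.compl.indicator (logMon L.f q p I η) ∈ _
        rw [h1]
        exact zero_mem _
  | zero => exact hzero _ (zero_mem _)
  | add a b ha hb iha ihb =>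
    obtain ⟨g, hg⟩ := iha
    obtain ⟨g', hg'⟩ := ihb
    exact ⟨g + g', add_mem hg hg'⟩
  | smul c a ha iha =>
    obtain ⟨g, hg⟩ := iha
    exact ⟨c • g, Submodule.smul_mem _ c hg⟩

open scoped Classical in
/-- The map `η ⊗ e_I ↦ η̃ ∧ ω_I`, with values modulo forms with fewer than `k` poles. -/
theorem exists_logMap_central (hp : q + k = p) :
    ∃ Θ : L.GObj k q →ₗ[ℂ] (E → Alt E p) ⧸ logSpan L.f Set.univ k p,
      ∀ (S : L.Stratum k) (I : Finset (Fin l)) (hS : inter L.hyp I = S.1) (η' : Hol E q),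
        Θ (DirectSum.lof ℂ (L.Stratum k) (fun S => TensQ (Hol S.1 q) (osPart L.hyp S.1)) S
          (TensQ.tmul (Hol.res S.1 η') (osGen L.hyp I hS))) =
            logMk L.f Set.univ k p (logMon L.f q p I η'.1) := by
  have h : ∀ S : L.Stratum k, ∃ B : TensQ (Hol S.1 q) (osPart L.hyp S.1) →ₗ[ℂ]
      (E → Alt E p) ⧸ logSpan L.f Set.univ k p, ∀ m n I (hI : inter L.hyp I = S.1),
        (∃ η' : Hol E q, Hol.res S.1 η' = m ∧ η'.1 = n) →
          B (TensQ.tmul m (osGen L.hyp I hI)) = logMk L.f Set.univ k p (logMon L.f q p I n) := by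
    intro S
    refine exists_logMap L.f (fun I hI y hy => ?_) (fun m => ?_) ?_ ?_ ?_
    · exact extEval_dlogVec_extDelta hy (fun i _ => L.ne_zero i)
        ((codim_inter_lt_iff (isKer_kers L.f) I).1 hI)
    · obtain ⟨η', h⟩ := exists_res_eq S.1 m
      exact ⟨_, η', h, rfl⟩
    · rintro _ _ _ _ ⟨η, rfl, rfl⟩ ⟨η', rfl, rfl⟩
      exact ⟨η + η', rfl, rfl⟩
    · rintro c _ _ ⟨η, rfl, rfl⟩
      exact ⟨c • η, rfl, rfl⟩
    · rintro _ ⟨η, h0, rfl⟩ I hI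
      refine logMon_mem_of_vanish_of_codim (fun _ _ _ _ _ => Set.mem_univ _)
        ((congrArg codim hI).trans S.2.2) hp (fun x _ => η.2 x)
        (Filter.Eventually.of_forall fun y hy => ?_)
      change pull (η.1 y) (inter L.hyp I).subtypeL = 0
      replace hy : y ∈ inter L.hyp I := hy
      obtain ⟨S, hS⟩ := S
      obtain rfl : inter L.hyp I = S := hI
      exact congrFun (congrArg Subtype.val h0) ⟨y, hy⟩
  choose B hB using h
  refine ⟨DirectSum.toModule ℂ (L.Stratum k) _ B, fun S I hS η' => ?_⟩
  exact (DirectSum.toModule_lof ℂ S _).trans (hB S _ _ I hS ⟨η', rfl, rfl⟩)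

end Central

/-- The sets without broken circuits whose intersection is the subspace `S`. -/
abbrev NbcSet {E ι : Type} [AddCommGroup E] [Module ℂ E] [LinearOrder ι] (H : ι → Submodule ℂ E)
    (S : Submodule ℂ E) : Type :=
  {J : Finset ι // NoBroken H J ∧ Indep H J ∧ inter H J = S}

theorem mem_span_osGen_nbc {E ι : Type} [AddCommGroup E] [Module ℂ E] [LinearOrder ι]
    [FiniteDimensional ℂ E] [Fintype ι] {H : ι → Submodule ℂ E} (hH : IsKer H)
    (S : Submodule ℂ E) (b : osPart H S) :
    b ∈ Submodule.span ℚ (Set.range fun J : NbcSet H S => osGen H J.1 J.2.2.2) := by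
  have h1 := osPart_le_span_nbc hH S b.2
  have h2 : nbcMonomials H S =
      (osPart H S).subtype '' Set.range fun J : NbcSet H S => osGen H J.1 J.2.2.2 := by
    ext z
    constructor
    · rintro ⟨J, h1, h2, h3, rfl⟩
      exact ⟨_, ⟨⟨J, h1, h2, h3⟩, rfl⟩, rfl⟩
    · rintro ⟨_, ⟨J, rfl⟩, rfl⟩
      exact ⟨J.1, J.2.1, J.2.2.1, J.2.2.2, rfl⟩
  rw [h2, ← Submodule.map_span] at h1
  obtain ⟨b', hb', h⟩ := h1
  rwa [← Subtype.ext h]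

namespace Central

variable {E : Type} [NormedAddCommGroup E] [NormedSpace ℂ E] {l : ℕ} (L : Central E l)
  {k p q : ℕ}

theorem logMk_indicator (ζ : E → Alt E p) :
    logMk L.f Set.univ k p (L.compl.indicator ζ) = logMk L.f Set.univ k p ζ := by
  rw [← sub_eq_zero, ← map_sub, logMk_eq_zero]
  refine logSpan_congr (zero_mem _) (Filter.Eventually.of_forall fun y hy => ?_)
  rw [offHyp_eq] at hy
  rw [Pi.sub_apply, Set.indicator_of_mem hy, sub_self]
  rfl

/-- The quotient `gr_k` maps injectively to the forms modulo forms with fewer than `k` poles. -/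
def grToLog (k p : ℕ) : L.grObj (k : ℤ) p →ₗ[ℂ] (E → Alt E p) ⧸ logSpan L.f Set.univ k p :=
  Submodule.liftQ _ (logMk L.f Set.univ k p ∘ₗ (L.W (k : ℤ) p).subtype) fun _ hw =>
    logMk_eq_zero.2 (L.mem_W_iff.1 hw).2

theorem grToLog_injective (w : L.grObj (k : ℤ) p) (h : L.grToLog k p w = 0) : w = 0 := by
  obtain ⟨w, rfl⟩ := Submodule.mkQ_surjective _ w
  have h1 : logMk L.f Set.univ k p w.1 = 0 := h
  exact L.grMk_eq_zero.2 (L.mem_W_iff.2 ⟨(L.mem_W_iff'.1 w.2).1, logMk_eq_zero.1 h1⟩)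

theorem Hol.d_res (S : Submodule ℂ E) (η : Hol E q) :
    Hol.d S q (Hol.res S η) = Hol.res S (Hol.d E q η) := by
  refine Subtype.ext <| funext fun s => ?_
  have h := extDeriv_pullback (r := ω) (x := s)
    (show DifferentiableAt ℂ η.1 (S.subtypeL s) from (η.2 _).differentiableAt)
    S.subtypeL.contDiff.contDiffAt le_top
  simp only [S.subtypeL.fderiv] at h
  exact h

theorem phiRel_d (hp : q + k = p) {g : L.GObj k q} {w : L.grObj (k : ℤ) p}
    (h : (g, w) ∈ L.phiRel k q p) :
    (L.Gd k q g, L.grd (k : ℤ) p w) ∈ L.phiRel k (q + 1) (p + 1) := by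
  classical
  have h1 : L.phiRel k q p ≤ (L.phiRel k (q + 1) (p + 1)).comap
      (LinearMap.prodMap (L.Gd k q) (L.grd (k : ℤ) p)) := by
    refine Submodule.span_le.2 ?_
    rintro _ ⟨S, I, hI, hS, η', w, hw, rfl⟩
    refine Submodule.subset_span ⟨S, I, hI, hS, Hol.d E q η', L.Wd (k : ℤ) p w, ?_,
      Prod.ext ?_ rfl⟩
    · change L.dCompl w.1 = _
      rw [hw, L.dCompl_smul]
      congr 1
      refine Set.indicator_congr fun y hy => ?_
      have h2 : extDeriv (L.compl.indicator (logMon L.f q p I η'.1)) y =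
          extDeriv (logMon L.f q p I η'.1) y := by
        refine Filter.EventuallyEq.extDeriv_eq ?_
        filter_upwards [L.isOpen_compl.mem_nhds hy] with z hz
        rw [Set.indicator_of_mem hz]
      rw [h2, (extDeriv_logMon (η'.2 y) (fun i _ => hy i) (by omega)).2]
      rfl
    · refine (DirectSum.lmap_lof _ S _).trans ?_
      rw [TensQ.map_tmul, Hol.d_res]
  exact h1 h

variable [FiniteDimensional ℂ E]

open scoped Classical in
/-- A map with the values `η̃ ∧ ω_I` on the elements `η ⊗ e_I` is injective, because the
monomials without broken circuits span. -/
theorem eq_zero_of_logMap_eq_zero (hp : q + k = p)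
    {Θ : L.GObj k q →ₗ[ℂ] (E → Alt E p) ⧸ logSpan L.f Set.univ k p}
    (hΘ : ∀ (S : L.Stratum k) (I : Finset (Fin l)) (hS : inter L.hyp I = S.1) (η' : Hol E q),
      Θ (DirectSum.lof ℂ (L.Stratum k) (fun S => TensQ (Hol S.1 q) (osPart L.hyp S.1)) S
        (TensQ.tmul (Hol.res S.1 η') (osGen L.hyp I hS))) =
          logMk L.f Set.univ k p (logMon L.f q p I η'.1))
    {g : L.GObj k q} (hg : Θ g = 0) : g = 0 := by
  subst hp
  have hfin : Finite (L.Stratum k) := Finite.of_injective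
    (fun S : L.Stratum k => S.2.1.choose) fun S S' h => Subtype.ext (by
      rw [← S.2.1.choose_spec, ← S'.2.1.choose_spec]
      exact congrArg _ h)
  have := Fintype.ofFinite (L.Stratum k)
  have hN : ∀ S : L.Stratum k, Fintype (NbcSet L.hyp S.1) := fun S => Fintype.ofFinite _
  choose m hm using fun S : L.Stratum k => TensQ.exists_sum (M := Hol S.1 q)
    (fun J : NbcSet L.hyp S.1 => osGen L.hyp J.1 J.2.2.2)
    (mem_span_osGen_nbc (isKer_kers L.f) S.1) (g S)
  choose η hη using fun (S : L.Stratum k) (J : NbcSet L.hyp S.1) => exists_res_eq S.1 (m S J)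
  have h0 : ∀ S : L.Stratum k, (g S : TensQ (Hol S.1 q) (osPart L.hyp S.1)) =
      ∑ J : NbcSet L.hyp S.1, TensQ.tmul (Hol.res S.1 (η S J)) (osGen L.hyp J.1 J.2.2.2) := fun S =>
    by simp only [hη]; exact hm S
  have h1 : g = ∑ S : L.Stratum k, DirectSum.lof ℂ (L.Stratum k)
      (fun S => TensQ (Hol S.1 q) (osPart L.hyp S.1)) S (∑ J : NbcSet L.hyp S.1,
        TensQ.tmul (Hol.res S.1 (η S J)) (osGen L.hyp J.1 J.2.2.2)) := by
    refine (DirectSum.sum_univ_of g).symm.trans (Finset.sum_congr rfl fun S _ => ?_)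
    exact congrArg _ (h0 S)
  have h2 : Θ g = logMk L.f Set.univ k (q + k) (∑ z : Σ S : L.Stratum k, NbcSet L.hyp S.1,
      logMon L.f q (q + k) z.2.1 (η z.1 z.2).1) := by
    rw [h1, map_sum, map_sum, Fintype.sum_sigma]
    refine Finset.sum_congr rfl fun S _ => ?_
    refine (map_sum (Θ ∘ₗ DirectSum.lof ℂ (L.Stratum k)
      (fun S => TensQ (Hol S.1 q) (osPart L.hyp S.1)) S) _ _).trans ?_
    exact Finset.sum_congr rfl fun J _ => hΘ S J.1 J.2.2.2 (η S J)
  have h3 := pull_eq_zero_of_sum_mem_of_injective (f := L.f) (A := Set.univ) (k := k)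
    (ψ := fun z : Σ S : L.Stratum k, NbcSet L.hyp S.1 => z.2.1)
    (η := fun z => (η z.1 z.2).1) (by
      rintro ⟨S, J⟩ ⟨S', J'⟩ h
      obtain rfl : S = S' := Subtype.ext (by
        rw [← J.2.2.2, ← J'.2.2.2]
        exact congrArg _ h)
      obtain rfl : J = J' := Subtype.ext h
      rfl)
    (fun z => by
      rw [← (codim_inter_eq_iff (isKer_kers L.f) _).2 z.2.2.2.1]
      exact (congrArg codim z.2.2.2.2).trans z.1.2.2)
    (fun z => z.2.2.2.1) (fun z i _ => z.2.2.1 i) (fun z x _ => (η z.1 z.2).2 x)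
    (logMk_eq_zero.1 (h2.symm.trans hg))
  have h4 : ∀ S J, Hol.res S.1 (η S J) = 0 := by
    intro S J
    refine Subtype.ext <| funext fun s => ?_
    have h5 := h3 ⟨S, J⟩
    rw [nhdsSet_univ, Filter.eventually_top] at h5
    have h6 : ∀ v ∈ S.1, v ∈ inter L.hyp J.1 := fun v hv => by rw [J.2.2.2]; exact hv
    ext v
    exact DFunLike.congr_fun (h5 s.1 (h6 s.1 s.2)) fun i => ⟨v i, h6 _ (v i).2⟩
  rw [h1]
  simp only [h4, TensQ.tmul_zero_left, Finset.sum_const_zero]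
  exact Finset.sum_eq_zero fun S _ => LinearMap.map_zero _

/-- Up to the constant, the relation is contained in the graph of an injective map to the forms
modulo forms with fewer than `k` poles. -/
theorem exists_grToLog_eq (hp : q + k = p) :
    ∃ Θ : L.GObj k q →ₗ[ℂ] (E → Alt E p) ⧸ logSpan L.f Set.univ k p,
      (∀ g w, (g, w) ∈ L.phiRel k q p →
        L.grToLog k p w = ((2 * Complex.I * Real.pi : ℂ) ^ k)⁻¹ • Θ g) ∧
      ∀ g, Θ g = 0 → g = 0 := by
  classical
  obtain ⟨Θ, hΘ⟩ := L.exists_logMap_central (q := q) hp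
  refine ⟨Θ, fun g w h => ?_, fun g hg => L.eq_zero_of_logMap_eq_zero hp hΘ hg⟩
  have h1 : L.phiRel k q p ≤ LinearMap.eqLocus (L.grToLog k p ∘ₗ LinearMap.snd ℂ _ _)
      ((((2 * Complex.I * Real.pi : ℂ) ^ k)⁻¹ • Θ) ∘ₗ LinearMap.fst ℂ _ _) := by
    refine Submodule.span_le.2 ?_
    rintro _ ⟨S, I, hI, hS, η', w, hw, rfl⟩
    have h2 : L.grToLog k p (Submodule.Quotient.mk w) = logMk L.f Set.univ k p w.1 := rfl
    change L.grToLog k p (Submodule.Quotient.mk w) =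
      ((2 * Complex.I * Real.pi : ℂ) ^ k)⁻¹ • Θ _
    rw [h2, hw, map_smul, logMk_indicator]
    exact congrArg _ (hΘ S I hS η').symm
  exact h1 h

theorem exists_phiEquiv (hp : q + k = p) : ∃ Ψ : L.GObj k q ≃ₗ[ℂ] L.grObj (k : ℤ) p,
    ∀ g w, (g, w) ∈ L.phiRel k q p → Ψ g = w := by
  obtain ⟨Θ, h1, h2⟩ := L.exists_grToLog_eq (q := q) hp
  refine exists_equiv_of_relation _ (L.exists_phiRel_left hp) (L.exists_phiRel_right hp)
    (fun w hw => L.grToLog_injective w ?_) fun g hg => h2 g ?_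
  · rw [h1 _ _ hw, map_zero, smul_zero]
  · have h3 := h1 _ _ hg
    rw [map_zero] at h3
    exact (smul_eq_zero.1 h3.symm).resolve_left (inv_two_pi_I_pow_ne_zero k)

theorem exists_unique_isPhi (k : ℕ) : ∃ Φ : L.G k ⟶ L.gr (k : ℤ), L.IsPhi k Φ ∧
    (∀ Φ' : L.G k ⟶ L.gr (k : ℤ), L.IsPhi k Φ' → Φ' = Φ) ∧ IsIso Φ := by
  classical
  choose Ψ hΨ using fun q p (hp : q + k = p) => L.exists_phiEquiv (q := q) hp
  have hgen : ∀ (q : ℕ) (S : L.Stratum k) (I : Finset (Fin l)) (hI : I.card = k)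
      (hS : inter L.hyp I = S.1) (η' : Hol E q),
      (DirectSum.lof ℂ (L.Stratum k) (fun S => TensQ (Hol S.1 q) (osPart L.hyp S.1)) S
        (TensQ.tmul (Hol.res S.1 η') (osGen L.hyp I hS)),
        (Submodule.Quotient.mk (L.phiForm η' I hI) : L.grObj (k : ℤ) (q + k))) ∈
          L.phiRel k q (q + k) := by
    intro q S I hI hS η'
    refine Submodule.subset_span ⟨S, I, hI, hS, η', L.phiForm η' I hI, ?_, rfl⟩
    have h1 : logMon L.f q (q + k) I η'.1 = L.wedgeOmega η'.1 I hI :=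
      funext fun y => logMon_eq_wedgeTuple hI η'.1 y
    rw [h1]
    rfl
  obtain ⟨Φ, hΦ⟩ := exists_iso_extend (k := k) (K := L.GUnshifted k) (L := L.gr (k : ℤ))
    (fun q p hp => (Ψ q p hp).toModuleIso) (fun q p hp => by
      have h1 : (L.GUnshifted k).d q (q + 1) = ModuleCat.ofHom (L.Gd k q) :=
        CochainComplex.of_d (fun q => ModuleCat.of ℂ (L.GObj k q))
          (fun q => ModuleCat.ofHom (L.Gd k q)) q
      have h2 : (L.gr (k : ℤ)).d p (p + 1) = ModuleCat.ofHom (L.grd (k : ℤ) p) :=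
        CochainComplex.of_d (fun p => ModuleCat.of ℂ (L.grObj (k : ℤ) p))
          (fun p => ModuleCat.ofHom (L.grd (k : ℤ) p)) p
      rw [h1, h2]
      ext1
      refine LinearMap.ext fun g => ?_
      obtain ⟨w, hw⟩ := L.exists_phiRel_left hp g
      change L.grd (k : ℤ) p (Ψ q p hp g) = Ψ (q + 1) (p + 1) _ (L.Gd k q g)
      rw [hΨ q p hp g w hw, hΨ _ _ _ _ _ (L.phiRel_d hp hw)])
    (fun p hp => by
      have : Subsingleton (L.grObj (k : ℤ) p) := by
        rw [subsingleton_iff_forall_eq 0]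
        intro w
        obtain ⟨w, rfl⟩ := Submodule.mkQ_surjective _ w
        exact L.grMk_eq_zero.2 (L.W_le_of_lt hp w.2)
      exact ModuleCat.isZero_of_subsingleton (ModuleCat.of ℂ (L.grObj (k : ℤ) p)))
  refine ⟨Φ.hom, ?_, fun Φ' h => hom_extend_ext fun q => ?_, Φ.isIso_hom⟩
  · rintro q S I hI hS _ η' rfl
    exact (ConcreteCategory.congr_hom (hΦ q) _).trans (hΨ q (q + k) rfl _ _ (hgen q S I hI hS η'))
  · refine Eq.trans ?_ (hΦ q).symm
    ext1
    refine LinearMap.ext fun g => ?_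
    obtain ⟨w, hw⟩ := L.exists_phiRel_left rfl g
    refine Eq.trans ?_ (hΨ q (q + k) rfl g w hw).symm
    have h1 : L.phiRel k q (q + k) ≤ LinearMap.eqLocus
        ((((L.GUnshifted k).extendXIso (shiftBy k) (i := q) rfl).inv ≫ Φ'.f (q + k)).hom ∘ₗ
          LinearMap.fst ℂ _ _) (LinearMap.snd ℂ _ _) := by
      refine Submodule.span_le.2 ?_
      rintro _ ⟨S, I, hI, hS, η', w, hw, rfl⟩
      refine (h q S I hI hS _ η' rfl).trans ?_
      change (Submodule.Quotient.mk (L.phiForm η' I hI) : L.grObj (k : ℤ) (q + k)) =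
        Submodule.Quotient.mk w
      congr 1
      refine Subtype.ext ?_
      rw [hw]
      have h1 : logMon L.f q (q + k) I η'.1 = L.wedgeOmega η'.1 I hI :=
        funext fun y => logMon_eq_wedgeTuple hI η'.1 y
      rw [h1]
      rfl
    exact h1 hw

end Central

/-! ### Holomorphic forms in charts -/

section Charts

variable {E : Type} [NormedAddCommGroup E] [NormedSpace ℂ E]

theorem analyticAt_pull [FiniteDimensional ℂ E] {q : ℕ} {η : E → Alt E q} {T : E → (E →L[ℂ] E)}
    {y : E} (hη : AnalyticAt ℂ η y) (hT : AnalyticAt ℂ T y) :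
    AnalyticAt ℂ (fun z => pull (η z) (T z)) y := by
  let M := ContinuousMultilinearMap ℂ (fun _ : Fin q => E) ℂ
  have : FiniteDimensional ℂ M := by
    let e : M →ₗ[ℂ] MultilinearMap ℂ (fun _ : Fin q => E) ℂ :=
      ContinuousMultilinearMap.toMultilinearMapLinear
    exact FiniteDimensional.of_injective e ContinuousMultilinearMap.toMultilinearMap_injective
  let J : Alt E q →ₗᵢ[ℂ] M := ContinuousAlternatingMap.toContinuousMultilinearMapLI
  -- Analyticity is checked in the space of all multilinear maps, where composition is polynomial.
  obtain ⟨P, hP⟩ := J.toLinearMap.exists_leftInverse_of_injective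
    (LinearMap.ker_eq_bot.2 J.injective)
  let P' : M →L[ℂ] Alt E q := LinearMap.toContinuousLinearMap P
  have h1 : AnalyticAt ℂ (fun z => ((fun _ : Fin q => T z), J (η z))) y :=
    (AnalyticAt.pi fun _ => hT).prod
      ((J.toContinuousLinearMap.analyticAt _).comp hη)
  have h2 := (P'.analyticAt _).comp
    ((ContinuousMultilinearMap.analyticAt_uncurry_compContinuousLinearMap
      (𝕜 := ℂ) (Fm := fun _ : Fin q => E) (Em := fun _ => E) (G := ℂ)
      (q := ((fun _ : Fin q => T y), J (η y)))).comp_of_eq h1 rfl)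
  refine h2.congr (Filter.Eventually.of_forall fun z => ?_)
  exact LinearMap.congr_fun hP (pull (η z) (T z))

variable {X : Type u} [TopologicalSpace X] [ChartedSpace E X] [IsManifold 𝓘(ℂ, E) ω X]

/-- The form on a manifold that is given by `η` in the chart `φ`. -/
def ofChart {q : ℕ} (φ : OpenPartialHomeomorph X E) (η : E → Alt E q) (z : X) : Alt E q :=
  pull (η (φ z)) (mfd (E := E) (E' := E) φ z)

theorem mfderiv_comp_symm {φ : OpenPartialHomeomorph X E}
    (hφ : φ ∈ IsManifold.maximalAtlas 𝓘(ℂ, E) ω X) {y : E} (hy : y ∈ φ.target) :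
    (mfd (E := E) (E' := E) φ (φ.symm y)).comp
      (mfd (E := E) (E' := E) φ.symm y) = ContinuousLinearMap.id ℂ E := by
  have h1 := mfd_comp y (mdiff_chart hφ (φ.map_target hy)) (mdiff_symm hφ hy)
  have h2 : φ ∘ φ.symm =ᶠ[𝓝 y] id := by
    filter_upwards [φ.open_target.mem_nhds hy] with z hz using φ.right_inv hz
  rw [mfd_eq_fderiv, h2.fderiv_eq, fderiv_id] at h1
  exact h1.symm

theorem ofChart_chartRep {φ : OpenPartialHomeomorph X E}
    (hφ : φ ∈ IsManifold.maximalAtlas 𝓘(ℂ, E) ω X) {q : ℕ} (ζ : X → Alt E q) {z : X}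
    (hz : z ∈ φ.source) : ofChart φ (chartRep φ ζ) z = ζ z := by
  have h := mfderiv_symm_comp hφ hz
  ext v
  change ζ (φ.symm (φ z)) (fun i => _) = ζ z v
  rw [φ.left_inv hz]
  exact congrArg (ζ z) (funext fun i => DFunLike.congr_fun h (v i))

theorem HolAt.ofChart [FiniteDimensional ℂ E] {φ : OpenPartialHomeomorph X E}
    (hφ : φ ∈ IsManifold.maximalAtlas 𝓘(ℂ, E) ω X) {q : ℕ} {η : E → Alt E q} {x : X}
    (hx : x ∈ φ.source) (hη : AnalyticAt ℂ η (φ x)) : HolAt (ofChart φ η) x := by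
  intro ψ hψ hxψ
  have hy := ψ.map_source hxψ
  set g : E → E := φ ∘ ψ.symm with hg
  have hgx : g (ψ x) = φ x := by simp [hg, ψ.left_inv hxψ]
  have hgc : ContDiffAt ℂ ω g (ψ x) := by
    rw [← contMDiffAt_iff_contDiffAt]
    refine ContMDiffAt.comp (ψ x) ?_ ((contMDiffOn_symm_of_mem_maximalAtlas hψ).contMDiffAt
      (ψ.open_target.mem_nhds hy))
    rw [ψ.left_inv hxψ]
    exact (contMDiffOn_of_mem_maximalAtlas hφ).contMDiffAt (φ.open_source.mem_nhds hx)
  have hga := hgc.analyticAt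
  have h1 : AnalyticAt ℂ (fun y => pull (η (g y)) (fderiv ℂ g y)) (ψ x) :=
    analyticAt_pull (hη.comp_of_eq hga hgx) hga.fderiv
  refine h1.congr ?_
  have hev : ∀ᶠ z in 𝓝 (ψ x), z ∈ ψ.target ∧ ψ.symm z ∈ φ.source := by
    refine Filter.Eventually.and (ψ.open_target.mem_nhds hy) ?_
    refine (ψ.continuousAt_symm hy).eventually ?_
    rw [ψ.left_inv hxψ]
    exact φ.open_source.mem_nhds hx
  filter_upwards [hev] with z hz
  rw [← mfd_eq_fderiv, mfd_comp z (mdiff_chart hφ hz.2) (mdiff_symm hψ hz.1)]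
  rfl

end Charts

/-! ### Linear charts and the global incidence relations -/

section Tangent

variable {E : Type} [NormedAddCommGroup E] [NormedSpace ℂ E]
  {X : Type u} [TopologicalSpace X] [ChartedSpace E X]

theorem tan_mono {S S' : Set X} {x : X} (h : ∀ᶠ z in 𝓝 x, z ∈ S → z ∈ S') :
    tan (E := E) S x ≤ tan (E := E) S' x := by
  intro v hv f hf h0
  refine hv f hf ?_
  rw [eventually_nhdsWithin_iff] at h0 ⊢
  filter_upwards [h, h0] with z hz hz' hzS using hz' (hz hzS)

variable [IsManifold 𝓘(ℂ, E) ω X]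

theorem mfd_chart_bijective {φ : OpenPartialHomeomorph X E}
    (hφ : φ ∈ IsManifold.maximalAtlas 𝓘(ℂ, E) ω X) {x : X} (hx : x ∈ φ.source) :
    Function.Bijective (mfd (E := E) (E' := E) φ x) := by
  have h1 := mfderiv_symm_comp hφ hx
  have h2 := mfderiv_comp_symm hφ (φ.map_source hx)
  rw [φ.left_inv hx] at h2
  exact ⟨fun v w h => by
    rw [← ContinuousLinearMap.id_apply (R₁ := ℂ) v, ← ContinuousLinearMap.id_apply (R₁ := ℂ) w,
      ← h1, ContinuousLinearMap.comp_apply, ContinuousLinearMap.comp_apply, h],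
    fun w => ⟨_, DFunLike.congr_fun h2 w⟩⟩

/-- The tangent space of a subset that is linear in a chart. -/
theorem tan_eq_comap {ι : Type} [LinearOrder ι] {S : Set X} {φ : OpenPartialHomeomorph X E}
    (hφ : φ ∈ IsManifold.maximalAtlas 𝓘(ℂ, E) ω X) {f : ι → (E →L[ℂ] ℂ)} {J : Finset ι}
    (hS : ∀ z ∈ φ.source, z ∈ S ↔ φ z ∈ inter (kers f) J) {x : X} (hx : x ∈ φ.source)
    (hxS : x ∈ S) :
    tan (E := E) S x = (inter (kers f) J).comap
      (mfd (E := E) (E' := E) φ x : E →ₗ[ℂ] E) := by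
  ext v
  rw [Submodule.mem_comap]
  constructor
  · intro hv
    refine mem_inter.2 fun i hi => ?_
    have hc : ContMDiffAt 𝓘(ℂ, E) 𝓘(ℂ, ℂ) ω (f i ∘ φ) x :=
      (f i).contMDiff.contMDiffAt.comp x
        ((contMDiffOn_of_mem_maximalAtlas hφ).contMDiffAt (φ.open_source.mem_nhds hx))
    have := hv (f i ∘ φ) hc (by
      filter_upwards [self_mem_nhdsWithin,
        mem_nhdsWithin_of_mem_nhds (φ.open_source.mem_nhds hx)] with z hz hz'
      exact mem_inter.1 ((hS z hz').1 hz) i hi)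
    rw [mfd_comp x (f i).differentiableAt.mdifferentiableAt (mdiff_chart hφ hx),
      mfd_eq_fderiv, (f i).fderiv] at this
    exact this
  · intro hw g hg hg0
    set w := mfd (E := E) (E' := E) φ x v with hwdef
    have hy := φ.map_source hx
    have hgm : MDifferentiableAt 𝓘(ℂ, E) 𝓘(ℂ, ℂ) g (φ.symm (φ x)) := by
      rw [φ.left_inv hx]; exact hg.mdifferentiableAt (by simp)
    have e1 : mfd (E := E) (E' := ℂ) (g ∘ φ.symm) (φ x) w =
        mfd (E := E) (E' := ℂ) g x v := by
      rw [mfd_comp _ hgm (mdiff_symm hφ hy), φ.left_inv hx]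
      exact congrArg _ (DFunLike.congr_fun (mfderiv_symm_comp hφ hx) v)
    rw [← e1, mfd_eq_fderiv]
    have hd : DifferentiableAt ℂ (g ∘ φ.symm) (φ x) :=
      (hgm.comp _ (mdiff_symm hφ hy)).differentiableAt
    -- The line in the direction `w` through the image of `x` corresponds to points of `S`, where
    -- `g` vanishes.
    have hline : HasDerivAt (fun t : ℂ => (g ∘ φ.symm) (φ x + t • w))
        (fderiv ℂ (g ∘ φ.symm) (φ x) w) 0 := by
      have h2 : HasFDerivAt (g ∘ φ.symm) (fderiv ℂ (g ∘ φ.symm) (φ x)) (φ x + (0 : ℂ) • w) := by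
        simpa using hd.hasFDerivAt
      have h3 : HasDerivAt (fun t : ℂ => φ x + t • w) w 0 := by
        simpa using ((hasDerivAt_id (0 : ℂ)).smul_const w).const_add (φ x)
      exact h2.comp_hasDerivAt (0 : ℂ) h3
    have hcont : Filter.Tendsto (fun t : ℂ => φ.symm (φ x + t • w)) (𝓝 0) (𝓝[S] x) := by
      have hc : Filter.Tendsto (fun t : ℂ => φ x + t • w) (𝓝 0) (𝓝 (φ x)) := by
        have : Continuous fun t : ℂ => φ x + t • w := by fun_prop
        simpa using this.tendsto 0
      refine tendsto_nhdsWithin_iff.2 ⟨?_, ?_⟩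
      · have := (φ.continuousAt_symm hy).tendsto.comp hc
        rwa [φ.left_inv hx] at this
      filter_upwards [hc.eventually (φ.open_target.mem_nhds hy)] with t ht
      rw [hS _ (φ.map_target ht), φ.right_inv ht]
      exact add_mem ((hS x hx).1 hxS) (Submodule.smul_mem _ t hw)
    have hz : (fun t : ℂ => (g ∘ φ.symm) (φ x + t • w)) =ᶠ[𝓝 0] fun _ => 0 :=
      hcont.eventually hg0
    rw [← hline.deriv, hz.deriv_eq, deriv_const]

end Tangent

namespace Hypersurfaces

variable {E : Type} [NormedAddCommGroup E] [NormedSpace ℂ E]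
  {X : Type u} [TopologicalSpace X] [ChartedSpace E X] {l : ℕ} (L : Hypersurfaces E X l)

/-- A chart around the point `x` in which the hypersurfaces through `x` are hyperplanes and which
does not meet the other hypersurfaces. The linear form `f i` is zero if `L_i` does not contain
`x`. -/
structure LinChart (x : X) where
  φ : OpenPartialHomeomorph X E
  mem_atlas : φ ∈ IsManifold.maximalAtlas 𝓘(ℂ, E) ω X
  mem_source : x ∈ φ.source
  f : Fin l → (E →L[ℂ] ℂ)
  mem_hyp_iff : ∀ z ∈ φ.source, ∀ i, z ∈ L.hyp i ↔ f i ≠ 0 ∧ f i (φ z) = 0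
  ne_zero_iff : ∀ i, f i ≠ 0 ↔ x ∈ L.hyp i

/-- Remove from a chart around `x` the hypersurfaces that do not contain `x`. -/
theorem exists_linChart (x : X) : Nonempty (L.LinChart x) := by
  classical
  obtain ⟨φ, hφ, hx, h⟩ := L.locally_linear x
  let s : Set X := ⋂ i : {i // x ∉ L.hyp i}, (L.hyp i)ᶜ
  have hs : IsOpen s := isOpen_iInter_of_finite fun i => (L.isClosed_hyp i).isOpen_compl
  have hxs : x ∈ s := Set.mem_iInter.2 fun i => i.2
  have h' : ∀ i, ∃ f : E →L[ℂ] ℂ, (f ≠ 0 ↔ x ∈ L.hyp i) ∧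
      ∀ z ∈ φ.source, z ∈ s → (z ∈ L.hyp i ↔ f ≠ 0 ∧ f (φ z) = 0) := by
    intro i
    by_cases hi : x ∈ L.hyp i
    · rcases h i with h | ⟨f, hf, h⟩
      · exact absurd hi (h x hx)
      · exact ⟨f, by simp [hf, hi], fun z hz _ => by rw [h z hz]; simp [hf]⟩
    · exact ⟨0, by simp [hi], fun z _ hzs => by simpa using Set.mem_iInter.1 hzs ⟨i, hi⟩⟩
  choose f hf hf' using h'
  have hsrc : (φ.restr s).source = φ.source ∩ s := by
    rw [φ.restr_source, hs.interior_eq]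
  exact ⟨{  φ := φ.restr s
            mem_atlas := restr_mem_maximalAtlas _ hφ hs
            mem_source := by rw [hsrc]; exact ⟨hx, hxs⟩
            f := f
            mem_hyp_iff := fun z hz i => by
              rw [hsrc] at hz
              exact hf' i z hz.1 hz.2
            ne_zero_iff := hf }⟩

theorem mem_interX {I : Finset (Fin l)} {x : X} : x ∈ L.interX I ↔ ∀ i ∈ I, x ∈ L.hyp i :=
  Set.mem_iInter₂

theorem interX_anti {I J : Finset (Fin l)} (h : I ⊆ J) : L.interX J ⊆ L.interX I :=
  fun _ hx => L.mem_interX.2 fun i hi => L.mem_interX.1 hx i (h hi)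

theorem interX_singleton (i : Fin l) : L.interX {i} = L.hyp i := by
  ext x
  simp [mem_interX]

theorem mem_union {x : X} : x ∈ L.union ↔ ∃ i, x ∈ L.hyp i := Set.mem_iUnion

namespace LinChart

variable {L} {x : X} (c : L.LinChart x)

theorem apply_center (i : Fin l) : c.f i (c.φ x) = 0 := by
  by_cases h : c.f i = 0
  · rw [h]; rfl
  · exact ((c.mem_hyp_iff x c.mem_source i).1 ((c.ne_zero_iff i).1 h)).2

theorem mem_hyp_center {z : X} (hz : z ∈ c.φ.source) {i : Fin l} (h : z ∈ L.hyp i) :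
    x ∈ L.hyp i := (c.ne_zero_iff i).1 ((c.mem_hyp_iff z hz i).1 h).1

theorem mem_offHyp_iff {z : X} (hz : z ∈ c.φ.source) : c.φ z ∈ offHyp c.f ↔ z ∉ L.union := by
  rw [mem_union, not_exists]
  refine forall_congr' fun i => ?_
  rw [c.mem_hyp_iff z hz, not_and]

theorem projStable : ProjStable c.f {c.φ x} := by
  rintro i e - _ rfl
  rw [projAlong_apply, c.apply_center, zero_smul, sub_zero]
  exact Set.mem_singleton _

theorem mem_interX_iff {J : Finset (Fin l)} (hJ : x ∈ L.interX J) {z : X} (hz : z ∈ c.φ.source) :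
    z ∈ L.interX J ↔ c.φ z ∈ inter (kers c.f) J := by
  rw [L.mem_interX, mem_inter]
  refine forall₂_congr fun i hi => ?_
  rw [c.mem_hyp_iff z hz]
  exact and_iff_right ((c.ne_zero_iff i).2 (L.mem_interX.1 hJ i hi))

theorem center_mem_interX {J : Finset (Fin l)} {z : X} (hz : z ∈ c.φ.source)
    (h : z ∈ L.interX J) : x ∈ L.interX J :=
  L.mem_interX.2 fun i hi => c.mem_hyp_center hz (L.mem_interX.1 h i hi)

variable [IsManifold 𝓘(ℂ, E) ω X]

theorem tan_interX {J : Finset (Fin l)} {z : X} (hz : z ∈ c.φ.source) (hzJ : z ∈ L.interX J) :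
    tan (E := E) (L.interX J) z = (inter (kers c.f) J).comap
      (mfd (E := E) (E' := E) c.φ z : E →ₗ[ℂ] E) :=
  tan_eq_comap c.mem_atlas (fun _ hz' => c.mem_interX_iff (c.center_mem_interX hz hzJ) hz') hz hzJ

theorem tan_hyp {i : Fin l} {z : X} (hz : z ∈ c.φ.source) (hi : z ∈ L.hyp i) :
    tan (E := E) (L.hyp i) z = (kers c.f i).comap
      (mfd (E := E) (E' := E) c.φ z : E →ₗ[ℂ] E) := by
  have h := c.tan_interX (J := {i}) hz (by rwa [L.interX_singleton])
  rw [L.interX_singleton] at h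
  rw [h]
  congr 1
  ext v
  simp [mem_inter]

theorem comap_le_comap_iff {z : X} (hz : z ∈ c.φ.source) {K K' : Submodule ℂ E} :
    K.comap (mfd (E := E) (E' := E) c.φ z : E →ₗ[ℂ] E) ≤
      K'.comap (mfd (E := E) (E' := E) c.φ z : E →ₗ[ℂ] E) ↔ K ≤ K' :=
  Submodule.comap_le_comap_iff_of_surjective (mfd_chart_bijective c.mem_atlas hz).2

theorem codim_comap {z : X} (hz : z ∈ c.φ.source) (K : Submodule ℂ E) :
    codim (K.comap (mfd (E := E) (E' := E) c.φ z : E →ₗ[ℂ] E)) = codim K := by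
  have hb := mfd_chart_bijective c.mem_atlas hz
  let e : E ≃ₗ[ℂ] E := LinearEquiv.ofBijective (mfd (E := E) (E' := E) c.φ z : E →ₗ[ℂ] E) hb
  exact (Submodule.Quotient.equiv _ _ e (Submodule.map_comap_eq_of_surjective hb.2 K)).finrank_eq

theorem codim_tan {J : Finset (Fin l)} {z : X} (hz : z ∈ c.φ.source) (hzJ : z ∈ L.interX J) :
    codim (tan (E := E) (L.interX J) z) = codim (inter (kers c.f) J) := by
  rw [c.tan_interX hz hzJ, c.codim_comap hz]

/-- Near a point of the chart, the inclusion of `L_J` in `L_a` is an inclusion of the corresponding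
linear subspaces; in particular it holds near all points of `L_J` in the chart or near none. -/
theorem eventually_subset_iff {J : Finset (Fin l)} {a : Fin l} {z : X} (hz : z ∈ c.φ.source)
    (hzJ : z ∈ L.interX J) : (∀ᶠ z' in 𝓝 z, z' ∈ L.interX J → z' ∈ L.hyp a) ↔
      x ∈ L.hyp a ∧ inter (kers c.f) J ≤ kers c.f a := by
  constructor
  · intro h
    have hza := h.self_of_nhds hzJ
    have h1 := tan_mono (E := E) h
    rw [c.tan_interX hz hzJ, c.tan_hyp hz hza, c.comap_le_comap_iff hz] at h1
    exact ⟨c.mem_hyp_center hz hza, h1⟩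
  · rintro ⟨h1, h2⟩
    filter_upwards [c.φ.open_source.mem_nhds hz] with z' hz' h
    rw [c.mem_hyp_iff z' hz']
    exact ⟨(c.ne_zero_iff a).2 h1,
      h2 ((c.mem_interX_iff (c.center_mem_interX hz hzJ) hz').1 h)⟩

/-- By connectedness, the inclusion of an intersection of hypersurfaces in a hypersurface can be
read off in a chart around any point. -/
theorem subset_hyp_iff {J : Finset (Fin l)} (hJ : _root_.IsPreconnected (L.interX J)) {a : Fin l}
    (hx : x ∈ L.interX J) :
    L.interX J ⊆ L.hyp a ↔ x ∈ L.hyp a ∧ inter (kers c.f) J ≤ kers c.f a := by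
  rw [← c.eventually_subset_iff c.mem_source hx]
  refine ⟨fun h => Filter.Eventually.of_forall fun z hz => h hz, fun h => ?_⟩
  let u : Set X := {z | ∀ᶠ z' in 𝓝 z, z' ∈ L.interX J → z' ∈ L.hyp a}
  let v : Set X := {z | ∀ᶠ z' in 𝓝 z, z' ∈ L.interX J → z' ∉ u}
  -- In a linear chart around `y` all points of `L_J` satisfy the condition of `u`, or none does.
  have hcover : L.interX J ⊆ u ∪ v := fun y hy => by
    obtain ⟨c'⟩ := L.exists_linChart y
    by_cases hu : y ∈ u
    · exact Or.inl hu
    · refine Or.inr ?_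
      filter_upwards [c'.φ.open_source.mem_nhds c'.mem_source] with z hz hzJ hzu
      exact hu ((c'.eventually_subset_iff c'.mem_source hy).2
        ((c'.eventually_subset_iff hz hzJ).1 hzu))
  have hdisj : L.interX J ∩ (u ∩ v) = ∅ := by
    refine Set.eq_empty_of_forall_notMem ?_
    rintro y ⟨hy, hyu, hyv⟩
    exact hyv.self_of_nhds hy hyu
  rcases isPreconnected_iff_subset_of_disjoint.1 hJ u v isOpen_setOfPred_eventually_nhds
    isOpen_setOfPred_eventually_nhds hcover hdisj with h' | h'
  · exact fun y hy => (h' hy).self_of_nhds hy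
  · exact absurd h ((h' hx).self_of_nhds hx)

end LinChart

/-- The hypersurfaces of `J` are independent: none of them contains the intersection of the
others. -/
def IndepX (J : Finset (Fin l)) : Prop := ∀ a ∈ J, ¬ L.interX (J.erase a) ⊆ L.hyp a

variable {L} [IsManifold 𝓘(ℂ, E) ω X]
  (hL : ∀ I : Finset (Fin l), _root_.IsPreconnected (L.interX I))

include hL in
/-- Independence in the chart around a point is a condition on the hypersurfaces and does not depend
on the point. -/
theorem LinChart.indep_iff {x : X} (c : L.LinChart x) {J : Finset (Fin l)}
    (hx : x ∈ L.interX J) : Indep (kers c.f) J ↔ L.IndepX J := by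
  refine forall₂_congr fun a ha => not_congr ?_
  rw [c.subset_hyp_iff (hL _) (L.interX_anti (Finset.erase_subset a J) hx)]
  exact (and_iff_right (L.mem_interX.1 hx a ha)).symm

namespace Stratum

variable {k : ℕ} (S : L.Stratum k)

/-- A set of hypersurfaces through the point of a stratum, as a set of hypersurfaces. -/
def idx (I : Finset S.Index) : Finset (Fin l) := I.map (Function.Embedding.subtype _)

variable {S} in
theorem mem_idx {I : Finset S.Index} {i : Fin l} : i ∈ S.idx I ↔ ∃ h, (⟨i, h⟩ : S.Index) ∈ I := by
  simp [idx]

theorem card_idx (I : Finset S.Index) : (S.idx I).card = I.card := Finset.card_map _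

theorem idx_injective : Function.Injective S.idx := Finset.map_injective _

theorem idx_erase [inst : DecidableEq S.Index] (I : Finset S.Index) (a : S.Index) :
    S.idx (I.erase a) = (S.idx I).erase a := by
  ext i
  simp only [mem_idx, Finset.mem_erase]
  constructor
  · rintro ⟨h, h1, h2⟩
    exact ⟨fun h3 => h1 (Subtype.ext h3), h, h2⟩
  · rintro ⟨h1, h, h2⟩
    exact ⟨h, fun h3 => h1 (congrArg Subtype.val h3), h2⟩

theorem point_mem : S.point ∈ S.carrier := S.nonempty.some_mem

theorem point_mem_interX (I : Finset S.Index) : S.point ∈ L.interX (S.idx I) :=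
  L.mem_interX.2 fun _ hi => (mem_idx.1 hi).1

theorem inter_localArr (c : L.LinChart S.point) (I : Finset S.Index) :
    inter S.localArr I = (inter (kers c.f) (S.idx I)).comap
      (mfd (E := E) (E' := E) c.φ S.point : E →ₗ[ℂ] E) := by
  ext v
  rw [mem_inter, Submodule.mem_comap, mem_inter]
  constructor
  · intro h i hi
    obtain ⟨h1, h2⟩ := mem_idx.1 hi
    have := h _ h2
    rwa [localArr, c.tan_hyp c.mem_source h1] at this
  · intro h i hi
    rw [localArr, c.tan_hyp c.mem_source i.2]
    exact h i (mem_idx.2 ⟨i.2, hi⟩)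

theorem isKer_localArr : IsKer S.localArr := by
  obtain ⟨c⟩ := L.exists_linChart S.point
  intro i
  refine ⟨((c.f i).comp (mfd (E := E) (E' := E) c.φ S.point) : E →L[ℂ] ℂ), ?_⟩
  rw [localArr, c.tan_hyp c.mem_source i.2]
  rfl

include hL

theorem inter_le_localArr_iff (I : Finset S.Index) (a : S.Index) :
    inter S.localArr I ≤ S.localArr a ↔ L.interX (S.idx I) ⊆ L.hyp a := by
  obtain ⟨c⟩ := L.exists_linChart S.point
  rw [S.inter_localArr c, localArr, c.tan_hyp c.mem_source a.2, c.comap_le_comap_iff c.mem_source,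
    c.subset_hyp_iff (hL _) (S.point_mem_interX I)]
  exact (and_iff_right a.2).symm

theorem inter_eq_tan_iff (I : Finset S.Index) :
    inter S.localArr I = tan S.carrier S.point ↔ L.interX (S.idx I) = S.carrier := by
  obtain ⟨c⟩ := L.exists_linChart S.point
  obtain ⟨J, hJ⟩ := S.exists_eq
  have hp : S.point ∈ L.interX J := by rw [hJ]; exact S.point_mem
  have hpI := S.point_mem_interX I
  rw [← hJ, S.inter_localArr c, c.tan_interX c.mem_source hp]
  constructor
  · intro h
    refine subset_antisymm (fun y hy => ?_) fun y hy => ?_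
    · refine L.mem_interX.2 fun a ha => ((c.subset_hyp_iff (hL _) hpI).2 ⟨L.mem_interX.1 hp a ha,
        ?_⟩) hy
      exact ((c.comap_le_comap_iff c.mem_source).1 h.le).trans (inter_le ha)
    · refine L.mem_interX.2 fun a ha => ((c.subset_hyp_iff (hL _) hp).2 ⟨L.mem_interX.1 hpI a ha,
        ?_⟩) hy
      exact ((c.comap_le_comap_iff c.mem_source).1 h.ge).trans (inter_le ha)
  · intro h
    rw [← c.tan_interX c.mem_source hp, ← c.tan_interX c.mem_source hpI, h]

theorem indep_localArr_iff (I : Finset S.Index) :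
    Indep S.localArr I ↔ L.IndepX (S.idx I) := by
  constructor
  · intro h a ha hle
    obtain ⟨h1, h2⟩ := mem_idx.1 ha
    refine h ⟨a, h1⟩ h2 ?_
    rwa [S.inter_le_localArr_iff hL, S.idx_erase (inst := _)]
  · intro h a ha hle
    refine h a (mem_idx.2 ⟨a.2, ha⟩) ?_
    rwa [S.inter_le_localArr_iff hL, S.idx_erase (inst := _)] at hle

/-- A set without broken circuits at the point of the stratum has none in a chart around any other
point `x` of the stratum. A hypersurface that would complete a broken circuit at `x` contains the
intersection of some hypersurfaces of `I`, so it passes through the point of the stratum. -/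
theorem noBrokenForms {I : Finset S.Index} (hI : NoBroken S.localArr I)
    (hS : L.interX (S.idx I) = S.carrier) {x : X} (hx : x ∈ S.carrier) (c : L.LinChart x) :
    NoBrokenForms c.f (S.idx I) := by
  intro i hi hle
  have hsub : (S.idx I).filter (i < ·) ⊆ S.idx I := Finset.filter_subset _ _
  have h1 := (c.subset_hyp_iff (hL _) (L.interX_anti hsub (by rwa [hS]))).2
    ⟨(c.ne_zero_iff i).1 hi, hle⟩
  have hp : S.point ∈ L.hyp i := h1 (L.interX_anti hsub (S.point_mem_interX I))
  refine hI ⟨i, hp⟩ ?_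
  rw [S.inter_le_localArr_iff hL]
  convert h1 using 2
  ext j
  simp only [mem_idx, Finset.mem_filter]
  constructor
  · rintro ⟨h, h1, h2⟩
    exact ⟨⟨h, h1⟩, h2⟩
  · rintro ⟨⟨h, h1⟩, h2⟩
    exact ⟨h, h1, h2⟩

end Stratum

end Hypersurfaces

/-! ### Logarithmic forms in linear charts -/

theorem dlogVec_zero_linear {E : Type} [NormedAddCommGroup E] [NormedSpace ℂ E] {g : E →L[ℂ] ℂ}
    (h : g = 0) (y : E) : dlogVec g y = 0 := by
  ext v
  rw [dlogVec_linear]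
  simp [h]

theorem logMon_eq_zero_of_form_eq_zero {E ι : Type} [NormedAddCommGroup E] [NormedSpace ℂ E]
    [LinearOrder ι] {f : ι → (E →L[ℂ] ℂ)} {I : Finset ι} {i : ι} (hi : i ∈ I) (h : f i = 0)
    {q p : ℕ} (η : E → Alt E q) : logMon f q p I η = 0 := by
  funext y
  rw [logMon, extEval_extMonomial_eq_zero _ hi fun v _ => by
    rw [dlogVec_zero_linear h]; rfl, map_zero]
  rfl

namespace Hypersurfaces

variable {E : Type} [NormedAddCommGroup E] [NormedSpace ℂ E] [FiniteDimensional ℂ E]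
  {X : Type u} [TopologicalSpace X] [ChartedSpace E X] [IsManifold 𝓘(ℂ, E) ω X]
  {l : ℕ} {L : Hypersurfaces E X l} {k p q : ℕ}

namespace LinChart

variable {x : X} (c : L.LinChart x)

/-- In a linear chart a defining equation is the product of the linear equation and of a function
without zeros. -/
theorem exists_eq_mul {j : Fin l} {V : Opens X} (hx : x ∈ V) {F : X → ℂ}
    (hF : L.IsEquation j V F) (hj : c.f j ≠ 0) :
    ∃ h : E → ℂ, AnalyticAt ℂ h (c.φ x) ∧ h (c.φ x) ≠ 0 ∧
      ∀ᶠ y in 𝓝 (c.φ x), (F ∘ c.φ.symm) y = c.f j y * h y := by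
  have := FiniteDimensional.complete ℂ E
  have hg := analyticAt_comp_symm (hF x hx).1 c.mem_atlas c.mem_source
  set g := F ∘ c.φ.symm
  set a := c.φ x
  have hxj := (c.ne_zero_iff j).1 hj
  obtain ⟨v, hv⟩ : ∃ v, c.f j v ≠ 0 := by
    by_contra h
    push Not at h
    exact hj (ContinuousLinearMap.ext h)
  have he : c.f j ((c.f j v)⁻¹ • v) = 1 := by
    rw [map_smul, smul_eq_mul, inv_mul_cancel₀ hv]
  set e := (c.f j v)⁻¹ • v
  obtain ⟨h, hh, hgh⟩ := exists_analyticAt_div hg (c.f j) e (c.apply_center j)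
  have ha : projAlong (c.f j) e a = a := by
    rw [projAlong_apply, c.apply_center, zero_smul, sub_zero]
  have hV : ∀ᶠ y in 𝓝 a, y ∈ c.φ.target ∧ c.φ.symm y ∈ V := by
    have hy := c.φ.map_source c.mem_source
    refine Filter.Eventually.and (c.φ.open_target.mem_nhds hy) ?_
    refine (c.φ.continuousAt_symm hy).eventually ?_
    rw [c.φ.left_inv c.mem_source]
    exact V.isOpen.mem_nhds hx
  have hT : Filter.Tendsto (projAlong (c.f j) e) (𝓝 a) (𝓝 a) := by
    have := (projAlong (c.f j) e).continuous.tendsto a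
    rwa [ha] at this
  have heq : ∀ᶠ y in 𝓝 a, g y = c.f j y * h y := by
    filter_upwards [hgh, hT.eventually hV] with y hy hy'
    have h0 : g (projAlong (c.f j) e y) = 0 := by
      refine ((hF _ hy'.2).2.1).1 ((c.mem_hyp_iff _ (c.φ.map_target hy'.1) j).2 ⟨hj, ?_⟩)
      rw [c.φ.right_inv hy'.1, projAlong_apply, map_sub, map_smul, he, smul_eq_mul, mul_one,
        sub_self]
    rwa [h0, sub_zero, smul_eq_mul] at hy
  refine ⟨h, hh, fun h0 => ?_, heq⟩
  have h1 : HasFDerivAt (fun y => c.f j y * h y) (0 : E →L[ℂ] ℂ) a := by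
    have := (c.f j).hasFDerivAt (x := a) |>.mul hh.differentiableAt.hasFDerivAt
    have h2 : c.f j a • fderiv ℂ h a + h a • c.f j = (0 : E →L[ℂ] ℂ) := by
      ext v
      simp [h0, c.apply_center, a]
    exact h2 ▸ this
  have h2 : fderiv ℂ g a = 0 := (Filter.EventuallyEq.fderiv_eq heq).trans h1.fderiv
  refine (hF x hx).2.2 hxj ?_
  have hFd : MDifferentiableAt 𝓘(ℂ, E) 𝓘(ℂ, ℂ) F x := (hF x hx).1.mdifferentiableAt (by simp)
  have h3 : mfd (E := E) (E' := ℂ) g a = (mfd (E := E) (E' := ℂ) F x).comp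
      (mfd (E := E) (E' := E) c.φ.symm a) := by
    have h4 : MDifferentiableAt 𝓘(ℂ, E) 𝓘(ℂ, ℂ) F (c.φ.symm a) := by
      rwa [c.φ.left_inv c.mem_source]
    rw [mfd_comp a h4 (mdiff_symm c.mem_atlas (c.φ.map_source c.mem_source)),
      c.φ.left_inv c.mem_source]
  rw [mfd_eq_fderiv, h2] at h3
  refine ContinuousLinearMap.ext fun w => ?_
  have h5 := DFunLike.congr_fun h3 (mfd (E := E) (E' := E) c.φ x w)
  have h6 := DFunLike.congr_fun (mfderiv_symm_comp c.mem_atlas c.mem_source) w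
  exact ((congrArg (mfd (E := E) (E' := ℂ) F x) h6).symm.trans h5.symm)

/-- The logarithmic differential of a defining equation differs from that of the linear equation
by a holomorphic form. -/
theorem exists_dlogVec_eq {j : Fin l} {V : Opens X} (hx : x ∈ V) {F : X → ℂ}
    (hF : L.IsEquation j V F) :
    ∃ α : E → (E →L[ℂ] ℂ), AnalyticAt ℂ α (c.φ x) ∧ ∀ᶠ y in 𝓝 (c.φ x), y ∈ offHyp c.f →
      dlogVec (F ∘ c.φ.symm) y = dlogVec (c.f j) y + α y := by
  have hg := analyticAt_comp_symm (hF x hx).1 c.mem_atlas c.mem_source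
  by_cases hj : c.f j = 0
  · refine ⟨_, analyticAt_dlogVec hg fun h0 => ?_, Filter.Eventually.of_forall fun y _ => ?_⟩
    · rw [Function.comp_apply, c.φ.left_inv c.mem_source] at h0
      exact (c.ne_zero_iff j).2 ((hF x hx).2.1.2 h0) hj
    · rw [dlogVec_zero_linear hj, zero_add]
  · obtain ⟨h, hh, h0, heq⟩ := c.exists_eq_mul hx hF hj
    refine ⟨_, analyticAt_dlogVec hh h0, ?_⟩
    filter_upwards [heq.eventually_nhds, hh.eventually_analyticAt,
      hh.continuousAt.eventually_ne h0] with y h1 h2 h3 hy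
    have h4 := ((c.f j).hasFDerivAt (x := y)).mul h2.differentiableAt.hasFDerivAt
    rw [dlogVec, (Filter.EventuallyEq.fderiv_eq h1).trans h4.fderiv, h1.self_of_nhds,
      dlogVec_linear, dlogVec]
    have h5 := hy j hj
    ext v
    simp only [smul_apply, add_apply, smul_eq_mul]
    field_simp
    ring

/-- The equation of `L_j` in the product with `d F / F` may be replaced by the linear equation. -/
theorem chartRep_wedge_mem {j : Fin l} {V : Opens X} (hx : x ∈ V) {F : X → ℂ}
    (hF : L.IsEquation j V F) {ζ : X → Alt E p}
    (h : chartRep c.φ ζ ∈ logSpan c.f {c.φ x} k p) :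
    (chartRep c.φ (fun z => wedgeOne (ζ z) (dlogM F z)) -
      fun y => wedgeOne (chartRep c.φ ζ y) (dlogVec (c.f j) y)) ∈
        logSpan c.f {c.φ x} k (p + 1) := by
  obtain ⟨α, hα, hd⟩ := c.exists_dlogVec_eq hx hF
  refine logSpan_congr (wedgeOne_analytic_mem h (α := α) fun y hy => by
    rwa [Set.mem_singleton_iff.1 hy]) ?_
  rw [nhdsSet_singleton]
  filter_upwards [hd, chartRep_wedge ζ (hF x hx).1 c.mem_atlas c.mem_source] with y h1 h2 hy
  rw [Pi.sub_apply, h2, h1 hy, wedgeOne_add_right]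
  exact add_sub_cancel_left _ _

theorem chartRep_mem_of_holAt {ζ : X → Alt E p} (h : HolAt ζ x) :
    chartRep c.φ ζ ∈ logSpan c.f {c.φ x} 1 p := by
  have := logMon_mem (f := c.f) (A := {c.φ x}) (I := ∅) (k := 1) (p := p) (q := p)
    (η := chartRep c.φ ζ) (by simp) (by simp) (fun y hy => by
      rw [Set.mem_singleton_iff.1 hy]; exact h c.φ c.mem_atlas c.mem_source)
  rwa [logMon_empty] at this

theorem chartRep_mem_of_isMonomial {V : Opens X} (hx : x ∈ V) {I : Finset (Fin l)}
    {ζ : X → Alt E p} (h : L.IsMonomial V I p ζ) :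
    chartRep c.φ ζ ∈ logSpan c.f {c.φ x} (I.card + 1) p := by
  induction h with
  | hol η hη => exact c.chartRep_mem_of_holAt (hη.2 x hx)
  | @wedge I p η h j hj F hF ih =>
    have h1 := c.chartRep_wedge_mem hx hF ih
    have h2 := wedgeOne_dlogVec_mem ih j
    rw [Finset.card_insert_of_notMem fun h => lt_irrefl _ (hj j h)]
    have h3 := add_mem (logSpan_mono (Nat.le_succ _) h1) h2
    rwa [sub_add_cancel] at h3

theorem eventually_chart {P : X → Prop} (h : ∀ᶠ z in 𝓝 x, P z) :
    ∀ᶠ y in 𝓝 (c.φ x), P (c.φ.symm y) := by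
  refine (c.φ.continuousAt_symm (c.φ.map_source c.mem_source)).eventually ?_
  rwa [c.φ.left_inv c.mem_source]

/-- Only the values off the hypersurfaces near the centre of the chart matter. -/
theorem chartRep_mem_congr {ζ ζ' : X → Alt E p} (h : chartRep c.φ ζ' ∈ logSpan c.f {c.φ x} k p)
    (he : ∀ᶠ z in 𝓝 x, z ∉ L.union → ζ z = ζ' z) :
    chartRep c.φ ζ ∈ logSpan c.f {c.φ x} k p := by
  refine logSpan_congr h ?_
  rw [nhdsSet_singleton]
  filter_upwards [c.eventually_chart he,
    c.φ.open_target.mem_nhds (c.φ.map_source c.mem_source)] with y h1 h2 hy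
  rw [chartRep, chartRep, h1]
  rwa [← c.mem_offHyp_iff (c.φ.map_target h2), c.φ.right_inv h2]

theorem chartRep_mem_of_mem_monSpan {V : Opens X} (hx : x ∈ V) {ζ : X → Alt E p}
    (h : ζ ∈ L.monSpan ((k : ℤ) - 1) p V) : chartRep c.φ ζ ∈ logSpan c.f {c.φ x} k p := by
  induction h using Submodule.span_induction with
  | mem ζ h =>
    obtain ⟨I, η, hI, h, rfl⟩ := h
    refine c.chartRep_mem_congr (logSpan_mono (by omega) (c.chartRep_mem_of_isMonomial hx h)) ?_
    filter_upwards [V.isOpen.mem_nhds hx] with z hz hz'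
    exact Set.indicator_of_mem (show z ∈ (V : Set X) \ L.union from ⟨hz, hz'⟩) η
  | zero =>
    have h1 : chartRep c.φ (0 : X → Alt E p) = 0 := by
      have := chartRep_smul c.φ (0 : ℂ) (0 : X → Alt E p)
      rwa [zero_smul, zero_smul] at this
    rw [h1]
    exact zero_mem _
  | add a b _ _ ha hb => exact add_mem ha hb
  | smul r a _ ha => exact Submodule.smul_mem _ r ha

theorem chartRep_mem_of_mem_W {U : Opens X} (hx : x ∈ U) {ζ : X → Alt E p}
    (h : ζ ∈ L.W ((k : ℤ) - 1) p U) : chartRep c.φ ζ ∈ logSpan c.f {c.φ x} k p := by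
  obtain ⟨V, hxV, -, h⟩ := h.2 x hx
  refine c.chartRep_mem_congr (c.chartRep_mem_of_mem_monSpan hxV h) ?_
  filter_upwards [V.isOpen.mem_nhds hxV] with z hz hz'
  exact (Set.indicator_of_mem (show z ∈ (V : Set X) \ L.union from ⟨hz, hz'⟩) ζ).symm

end LinChart

/-- The form `η ∧ ω_I`, in degree `p`, where `ω_i = d F_i / F_i`. -/
def monM {κ : Type} [LinearOrder κ] (F : κ → X → ℂ) (q p : ℕ) (I : Finset κ) (η : X → Alt E q)
    (z : X) : Alt E p :=
  wedgeExt q p (extEval (fun i => dlogM (F i) z) (extMonomial I)) (η z)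

theorem monM_empty {κ : Type} [LinearOrder κ] (F : κ → X → ℂ) (η : X → Alt E q) :
    monM F q q ∅ η = η := by
  funext z
  rw [monM, extMonomial_empty, map_one, wedgeExt_one]

theorem monM_insert_max {κ : Type} [LinearOrder κ] (F : κ → X → ℂ) {j : κ} {I : Finset κ}
    (h : ∀ i ∈ I, i < j) (η : X → Alt E q) :
    monM F q (p + 1) (insert j I) η = fun z => wedgeOne (monM F q p I η z) (dlogM (F j) z) :=
  funext fun _ => wedgeExt_extMonomial_insert_max _ h _

theorem isMonomial_monM {V : Opens X} {F : Fin l → X → ℂ} {I : Finset (Fin l)}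
    (hF : ∀ i ∈ I, L.IsEquation i V (F i)) {η : X → Alt E q} (hη : η ∈ HolOn (V : Set X) q)
    (hp : q + I.card = p) : L.IsMonomial V I p (monM F q p I η) := by
  induction I using Finset.induction_on_max generalizing p with
  | empty =>
    obtain rfl : q = p := by simpa using hp
    rw [monM_empty]
    exact .hol η hη
  | insert j I hj ih =>
    have hjI : j ∉ I := fun h => lt_irrefl _ (hj j h)
    rw [Finset.card_insert_of_notMem hjI] at hp
    obtain ⟨p, rfl⟩ : ∃ p', p = p' + 1 := ⟨q + I.card, by omega⟩
    rw [monM_insert_max F hj]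
    exact .wedge (ih (fun i hi => hF i (Finset.mem_insert_of_mem hi)) (by omega)) j hj _
      (hF j (Finset.mem_insert_self j I))

namespace LinChart

variable {x : X} (c : L.LinChart x)

/-- Modulo forms with fewer poles, the form `η ∧ ω_I` does not depend on the choice of the
equations. -/
theorem chartRep_monM_sub_mem {V : Opens X} (hx : x ∈ V) {F : Fin l → X → ℂ}
    {I : Finset (Fin l)} (hF : ∀ i ∈ I, L.IsEquation i V (F i)) {η : X → Alt E q}
    (hη : HolAt η x) (hp : q + I.card = p) :
    chartRep c.φ (monM F q p I η) - logMon c.f q p I (chartRep c.φ η) ∈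
      logSpan c.f {c.φ x} I.card p := by
  induction I using Finset.induction_on_max generalizing p with
  | empty =>
    obtain rfl : q = p := by simpa using hp
    rw [monM_empty, logMon_empty, sub_self]
    exact zero_mem _
  | insert j I hj ih =>
    have hjI : j ∉ I := fun h => lt_irrefl _ (hj j h)
    rw [Finset.card_insert_of_notMem hjI] at hp ⊢
    obtain ⟨p, rfl⟩ : ∃ p', p = p' + 1 := ⟨q + I.card, by omega⟩
    have h1 := ih (fun i hi => hF i (Finset.mem_insert_of_mem hi)) (show q + I.card = p by omega)
    have h2 : logMon c.f q p I (chartRep c.φ η) ∈ logSpan c.f {c.φ x} (I.card + 1) p :=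
      logMon_mem (Nat.lt_succ_self _) (by omega) fun y hy => by
        rw [Set.mem_singleton_iff.1 hy]; exact hη c.φ c.mem_atlas c.mem_source
    have h3 : chartRep c.φ (monM F q p I η) ∈ logSpan c.f {c.φ x} (I.card + 1) p := by
      have := add_mem (logSpan_mono (Nat.le_succ _) h1) h2
      rwa [sub_add_cancel] at this
    have h4 := c.chartRep_wedge_mem hx (hF j (Finset.mem_insert_self j I)) h3
    have h5 := wedgeOne_dlogVec_mem h1 j
    rw [monM_insert_max F hj, logMon_insert_max hj]
    convert add_mem h4 h5 using 1
    funext y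
    have h6 : wedgeOne (chartRep c.φ (monM F q p I η) y) (dlogVec (c.f j) y) =
        wedgeOne ((chartRep c.φ (monM F q p I η) - logMon c.f q p I (chartRep c.φ η)) y)
          (dlogVec (c.f j) y) +
        wedgeOne (logMon c.f q p I (chartRep c.φ η) y) (dlogVec (c.f j) y) := by
      rw [← wedgeOne_add_left, Pi.sub_apply, sub_add_cancel]
    simp only [Pi.sub_apply, Pi.add_apply]
    rw [h6]
    simp only [Pi.sub_apply]
    abel

theorem dlogM_linear {z : X} (hz : z ∈ c.φ.source) (i : Fin l) :
    dlogM (c.f i ∘ c.φ) z =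
      (dlogVec (c.f i) (c.φ z)).comp (mfd (E := E) (E' := E) c.φ z) := by
  rw [dlogM, mfd_comp z (c.f i).differentiableAt.mdifferentiableAt (mdiff_chart c.mem_atlas hz),
    mfd_eq_fderiv, dlogVec]
  rfl

theorem isEquation_linear {V : Opens X} (hV : (V : Set X) ⊆ c.φ.source) {i : Fin l}
    (hi : c.f i ≠ 0) : L.IsEquation i V (c.f i ∘ c.φ) := by
  intro z hz
  have hz' := hV hz
  refine ⟨(c.f i).contMDiff.contMDiffAt.comp z ((contMDiffOn_of_mem_maximalAtlas
    c.mem_atlas).contMDiffAt (c.φ.open_source.mem_nhds hz')), ?_, fun _ h0 => hi ?_⟩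
  · rw [c.mem_hyp_iff z hz']
    exact and_iff_right hi
  · rw [mfd_comp z (c.f i).differentiableAt.mdifferentiableAt (mdiff_chart c.mem_atlas hz'),
      mfd_eq_fderiv, (c.f i).fderiv] at h0
    ext w
    obtain ⟨v, rfl⟩ := (mfd_chart_bijective c.mem_atlas hz').2 w
    exact DFunLike.congr_fun h0 v

theorem ofChart_logMon {z : X} (hz : z ∈ c.φ.source) {I : Finset (Fin l)} (hp : q + I.card = p)
    (η : E → Alt E q) : ofChart c.φ (logMon c.f q p I η) z =
      monM (fun i => c.f i ∘ c.φ) q p I (ofChart c.φ η) z := by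
  subst hp
  rw [ofChart, logMon_eq_wedgeTuple rfl, wedgeTuple_pull, monM, wedgeExt_extMonomial _ _ rfl]
  simp only [c.dlogM_linear hz]
  rfl

/-- A form on the model space with fewer than `k` poles at the centre of the chart comes from a form
with fewer than `k` poles on an open set of the manifold. -/
theorem exists_cut_mem_monSpan {ξ : E → Alt E p} (h : ξ ∈ logSpan c.f {c.φ x} k p) :
    ∃ V : Opens X, x ∈ V ∧ L.cut p V (ofChart c.φ ξ) ∈ L.monSpan ((k : ℤ) - 1) p V := by
  let U : Opens X := ⟨c.φ.source, c.φ.open_source⟩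
  refine logSpan_induction (P := fun ξ => ∃ V : Opens X, x ∈ V ∧
    L.cut p V (ofChart c.φ ξ) ∈ L.monSpan ((k : ℤ) - 1) p V) (fun I q η hI hp hη => ?_) ?_
    (fun a b ha hb => ?_) (fun r a ha => ?_) (fun ζ ζ' h he => ?_) h
  · by_cases hz : ∃ i ∈ I, c.f i = 0
    · obtain ⟨i, hi, h0⟩ := hz
      refine ⟨U, c.mem_source, ?_⟩
      have h2 : ofChart c.φ (logMon c.f q p I η) = 0 := by
        rw [logMon_eq_zero_of_form_eq_zero hi h0]; rfl
      rw [h2, map_zero]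
      exact zero_mem _
    · push Not at hz
      have ha : ∀ᶠ z in 𝓝 x, AnalyticAt ℂ η (c.φ z) ∧ z ∈ c.φ.source :=
        ((c.φ.continuousAt c.mem_source).eventually
          (hη _ (Set.mem_singleton _)).eventually_analyticAt).and
            (c.φ.open_source.mem_nhds c.mem_source)
      obtain ⟨V, hV, hVo, hxV⟩ := eventually_nhds_iff.1 ha
      let V' : Opens X := ⟨V, hVo⟩
      have hhol : V.indicator (ofChart c.φ η) ∈ HolOn V q :=
        ⟨fun _ hz => Set.indicator_of_notMem hz _, fun z hz =>
          (HolAt.ofChart c.mem_atlas (hV z hz).2 (hV z hz).1).congr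
            (eventually_indicator hVo hz _)⟩
      have hmon := isMonomial_monM (L := L) (V := V') (F := fun i => c.f i ∘ c.φ) (I := I)
        (fun i hi => c.isEquation_linear (fun z hz => (hV z hz).2) (hz i hi)) hhol hp
      refine ⟨V', hxV, Submodule.subset_span ⟨I, _, by omega, hmon, ?_⟩⟩
      refine Set.indicator_congr fun z hz => ?_
      rw [c.ofChart_logMon (hV z hz.1).2 hp, monM, monM,
        Set.indicator_of_mem (show z ∈ V from hz.1)]
  · refine ⟨U, c.mem_source, ?_⟩
    have h2 : ofChart c.φ (0 : E → Alt E p) = 0 := rfl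
    rw [h2, map_zero]
    exact zero_mem _
  · obtain ⟨V, hxV, h⟩ := ha
    obtain ⟨V', hxV', h'⟩ := hb
    refine ⟨V ⊓ V', ⟨hxV, hxV'⟩, ?_⟩
    have h2 : ofChart c.φ (a + b) = ofChart c.φ a + ofChart c.φ b := rfl
    rw [h2, map_add, ← L.cut_cut p (inf_le_left : V ⊓ V' ≤ V),
      ← L.cut_cut p (inf_le_right : V ⊓ V' ≤ V') (ofChart c.φ b)]
    exact add_mem (L.monSpan_mono inf_le_left h) (L.monSpan_mono inf_le_right h')
  · obtain ⟨V, hxV, h⟩ := ha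
    refine ⟨V, hxV, ?_⟩
    have h2 : ofChart c.φ (r • a) = r • ofChart c.φ a := rfl
    rw [h2, map_smul]
    exact Submodule.smul_mem _ r h
  · obtain ⟨V, hxV, h⟩ := h
    rw [nhdsSet_singleton] at he
    obtain ⟨V', hV', hVo, hxV'⟩ := eventually_nhds_iff.1
      (((c.φ.continuousAt c.mem_source).eventually he).and
        (c.φ.open_source.mem_nhds c.mem_source))
    refine ⟨V ⊓ ⟨V', hVo⟩, ⟨hxV, hxV'⟩, ?_⟩
    convert L.monSpan_mono (inf_le_left : V ⊓ ⟨V', hVo⟩ ≤ V) h using 1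
    rw [L.cut_cut p inf_le_left]
    refine Set.indicator_congr fun z hz => ?_
    have h1 := hV' z hz.1.2
    rw [ofChart, ofChart, h1.1 ((c.mem_offHyp_iff h1.2).2 hz.2)]

theorem exists_cut_mem {ζ : X → Alt E p} (h : chartRep c.φ ζ ∈ logSpan c.f {c.φ x} k p)
    {U : Opens X} (hx : x ∈ U) :
    ∃ V : Opens X, x ∈ V ∧ V ≤ U ∧ L.cut p V ζ ∈ L.monSpan ((k : ℤ) - 1) p V := by
  obtain ⟨V, hxV, h⟩ := c.exists_cut_mem_monSpan h
  refine ⟨V ⊓ (U ⊓ ⟨c.φ.source, c.φ.open_source⟩), ⟨hxV, hx, c.mem_source⟩,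
    inf_le_right.trans inf_le_left, ?_⟩
  convert L.monSpan_mono (inf_le_left : V ⊓ (U ⊓ ⟨c.φ.source, c.φ.open_source⟩) ≤ V) h using 1
  rw [L.cut_cut p inf_le_left]
  refine Set.indicator_congr fun z hz => ?_
  rw [ofChart_chartRep c.mem_atlas ζ hz.1.2.2]

end LinChart

/-- Membership in `W_{k - 1}` may be checked in one linear chart around each point. -/
theorem mem_W_of_chartRep_mem {U : Opens X} {ζ : X → Alt E p}
    (h0 : ∀ z ∉ (U : Set X) \ L.union, ζ z = 0)
    (h : ∀ x ∈ U, ∃ c : L.LinChart x, chartRep c.φ ζ ∈ logSpan c.f {c.φ x} k p) :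
    ζ ∈ L.W ((k : ℤ) - 1) p U :=
  ⟨h0, fun x hx => by
    obtain ⟨c, hc⟩ := h x hx
    exact c.exists_cut_mem hc hx⟩

theorem W_le_of_lt {U : Opens X} (h : p < k) : L.W (k : ℤ) p U ≤ L.W ((k : ℤ) - 1) p U := by
  intro ζ hζ
  refine ⟨hζ.1, fun x hx => ?_⟩
  obtain ⟨V, hxV, hV, hζ⟩ := hζ.2 x hx
  refine ⟨V, hxV, hV, ?_⟩
  have hcard : ∀ {I : Finset (Fin l)} {p : ℕ} {η : X → Alt E p}, L.IsMonomial V I p η →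
      I.card ≤ p := by
    intro I p η h
    induction h with
    | hol η hη => simp
    | wedge h j hj f hf ih => exact (Finset.card_insert_le _ _).trans (by omega)
  refine Submodule.span_mono ?_ hζ
  rintro _ ⟨I, η, hI, h', rfl⟩
  have := hcard h'
  exact ⟨I, η, by omega, h', rfl⟩

end Hypersurfaces

/-! ### The residue map at a point of a manifold -/

theorem extEval_extMonomial_map {E ι κ : Type} [NormedAddCommGroup E] [NormedSpace ℂ E]
    [LinearOrder ι] [LinearOrder κ] {e : κ ↪ ι} (he : StrictMono e) {θ : ι → (E →L[ℂ] ℂ)}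
    {θ' : κ → (E →L[ℂ] ℂ)} {I : Finset κ} (h : ∀ i ∈ I, θ' i = θ (e i)) :
    extEval θ' (extMonomial I) = extEval θ (extMonomial (I.map e)) := by
  induction I using Finset.induction_on_max with
  | empty => rw [Finset.map_empty, extMonomial_empty, extMonomial_empty, map_one, map_one]
  | insert j I hj ih =>
    rw [Finset.map_insert, extMonomial_insert_max hj, extMonomial_insert_max fun i hi => by
      obtain ⟨a, ha, rfl⟩ := Finset.mem_map.1 hi
      exact he (hj a ha), map_mul, map_mul, ih fun i hi => h i (Finset.mem_insert_of_mem hi),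
      extEval_extGen, extEval_extGen, h j (Finset.mem_insert_self j I)]

/-- If a dependent set becomes independent without `b`, then the hyperplane `H b` contains the
intersection of the others. -/
theorem Indep.inter_erase_le {E ι : Type} [AddCommGroup E] [Module ℂ E] [FiniteDimensional ℂ E]
    [LinearOrder ι] {H : ι → Submodule ℂ E} (hH : IsKer H) {I : Finset ι} {b : ι} (hb : b ∈ I)
    (hI : ¬ Indep H I) (h : Indep H (I.erase b)) : inter H (I.erase b) ≤ H b := by
  by_contra hle
  have h1 := codim_inter_insert hH hle
  rw [Finset.insert_erase hb, (codim_inter_eq_iff hH _).2 h, Finset.card_erase_add_one hb] at h1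
  exact hI ((codim_inter_eq_iff hH I).1 h1)

namespace Hypersurfaces

variable {E : Type} [NormedAddCommGroup E] [NormedSpace ℂ E] [FiniteDimensional ℂ E]
  {X : Type u} [TopologicalSpace X] [ChartedSpace E X] [IsManifold 𝓘(ℂ, E) ω X]
  {l : ℕ} {L : Hypersurfaces E X l} {k p q : ℕ}

namespace Stratum

variable (S : L.Stratum k)

theorem isClosed : IsClosed S.carrier := by
  obtain ⟨I, hI⟩ := S.exists_eq
  rw [← hI]
  exact isClosed_biInter fun i _ => L.isClosed_hyp i

theorem extEval_idx {θ : Fin l → (E →L[ℂ] ℂ)} {θ' : S.Index → (E →L[ℂ] ℂ)}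
    {I : Finset S.Index} (h : ∀ i ∈ I, θ' i = θ i) :
    extEval θ' (extMonomial I) = extEval θ (extMonomial (S.idx I)) :=
  extEval_extMonomial_map (e := Function.Embedding.subtype _) (fun _ _ h => h) h

variable {x : X} (c : L.LinChart x)

open scoped Classical in
/-- The linear equations, in a chart around a point of a stratum, of the hypersurfaces that contain
the stratum. The other hypersurfaces get the form zero: their equations at two points of the
stratum may satisfy different relations. -/
def forms (i : S.Index) : E →L[ℂ] ℂ := if S.carrier ⊆ L.hyp i then c.f i else 0

theorem forms_eq {i : S.Index} (h : S.carrier ⊆ L.hyp i) : S.forms c i = c.f i := if_pos h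

theorem forms_eq_zero {i : S.Index} (h : ¬ S.carrier ⊆ L.hyp i) : S.forms c i = 0 := if_neg h

theorem mem_offHyp_forms {y : E} (hy : y ∈ offHyp c.f) : y ∈ offHyp (S.forms c) := by
  intro i hi
  by_cases h : S.carrier ⊆ L.hyp i
  · rw [S.forms_eq c h] at hi ⊢
    exact hy i hi
  · exact absurd (S.forms_eq_zero c h) hi

theorem extEval_forms_eq_zero {I : Finset S.Index} {i : S.Index} (hi : i ∈ I)
    (h : ¬ S.carrier ⊆ L.hyp i) (y : E) :
    extEval (fun i => dlogVec (S.forms c i) y) (extMonomial I) = 0 :=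
  extEval_extMonomial_eq_zero _ hi fun v _ => by
    rw [dlogVec_zero_linear (S.forms_eq_zero c h)]; rfl

variable (hL : ∀ I : Finset (Fin l), _root_.IsPreconnected (L.interX I))

include hL

theorem not_indep_forms (hx : x ∈ S.carrier) {I : Finset S.Index}
    (hI : ∀ i ∈ I, S.carrier ⊆ L.hyp i) (h : ¬ Indep S.localArr I) :
    ¬ Indep (kers (S.forms c)) I := by
  intro h'
  refine h fun a ha hle => h' a ha fun v hv => ?_
  rw [S.inter_le_localArr_iff hL] at hle
  have h1 := (c.subset_hyp_iff (hL _) (L.mem_interX.2 fun i hi => by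
    obtain ⟨h1, h2⟩ := mem_idx.1 hi
    exact hI _ (Finset.mem_of_mem_erase h2) hx)).1 hle
  rw [mem_kers, S.forms_eq c (hI a ha)]
  refine h1.2 (mem_inter.2 fun i hi => ?_)
  obtain ⟨h2, h3⟩ := mem_idx.1 hi
  have h4 := mem_inter.1 hv _ h3
  rwa [mem_kers, S.forms_eq c (hI _ (Finset.mem_of_mem_erase h3))] at h4

/-- The Orlik-Solomon relations of the arrangement at the point of the stratum hold in the chart
around `x`. -/
theorem extEval_forms_extDelta (hx : x ∈ S.carrier) {I : Finset S.Index}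
    (hI : codim (inter S.localArr I) < I.card) {y : E} (hy : y ∈ offHyp c.f) :
    extEval (fun i => dlogVec (S.forms c i) y) (extDelta I) = 0 := by
  have hdep := (codim_inter_lt_iff S.isKer_localArr I).1 hI
  by_cases hall : ∀ i ∈ I, S.carrier ⊆ L.hyp i
  · refine extEval_dlogVec_extDelta (S.mem_offHyp_forms c hy) (fun i hi => ?_)
      (S.not_indep_forms c hL hx hall hdep)
    rw [S.forms_eq c (hall i hi)]
    exact (c.ne_zero_iff i).2 (hall i hi hx)
  · push Not at hall
    -- The form of `b` is zero, so only the term of `δ` without `b` could be different from zero. It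
    -- vanishes too: the form of another element is zero, or the other elements are dependent. For
    -- if the others contain the stratum and are independent, then `b` contains the stratum as well.
    obtain ⟨b, hb, hbS⟩ := hall
    rw [extDelta, map_sum]
    refine Finset.sum_eq_zero fun s _ => ?_
    rw [map_smul]
    convert smul_zero _
    set i := I.orderEmbOfFin rfl s
    by_cases hib : i = b
    · rw [hib]
      by_cases hall' : ∀ i ∈ I.erase b, S.carrier ⊆ L.hyp i
      · refine extEval_dlogVec_eq_zero (S.mem_offHyp_forms c hy)
          (S.not_indep_forms c hL hx hall' fun hind => hbS ?_)
        have hle : inter S.localArr (I.erase b) ≤ S.localArr b :=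
          Indep.inter_erase_le S.isKer_localArr hb hdep hind
        rw [S.inter_le_localArr_iff hL] at hle
        refine subset_trans (fun z hz => L.mem_interX.2 fun j hj => ?_) hle
        obtain ⟨h1, h2⟩ := mem_idx.1 hj
        exact hall' _ h2 hz
      · push Not at hall'
        obtain ⟨j, hj, hjS⟩ := hall'
        exact S.extEval_forms_eq_zero c hj hjS y
    · exact S.extEval_forms_eq_zero c (Finset.mem_erase.2 ⟨Ne.symm hib, hb⟩) hbS y

/-- If the form `η` vanishes on the stratum, then `η ∧ ω_I` is a combination of forms with fewer
poles. -/
theorem logMon_mem_of_resT_eq_zero (hp : q + k = p) (hx : x ∈ S.carrier) {I : Finset (Fin l)}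
    (hI : L.interX I = S.carrier) {η : X → Alt E q} (hη : HolAt η x)
    (h0 : ∀ᶠ z in 𝓝 x, z ∈ S.carrier → resT S.carrier η z = 0) :
    logMon c.f q p I (chartRep c.φ η) ∈ logSpan c.f {c.φ x} k p := by
  have hxI : x ∈ L.interX I := by rwa [hI]
  refine logMon_mem_of_vanish_of_codim c.projStable ?_ hp (fun y hy => ?_) ?_
  · rw [← c.codim_tan c.mem_source hxI, hI]
    exact S.codim_eq x hx
  · rw [Set.mem_singleton_iff.1 hy]
    exact hη c.φ c.mem_atlas c.mem_source
  · rw [nhdsSet_singleton]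
    filter_upwards [c.eventually_chart h0,
      c.φ.open_target.mem_nhds (c.φ.map_source c.mem_source)] with y h1 hy hyI
    have hz := c.φ.map_target hy
    have hzI : c.φ.symm y ∈ L.interX I := by
      rw [c.mem_interX_iff hxI hz, c.φ.right_inv hy]
      exact hyI
    have h2 := h1 (by rwa [hI] at hzI)
    have h3 : ∀ v ∈ inter (kers c.f) I,
        mfd (E := E) (E' := E) c.φ.symm y v ∈ tan (E := E) S.carrier (c.φ.symm y) := by
      intro v hv
      rw [← hI, c.tan_interX hz hzI, Submodule.mem_comap]
      have h4 := DFunLike.congr_fun (mfderiv_comp_symm c.mem_atlas hy) v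
      have h5 : mfd (E := E) (E' := E) c.φ (c.φ.symm y)
        (mfd (E := E) (E' := E) c.φ.symm y v) = v := h4
      exact (congrArg (· ∈ inter (kers c.f) I) h5).mpr hv
    ext v
    exact DFunLike.congr_fun h2 fun i => ⟨_, h3 (v i) (v i).2⟩

/-- Conversely, if `η` vanishes in a chart on the intersection of hyperplanes that corresponds to
the stratum, it vanishes on the stratum. -/
theorem resT_eq_zero_of_pull {I : Finset (Fin l)} (hx : x ∈ S.carrier)
    (hI : L.interX I = S.carrier) {η : X → Alt E q}
    (h0 : pull (chartRep c.φ η (c.φ x)) (inter (kers c.f) I).subtypeL = 0) :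
    resT S.carrier η x = 0 := by
  have hxI : x ∈ L.interX I := by rwa [hI]
  have h1 : ∀ v ∈ tan (E := E) S.carrier x,
      mfd (E := E) (E' := E) c.φ x v ∈ inter (kers c.f) I := fun v hv => by
    rw [← hI, c.tan_interX c.mem_source hxI] at hv
    exact hv
  ext v
  have h2 := DFunLike.congr_fun h0 fun i => ⟨_, h1 (v i) (v i).2⟩
  refine Eq.trans ?_ h2
  change η x _ = ofChart c.φ (chartRep c.φ η) x _
  rw [ofChart_chartRep c.mem_atlas η c.mem_source]
  rfl

/-- The map `η ⊗ e_I ↦ η̃ ∧ ω_I` near a point of the stratum, with values modulo forms with fewer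
poles in a chart. -/
theorem exists_pointMap (hp : q + k = p) (hx : x ∈ S.carrier) {U : Opens X} (hxU : x ∈ U) :
    ∃ B : TensQ (HolS (E := E) S.carrier q U) S.A →ₗ[ℂ]
        (E → Alt E p) ⧸ logSpan c.f {c.φ x} k p,
      ∀ (m : HolS (E := E) S.carrier q U) (η : X → Alt E q) (I : Finset S.Index)
        (hI : inter S.localArr I = tan S.carrier S.point), HolAt η x →
        (∀ᶠ z in 𝓝 x, z ∈ S.carrier → m.1 z = resT S.carrier η z) →
        B (TensQ.tmul m (osGen S.localArr I hI)) =
          logMk c.f {c.φ x} k p (logMon c.f q p (S.idx I) (chartRep c.φ η)) := by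
  have hmon : ∀ (n : E → Alt E q) (I : Finset S.Index),
      inter S.localArr I = tan S.carrier S.point →
      logMon (S.forms c) q p I n = logMon c.f q p (S.idx I) n := by
    intro n I hI
    rw [S.inter_eq_tan_iff hL] at hI
    funext y
    rw [logMon, logMon, S.extEval_idx (θ := fun i => dlogVec (c.f i) y) fun i hi => ?_]
    rw [S.forms_eq c]
    rw [← hI]
    exact fun z hz => L.mem_interX.1 hz i (mem_idx.2 ⟨i.2, hi⟩)
  obtain ⟨B, hB⟩ := exists_logMap (M := HolS (E := E) S.carrier q U) (H := S.localArr)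
    (T := tan S.carrier S.point) (f := c.f) (A := {c.φ x}) (k := k) (p := p) (q := q)
    (Rep := fun m n => ∃ η : X → Alt E q, HolAt η x ∧
      (∀ᶠ z in 𝓝 x, z ∈ S.carrier → m.1 z = resT S.carrier η z) ∧ n = chartRep c.φ η)
    (S.forms c) (fun I hI y hy => S.extEval_forms_extDelta c hL hx hI hy)
    (fun m => by
      obtain ⟨V, η, hxV, -, hη⟩ := m.2.2 x ⟨hx, hxU⟩
      refine ⟨_, η, hη.1.2 x hxV, ?_, rfl⟩
      filter_upwards [V.isOpen.mem_nhds hxV] with z hz hzS using hη.2 z ⟨hzS, hz⟩)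
    (by
      rintro m _ m' _ ⟨η, h1, h2, rfl⟩ ⟨η', h1', h2', rfl⟩
      refine ⟨η + η', h1.add h1', ?_, rfl⟩
      filter_upwards [h2, h2'] with z h3 h3' hz
      have h4 : (m + m').1 z = m.1 z + m'.1 z := rfl
      rw [h4, h3 hz, h3' hz]
      rfl)
    (by
      rintro r m _ ⟨η, h1, h2, rfl⟩
      refine ⟨r • η, h1.smul r, ?_, rfl⟩
      filter_upwards [h2] with z h3 hz
      have h4 : (r • m).1 z = r • m.1 z := rfl
      rw [h4, h3 hz]
      rfl)
    (by
      rintro _ ⟨η, h1, h2, rfl⟩ I hI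
      rw [hmon _ I hI]
      refine S.logMon_mem_of_resT_eq_zero c hL hp hx ((S.inter_eq_tan_iff hL I).1 hI) h1 ?_
      filter_upwards [h2] with z h3 hz using (h3 hz).symm)
  exact ⟨B, fun m η I hI h1 h2 => (hB m _ I hI ⟨η, h1, h2, rfl⟩).trans (by rw [hmon _ I hI])⟩

end Stratum

theorem finite_stratum (L : Hypersurfaces E X l) (k : ℕ) : Finite (L.Stratum k) :=
  Finite.of_injective (fun S : L.Stratum k => S.exists_eq.choose) fun S S' h => by
    have h1 : S.carrier = S'.carrier := by
      rw [← S.exists_eq.choose_spec, ← S'.exists_eq.choose_spec]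
      exact congrArg _ h
    cases S
    cases S'
    cases h1
    rfl

open scoped Classical in
/-- The element `η ⊗ e_I` of the summand of the stratum `S`. -/
abbrev gen {U : Opens X} (S : L.Stratum k) (η : HolS (E := E) S.carrier q U)
    (I : Finset S.Index) (hI : inter S.localArr I = tan S.carrier S.point) : L.GObj k q U :=
  DirectSum.lof ℂ (L.Stratum k) (fun S => TensQ (HolS (E := E) S.carrier q U) S.A) S
    (TensQ.tmul η (osGen S.localArr I hI))

variable {x : X} (c : L.LinChart x)

open scoped Classical in
/-- The linear map `Θ` maps `η ⊗ e_I` to the class of `η̃ ∧ ω_I` near the point `x`, and it kills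
the summands of the strata that do not contain `x`. -/
def IsPointMap {U : Opens X}
    (Θ : L.GObj k q U →ₗ[ℂ] (E → Alt E p) ⧸ logSpan c.f {c.φ x} k p) : Prop :=
  (∀ (S : L.Stratum k) (m : HolS (E := E) S.carrier q U) (η : X → Alt E q)
    (I : Finset S.Index) (hI : inter S.localArr I = tan S.carrier S.point),
    x ∈ S.carrier → HolAt η x →
    (∀ᶠ z in 𝓝 x, z ∈ S.carrier → m.1 z = resT S.carrier η z) →
    Θ (gen S m I hI) =
      logMk c.f {c.φ x} k p (logMon c.f q p (S.idx I) (chartRep c.φ η))) ∧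
  ∀ (S : L.Stratum k) (t : TensQ (HolS (E := E) S.carrier q U) S.A), x ∉ S.carrier →
    Θ (DirectSum.lof ℂ (L.Stratum k)
      (fun S => TensQ (HolS (E := E) S.carrier q U) S.A) S t) = 0

variable (hL : ∀ I : Finset (Fin l), _root_.IsPreconnected (L.interX I))

include hL

theorem exists_isPointMap (hp : q + k = p) {U : Opens X} (hxU : x ∈ U) :
    ∃ Θ : L.GObj k q U →ₗ[ℂ] (E → Alt E p) ⧸ logSpan c.f {c.φ x} k p, IsPointMap c Θ := by
  classical
  have h : ∀ S : L.Stratum k, ∃ B : TensQ (HolS (E := E) S.carrier q U) S.A →ₗ[ℂ]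
        (E → Alt E p) ⧸ logSpan c.f {c.φ x} k p,
      (∀ (m : HolS (E := E) S.carrier q U) (η : X → Alt E q) (I : Finset S.Index)
        (hI : inter S.localArr I = tan S.carrier S.point), x ∈ S.carrier → HolAt η x →
        (∀ᶠ z in 𝓝 x, z ∈ S.carrier → m.1 z = resT S.carrier η z) →
        B (TensQ.tmul m (osGen S.localArr I hI)) =
          logMk c.f {c.φ x} k p (logMon c.f q p (S.idx I) (chartRep c.φ η))) ∧
      (x ∉ S.carrier → B = 0) := by
    intro S
    by_cases hx : x ∈ S.carrier
    · obtain ⟨B, hB⟩ := S.exists_pointMap c hL hp hx hxU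
      exact ⟨B, fun m η I hI _ => hB m η I hI, fun h => absurd hx h⟩
    · exact ⟨0, fun m η I hI h => absurd h hx, fun _ => rfl⟩
  choose B hB hB0 using h
  refine ⟨DirectSum.toModule ℂ (L.Stratum k) _ B, fun S m η I hI hx hη h => ?_,
    fun S t hx => ?_⟩
  · exact (DirectSum.toModule_lof ℂ S _).trans (hB S m η I hI hx hη h)
  · exact (DirectSum.toModule_lof ℂ S _).trans (by rw [hB0 S hx]; rfl)

end Hypersurfaces

/-! ### The relation between the two presheaves -/

namespace Hypersurfaces

variable {E : Type} [NormedAddCommGroup E] [NormedSpace ℂ E] [FiniteDimensional ℂ E]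
  {X : Type u} [TopologicalSpace X] [ChartedSpace E X] [IsManifold 𝓘(ℂ, E) ω X]
  {l : ℕ} {L : Hypersurfaces E X l} {k p q : ℕ}
  (hL : ∀ I : Finset (Fin l), _root_.IsPreconnected (L.interX I))

include hL in
open scoped Classical in
/-- A section that is killed by the residue maps of all points is zero, because the monomials
without broken circuits span. -/
theorem eq_zero_of_pointMaps (hp : q + k = p) {U : Opens X} {g : L.GObj k q U}
    (h : ∀ x ∈ U, ∃ (c : L.LinChart x)
      (Θ : L.GObj k q U →ₗ[ℂ] (E → Alt E p) ⧸ logSpan c.f {c.φ x} k p),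
      IsPointMap c Θ ∧ Θ g = 0) : g = 0 := by
  subst hp
  have := L.finite_stratum k
  have := Fintype.ofFinite (L.Stratum k)
  have hN : ∀ S : L.Stratum k, Fintype (NbcSet S.localArr (tan (E := E) S.carrier S.point)) :=
    fun S => Fintype.ofFinite _
  choose m hm using fun S : L.Stratum k => TensQ.exists_sum (M := HolS (E := E) S.carrier q U)
    (fun J : NbcSet S.localArr (tan (E := E) S.carrier S.point) =>
      osGen S.localArr J.1 J.2.2.2)
    (mem_span_osGen_nbc S.isKer_localArr (tan (E := E) S.carrier S.point)) (g S)
  have h1 : g = ∑ S : L.Stratum k, DirectSum.lof ℂ (L.Stratum k)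
      (fun S => TensQ (HolS (E := E) S.carrier q U) S.A) S
        (∑ J : NbcSet S.localArr (tan (E := E) S.carrier S.point),
          TensQ.tmul (m S J) (osGen S.localArr J.1 J.2.2.2)) := by
    refine (DirectSum.sum_univ_of g).symm.trans (Finset.sum_congr rfl fun S _ => ?_)
    exact congrArg _ (hm S)
  -- The coefficients vanish at every point `x`: the strata that contain `x` contribute a sum of
  -- forms in a chart around `x`, to which the independence of the monomials without broken circuits
  -- applies.
  have hm0 : ∀ S J, m S J = 0 := by
    intro S J
    refine Subtype.ext <| funext fun x => ?_
    by_cases hx : x ∈ S.carrier ∩ U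
    swap
    · exact (m S J).2.1 x hx
    obtain ⟨c, Θ, hΘ, h0⟩ := h x hx.2
    have hη : ∀ (S : L.Stratum k) (J : NbcSet S.localArr (tan (E := E) S.carrier S.point)),
        ∃ η : X → Alt E q, x ∈ S.carrier → HolAt η x ∧
          ∀ᶠ z in 𝓝 x, z ∈ S.carrier → (m S J).1 z = resT S.carrier η z := by
      intro S J
      by_cases hxS : x ∈ S.carrier
      · obtain ⟨V, η, hxV, -, hη⟩ := (m S J).2.2 x ⟨hxS, hx.2⟩
        refine ⟨η, fun _ => ⟨hη.1.2 x hxV, ?_⟩⟩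
        filter_upwards [V.isOpen.mem_nhds hxV] with z hz hzS using hη.2 z ⟨hzS, hz⟩
      · exact ⟨0, fun h => absurd h hxS⟩
    choose η hη using hη
    let Z := Σ S : {S : L.Stratum k // x ∈ S.carrier},
      NbcSet S.1.localArr (tan (E := E) S.1.carrier S.1.point)
    have hcar : ∀ z : Z, L.interX (z.1.1.idx z.2.1) = z.1.1.carrier := fun z =>
      (z.1.1.inter_eq_tan_iff hL _).1 z.2.2.2.2
    have h2 : Θ g = logMk c.f {c.φ x} k (q + k) (∑ z : Z,
        logMon c.f q (q + k) (z.1.1.idx z.2.1) (chartRep c.φ (η z.1.1 z.2))) := by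
      rw [h1, map_sum, map_sum, Fintype.sum_sigma]
      refine (Fintype.sum_of_injective (Subtype.val : {S : L.Stratum k // x ∈ S.carrier} → _)
        Subtype.val_injective _ _ (fun S hS => ?_) fun S => ?_).symm
      · exact hΘ.2 S _ fun hxS => hS ⟨⟨S, hxS⟩, rfl⟩
      · refine Eq.symm ((map_sum (Θ ∘ₗ DirectSum.lof ℂ (L.Stratum k)
          (fun S => TensQ (HolS (E := E) S.carrier q U) S.A) S.1) _ _).trans ?_)
        exact Finset.sum_congr rfl fun J _ =>
          hΘ.1 S.1 _ _ J.1 J.2.2.2 S.2 (hη S.1 J S.2).1 (hη S.1 J S.2).2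
    have h3 := pull_eq_zero_of_sum_mem_of_injective (f := c.f) (A := {c.φ x}) (k := k)
      (ψ := fun z : Z => z.1.1.idx z.2.1) (η := fun z => chartRep c.φ (η z.1.1 z.2))
      (by
        rintro ⟨⟨S, hS⟩, J⟩ ⟨⟨S', hS'⟩, J'⟩ h
        have h4 : S.carrier = S'.carrier :=
          (hcar ⟨⟨S, hS⟩, J⟩).symm.trans ((congrArg L.interX h).trans (hcar ⟨⟨S', hS'⟩, J'⟩))
        obtain rfl : S = S' := by
          cases S
          cases S'
          cases h4
          rfl
        obtain rfl : J = J' := Subtype.ext (S.idx_injective h)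
        rfl)
      (fun z => by
        rw [z.1.1.card_idx, ← (codim_inter_eq_iff z.1.1.isKer_localArr _).2 z.2.2.2.1, z.2.2.2.2]
        exact z.1.1.codim_eq _ z.1.1.point_mem)
      (fun z => (c.indep_iff hL (by rw [hcar]; exact z.1.2)).2
        ((z.1.1.indep_localArr_iff hL _).1 z.2.2.2.1))
      (fun z => z.1.1.noBrokenForms hL z.2.2.1 (hcar z) z.1.2 c)
      (fun z y hy => by
        rw [Set.mem_singleton_iff.1 hy]
        exact (hη z.1.1 z.2 z.1.2).1 c.φ c.mem_atlas c.mem_source)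
      (logMk_eq_zero.1 (h2.symm.trans h0)) ⟨⟨S, hx.1⟩, J⟩
    rw [nhdsSet_singleton] at h3
    have h4 := h3.self_of_nhds (mem_inter.2 fun i _ => c.apply_center i)
    rw [(hη S J hx.1).2.self_of_nhds hx.1]
    exact S.resT_eq_zero_of_pull c hL hx.1 (hcar ⟨⟨S, hx.1⟩, J⟩) h4
  rw [h1]
  simp only [hm0, TensQ.tmul_zero_left, Finset.sum_const_zero]
  exact Finset.sum_eq_zero fun S _ => LinearMap.map_zero _

variable (L) in
/-- The relation between `η ⊗ e_I` and the class of `(2iπ)^{-k} η̃ ∧ ω_I` over an open set, in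
degree `p = q + k`. -/
def phiRel (k q p : ℕ) (U : Opens X) : Submodule ℂ (L.GObj k q U × L.grObj (k : ℤ) p U) :=
  Submodule.span ℂ {z | ∃ (S : L.Stratum k) (I : Finset S.Index) (_ : I.card = k)
    (hS : inter S.localArr I = tan S.carrier S.point) (η : HolS (E := E) S.carrier q U)
    (η' : X → Alt E q) (_ : Extends S.carrier U η' η.1) (F : Fin l → X → ℂ)
    (_ : ∀ i ∈ S.idx I, L.IsEquation i U (F i)) (w : L.W (k : ℤ) p U),
    w.1 = ((2 * Complex.I * Real.pi : ℂ) ^ k)⁻¹ • L.cut p U (monM F q p (S.idx I) η') ∧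
    z = (gen S η I hS, L.grMk (k : ℤ) p U w)}

theorem grMk_eq_zero {U : Opens X} {w : L.W (k : ℤ) p U} :
    L.grMk (k : ℤ) p U w = 0 ↔ w.1 ∈ L.W ((k : ℤ) - 1) p U :=
  (Submodule.Quotient.mk_eq_zero _).trans Iff.rfl

/-- The class of a form in a chart, modulo forms with fewer than `k` poles near the point `x`. -/
def grToLog (k p : ℕ) {x : X} (c : L.LinChart x) {U : Opens X} (hx : x ∈ U) :
    L.grObj (k : ℤ) p U →ₗ[ℂ] (E → Alt E p) ⧸ logSpan c.f {c.φ x} k p :=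
  Submodule.liftQ _ (logMk c.f {c.φ x} k p ∘ₗ
    { toFun := fun ζ : L.W (k : ℤ) p U => chartRep c.φ ζ.1
      map_add' := fun _ _ => rfl
      map_smul' := fun _ _ => rfl }) fun _ hζ =>
        logMk_eq_zero.2 (c.chartRep_mem_of_mem_W hx hζ)

/-- A class of forms is zero if its germs in charts around all points are. -/
theorem eq_zero_of_grToLog {U : Opens X} {w : L.grObj (k : ℤ) p U}
    (h : ∀ x, ∀ hx : x ∈ U, ∃ c : L.LinChart x, grToLog k p c hx w = 0) : w = 0 := by
  obtain ⟨w, rfl⟩ := Submodule.mkQ_surjective _ w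
  refine grMk_eq_zero.2 (mem_W_of_chartRep_mem (fun z hz => w.2.1 z hz) fun x hx => ?_)
  obtain ⟨c, hc⟩ := h x hx
  exact ⟨c, logMk_eq_zero.1 hc⟩

theorem logMk_chartRep_cut {x : X} (c : L.LinChart x) {U : Opens X} (hx : x ∈ U)
    (ζ : X → Alt E p) : logMk c.f {c.φ x} k p (chartRep c.φ (L.cut p U ζ)) =
      logMk c.f {c.φ x} k p (chartRep c.φ ζ) := by
  rw [← sub_eq_zero, ← map_sub, logMk_eq_zero]
  have h1 : chartRep c.φ (L.cut p U ζ - ζ) = chartRep c.φ (L.cut p U ζ) - chartRep c.φ ζ := rfl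
  rw [← h1]
  refine c.chartRep_mem_congr (ζ' := 0) (zero_mem _) ?_
  filter_upwards [U.isOpen.mem_nhds hx] with z hz hz'
  rw [Pi.sub_apply]
  exact sub_eq_zero.2 (Set.indicator_of_mem (show z ∈ (U : Set X) \ L.union from ⟨hz, hz'⟩) ζ)

include hL in
/-- The germ of a class of forms is determined by any section that is related to it. -/
theorem grToLog_of_mem_phiRel (hp : q + k = p) {x : X} (c : L.LinChart x) {U : Opens X}
    (hx : x ∈ U) {Θ : L.GObj k q U →ₗ[ℂ] (E → Alt E p) ⧸ logSpan c.f {c.φ x} k p}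
    (hΘ : IsPointMap c Θ) {g : L.GObj k q U} {w : L.grObj (k : ℤ) p U}
    (h : (g, w) ∈ L.phiRel k q p U) :
    grToLog k p c hx w = ((2 * Complex.I * Real.pi : ℂ) ^ k)⁻¹ • Θ g := by
  have h1 : L.phiRel k q p U ≤ LinearMap.eqLocus (grToLog k p c hx ∘ₗ LinearMap.snd ℂ _ _)
      ((((2 * Complex.I * Real.pi : ℂ) ^ k)⁻¹ • Θ) ∘ₗ LinearMap.fst ℂ _ _) := by
    refine Submodule.span_le.2 ?_
    rintro _ ⟨S, I, hI, hS, η, η', hη, F, hF, w, hw, rfl⟩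
    change logMk c.f {c.φ x} k p (chartRep c.φ w.1) =
      ((2 * Complex.I * Real.pi : ℂ) ^ k)⁻¹ • Θ (gen S η I hS)
    rw [hw, chartRep_smul, map_smul, logMk_chartRep_cut c hx]
    refine congrArg _ ?_
    have hcard : (S.idx I).card = k := (S.card_idx I).trans hI
    have h2 := c.chartRep_monM_sub_mem (p := p) hx hF (hη.1.2 x hx) (by rw [hcard]; exact hp)
    rw [hcard] at h2
    rw [sub_eq_zero.1 ((map_sub _ _ _).symm.trans (logMk_eq_zero.2 h2))]
    by_cases hxS : x ∈ S.carrier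
    · refine (hΘ.1 S η η' I hS hxS (hη.1.2 x hx) ?_).symm
      filter_upwards [U.isOpen.mem_nhds hx] with z hz hzS using hη.2 z ⟨hzS, hz⟩
    · rw [← (S.inter_eq_tan_iff hL I).1 hS, L.mem_interX] at hxS
      push Not at hxS
      obtain ⟨i, hi, hxi⟩ := hxS
      rw [logMon_eq_zero_of_form_eq_zero hi (not_not.1 fun h => hxi ((c.ne_zero_iff i).1 h)),
        map_zero]
      refine (hΘ.2 S _ fun hxS => hxi ?_).symm
      rw [← (S.inter_eq_tan_iff hL I).1 hS] at hxS
      exact L.mem_interX.1 hxS i hi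
  exact h1 h

include hL in
theorem eq_zero_of_phiRel_left (hp : q + k = p) {U : Opens X} {w : L.grObj (k : ℤ) p U}
    (h : (0, w) ∈ L.phiRel k q p U) : w = 0 := by
  refine eq_zero_of_grToLog fun x hx => ?_
  obtain ⟨c⟩ := L.exists_linChart x
  obtain ⟨Θ, hΘ⟩ := exists_isPointMap c hL hp hx
  refine ⟨c, ?_⟩
  rw [grToLog_of_mem_phiRel hL hp c hx hΘ h, map_zero, smul_zero]

include hL in
theorem eq_zero_of_phiRel_right (hp : q + k = p) {U : Opens X} {g : L.GObj k q U}
    (h : (g, 0) ∈ L.phiRel k q p U) : g = 0 := by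
  refine eq_zero_of_pointMaps hL hp fun x hx => ?_
  obtain ⟨c⟩ := L.exists_linChart x
  obtain ⟨Θ, hΘ⟩ := exists_isPointMap c hL hp hx
  refine ⟨c, Θ, hΘ, ?_⟩
  have h1 := grToLog_of_mem_phiRel hL hp c hx hΘ h
  rw [map_zero] at h1
  exact (smul_eq_zero.1 h1.symm).resolve_left (Central.inv_two_pi_I_pow_ne_zero k)

/-! ### Restrictions, differentials and local surjectivity -/

/-- The restriction maps of `⨁_S Ω^q(S ∩ U) ⊗ A_S`. -/
abbrev GRes (k q : ℕ) {U V : Opens X} (hV : V ≤ U) : L.GObj k q U →ₗ[ℂ] L.GObj k q V :=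
  DirectSum.lmap fun S : L.Stratum k => TensQ.map S.A (HolS.res S.carrier q hV)

/-- The differential of `⨁_S Ω^q(S ∩ U) ⊗ A_S`. -/
abbrev Gd (k q : ℕ) (U : Opens X) : L.GObj k q U →ₗ[ℂ] L.GObj k (q + 1) U :=
  DirectSum.lmap fun S : L.Stratum k => TensQ.map S.A (HolS.d S.locLin q U)

theorem GRes_gen {U V : Opens X} (hV : V ≤ U) (S : L.Stratum k)
    (η : HolS (E := E) S.carrier q U) (I : Finset S.Index)
    (hI : inter S.localArr I = tan S.carrier S.point) :
    GRes k q hV (gen S η I hI) = gen S (HolS.res S.carrier q hV η) I hI := by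
  classical
  exact DirectSum.lmap_lof _ _ _

theorem Gd_gen {U : Opens X} (S : L.Stratum k) (η : HolS (E := E) S.carrier q U)
    (I : Finset S.Index) (hI : inter S.localArr I = tan S.carrier S.point) :
    Gd k q U (gen S η I hI) = gen S (HolS.d S.locLin q U η) I hI := by
  classical
  exact DirectSum.lmap_lof _ _ _

theorem Extends.res {S : Set X} {U V V' : Opens X} (hV : V' ≤ V) (hU : V' ≤ U)
    {η : HolS (E := E) S q U} {η' : X → Alt E q} (h : Extends S V η' η.1) :
    Extends S V' ((V' : Set X).indicator η') (HolS.res S q hU η).1 := by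
  classical
  refine ⟨HolOn.indicator h.1 V'.isOpen hV, fun y hy => ?_⟩
  change (if y ∈ V' then η.1 y else 0) = _
  rw [if_pos (show y ∈ V' from hy.2), h.2 y ⟨hy.1, hV hy.2⟩, resT, resT,
    Set.indicator_of_mem hy.2]

theorem IsEquation.mono {U V : Opens X} (hV : V ≤ U) {i : Fin l} {F : X → ℂ}
    (h : L.IsEquation i U F) : L.IsEquation i V F := fun x hx => h x (hV hx)

theorem cut_monM_indicator {κ : Type} [LinearOrder κ] (F : κ → X → ℂ) (V : Opens X)
    (I : Finset κ) (η : X → Alt E q) :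
    L.cut p V (monM F q p I ((V : Set X).indicator η)) = L.cut p V (monM F q p I η) := by
  refine Set.indicator_congr fun z hz => ?_
  rw [monM, monM, Set.indicator_of_mem hz.1]

theorem phiRel_res {U V : Opens X} (hV : V ≤ U) {g : L.GObj k q U} {w : L.grObj (k : ℤ) p U}
    (h : (g, w) ∈ L.phiRel k q p U) :
    (GRes k q hV g, L.grRes (k : ℤ) p hV w) ∈ L.phiRel k q p V := by
  have h1 : L.phiRel k q p U ≤ (L.phiRel k q p V).comap
      ((GRes k q hV).prodMap (L.grRes (k : ℤ) p hV)) := by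
    refine Submodule.span_le.2 ?_
    rintro _ ⟨S, I, hI, hS, η, η', hη, F, hF, w, hw, rfl⟩
    refine Submodule.subset_span ⟨S, I, hI, hS, _, _, Extends.res hV hV hη, F,
      fun i hi => (hF i hi).mono hV, L.Wres (k : ℤ) p hV w, ?_,
      Prod.ext (GRes_gen hV S η I hS) rfl⟩
    change L.cut p V w.1 = _
    rw [hw, map_smul, L.cut_cut p hV, cut_monM_indicator]
  exact h1 h

theorem extM_monM {U : Opens X} {I : Finset (Fin l)} {F : Fin l → X → ℂ}
    (hF : ∀ i ∈ I, L.IsEquation i U (F i)) {η : X → Alt E q} (hη : η ∈ HolOn (U : Set X) q)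
    (hp : q + I.card = p) {z : X} (hz : z ∈ (U : Set X) \ L.union) :
    extM (monM F q p I η) z = monM F (q + 1) (p + 1) I (extM η) z := by
  induction I using Finset.induction_on_max generalizing p with
  | empty =>
    obtain rfl : q = p := by simpa using hp
    rw [monM_empty, monM_empty]
  | insert j I hj ih =>
    have hjI : j ∉ I := fun h => lt_irrefl _ (hj j h)
    rw [Finset.card_insert_of_notMem hjI] at hp
    obtain ⟨p, rfl⟩ : ∃ p', p = p' + 1 := ⟨q + I.card, by omega⟩
    have hF' : ∀ i ∈ I, L.IsEquation i U (F i) := fun i hi => hF i (Finset.mem_insert_of_mem hi)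
    have hp' : q + I.card = p := by omega
    have hj' := hF j (Finset.mem_insert_self j I) z hz.1
    rw [monM_insert_max F hj, monM_insert_max F hj, extM_wedge
      ((isMonomial_monM hF' hη hp').holAt hz) hj'.1 fun h0 =>
        hz.2 (Set.mem_iUnion.2 ⟨j, hj'.2.1.2 h0⟩), ih hF' hp']

theorem phiRel_d (hp : q + k = p) {U : Opens X} {g : L.GObj k q U} {w : L.grObj (k : ℤ) p U}
    (h : (g, w) ∈ L.phiRel k q p U) :
    (Gd k q U g, L.grd (k : ℤ) p U w) ∈ L.phiRel k (q + 1) (p + 1) U := by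
  have h1 : L.phiRel k q p U ≤ (L.phiRel k (q + 1) (p + 1) U).comap
      ((Gd k q U).prodMap (L.grd (k : ℤ) p U)) := by
    refine Submodule.span_le.2 ?_
    rintro _ ⟨S, I, hI, hS, η, η', hη, F, hF, w, hw, rfl⟩
    refine Submodule.subset_span ⟨S, I, hI, hS, HolS.d S.locLin q U η, dOn (U : Set X) η',
      hη.d S.locLin le_rfl, F, hF, L.Wd (k : ℤ) p U w, ?_, Prod.ext (Gd_gen S η I hS) rfl⟩
    change dOn ((U : Set X) \ L.union) w.1 = _
    rw [hw, dOn_smul]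
    refine congrArg _ ?_
    have hp' : q + (S.idx I).card = p := by rw [S.card_idx, hI]; exact hp
    refine Set.indicator_congr fun z hz => ?_
    rw [monM, dOn, Set.indicator_of_mem hz.1]
    refine (extM_congr ?_).trans (extM_monM hF hη.1 hp' hz)
    filter_upwards [(L.isOpen_diff U).mem_nhds hz] with y hy
    exact Set.indicator_of_mem hy _
  exact h1 h

end Hypersurfaces

/-! ### Local surjectivity of the two projections of the relation -/

namespace Hypersurfaces

variable {E : Type} [NormedAddCommGroup E] [NormedSpace ℂ E] [FiniteDimensional ℂ E]
  {X : Type u} [TopologicalSpace X] [ChartedSpace E X] [IsManifold 𝓘(ℂ, E) ω X]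
  {l : ℕ} {L : Hypersurfaces E X l} {k p q : ℕ}

theorem GRes_GRes {U V V' : Opens X} (hV : V ≤ U) (hV' : V' ≤ V) (g : L.GObj k q U) :
    GRes k q hV' (GRes k q hV g) = GRes k q (hV'.trans hV) g :=
  (ConcreteCategory.congr_hom
    ((L.GPsh k q).map_comp (homOfLE hV).op (homOfLE hV').op) g).symm

theorem cut_mem_W_of_mem_monSpan {m : ℤ} {V : Opens X} {ξ : X → Alt E p}
    (h : L.cut p V ξ ∈ L.monSpan m p V) : L.cut p V ξ ∈ L.W m p V := by
  refine ⟨fun z hz => L.cut_of_notMem hz _, fun z hz => ⟨V, hz, le_rfl, ?_⟩⟩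
  rwa [L.cut_cut p le_rfl]

theorem cut_monM_mem {V : Opens X} {I : Finset (Fin l)} {F : Fin l → X → ℂ}
    (hF : ∀ i ∈ I, L.IsEquation i V (F i)) {η : X → Alt E q} (hη : η ∈ HolOn (V : Set X) q)
    (hp : q + I.card = p) (hI : I.card ≤ k) :
    L.cut p V (monM F q p I η) ∈ L.W (k : ℤ) p V :=
  cut_mem_W_of_mem_monSpan (Submodule.subset_span
    ⟨I, _, by exact_mod_cast hI, isMonomial_monM hF hη hp, rfl⟩)

/-- The holomorphic form `η'` on `V` has a restriction to `S`. -/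
theorem exists_extends {S : Set X} {V : Opens X} {η' : X → Alt E q}
    (hη : η' ∈ HolOn (V : Set X) q) : ∃ η : HolS (E := E) S q V, Extends S V η' η.1 := by
  classical
  have h : ∀ y ∈ S ∩ V, (if y ∈ S ∩ (V : Set X) then resT (E := E) S η' y else 0) =
      resT S η' y := fun y hy => if_pos hy
  exact ⟨⟨fun y => if y ∈ S ∩ (V : Set X) then resT S η' y else 0, fun y hy => if_neg hy,
    fun y hy => ⟨V, η', hy.2, le_rfl, hη, h⟩⟩, hη, h⟩

theorem gen_zero {U : Opens X} (S : L.Stratum k) (I : Finset S.Index)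
    (hI : inter S.localArr I = tan S.carrier S.point) :
    gen S (0 : HolS (E := E) S.carrier q U) I hI = 0 := by
  rw [gen, TensQ.tmul_zero_left, map_zero]

/-- Every section of `⨁_S Ω^q(S ∩ U) ⊗ A_S` is locally related to a class of forms. -/
theorem exists_phiRel_left (hL : ∀ I : Finset (Fin l), _root_.IsPreconnected (L.interX I))
    (hp : q + k = p) {U : Opens X} (g : L.GObj k q U) {x : X} (hx : x ∈ U) :
    ∃ (V : Opens X) (hV : V ≤ U), x ∈ V ∧ ∃ w, (GRes k q hV g, w) ∈ L.phiRel k q p V := by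
  classical
  have hzero : ∃ (V : Opens X) (hV : V ≤ U), x ∈ V ∧
      ∃ w, (GRes k q hV (0 : L.GObj k q U), w) ∈ L.phiRel k q p V :=
    ⟨U, le_rfl, hx, 0, by rw [map_zero]; exact zero_mem _⟩
  have hadd : ∀ g g' : L.GObj k q U,
      (∃ (V : Opens X) (hV : V ≤ U), x ∈ V ∧ ∃ w, (GRes k q hV g, w) ∈ L.phiRel k q p V) →
      (∃ (V : Opens X) (hV : V ≤ U), x ∈ V ∧ ∃ w, (GRes k q hV g', w) ∈ L.phiRel k q p V) →
      ∃ (V : Opens X) (hV : V ≤ U), x ∈ V ∧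
        ∃ w, (GRes k q hV (g + g'), w) ∈ L.phiRel k q p V := by
    rintro g g' ⟨V, hV, hxV, w, h⟩ ⟨V', hV', hxV', w', h'⟩
    refine ⟨V ⊓ V', inf_le_left.trans hV, ⟨hxV, hxV'⟩,
      L.grRes (k : ℤ) p inf_le_left w + L.grRes (k : ℤ) p inf_le_right w', ?_⟩
    have h1 := add_mem (phiRel_res (inf_le_left : V ⊓ V' ≤ V) h)
      (phiRel_res (inf_le_right : V ⊓ V' ≤ V') h')
    rw [GRes_GRes, GRes_GRes] at h1
    rw [map_add]
    exact h1
  induction g using DirectSum.induction_on with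
  | zero => exact hzero
  | add g g' h h' => exact hadd g g' h h'
  | of S m =>
    change ∃ (V : Opens X) (hV : V ≤ U), x ∈ V ∧ ∃ w, (GRes k q hV (DirectSum.lof ℂ (L.Stratum k)
      (fun S => TensQ (HolS (E := E) S.carrier q U) S.A) S m), w) ∈ L.phiRel k q p V
    refine TensQ.osPart_induction S.isKer_localArr (P := fun m => ∃ (V : Opens X) (hV : V ≤ U),
      x ∈ V ∧ ∃ w, (GRes k q hV (DirectSum.lof ℂ (L.Stratum k)
      (fun S => TensQ (HolS (E := E) S.carrier q U) S.A) S m), w) ∈ L.phiRel k q p V)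
      ?_ (fun a b ha hb => ?_) (fun η I hI hc => ?_) m
    · rw [map_zero]
      exact hzero
    · rw [map_add]
      exact hadd _ _ ha hb
    · change ∃ (V : Opens X) (hV : V ≤ U), x ∈ V ∧
        ∃ w, (GRes k q hV (gen S η I hI), w) ∈ L.phiRel k q p V
      have hk : I.card = k := hc.symm.trans (S.codim_eq _ S.point_mem)
      by_cases hxS : x ∈ S.carrier
      · obtain ⟨V₀, η', hxV₀, hV₀, hη⟩ := η.2.2 x ⟨hxS, hx⟩
        obtain ⟨c⟩ := L.exists_linChart x
        let V : Opens X := V₀ ⊓ ⟨c.φ.source, c.φ.open_source⟩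
        have hV : V ≤ U := inf_le_left.trans hV₀
        have hη' := Extends.res (inf_le_left : V ≤ V₀) hV hη
        have hF : ∀ i ∈ S.idx I, L.IsEquation i V (c.f i ∘ c.φ) := fun i hi =>
          c.isEquation_linear (V := V) (fun z hz => hz.2) ((c.ne_zero_iff i).2 (by
            rw [← (S.inter_eq_tan_iff hL I).1 hI] at hxS
            exact L.mem_interX.1 hxS i hi))
        have hIk : (S.idx I).card = k := (S.card_idx I).trans hk
        let w : L.W (k : ℤ) p V := ⟨((2 * Complex.I * Real.pi : ℂ) ^ k)⁻¹ • L.cut p V _,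
          Submodule.smul_mem _ _ (cut_monM_mem hF hη'.1 (by rw [hIk]; exact hp) hIk.le)⟩
        refine ⟨V, hV, ⟨hxV₀, c.mem_source⟩, L.grMk (k : ℤ) p V w, ?_⟩
        rw [GRes_gen]
        exact Submodule.subset_span ⟨S, I, hk, hI, _, _, hη', _, hF, w, rfl, rfl⟩
      · refine ⟨U ⊓ ⟨S.carrierᶜ, S.isClosed.isOpen_compl⟩, inf_le_left, ⟨hx, hxS⟩, 0, ?_⟩
        have h0 : HolS.res S.carrier q (inf_le_left :
            U ⊓ ⟨S.carrierᶜ, S.isClosed.isOpen_compl⟩ ≤ U) η = 0 := by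
          refine Subtype.ext <| funext fun y => ?_
          change (if y ∈ U ⊓ ⟨S.carrierᶜ, S.isClosed.isOpen_compl⟩ then η.1 y else 0) = 0
          split_ifs with hy
          · exact η.2.1 y fun h => hy.2 h.1
          · rfl
        rw [GRes_gen, h0, gen_zero]
        exact zero_mem _

theorem monM_congr {κ : Type} [LinearOrder κ] {F F' : κ → X → ℂ} {I : Finset κ}
    (h : ∀ i ∈ I, F i = F' i) (η : X → Alt E q) : monM F q p I η = monM F' q p I η := by
  funext z
  have h1 := extEval_extMonomial_map (e := Function.Embedding.refl κ) (I := I) strictMono_id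
    (θ := fun i => dlogM (E := E) (F' i) z) (θ' := fun i => dlogM (E := E) (F i) z) fun i hi => by
      rw [h i hi]
      rfl
  rw [Finset.map_refl] at h1
  rw [monM, monM, h1]

theorem IsMonomial.exists_eq_monM {V : Opens X} {I : Finset (Fin l)} {η : X → Alt E p}
    (h : L.IsMonomial V I p η) : ∃ (q : ℕ) (F : Fin l → X → ℂ) (η' : X → Alt E q),
      q + I.card = p ∧ (∀ i ∈ I, L.IsEquation i V (F i)) ∧ η' ∈ HolOn (V : Set X) q ∧
      η = monM F q p I η' := by
  induction h with
  | @hol q η hη => exact ⟨q, 0, η, rfl, by simp, hη, (monM_empty _ _).symm⟩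
  | @wedge I p η h j hj f hf ih =>
    obtain ⟨q, F, η', hp, hF, hη, rfl⟩ := ih
    have hne : ∀ i ∈ I, i ≠ j := fun i hi => (hj i hi).ne
    refine ⟨q, Function.update F j f, η', ?_, fun i hi => ?_, hη, ?_⟩
    · rw [Finset.card_insert_of_notMem fun h => lt_irrefl _ (hj j h)]
      omega
    · rcases Finset.mem_insert.1 hi with rfl | hi
      · rwa [Function.update_self]
      · rw [Function.update_of_ne (hne i hi)]
        exact hF i hi
    · rw [monM_insert_max _ hj, Function.update_self,
        monM_congr fun i hi => Function.update_of_ne (hne i hi) f F]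

/-- A form with `k` poles along dependent hypersurfaces has locally fewer poles. -/
theorem exists_cut_monM_mem_of_not_indep {x : X} (c : L.LinChart x) {V : Opens X} (hx : x ∈ V)
    {I : Finset (Fin l)} {F : Fin l → X → ℂ} (hF : ∀ i ∈ I, L.IsEquation i V (F i))
    {η : X → Alt E q} (hη : η ∈ HolOn (V : Set X) q) (hp : q + I.card = p)
    (hI : ¬ Indep (kers c.f) I) : ∃ V' : Opens X, x ∈ V' ∧ V' ≤ V ∧
      L.cut p V' (monM F q p I η) ∈ L.monSpan ((I.card : ℤ) - 1) p V' := by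
  refine c.exists_cut_mem ?_ hx
  have h1 := c.chartRep_monM_sub_mem (p := p) hx hF (hη.2 x hx) hp
  have h2 : logMon c.f q p I (chartRep c.φ η) ∈ logSpan c.f {c.φ x} I.card p := by
    refine logSpan_congr (zero_mem _) (Filter.Eventually.of_forall fun y hy => ?_)
    rw [logMon, extEval_dlogVec_eq_zero hy hI, map_zero]
    rfl
  have h3 := add_mem h1 h2
  rwa [sub_add_cancel] at h3

variable (hL : ∀ I : Finset (Fin l), _root_.IsPreconnected (L.interX I))

include hL in
/-- The intersection of `k` independent hypersurfaces through a point is a stratum. -/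
theorem exists_stratum {x : X} (c : L.LinChart x) {I : Finset (Fin l)}
    (hI : Indep (kers c.f) I) : ∃ (S : L.Stratum I.card) (J : Finset S.Index),
      S.idx J = I ∧ inter S.localArr J = tan (E := E) S.carrier S.point := by
  classical
  have hx : x ∈ L.interX I :=
    L.mem_interX.2 fun i hi => (c.ne_zero_iff i).1 (hI.ne_zero hi)
  let S : L.Stratum I.card := ⟨L.interX I, ⟨I, rfl⟩, ⟨x, hx⟩, fun y hy => by
    obtain ⟨c'⟩ := L.exists_linChart y
    rw [c'.codim_tan c'.mem_source hy]
    exact (codim_inter_eq_iff (isKer_kers _) _).2 ((c'.indep_iff hL hy).2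
      ((c.indep_iff hL hx).1 hI))⟩
  have hJ : S.idx (I.subtype fun i => S.point ∈ L.hyp i) = I :=
    Finset.subtype_map_of_mem fun i hi => L.mem_interX.1 S.point_mem i hi
  exact ⟨S, _, hJ, (S.inter_eq_tan_iff hL _).2 (congrArg L.interX hJ)⟩

include hL in
/-- Every class of forms is locally related to a section of `⨁_S Ω^q(S ∩ U) ⊗ A_S`. -/
theorem exists_phiRel_right (hp : q + k = p) {U : Opens X} (w : L.grObj (k : ℤ) p U) {x : X}
    (hx : x ∈ U) : ∃ (V : Opens X) (hV : V ≤ U), x ∈ V ∧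
      ∃ g, (g, L.grRes (k : ℤ) p hV w) ∈ L.phiRel k q p V := by
  obtain ⟨ζ, rfl⟩ := Submodule.mkQ_surjective _ w
  obtain ⟨V₀, hxV₀, hV₀, hζ⟩ := ζ.2.2 x hx
  suffices h : ∀ ξ ∈ L.monSpan (k : ℤ) p V₀, ∃ V ≤ V₀, x ∈ V ∧ ∃ (g : L.GObj k q V)
      (w : L.W (k : ℤ) p V), w.1 = L.cut p V ξ ∧ (g, L.grMk (k : ℤ) p V w) ∈ L.phiRel k q p V by
    obtain ⟨V, hV, hxV, g, w, hw, h⟩ := h _ hζ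
    refine ⟨V, hV.trans hV₀, hxV, g, ?_⟩
    have h1 : w = L.Wres (k : ℤ) p (hV.trans hV₀) ζ :=
      Subtype.ext (hw.trans (L.cut_cut p hV ζ.1))
    rw [h1] at h
    exact h
  intro ξ hξ
  induction hξ using Submodule.span_induction with
  | zero => exact ⟨V₀, le_rfl, hxV₀, 0, 0, (map_zero _).symm, by rw [map_zero]; exact zero_mem _⟩
  | add a b _ _ ha hb =>
    obtain ⟨V, hV, hxV, g, w, hw, h⟩ := ha
    obtain ⟨V', hV', hxV', g', w', hw', h'⟩ := hb
    refine ⟨V ⊓ V', inf_le_left.trans hV, ⟨hxV, hxV'⟩, _,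
      L.Wres (k : ℤ) p inf_le_left w + L.Wres (k : ℤ) p inf_le_right w', ?_,
      add_mem (phiRel_res (inf_le_left : V ⊓ V' ≤ V) h)
        (phiRel_res (inf_le_right : V ⊓ V' ≤ V') h')⟩
    change L.cut p (V ⊓ V') w.1 + L.cut p (V ⊓ V') w'.1 = _
    rw [hw, hw', L.cut_cut p inf_le_left, L.cut_cut p inf_le_right, map_add]
  | smul r a _ ha =>
    obtain ⟨V, hV, hxV, g, w, hw, h⟩ := ha
    refine ⟨V, hV, hxV, _, r • w, ?_, Submodule.smul_mem _ r h⟩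
    rw [map_smul, ← hw]
    rfl
  | mem ξ h =>
    obtain ⟨I, η, hI, h, rfl⟩ := h
    obtain ⟨q', F, η', hp', hF, hη, rfl⟩ := h.exists_eq_monM
    have hcut : ∀ V ≤ V₀, L.cut p V (((V₀ : Set X) \ L.union).indicator (monM F q' p I η')) =
        L.cut p V (monM F q' p I η') := fun V hV => L.cut_cut p hV _
    -- Forms with fewer than `k` poles have class zero.
    have hlow : ∀ V ≤ V₀, x ∈ V → L.cut p V (monM F q' p I η') ∈ L.monSpan ((k : ℤ) - 1) p V →
        ∃ V ≤ V₀, x ∈ V ∧ ∃ (g : L.GObj k q V) (w : L.W (k : ℤ) p V),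
          w.1 = L.cut p V (((V₀ : Set X) \ L.union).indicator (monM F q' p I η')) ∧
            (g, L.grMk (k : ℤ) p V w) ∈ L.phiRel k q p V := by
      intro V hV hxV h
      have h1 := cut_mem_W_of_mem_monSpan h
      have h2 : L.cut p V (monM F q' p I η') ∈ L.W (k : ℤ) p V :=
        cut_mem_W_of_mem_monSpan (Submodule.span_mono (by
          rintro _ ⟨I, η, hI, h⟩
          exact ⟨I, η, by omega, h⟩) h)
      refine ⟨V, hV, hxV, 0, ⟨_, h2⟩, (hcut V hV).symm, ?_⟩
      rw [grMk_eq_zero.2 h1]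
      exact zero_mem _
    rcases (show I.card ≤ k by exact_mod_cast hI).lt_or_eq with hlt | rfl
    · exact hlow V₀ le_rfl hxV₀ (Submodule.subset_span ⟨I, _, by omega, h, rfl⟩)
    obtain rfl : q' = q := by omega
    obtain ⟨c⟩ := L.exists_linChart x
    by_cases hind : Indep (kers c.f) I
    · obtain ⟨S, J, hJ, hS⟩ := exists_stratum hL c hind
      have hJI : J.card = I.card := by rw [← S.card_idx, hJ]
      obtain ⟨η, hη'⟩ := exists_extends (S := S.carrier) hη
      let w : L.W (I.card : ℤ) p V₀ :=
        ⟨((2 * Complex.I * Real.pi : ℂ) ^ I.card)⁻¹ • L.cut p V₀ (monM F q' p (S.idx J) η'),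
          Submodule.smul_mem _ _ (cut_monM_mem (by rwa [hJ]) hη (by rw [hJ]; exact hp)
            (by rw [hJ]))⟩
      have hw : (gen S η J hS, L.grMk (I.card : ℤ) p V₀ w) ∈ L.phiRel I.card q' p V₀ :=
        Submodule.subset_span ⟨S, J, hJI, hS, η, η', hη', F, by rwa [hJ], w, rfl, rfl⟩
      refine ⟨V₀, le_rfl, hxV₀, _, ((2 * Complex.I * Real.pi : ℂ) ^ I.card) • w, ?_,
        Submodule.smul_mem _ ((2 * Complex.I * Real.pi : ℂ) ^ I.card) hw⟩
      have h1 : ((2 * Complex.I * Real.pi : ℂ) ^ I.card • w).1 =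
          L.cut p V₀ (monM F q' p (S.idx J) η') :=
        smul_inv_smul₀ (fun h => Central.inv_two_pi_I_pow_ne_zero I.card (inv_eq_zero.2 h))
          (L.cut p V₀ (monM F q' p (S.idx J) η'))
      rw [h1, hcut V₀ le_rfl, hJ]
    · obtain ⟨V, hxV, hV, h⟩ := exists_cut_monM_mem_of_not_indep c hxV₀ hF hη hp' hind
      exact hlow V hV hxV h

end Hypersurfaces

/-! ### The isomorphism of complexes of sheaves -/

/-- A morphism of presheaves that is injective and locally surjective becomes an isomorphism after
sheafification. -/
theorem isIso_presheafToSheaf_map {X : Type u} [TopologicalSpace X]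
    {P Q : (Opens X)ᵒᵖ ⥤ ModuleCat.{u} ℂ} (f : P ⟶ Q)
    (hinj : ∀ U, Function.Injective (f.app (op U)))
    (hsurj : ∀ (U : Opens X) (s : Q.obj (op U)), ∀ x ∈ U, ∃ (V : Opens X) (i : V ⟶ U), x ∈ V ∧
      ∃ t, f.app (op V) t = Q.map i.op s) :
    IsIso ((presheafToSheaf (Opens.grothendieckTopology X) (ModuleCat.{u} ℂ)).map f) := by
  have h1 : Presheaf.IsLocallyInjective (Opens.grothendieckTopology X) f :=
    Presheaf.isLocallyInjective_of_injective _ f fun U => hinj U.unop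
  have h2 : Presheaf.IsLocallySurjective (Opens.grothendieckTopology X) f :=
    ⟨fun {U} s x hx => by
      obtain ⟨V, i, hxV, h⟩ := hsurj U s x hx
      exact ⟨V, i, h, hxV⟩⟩
  exact (GrothendieckTopology.W_iff _ f).1 (GrothendieckTopology.W_of_isLocallyBijective _ f)

namespace Hypersurfaces

variable {E : Type} [NormedAddCommGroup E] [NormedSpace ℂ E] [FiniteDimensional ℂ E]
  {X : Type u} [TopologicalSpace X] [ChartedSpace E X] [IsManifold 𝓘(ℂ, E) ω X]
  {l : ℕ} (L : Hypersurfaces E X l) {k p q : ℕ}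

/-- The differential of the presheaf `U ↦ ⨁_S Ω^q(S ∩ U) ⊗ A_S`. -/
def GPshD (k q : ℕ) : L.GPsh k q ⟶ L.GPsh k (q + 1) := (L.GPshCx k).d q (q + 1)

/-- The differential of the presheaf of classes of forms. -/
def grPshD (k : ℤ) (p : ℕ) : L.grPsh k p ⟶ L.grPsh k (p + 1) := (L.grPshCx k).d p (p + 1)

theorem GPshD_app (U : (Opens X)ᵒᵖ) :
    (L.GPshD k q).app U = ModuleCat.ofHom (Gd (L := L) k q U.unop) :=
  congrArg (fun f : L.GPsh k q ⟶ L.GPsh k (q + 1) => f.app U) (CochainComplex.of_d _ _ q)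

theorem grPshD_app (U : (Opens X)ᵒᵖ) :
    (L.grPshD (k : ℤ) p).app U = ModuleCat.ofHom (L.grd (k : ℤ) p U.unop) :=
  congrArg (fun f : L.grPsh (k : ℤ) p ⟶ L.grPsh (k : ℤ) (p + 1) => f.app U)
    (CochainComplex.of_d _ _ p)

/-- The restriction of a pair of related sections. -/
def phiRelRes (k q p : ℕ) {U V : Opens X} (hV : V ≤ U) :
    L.phiRel k q p U →ₗ[ℂ] L.phiRel k q p V :=
  LinearMap.restrict (LinearMap.prodMap (GRes (L := L) k q hV) (L.grRes (k : ℤ) p hV))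
    fun _ h => phiRel_res _ h

/-- The differential of a pair of related sections. -/
def phiRelD (hp : q + k = p) (U : Opens X) :
    L.phiRel k q p U →ₗ[ℂ] L.phiRel k (q + 1) (p + 1) U :=
  LinearMap.restrict (LinearMap.prodMap (Gd (L := L) k q U) (L.grd (k : ℤ) p U))
    fun _ h => phiRel_d hp h

/-- The presheaf of pairs of related sections. -/
def phiPsh (k q p : ℕ) : (Opens X)ᵒᵖ ⥤ ModuleCat.{u} ℂ where
  obj U := ModuleCat.of ℂ (L.phiRel k q p U.unop)
  map i := ModuleCat.ofHom (L.phiRelRes k q p i.unop.le)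
  map_id U := by
    ext1
    refine LinearMap.ext fun (x : L.phiRel k q p U.unop) => ?_
    have e1 := ConcreteCategory.congr_hom ((L.GPsh k q).map_id U) x.1.1
    have e2 := ConcreteCategory.congr_hom ((L.grPsh (k : ℤ) p).map_id U) x.1.2
    exact Subtype.ext (Prod.ext e1 e2)
  map_comp {U V V'} i j := by
    ext1
    refine LinearMap.ext fun (x : L.phiRel k q p U.unop) => ?_
    have e1 := ConcreteCategory.congr_hom ((L.GPsh k q).map_comp i j) x.1.1
    have e2 := ConcreteCategory.congr_hom ((L.grPsh (k : ℤ) p).map_comp i j) x.1.2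
    exact Subtype.ext (Prod.ext e1 e2)

/-- The projection of the relation to `⨁_S Ω^q(S ∩ U) ⊗ A_S`. -/
def phiFst (k q p : ℕ) : L.phiPsh k q p ⟶ L.GPsh k q where
  app U := ModuleCat.ofHom (LinearMap.fst ℂ _ _ ∘ₗ (L.phiRel k q p U.unop).subtype)
  naturality _ _ _ := rfl

/-- The projection of the relation to the classes of forms. -/
def phiSnd (k q p : ℕ) : L.phiPsh k q p ⟶ L.grPsh (k : ℤ) p where
  app U := ModuleCat.ofHom (LinearMap.snd ℂ _ _ ∘ₗ (L.phiRel k q p U.unop).subtype)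
  naturality _ _ _ := rfl

/-- The differential of the presheaf of pairs of related sections. -/
def phiD (hp : q + k = p) : L.phiPsh k q p ⟶ L.phiPsh k (q + 1) (p + 1) where
  app U := ModuleCat.ofHom (L.phiRelD hp U.unop)
  naturality U V i := by
    have h1 := (L.GPshD k q).naturality i
    have h2 := (L.grPshD (k : ℤ) p).naturality i
    rw [GPshD_app, GPshD_app] at h1
    rw [grPshD_app, grPshD_app] at h2
    ext1
    refine LinearMap.ext fun (x : L.phiRel k q p U.unop) => ?_
    have e1 := ConcreteCategory.congr_hom h1 x.1.1
    have e2 := ConcreteCategory.congr_hom h2 x.1.2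
    exact Subtype.ext (Prod.ext e1 e2)

theorem phiD_fst (hp : q + k = p) : L.phiD hp ≫ L.phiFst k (q + 1) (p + 1) =
    L.phiFst k q p ≫ L.GPshD k q := by
  refine NatTrans.ext (funext fun U => ?_)
  exact congrArg ((L.phiFst k q p).app U ≫ ·) (L.GPshD_app U).symm

theorem phiD_snd (hp : q + k = p) : L.phiD hp ≫ L.phiSnd k (q + 1) (p + 1) =
    L.phiSnd k q p ≫ L.grPshD (k : ℤ) p := by
  refine NatTrans.ext (funext fun U => ?_)
  exact congrArg ((L.phiSnd k q p).app U ≫ ·) (L.grPshD_app U).symm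

variable {L} (hL : ∀ I : Finset (Fin l), _root_.IsPreconnected (L.interX I))

include hL in
theorem isIso_phiFst (hp : q + k = p) : IsIso ((presheafToSheaf (Opens.grothendieckTopology X)
    (ModuleCat.{u} ℂ)).map (L.phiFst k q p)) := by
  refine isIso_presheafToSheaf_map _ (fun U => ?_) fun U g x hx => ?_
  · refine (injective_iff_map_eq_zero (L.phiFst k q p |>.app (op U)).hom).2 ?_
    rintro ⟨⟨g, w⟩, h⟩ h0
    obtain rfl : g = 0 := h0
    exact Subtype.ext (Prod.ext rfl (eq_zero_of_phiRel_left hL hp h))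
  · obtain ⟨V, hV, hxV, w, h⟩ := exists_phiRel_left hL hp g hx
    exact ⟨V, homOfLE hV, hxV, ⟨_, h⟩, rfl⟩

include hL in
theorem isIso_phiSnd (hp : q + k = p) : IsIso ((presheafToSheaf (Opens.grothendieckTopology X)
    (ModuleCat.{u} ℂ)).map (L.phiSnd k q p)) := by
  refine isIso_presheafToSheaf_map _ (fun U => ?_) fun U w x hx => ?_
  · refine (injective_iff_map_eq_zero (L.phiSnd k q p |>.app (op U)).hom).2 ?_
    rintro ⟨⟨g, w⟩, h⟩ h0
    obtain rfl : w = 0 := h0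
    exact Subtype.ext (Prod.ext (eq_zero_of_phiRel_right hL hp h) rfl)
  · obtain ⟨V, hV, hxV, g, h⟩ := exists_phiRel_right hL hp w hx
    exact ⟨V, homOfLE hV, hxV, ⟨_, h⟩, rfl⟩

/-- A morphism of sheaves is compatible with the two projections of the relation if it maps
sections to related sections. -/
theorem phiFst_comp_eq_iff
    {Θ : (presheafToSheaf (Opens.grothendieckTopology X) (ModuleCat.{u} ℂ)).obj (L.GPsh k q) ⟶
      (presheafToSheaf (Opens.grothendieckTopology X) (ModuleCat.{u} ℂ)).obj
        (L.grPsh (k : ℤ) p)} :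
    (presheafToSheaf (Opens.grothendieckTopology X) (ModuleCat.{u} ℂ)).map (L.phiFst k q p) ≫ Θ =
      (presheafToSheaf (Opens.grothendieckTopology X) (ModuleCat.{u} ℂ)).map (L.phiSnd k q p) ↔
    ∀ (U : Opens X) (g : L.GObj k q U) (w : L.grObj (k : ℤ) p U), (g, w) ∈ L.phiRel k q p U →
      (toSheafify (Opens.grothendieckTopology X) (L.GPsh k q) ≫ Θ.hom).app (op U) g =
        (toSheafify (Opens.grothendieckTopology X) (L.grPsh (k : ℤ) p)).app (op U) w := by
  have h1 : L.phiFst k q p ≫ toSheafify (Opens.grothendieckTopology X) (L.GPsh k q) ≫ Θ.hom =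
      toSheafify (Opens.grothendieckTopology X) (L.phiPsh k q p) ≫ ((presheafToSheaf
        (Opens.grothendieckTopology X) (ModuleCat.{u} ℂ)).map (L.phiFst k q p) ≫ Θ).hom := by
    rw [← Category.assoc, toSheafify_naturality, Category.assoc]
    rfl
  have h2 : L.phiSnd k q p ≫ toSheafify (Opens.grothendieckTopology X) (L.grPsh (k : ℤ) p) =
      toSheafify (Opens.grothendieckTopology X) (L.phiPsh k q p) ≫ ((presheafToSheaf
        (Opens.grothendieckTopology X) (ModuleCat.{u} ℂ)).map (L.phiSnd k q p)).hom := by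
    rw [toSheafify_naturality]
  constructor
  · intro h U g w hgw
    rw [h, ← h2] at h1
    exact ConcreteCategory.congr_hom (congrArg (fun a => NatTrans.app a (op U)) h1)
      (⟨(g, w), hgw⟩ : L.phiRel k q p U)
  · intro h
    refine Sheaf.hom_ext ?_
    refine sheafify_hom_ext _ _ _ (ObjectProperty.FullSubcategory.property _) ?_
    refine h1.symm.trans (Eq.trans ?_ h2)
    ext U : 2
    ext1
    exact LinearMap.ext fun x => h U.unop x.1.1 x.1.2 x.2

/-- The form in the definition of `Φ` is the form `η ∧ ω_I`, up to the constant. -/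
theorem phiFun_enum {U : Opens X} {S : L.Stratum k} (I : Finset S.Index) (hI : I.card = k)
    (η : X → Alt E q) (F : Fin l → X → ℂ) : L.phiFun U η (Stratum.enum I hI) F =
      ((2 * Complex.I * Real.pi : ℂ) ^ k)⁻¹ • L.cut (q + k) U (monM F q (q + k) (S.idx I) η) := by
  have h : monM F q (q + k) (S.idx I) η =
      fun x => wedgeTuple (η x) k fun s => dlogM (F (Stratum.enum I hI s)) x := by
    funext z
    rw [monM, ← S.extEval_idx (θ' := fun i => dlogM (E := E) (F i.1) z) fun i _ => rfl,
      wedgeExt_extMonomial _ _ hI]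
    rfl
  rw [h, phiFun]

theorem Stratum.mem_idx_iff_enum {S : L.Stratum k} {I : Finset S.Index} (hI : I.card = k)
    {i : Fin l} : i ∈ S.idx I ↔ ∃ s, Stratum.enum I hI s = i := by
  rw [Stratum.mem_idx]
  constructor
  · rintro ⟨h, hi⟩
    have h1 : (⟨i, h⟩ : S.Index) ∈ Set.range (I.orderEmbOfFin hI) := by
      rw [Finset.range_orderEmbOfFin]
      exact hi
    obtain ⟨s, hs⟩ := h1
    exact ⟨s, congrArg Subtype.val hs⟩
  · rintro ⟨s, rfl⟩
    exact ⟨_, Finset.orderEmbOfFin_mem I hI s⟩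

/-- The morphism has the prescribed values on the elements `η ⊗ e_I` if and only if it maps sections
to related sections. -/
theorem isPhi_iff {Φ : L.G k ⟶ L.gr (k : ℤ)} : L.IsPhi k Φ ↔
    ∀ (q : ℕ) (U : Opens X) (g : L.GObj k q U) (w : L.grObj (k : ℤ) (q + k) U),
      (g, w) ∈ L.phiRel k q (q + k) U →
      (toSheafify (Opens.grothendieckTopology X) (L.GPsh k q) ≫
        (((sheafifyCx (L.GPshCx k)).extendXIso (shiftBy k) (i := q) rfl).inv ≫
          Φ.f (q + k)).hom).app (op U) g =
        (toSheafify (Opens.grothendieckTopology X) (L.grPsh (k : ℤ) (q + k))).app (op U) w := by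
  constructor
  · intro h q U g w hgw
    have h1 : L.phiRel k q (q + k) U ≤ LinearMap.eqLocus
        (((toSheafify (Opens.grothendieckTopology X) (L.GPsh k q) ≫
          (((sheafifyCx (L.GPshCx k)).extendXIso (shiftBy k) (i := q) rfl).inv ≫
            Φ.f (q + k)).hom).app (op U)).hom ∘ₗ LinearMap.fst ℂ _ _)
        (((toSheafify (Opens.grothendieckTopology X) (L.grPsh (k : ℤ) (q + k))).app
          (op U)).hom ∘ₗ LinearMap.snd ℂ _ _) := by
      refine Submodule.span_le.2 ?_
      rintro _ ⟨S, I, hI, hS, η, η', hη, F, hF, w, hw, rfl⟩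
      have hf : ∀ s, L.IsEquation (Stratum.enum I hI s) U (F (Stratum.enum I hI s)) :=
        fun s => hF _ ((Stratum.mem_idx_iff_enum hI).2 ⟨s, rfl⟩)
      obtain rfl : w = ⟨L.phiFun U η' (Stratum.enum I hI) F,
          L.phiFun_mem hη.1 (Stratum.enum_strictMono I hI) hf⟩ :=
        Subtype.ext (hw.trans (phiFun_enum I hI η' F).symm)
      exact h q U S I hI hS η η' hη.1 hη.2 F hf
    exact h1 hgw
  · intro h q U S I hI hS η η' hη he f hf
    refine h q U _ _ (Submodule.subset_span ⟨S, I, hI, hS, η, η', ⟨hη, he⟩, f, fun i hi => ?_, _,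
      phiFun_enum I hI η' f, rfl⟩)
    obtain ⟨s, rfl⟩ := (Stratum.mem_idx_iff_enum hI).1 hi
    exact hf s

include hL in
theorem exists_unique_isPhi (k : ℕ) : ∃ Φ : L.G k ⟶ L.gr (k : ℤ), L.IsPhi k Φ ∧
    (∀ Φ' : L.G k ⟶ L.gr (k : ℤ), L.IsPhi k Φ' → Φ' = Φ) ∧ IsIso Φ := by
  let sh := presheafToSheaf (Opens.grothendieckTopology X) (ModuleCat.{u} ℂ)
  have hΨ : ∀ q p, q + k = p → ∃ Ψ : sh.obj (L.GPsh k q) ≅ sh.obj (L.grPsh (k : ℤ) p),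
      sh.map (L.phiFst k q p) ≫ Ψ.hom = sh.map (L.phiSnd k q p) := by
    intro q p hp
    have := isIso_phiFst hL hp
    have := isIso_phiSnd hL hp
    exact ⟨(asIso (sh.map (L.phiFst k q p))).symm ≪≫ asIso (sh.map (L.phiSnd k q p)),
      IsIso.hom_inv_id_assoc _ _⟩
  choose Ψ hΨ using hΨ
  obtain ⟨Φ, hΦ⟩ := exists_iso_extend (k := k) (K := sheafifyCx (L.GPshCx k)) (L := L.gr (k : ℤ))
    Ψ (fun q p hp => by
      have := isIso_phiFst hL hp
      have hp' : q + 1 + k = p + 1 := by omega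
      have h1 : sh.map (L.phiFst k q p) ≫ sh.map (L.GPshD k q) =
          sh.map (L.phiD hp) ≫ sh.map (L.phiFst k (q + 1) (p + 1)) := by
        rw [← sh.map_comp, ← sh.map_comp, phiD_fst]
      have h2 : sh.map (L.phiSnd k q p) ≫ sh.map (L.grPshD (k : ℤ) p) =
          sh.map (L.phiD hp) ≫ sh.map (L.phiSnd k (q + 1) (p + 1)) := by
        rw [← sh.map_comp, ← sh.map_comp, phiD_snd]
      refine (cancel_epi (sh.map (L.phiFst k q p))).1 ?_
      change sh.map (L.phiFst k q p) ≫ (Ψ q p hp).hom ≫ sh.map (L.grPshD (k : ℤ) p) =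
        sh.map (L.phiFst k q p) ≫ sh.map (L.GPshD k q) ≫ (Ψ (q + 1) (p + 1) hp').hom
      rw [← Category.assoc, hΨ, h2, ← Category.assoc, h1, Category.assoc, hΨ])
    (fun p hp => by
      have h1 : Limits.IsZero (L.grPsh (k : ℤ) p) := by
        refine Functor.isZero _ fun U => ?_
        have : Subsingleton (L.grObj (k : ℤ) p U.unop) := by
          rw [subsingleton_iff_forall_eq 0]
          intro w
          obtain ⟨w, rfl⟩ := Submodule.mkQ_surjective _ w
          exact grMk_eq_zero.2 (W_le_of_lt hp w.2)
        exact ModuleCat.isZero_of_subsingleton (ModuleCat.of ℂ (L.grObj (k : ℤ) p U.unop))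
      exact sh.map_isZero h1)
  refine ⟨Φ.hom, isPhi_iff.2 fun q U g w h => ?_, fun Φ' h => hom_extend_ext fun q => ?_,
    Φ.isIso_hom⟩
  · rw [hΦ]
    exact phiFst_comp_eq_iff.1 (hΨ q (q + k) rfl) U g w h
  · rw [hΦ]
    have := isIso_phiFst (k := k) (q := q) hL rfl
    refine (cancel_epi (sh.map (L.phiFst k q (q + k)))).1 ?_
    exact (phiFst_comp_eq_iff.2 (isPhi_iff.1 h q)).trans (hΨ q (q + k) rfl).symm

end Hypersurfaces

end LogArr

end

theorem theorem3p4 :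
    (∀ (n l k : ℕ) (L : LogArr.Central (EuclideanSpace ℂ (Fin n)) l),
      ∃ Φ : L.G k ⟶ L.gr (k : ℤ), L.IsPhi k Φ ∧
        (∀ Φ' : L.G k ⟶ L.gr (k : ℤ), L.IsPhi k Φ' → Φ' = Φ) ∧ IsIso Φ) ∧
    (∀ (n l k : ℕ) (X : Type*) [TopologicalSpace X] [T2Space X]
      [ChartedSpace (EuclideanSpace ℂ (Fin n)) X]
      [IsManifold 𝓘(ℂ, EuclideanSpace ℂ (Fin n)) ω X]
      (L : LogArr.Hypersurfaces (EuclideanSpace ℂ (Fin n)) X l),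
      (∀ I : Finset (Fin l), _root_.IsPreconnected (L.interX I)) →
      ∃ Φ : L.G k ⟶ L.gr (k : ℤ), L.IsPhi k Φ ∧
        (∀ Φ' : L.G k ⟶ L.gr (k : ℤ), L.IsPhi k Φ' → Φ' = Φ) ∧ IsIso Φ) := by
  exact ⟨fun n l k L => L.exists_unique_isPhi k,
    fun n l k X _ _ _ _ L hL => LogArr.Hypersurfaces.exists_unique_isPhi hL k⟩
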